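/- Let $k$ be an algebraically closed field and let $\overline M_{0,6}$ be the moduli space of stable six-pointed rational curves over $k$, realized as the iterated blow-up of $\mathbb P^3$ at five points $p_1,\dots,p_5$ in linear general position and then along the proper transforms of the ten lines $p_ip_j$. Let $\sigma\in\mathfrak S_6$ be a product of three disjoint transpositions and let $F_\sigma\subset\overline M_{0,6}$ be the closure of the locus in $M_{0,6}$ of the pointed curves $(\mathbb P^1;s_1,\dots,s_6)$ that are isomorphic to $(\mathbb P^1;s_{\sigma(1)},\dots,s_{\sigma(6)})$. Let $\ell_1,\dots,\ell_4\subset\mathbb P^2$ be four lines no three of which are concurrent, with the six intersection points $q_{ij}=\ell_i\cap\ell_j$. Then $F_\sigma$ is isomorphic to the blow-up of $\mathbb P^2$ at the six points $q_{ij}$. Moreover, for every such isomorphism, let $\varphi:F_\sigma\to\mathbb P^2$ be the induced blow-down, $G_{ij}=\varphi^{-1}(q_{ij})$ the exceptional curves, and $H\in \mathrm{NS}(F_\sigma)$ the pull-back of the class of a line. Then 1. the six curves $G_{ij}$ are $(-1)$-curves (smooth rational curves of self-intersection $-1$); 2. each of the three classes $H-G_{ij}-G_{kl}$, $\{i,j,k,l\}=\{1,2,3,4\}$,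 is the class of a $(-1)$-curve; 3. each of the four classes $H-G_{ij}-G_{ik}-G_{il}$, $\{i,j,k,l\}=\{1,2,3,4\}$, is the class of a $(-2)$-curve (a smooth rational curve of self-intersection $-2$); 4. these are $13$ distinct curves, and the closed effective cone $\mathrm{NE}^1(F_\sigma)\subset \mathrm{NS}(F_\sigma)\otimes\mathbb R$, that is, the closed convex cone generated by the classes of the effective divisors, is the convex cone generated by the classes of these $13$ curves. -/

import Mathlib

open scoped LinearAlgebra.Projectivization TensorProduct Topology

/-! Classical projective geometry over an algebraically closed field: varieties are sets of closed
points in finite products of projective spaces, with the Zariski topology and regular functions. -/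

namespace ProjGeom

noncomputable section

universe u

/-- The points of the product over `i : ι` of the projective spaces with homogeneous coordinates
indexed by `κ i`. -/
def MultiProj (k : Type u) [Field k] {ι : Type} (κ : ι → Type) : Type u :=
  (i : ι) → ℙ k (κ i → k)

section Ambient

variable {k : Type u} [Field k] {ι : Type} {κ : ι → Type}

/-- `A` is multihomogeneous of multidegree `d` (degree `d i` in the `i`-th group of variables). -/
def IsForm (A : MvPolynomial (Σ i, κ i) k) (d : ι →₀ ℕ) : Prop :=
  MvPolynomial.IsWeightedHomogeneous (fun v : (Σ i, κ i) => Finsupp.single v.1 1) A d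

/-- The value of `A` at a representative of the point `x`. For a multihomogeneous `A`, its vanishing
does not depend on the representative, and neither does the quotient of the values of two forms of
the same multidegree. -/
def evalAt (A : MvPolynomial (Σ i, κ i) k) (x : MultiProj k κ) : k :=
  MvPolynomial.eval (fun v : (Σ i, κ i) => (x v.1).rep v.2) A

/-- The Zariski topology. -/
instance : TopologicalSpace (MultiProj k κ) :=
  TopologicalSpace.generateFrom
    {U | ∃ A d, IsForm A d ∧ U = {x : MultiProj k κ | evalAt A x ≠ 0}}

/-- `f` is regular at the point `x` of `X`: near `x` it is a quotient `A / B` of two forms of the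
same multidegree, with `B x ≠ 0`. -/
def RegularAt (X : Set (MultiProj k κ)) (f : X → k) (x : X) : Prop :=
  ∃ A B d, IsForm A d ∧ IsForm B d ∧ evalAt B x.1 ≠ 0 ∧
    ∀ᶠ y : X in 𝓝 x, f y * evalAt B y.1 = evalAt A y.1

theorem IsForm.mul {A B : MvPolynomial (Σ i, κ i) k} {d e : ι →₀ ℕ}
    (hA : IsForm A d) (hB : IsForm B e) : IsForm (A * B) (d + e) :=
  MvPolynomial.IsWeightedHomogeneous.mul hA hB

theorem RegularAt.const (X : Set (MultiProj k κ)) (c : k) (x : X) :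
    RegularAt X (fun _ => c) x :=
  ⟨MvPolynomial.C c, 1, 0, MvPolynomial.isWeightedHomogeneous_C _ _,
    MvPolynomial.isWeightedHomogeneous_one _ _, by simp [evalAt],
    Filter.Eventually.of_forall fun y => by simp [evalAt]⟩

theorem RegularAt.mul {X : Set (MultiProj k κ)} {f g : X → k} {x : X}
    (hf : RegularAt X f x) (hg : RegularAt X g x) : RegularAt X (f * g) x := by
  obtain ⟨A, B, d, hA, hB, h0, h⟩ := hf
  obtain ⟨A', B', d', hA', hB', h0', h'⟩ := hg
  refine ⟨A * A', B * B', d + d', hA.mul hA', hB.mul hB', ?_, ?_⟩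
  · simpa [evalAt] using And.intro h0 h0'
  · filter_upwards [h, h'] with y hy hy'
    simp only [evalAt, map_mul, Pi.mul_apply] at *
    rw [← hy, ← hy']; ring

theorem RegularAt.add {X : Set (MultiProj k κ)} {f g : X → k} {x : X}
    (hf : RegularAt X f x) (hg : RegularAt X g x) : RegularAt X (f + g) x := by
  obtain ⟨A, B, d, hA, hB, h0, h⟩ := hf
  obtain ⟨A', B', d', hA', hB', h0', h'⟩ := hg
  refine ⟨A * B' + B * A', B * B', d + d', ?_, hB.mul hB', ?_, ?_⟩
  · exact (MvPolynomial.weightedHomogeneousSubmodule k _ _).add_mem (hA.mul hB') (hB.mul hA')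
  · simpa [evalAt] using And.intro h0 h0'
  · filter_upwards [h, h'] with y hy hy'
    simp only [evalAt, map_mul, map_add, Pi.add_apply] at *
    rw [← hy, ← hy']; ring

theorem RegularAt.neg {X : Set (MultiProj k κ)} {f : X → k} {x : X}
    (hf : RegularAt X f x) : RegularAt X (-f) x := by
  have h := (RegularAt.const X (-1) x).mul hf
  have e : (fun _ : X => (-1 : k)) * f = -f := by ext y; simp
  rwa [e] at h

end Ambient

/-- The filter generated by the open sets meeting `Z` (for irreducible `Z`: the neighbourhoods of
the generic point of `Z`; for `Z = {x}`: the neighbourhoods of `x`). -/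
def nhdsGeneric {S : Type*} [TopologicalSpace S] (Z : Set S) : Filter S :=
  ⨅ (U : Set S) (_ : IsOpen U ∧ (U ∩ Z).Nonempty), Filter.principal U

section Isomorphism

variable {k : Type u} [Field k] {ι ι' : Type} {κ : ι → Type} {κ' : ι' → Type}

/-- An isomorphism of varieties: a homeomorphism which, together with its inverse, pulls back
regular functions to regular functions. -/
structure VarIso (X : Set (MultiProj k κ)) (Y : Set (MultiProj k κ')) where
  toHomeomorph : X ≃ₜ Y
  regular_iff : ∀ (g : Y → k) (x : X),
    RegularAt Y g (toHomeomorph x) ↔ RegularAt X (g ∘ toHomeomorph) x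

end Isomorphism

/-- The projective line. -/
def projLine (k : Type u) [Field k] : Set (MultiProj k (fun _ : Unit => Fin 2)) := Set.univ

section Divisors

variable {k : Type u} [Field k] {ι : Type} {κ : ι → Type} (X : Set (MultiProj k κ))

/-- The local ring of `X` along an irreducible subset `Z`: germs of functions regular near the
generic point of `Z`. -/
def localRing (Z : Set X) : Subring (Filter.Germ (nhdsGeneric Z) k) where
  carrier := {g | ∃ f : X → k, (∀ᶠ y in nhdsGeneric Z, RegularAt X f y) ∧ (f : Filter.Germ _ k) = g}
  mul_mem' := by
    rintro _ _ ⟨f, hf, rfl⟩ ⟨g, hg, rfl⟩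
    exact ⟨f * g, by filter_upwards [hf, hg] with y h h' using h.mul h', rfl⟩
  one_mem' := ⟨fun _ => 1, Filter.Eventually.of_forall fun y => RegularAt.const X 1 y, rfl⟩
  add_mem' := by
    rintro _ _ ⟨f, hf, rfl⟩ ⟨g, hg, rfl⟩
    exact ⟨f + g, by filter_upwards [hf, hg] with y h h' using h.add h', rfl⟩
  zero_mem' := ⟨fun _ => 0, Filter.Eventually.of_forall fun y => RegularAt.const X 0 y, rfl⟩
  neg_mem' := by
    rintro _ ⟨f, hf, rfl⟩
    exact ⟨-f, by filter_upwards [hf] with y h using h.neg, rfl⟩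

/-- Prime divisors: closed irreducible subsets of codimension one. -/
def PrimeDivisor : Type u :=
  {Z : TopologicalSpace.IrreducibleCloseds X // Order.coheight Z = 1}

variable {X}

/-- The set of points of a prime divisor. -/
def PrimeDivisor.pts (Z : PrimeDivisor X) : Set X := (Z.1 : Set X)

/-- The rational function `f` on `X` is not zero and has order `n` along `Z`: in the function field
`f = a / b` with `a`, `b` in the local ring of `X` along `Z`, of finite orders `r`, `s` of vanishing,
and `n = r - s`. -/
def HasOrder (f : X → k) (Z : PrimeDivisor X) (n : ℤ) : Prop :=
  ∃ (a b : localRing X Z.pts) (fa fb : X → k) (r s : ℕ),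
    (fa : Filter.Germ (nhdsGeneric Z.pts) k) = a.1 ∧
    (fb : Filter.Germ (nhdsGeneric Z.pts) k) = b.1 ∧
    (∀ᶠ y in nhdsGeneric (Set.univ : Set X), f y * fb y = fa y) ∧
    Ring.ord (localRing X Z.pts) a = r ∧ Ring.ord (localRing X Z.pts) b = s ∧ n = r - s

variable (X)

/-- The group of divisors. -/
abbrev Divisor : Type u := PrimeDivisor X →₀ ℤ

variable {X}

/-- `D` is the divisor of a nonzero rational function. -/
def IsPrincipal (D : Divisor X) : Prop :=
  ∃ f : X → k, (∀ᶠ y in nhdsGeneric (Set.univ : Set X), RegularAt X f y ∧ f y ≠ 0) ∧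
    ∀ Z, HasOrder f Z (D Z)

/-- The prime divisor `C` as a divisor. -/
def PrimeDivisor.toDivisor (C : PrimeDivisor X) : Divisor X := Finsupp.single C 1

/-- The product of two sets of points. -/
def prodVar {ι' : Type} {κ' : ι' → Type} (X : Set (MultiProj k κ)) (T : Set (MultiProj k κ')) :
    Set (MultiProj k (Sum.elim κ κ')) :=
  {p | (fun i => p (Sum.inl i) : MultiProj k κ) ∈ X ∧
    (fun j => p (Sum.inr j) : MultiProj k κ') ∈ T}

/-- The point `(x, t)` of the product. -/
def prodPt {ι' : Type} {κ' : ι' → Type} {T : Set (MultiProj k κ')} (x : X) (t : T) :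
    prodVar X T :=
  ⟨fun s => match s with
    | Sum.inl i => x.1 i
    | Sum.inr j => t.1 j, x.2, t.2⟩

/-- `D₀` and `D₁` are two members of an algebraic family of effective divisors on `X`: there is an
irreducible projective variety `T` and an effective Cartier divisor on `X × T`, given by a local
equation `f p`, regular on the open neighbourhood `W p`, for every point `p`, such that any two of
the local equations differ by a nowhere vanishing regular function where both are defined, and the
restrictions to `X × {t₀}` and `X × {t₁}` have divisors `D₀` and `D₁`. -/
def InFamily (D₀ D₁ : Divisor X) : Prop :=
  ∃ (ι' : Type) (κ' : ι' → Type) (_ : Finite ι') (_ : ∀ j, Finite (κ' j))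
    (T : Set (MultiProj k κ')) (_ : IsClosed T) (_ : IsIrreducible T) (t₀ t₁ : T)
    (W : prodVar X T → Set (prodVar X T)) (f : prodVar X T → prodVar X T → k),
    (∀ p, IsOpen (W p) ∧ p ∈ W p ∧ ∀ q ∈ W p, RegularAt (prodVar X T) (f p) q) ∧
    (∀ p p', ∃ v : prodVar X T → k, ∀ q ∈ W p ∩ W p',
      RegularAt (prodVar X T) v q ∧ v q ≠ 0 ∧ f p q = v q * f p' q) ∧
    (∀ (Z : PrimeDivisor X), ∀ x ∈ Z.pts,
      HasOrder (fun y => f (prodPt x t₀) (prodPt y t₀)) Z (D₀ Z) ∧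
      HasOrder (fun y => f (prodPt x t₁) (prodPt y t₁)) Z (D₁ Z))

variable (X)

/-- The divisors algebraically equivalent to zero. -/
def algEquivZero : AddSubgroup (Divisor X) :=
  AddSubgroup.closure ({D | IsPrincipal D} ∪ {D | ∃ D₀ D₁, InFamily D₀ D₁ ∧ D = D₀ - D₁})

/-- The Néron–Severi group: divisors modulo algebraic equivalence. -/
abbrev NS : Type u := Divisor X ⧸ algEquivZero X

variable {X}

/-- The class of a divisor. -/
def nsClass (D : Divisor X) : NS X := QuotientAddGroup.mk D

/-- The class of a prime divisor. -/
def PrimeDivisor.nsClass (C : PrimeDivisor X) : NS X := ProjGeom.nsClass C.toDivisor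

variable (X)

/-- The closed effective cone: the closed convex cone in `NS X ⊗ ℝ` generated by the classes of the
effective divisors. (The module topology is the usual one on a finite-dimensional space.) -/
def effectiveCone : Set (ℝ ⊗[ℤ] NS X) :=
  @closure _ (moduleTopology ℝ (ℝ ⊗[ℤ] NS X))
    (PointedCone.hull ℝ {c : ℝ ⊗[ℤ] NS X | ∃ D : Divisor X, 0 ≤ D ∧ c = 1 ⊗ₜ nsClass D})

variable {X}

/-! Intersection numbers on a smooth projective surface. -/

/-- The ideal of `Z` in the local ring of `X` at `x`. -/
def idealAt (Z : Set X) (x : X) : Ideal (localRing X {x}) :=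
  Ideal.span {a | ∃ f : X → k, (f : Filter.Germ (nhdsGeneric {x}) k) = a.1 ∧
    ∀ᶠ y in 𝓝 x, y ∈ Z → f y = 0}

/-- The intersection number of two distinct prime divisors: the sum of the lengths of the local
rings of the scheme-theoretic intersection. -/
def intersectionNumber (Z C : PrimeDivisor X) : ℤ :=
  ∑ᶠ x : X, ((Module.length (localRing X {x})
    (localRing X {x} ⧸ (idealAt Z.pts x ⊔ idealAt C.pts x))).toNat : ℤ)

/-- The self-intersection number of the curve `C` is `n`: some divisor linearly equivalent to `C`
does not contain `C`, and all of these have intersection number `n` with `C`. -/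
def HasSelfIntersection (C : PrimeDivisor X) (n : ℤ) : Prop :=
  (∃ D : Divisor X, IsPrincipal (D - C.toDivisor) ∧ D C = 0) ∧
  ∀ D : Divisor X, IsPrincipal (D - C.toDivisor) → D C = 0 →
    (D.sum fun Z a => a * intersectionNumber Z C) = n

/-- `C` is a smooth rational curve with self-intersection number `n`. -/
def IsSmoothRationalCurve (C : PrimeDivisor X) (n : ℤ) : Prop :=
  Nonempty (VarIso (Subtype.val '' C.pts) (projLine k)) ∧ HasSelfIntersection C n

/-- `D` is the pull-back under `φ : X → ℙ²` of the line with equation `m`: along every prime divisor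
`Z` its multiplicity is the order of `m / m'`, for the linear forms `m'` not identically zero on
`φ(Z)`. -/
def IsLinePullback (φ : X → ℙ k (Fin 3 → k)) (m : Fin 3 → k) (D : Divisor X) : Prop :=
  ∀ (Z : PrimeDivisor X) (m' : Fin 3 → k), (∃ x ∈ Z.pts, m' ⬝ᵥ (φ x).rep ≠ 0) →
    HasOrder (fun x => (m ⬝ᵥ (φ x).rep) / (m' ⬝ᵥ (φ x).rep)) Z (D Z)

end Divisors

section BlowUp

variable {k : Type u} [Field k]

/-- The two-element subsets `{i, j}`, `i < j`, of the four indices. -/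
abbrev Pair : Type := {p : Fin 4 × Fin 4 // p.1 < p.2}

/-- The sizes of the factors of `ℙ² × (ℙ¹)⁶`. -/
abbrev blowUpCoord : Option Pair → Type
  | none => Fin 3
  | some _ => Fin 2

/-- The blow-up of `ℙ²` at the six points `q_{ij}` of intersection of the four lines `ℓ i = 0`: the
closure of the graph of the product of the projections `x ↦ [ℓ i (x) : ℓ j (x)]` from the `q_{ij}`
to `ℙ¹`. -/
def blowUpPlane (ℓ : Fin 4 → Fin 3 → k) : Set (MultiProj k blowUpCoord) :=
  closure {z | ∃ (v : Fin 3 → k) (hv : v ≠ 0), z none = Projectivization.mk k v hv ∧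
    ∀ p : Pair, ∃ h : ![ℓ p.1.1 ⬝ᵥ v, ℓ p.1.2 ⬝ᵥ v] ≠ 0,
      z (some p) = Projectivization.mk k ![ℓ p.1.1 ⬝ᵥ v, ℓ p.1.2 ⬝ᵥ v] h}

/-- The blow-down to `ℙ²`. -/
def blowDown (ℓ : Fin 4 → Fin 3 → k) (z : blowUpPlane ℓ) : ℙ k (Fin 3 → k) := z.1 none

end BlowUp

/-! The moduli space of stable six-pointed rational curves. A six-pointed line is isomorphic to
`(ℙ¹; s 0, …, s 4, ∞)`, with the `s i` distinct and unique up to a common affine substitution. So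
the open moduli space is the complement of the ten planes `s i = s j` in the `ℙ³` of vectors `s`
modulo constants, with homogeneous coordinates the differences `s a - s b`. These are the planes
spanned by triples of the five points in linear general position
`p i = (s i ≠ s j = s l for all j, l ≠ i)`. Blowing up the `p i` and then the proper transforms of
the lines `p i p j` amounts to taking the closure of the graph of the linear projections from all
of them. The projection from the span of the `p i`, `i ∉ S`, keeps the differences `s a - s b`
with `a, b ∈ S`. -/

section Moduli

variable {k : Type u} [Field k]

/-- The index sets of size `5` (for `ℙ³`), `4` (projections from the five points) and `3`
(projections from the ten lines). -/
abbrev ForgetIndex : Type := {S : Finset (Fin 5) // 3 ≤ S.card}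

/-- Homogeneous coordinates: the differences `s a - s b` with `a, b ∈ S`. -/
abbrev forgetCoord (S : ForgetIndex) : Type := S.1 × S.1

/-- `z` is the point of the moduli space given by the marked points `s 0, …, s 4, ∞`. -/
def IsModuliPoint (s : Fin 5 → k) (z : MultiProj k forgetCoord) : Prop :=
  ∀ S : ForgetIndex, ∃ h : (fun c : forgetCoord S => s c.1 - s c.2) ≠ 0,
    z S = Projectivization.mk k (fun c : forgetCoord S => s c.1 - s c.2) h

variable (k)

/-- The open moduli space `M_{0,6}`. -/
def moduliOpen : Set (MultiProj k forgetCoord) :=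
  {z | ∃ s : Fin 5 → k, Function.Injective s ∧ IsModuliPoint s z}

/-- The compactification of `M_{0,6}` by stable curves. -/
def moduliStable : Set (MultiProj k forgetCoord) := closure (moduliOpen k)

variable {k}

/-- The six marked points `s 0, …, s 4, ∞` of `ℙ¹`. -/
def markedPoints (s : Fin 5 → k) : Fin 6 → ℙ k (Fin 2 → k) :=
  Fin.snoc (α := fun _ => ℙ k (Fin 2 → k))
    (fun i => Projectivization.mk k ![s i, 1] (by intro h; simpa using congrFun h 1))
    (Projectivization.mk k ![1, 0] (by intro h; simpa using congrFun h 0))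

variable (k)

/-- The surface `F_σ`: the closure in the moduli space of stable curves of the locus in `M_{0,6}` of
the `(ℙ¹; s)` which are isomorphic to `(ℙ¹; s ∘ σ)`. -/
def fixedSurface (σ : Equiv.Perm (Fin 6)) : Set (MultiProj k forgetCoord) :=
  closure {z | z ∈ moduliOpen k ∧ ∃ s : Fin 5 → k, Function.Injective s ∧ IsModuliPoint s z ∧
    ∃ g : GL (Fin 2) k, ∀ i, g • markedPoints s i = markedPoints s (σ i)}

end Moduli

end

end ProjGeom

/-! Why `F_σ` is a blown-up plane. Number the marked points so that `σ` exchanges `∞` with `s₀`,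
`s₁` with `s₂` and `s₃` with `s₄`. An automorphism of the line inducing `σ` has the form `x ↦ s₀ + P
/ (x - s₀)`, so it exists exactly when `(s₀ - s₁)(s₀ - s₂) = (s₀ - s₃)(s₀ - s₄)`
(`IsLabeling.exists_smul_iff`). In `ℙ³` this is a smooth quadric through the five points `pᵢ`.
Projection from `p₀` keeps the differences of `s₁, …, s₄` and maps the quadric birationally onto a
plane. The forms `s₁ - s₃`, `-(s₁ - s₄)`, `-(s₂ - s₃)`, `s₂ - s₄` have sum zero and define four
lines in general position. The inverse map is quadratic: `l ↦ (0, l₀l₁, l₂l₃, -l₀l₂, -l₁l₃)`. The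
two rulings through `p₀` and the points `p₁, …, p₄` account for the six vertices of the
quadrilateral.

Both surfaces are compared through one explicit atlas, `LinesAtlas`. For each numbering `π` of the
lines there is a chart with coordinates `(t, w)` in which the four linear forms take the values `(tw
: w : 1 : -(1 + w + tw))`; its image is the affine plane without the curve `1 + w + tw = 0`. The
blow-up of the plane and `F_σ` each carry such an atlas (`BlowUpPlane.exists_atlas`,
`FixedSurface.nonempty_atlas`), and points with equal coordinates correspond
(`LinesAtlas.nonempty_varIso`). For `F_σ` the essential point is that for every set of at least
three marked points the quadratic expressions have, after division by a common polynomial factor, no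
common zero on the chart (`FixedSurface.hasCoord`).

The curves. In suitable charts `G`, `L` and `M` are the coordinate lines `w = 0`, `t = 0` and `t =
-1`. The pull-back of the line `i` is `Lᵢ + ∑ Gᵢⱼ`, and the form `lamᵢ + lamⱼ` cuts out `Mᵢⱼ + Gᵢⱼ +
Gₖₗ`; this gives the classes. Every rational function is a quotient of two forms of equal degree.
Restricting a form to one of these curves and counting the zeros of the restricted polynomials in
two or three charts gives the degree of its divisor on the curve (`hasDegree_gCurve`,
`hasDegree_mCurve`, `hasDegree_lCurve`), hence the self-intersection numbers.

The cone. Let `Z` be a prime divisor other than the `G` and `L`. Some form of degree `d` vanishes,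
apart from these curves, only along `Z`, so `ν Z = d H - ∑ aᵢ Lᵢ - ∑ bᵢⱼ Gᵢⱼ` for some `ν > 0`. The
intersection numbers of `Z` with the `G` and `L` are nonnegative, which bounds the coefficients; an
explicit decomposition then writes the class as a nonnegative combination of the thirteen
(`exists_perm_mem_of_nonneg`). A finitely generated cone in a finite-dimensional space is closed, by
Carathéodory's argument (`isClosed_hull`). Only relations coming from principal divisors are used in
the Néron–Severi group, and the intersection numbers are taken of divisors, so invariance under
algebraic equivalence is never needed. -/

namespace ProjGeom

noncomputable section

universe u

/-! ### Regular functions and the Zariski topology -/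

section Regular

variable {k : Type u} [Field k] {ι : Type} {κ : ι → Type}

/-- All monomials of a form have the same weight `d`, so all pick up the same factor when the groups
of variables are rescaled. -/
theorem IsForm.eval_smul {A : MvPolynomial (Σ i, κ i) k} {d : ι →₀ ℕ} (hA : IsForm A d)
    (c : ι → k) (v : (Σ i, κ i) → k) :
    MvPolynomial.eval (fun s => c s.1 * v s) A =
      (d.prod fun i n => c i ^ n) * MvPolynomial.eval v A := by
  rw [MvPolynomial.eval_eq, MvPolynomial.eval_eq, Finset.mul_sum]
  refine Finset.sum_congr rfl fun m hm => ?_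
  have hw := hA (MvPolynomial.mem_support_iff.mp hm)
  have key : (d.prod fun i n => c i ^ n) = ∏ s ∈ m.support, c s.1 ^ m s := by
    rw [← hw, Finsupp.weight_apply, Finsupp.prod_sum_index (by simp) (by intros; exact pow_add _ _ _)]
    refine Finset.prod_congr rfl fun s _ => ?_
    simp only [Finsupp.smul_single, smul_eq_mul, mul_one]
    rw [Finsupp.prod_single_index (by simp)]
  rw [key]
  simp only [mul_pow, Finset.prod_mul_distrib]
  ring

/-- Products of forms are forms, so the generating open sets are closed under finite intersections,
and a neighbourhood can always be shrunk to the set where a single form does not vanish. -/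
theorem isTopologicalBasis_forms :
    TopologicalSpace.IsTopologicalBasis
      {U | ∃ A d, IsForm A d ∧ U = {x : MultiProj k κ | evalAt A x ≠ 0}} where
  exists_subset_inter := by
    rintro _ ⟨A, d, hA, rfl⟩ _ ⟨B, e, hB, rfl⟩ x hx
    refine ⟨_, ⟨A * B, d + e, hA.mul hB, rfl⟩, ?_, ?_⟩
    · simpa [evalAt] using hx
    · intro y hy
      simpa [evalAt] using hy
  sUnion_eq := by
    refine Set.eq_univ_of_forall fun x => ⟨_, ⟨1, 0, MvPolynomial.isWeightedHomogeneous_one _ _, rfl⟩, ?_⟩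
    simp [evalAt]
  eq_generateFrom := rfl

variable {X : Set (MultiProj k κ)}

theorem isOpen_evalAt_ne_zero {A : MvPolynomial (Σ i, κ i) k} {d : ι →₀ ℕ} (hA : IsForm A d) :
    IsOpen {y : X | evalAt A y.1 ≠ 0} :=
  (isTopologicalBasis_forms.isOpen ⟨A, d, hA, rfl⟩).preimage continuous_subtype_val

theorem exists_form_of_mem_nhds {x : X} {V : Set X} (hV : V ∈ 𝓝 x) :
    ∃ A d, IsForm A d ∧ evalAt A x.1 ≠ 0 ∧ ∀ y : X, evalAt A y.1 ≠ 0 → y ∈ V := by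
  rw [nhds_subtype, Filter.mem_comap] at hV
  obtain ⟨W, hW, hWV⟩ := hV
  obtain ⟨_, ⟨A, d, hA, rfl⟩, hx, hsub⟩ := isTopologicalBasis_forms.mem_nhds_iff.mp hW
  exact ⟨A, d, hA, hx, fun y hy => hWV (hsub hy)⟩

theorem RegularAt.congr {f g : X → k} {x : X} (hf : RegularAt X f x) (h : f =ᶠ[𝓝 x] g) :
    RegularAt X g x := by
  obtain ⟨A, B, d, hA, hB, h0, hAB⟩ := hf
  refine ⟨A, B, d, hA, hB, h0, ?_⟩
  filter_upwards [h, hAB] with y hy hy'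
  rw [← hy, hy']

theorem RegularAt.eventually_ne {f : X → k} {x : X} (hf : RegularAt X f x) (hx : f x ≠ 0) :
    ∀ᶠ y in 𝓝 x, f y ≠ 0 := by
  obtain ⟨A, B, d, hA, hB, h0, hAB⟩ := hf
  have hA0 : evalAt A x.1 ≠ 0 := by rw [← hAB.self_of_nhds]; exact mul_ne_zero hx h0
  filter_upwards [hAB, (isOpen_evalAt_ne_zero hA).mem_nhds hA0] with y hy hy' h
  rw [h, zero_mul] at hy
  exact hy' hy.symm

theorem RegularAt.inv {f : X → k} {x : X} (hf : RegularAt X f x) (hx : f x ≠ 0) :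
    RegularAt X (fun y => (f y)⁻¹) x := by
  have hne := hf.eventually_ne hx
  obtain ⟨A, B, d, hA, hB, h0, hAB⟩ := hf
  have hA0 : evalAt A x.1 ≠ 0 := by rw [← hAB.self_of_nhds]; exact mul_ne_zero hx h0
  refine ⟨B, A, d, hB, hA, hA0, ?_⟩
  filter_upwards [hAB, hne] with y hy hy'
  rw [← hy]
  field_simp

theorem RegularAt.div {f g : X → k} {x : X} (hf : RegularAt X f x) (hg : RegularAt X g x)
    (hx : g x ≠ 0) : RegularAt X (fun y => f y / g y) x := by
  simp only [div_eq_mul_inv]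
  exact hf.mul (hg.inv hx)

theorem RegularAt.sub {f g : X → k} {x : X} (hf : RegularAt X f x) (hg : RegularAt X g x) :
    RegularAt X (f - g) x := by
  rw [sub_eq_add_neg]; exact hf.add hg.neg

theorem RegularAt.pow {f : X → k} {x : X} (hf : RegularAt X f x) (n : ℕ) :
    RegularAt X (fun y => f y ^ n) x := by
  induction n with
  | zero => simpa using RegularAt.const X 1 x
  | succ n ih => simp only [pow_succ]; exact ih.mul hf

theorem RegularAt.eval {σ : Type*} {c : X → σ → k} {x : X}
    (hc : ∀ a, RegularAt X (fun y => c y a) x) (p : MvPolynomial σ k) :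
    RegularAt X (fun y => MvPolynomial.eval (c y) p) x := by
  induction p using MvPolynomial.induction_on with
  | C a => simpa using RegularAt.const X a x
  | add p q hp hq => simp only [map_add]; exact hp.add hq
  | mul_X p a hp => simp only [map_mul, MvPolynomial.eval_X]; exact hp.mul (hc a)

/-- A linear form in the `i`-th group of variables. -/
def linForm (i : ι) [Fintype (κ i)] (l : κ i → k) : MvPolynomial (Σ i, κ i) k :=
  ∑ j, MvPolynomial.C (l j) * MvPolynomial.X ⟨i, j⟩

theorem isForm_linForm (i : ι) [Fintype (κ i)] (l : κ i → k) :
    IsForm (linForm i l) (Finsupp.single i 1) := by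
  refine (MvPolynomial.weightedHomogeneousSubmodule k _ _).sum_mem fun j _ => ?_
  have := (MvPolynomial.isWeightedHomogeneous_C (fun v : (Σ i, κ i) => Finsupp.single v.1 1) (l j)).mul
    (MvPolynomial.isWeightedHomogeneous_X k (fun v : (Σ i, κ i) => Finsupp.single v.1 1) ⟨i, j⟩)
  simpa using this

theorem evalAt_linForm (i : ι) [Fintype (κ i)] (l : κ i → k) (x : MultiProj k κ) :
    evalAt (linForm i l) x = l ⬝ᵥ (x i).rep := by
  simp [evalAt, linForm, dotProduct]

theorem isOpen_dotProduct_ne_zero (i : ι) [Fintype (κ i)] (l : κ i → k) :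
    IsOpen {y : X | l ⬝ᵥ (y.1 i).rep ≠ 0} := by
  simpa [evalAt_linForm] using isOpen_evalAt_ne_zero (X := X) (isForm_linForm i l)

theorem RegularAt.linear_div (i : ι) [Fintype (κ i)] (l m : κ i → k) {x : X}
    (hx : m ⬝ᵥ (x.1 i).rep ≠ 0) :
    RegularAt X (fun y => (l ⬝ᵥ (y.1 i).rep) / (m ⬝ᵥ (y.1 i).rep)) x := by
  refine ⟨linForm i l, linForm i m, _, isForm_linForm i l, isForm_linForm i m, ?_, ?_⟩
  · rwa [evalAt_linForm]
  · filter_upwards [(isOpen_dotProduct_ne_zero i m).mem_nhds hx] with y hy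
    rw [evalAt_linForm, evalAt_linForm, div_mul_cancel₀ _ hy]

end Regular

/-- A coordinate chart: an open subset of `X` which is isomorphic, through the coordinates `coord`,
to the principal open subset `h ≠ 0` of affine space. -/
structure Chart {k : Type u} [Field k] {ι : Type} {κ : ι → Type} (X : Set (MultiProj k κ))
    (n : ℕ) where
  dom : Set X
  coord : X → Fin n → k
  h : MvPolynomial (Fin n) k
  h_ne_zero : h ≠ 0
  injOn : Set.InjOn coord dom
  image : coord '' dom = {a | MvPolynomial.eval a h ≠ 0}
  -- Together with `basis` this says that `dom` carries the Zariski topology of the principal open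
  -- set; no topology on affine space is needed.
  isOpen_ne : ∀ g : MvPolynomial (Fin n) k, IsOpen {x | x ∈ dom ∧ MvPolynomial.eval (coord x) g ≠ 0}
  basis : ∀ x ∈ dom, ∀ V ∈ 𝓝 x, ∃ g : MvPolynomial (Fin n) k, MvPolynomial.eval (coord x) g ≠ 0 ∧
    ∀ y ∈ dom, MvPolynomial.eval (coord y) g ≠ 0 → y ∈ V
  regular_iff : ∀ x ∈ dom, ∀ f : X → k, RegularAt X f x ↔ ∃ A B : MvPolynomial (Fin n) k,
    MvPolynomial.eval (coord x) B ≠ 0 ∧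
      ∀ᶠ y in 𝓝 x, f y * MvPolynomial.eval (coord y) B = MvPolynomial.eval (coord y) A

/-! ### Charts, and isomorphisms obtained by matching them -/

section Charts

variable {k : Type u} [Field k] {ι : Type} {κ : ι → Type} {X : Set (MultiProj k κ)} {n : ℕ}

theorem Chart.isOpen_dom (c : Chart X n) : IsOpen c.dom := by
  simpa using c.isOpen_ne 1

theorem Chart.dom_mem_nhds (c : Chart X n) {x : X} (hx : x ∈ c.dom) : c.dom ∈ 𝓝 x :=
  c.isOpen_dom.mem_nhds hx

theorem Chart.exists_point (c : Chart X n) {a : Fin n → k} (ha : MvPolynomial.eval a c.h ≠ 0) :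
    ∃ x ∈ c.dom, c.coord x = a := by
  have : a ∈ c.coord '' c.dom := by rw [c.image]; exact ha
  exact this

theorem Chart.eval_h (c : Chart X n) {x : X} (hx : x ∈ c.dom) :
    MvPolynomial.eval (c.coord x) c.h ≠ 0 := by
  have : c.coord x ∈ c.coord '' c.dom := ⟨x, hx, rfl⟩
  rw [c.image] at this
  exact this

theorem Chart.regularAt_eval (c : Chart X n) {x : X} (hx : x ∈ c.dom)
    (p : MvPolynomial (Fin n) k) : RegularAt X (fun y => MvPolynomial.eval (c.coord y) p) x :=
  (c.regular_iff x hx _).mpr ⟨p, 1, by simp, by simp⟩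

/-- The coordinates given by `r` are homogeneous coordinates of the point `z`. -/
def IsRep (r : (Σ i, κ i) → MvPolynomial (Fin n) k) (a : Fin n → k) (z : MultiProj k κ) : Prop :=
  ∀ i, ∃ c : k, c ≠ 0 ∧ ∀ j, MvPolynomial.eval a (r ⟨i, j⟩) = c * (z i).rep j

/-- The unit `u` depends on the multidegree only. Quotients of forms of equal multidegree therefore
become quotients of polynomials in the chart coordinates. -/
theorem IsRep.exists_evalAt {r : (Σ i, κ i) → MvPolynomial (Fin n) k} {a : Fin n → k}
    {z : MultiProj k κ} (h : IsRep r a z) (d : ι →₀ ℕ) :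
    ∃ u : k, u ≠ 0 ∧ ∀ A, IsForm A d →
      MvPolynomial.eval a (MvPolynomial.bind₁ r A) = u * evalAt A z := by
  choose c hc0 hc using h
  refine ⟨d.prod fun i n => c i ^ n, ?_, fun A hA => ?_⟩
  · exact Finset.prod_ne_zero_iff.mpr fun i _ => pow_ne_zero _ (hc0 i)
  · rw [show MvPolynomial.eval a (MvPolynomial.bind₁ r A) =
      MvPolynomial.eval (fun s => MvPolynomial.eval a (r s)) A from
      MvPolynomial.eval₂Hom_bind₁ _ _ _ _, evalAt, ← hA.eval_smul]
    congr 2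
    ext s
    exact hc s.1 s.2

theorem IsRep.unique {r : (Σ i, κ i) → MvPolynomial (Fin n) k} {a : Fin n → k}
    {z z' : MultiProj k κ} (h : IsRep r a z) (h' : IsRep r a z') : z = z' := by
  funext i
  obtain ⟨c, hc, hz⟩ := h i
  obtain ⟨c', hc', hz'⟩ := h' i
  rw [← (z i).mk_rep, ← (z' i).mk_rep, Projectivization.mk_eq_mk_iff']
  refine ⟨c⁻¹ * c', ?_⟩
  ext j
  simp only [Pi.smul_apply, smul_eq_mul]
  rw [mul_assoc, ← hz' j, hz j, inv_mul_cancel_left₀ hc]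

theorem exists_isRep {r : (Σ i, κ i) → MvPolynomial (Fin n) k} {a : Fin n → k}
    (h : ∀ i, ∃ j, MvPolynomial.eval a (r ⟨i, j⟩) ≠ 0) : ∃ z : MultiProj k κ, IsRep r a z := by
  have h' : ∀ i, (fun j => MvPolynomial.eval a (r ⟨i, j⟩)) ≠ 0 := fun i hi => by
    obtain ⟨j, hj⟩ := h i
    exact hj (congrFun hi j)
  refine ⟨fun i => Projectivization.mk k _ (h' i), fun i => ?_⟩
  obtain ⟨c, hc⟩ := Projectivization.exists_smul_eq_mk_rep k _ (h' i)
  refine ⟨c⁻¹.1, Units.ne_zero _, fun j => ?_⟩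
  rw [← hc]
  simp [Units.smul_def]

theorem exists_mem_of_mem_nhds_closure {Ω : Set (MultiProj k κ)} {x : closure Ω}
    {V : Set (closure Ω)} (hV : V ∈ 𝓝 x) : ∃ y ∈ V, y.1 ∈ Ω := by
  rw [nhds_subtype, Filter.mem_comap] at hV
  obtain ⟨W, hW, hWV⟩ := hV
  obtain ⟨z, hzW, hz⟩ := mem_closure_iff_nhds.mp x.2 W hW
  exact ⟨⟨z, subset_closure hz⟩, hWV hzW, hz⟩

/-- The locus where a regular function does not vanish is open, so it would meet the dense subset
`Ω`. Identities checked on `Ω` extend to its closure in this way. -/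
theorem RegularAt.eq_zero_of_closure {Ω : Set (MultiProj k κ)} {x : closure Ω}
    {f : closure Ω → k} (hf : RegularAt _ f x) {V : Set (closure Ω)} (hV : V ∈ 𝓝 x)
    (h : ∀ y ∈ V, y.1 ∈ Ω → f y = 0) : f x = 0 := by
  by_contra hne
  obtain ⟨y, hy, hyΩ⟩ := exists_mem_of_mem_nhds_closure (Filter.inter_mem hV (hf.eventually_ne hne))
  exact hy.2 (h y hy.1 hyΩ)

theorem exists_rep_ne_zero (x : MultiProj k κ) (i : ι) : ∃ j, (x i).rep j ≠ 0 := by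
  by_contra! h
  exact (x i).rep_nonzero (funext h)

open MvPolynomial in
theorem exists_eval_ne_zero [Infinite k] {p : MvPolynomial (Fin n) k} (hp : p ≠ 0) :
    ∃ a, eval a p ≠ 0 := by
  by_contra! h
  exact hp (MvPolynomial.funext fun a => by simpa using h a)

open MvPolynomial in
/-- Charts on a closure, from polynomial homogeneous coordinates. -/
def Chart.ofClosure [Infinite k] [∀ i, Fintype (κ i)] (Ω : Set (MultiProj k κ))
    (dom : Set (closure Ω)) (hdom : IsOpen dom) (coord : closure Ω → Fin n → k)
    (hreg : ∀ x ∈ dom, ∀ a, RegularAt (closure Ω) (fun y => coord y a) x)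
    (h : MvPolynomial (Fin n) k) (h_ne_zero : h ≠ 0) (r : (Σ i, κ i) → MvPolynomial (Fin n) k)
    (hr : ∀ a, eval a h ≠ 0 → ∀ i, ∃ j, eval a (r ⟨i, j⟩) ≠ 0)
    (hdomh : ∀ x ∈ dom, eval (coord x) h ≠ 0)
    (hΩ : ∀ x ∈ dom, x.1 ∈ Ω → ∀ i j j', (x.1 i).rep j * eval (coord x) (r ⟨i, j'⟩) =
      (x.1 i).rep j' * eval (coord x) (r ⟨i, j⟩))
    (g : MvPolynomial (Fin n) k) (hg : g ≠ 0)
    (hgen : ∀ a z, eval a g ≠ 0 → eval a h ≠ 0 → IsRep r a z → z ∈ Ω)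
    (hpt : ∀ (x : closure Ω) a, eval a h ≠ 0 → IsRep r a x.1 → x ∈ dom ∧ coord x = a) :
    Chart (closure Ω) n :=
  have hrep : ∀ x ∈ dom, IsRep r (coord x) x.1 := by
    intro x hx i
    obtain ⟨j₀, hj₀⟩ := exists_rep_ne_zero x.1 i
    -- Proportionality of the coordinates is known on `Ω`. Divided by the coordinate `j₀`, which
    -- does not vanish at `x`, it becomes the vanishing of a regular function and so passes to the
    -- closure.
    have hminor : ∀ j j', (x.1 i).rep j * eval (coord x) (r ⟨i, j'⟩) =
        (x.1 i).rep j' * eval (coord x) (r ⟨i, j⟩) := by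
      classical
      intro j j'
      have hq : ∀ j, RegularAt (closure Ω)
          (fun y => (Pi.single j 1 ⬝ᵥ (y.1 i).rep) / (Pi.single j₀ 1 ⬝ᵥ (y.1 i).rep)) x := fun j =>
        RegularAt.linear_div i _ _ (by simpa using hj₀)
      have := (((hq j).mul (RegularAt.eval (hreg x hx) (r ⟨i, j'⟩))).sub
        ((hq j').mul (RegularAt.eval (hreg x hx) (r ⟨i, j⟩)))).eq_zero_of_closure
        (hdom.mem_nhds hx) (by
          intro y hy hyΩ
          have := hΩ y hy hyΩ i j j'
          simp only [single_dotProduct, one_mul, Pi.sub_apply, Pi.mul_apply]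
          rw [div_mul_eq_mul_div, div_mul_eq_mul_div, this, sub_self])
      simp only [single_dotProduct, one_mul, Pi.sub_apply, Pi.mul_apply] at this
      rw [div_mul_eq_mul_div, div_mul_eq_mul_div, ← sub_div, div_eq_zero_iff] at this
      exact sub_eq_zero.mp (this.resolve_right hj₀)
    have hj₁ : eval (coord x) (r ⟨i, j₀⟩) ≠ 0 := by
      obtain ⟨j₁, hj₁⟩ := hr _ (hdomh x hx) i
      intro h0
      have := hminor j₀ j₁
      rw [h0, mul_zero] at this
      exact (mul_ne_zero hj₀ hj₁) this
    refine ⟨eval (coord x) (r ⟨i, j₀⟩) / (x.1 i).rep j₀, div_ne_zero hj₁ hj₀, fun j => ?_⟩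
    have := hminor j₀ j
    field_simp
    linear_combination this
  have hopen : ∀ g : MvPolynomial (Fin n) k, IsOpen {x | x ∈ dom ∧ eval (coord x) g ≠ 0} := by
    intro g
    rw [isOpen_iff_mem_nhds]
    rintro x ⟨hx, hgx⟩
    exact Filter.inter_mem (hdom.mem_nhds hx) ((RegularAt.eval (hreg x hx) g).eventually_ne hgx)
  { dom := dom
    coord := coord
    h := h
    h_ne_zero := h_ne_zero
    injOn := by
      intro x hx y hy hxy
      have h2 := hrep y hy
      rw [← hxy] at h2
      exact Subtype.ext ((hrep x hx).unique h2)
    image := by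
      ext a
      constructor
      · rintro ⟨x, hx, rfl⟩
        exact hdomh x hx
      · intro ha
        obtain ⟨z, hz⟩ := exists_isRep (hr a ha)
        -- If the form `A` does not vanish at `z`, then `bind₁ r A` is a nonzero polynomial. Over an
        -- infinite field there is a point `b` where it, `g` and `h` are all nonzero, and the point
        -- with coordinates `r b` lies in `Ω` and in the given neighbourhood.
        have hzΩ : z ∈ closure Ω := by
          rw [isTopologicalBasis_forms.mem_closure_iff]
          rintro _ ⟨A, d, hA, rfl⟩ hAz
          obtain ⟨u, hu, hA'⟩ := hz.exists_evalAt d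
          have hne : bind₁ r A ≠ 0 := by
            intro h0
            have := hA' A hA
            rw [h0, map_zero] at this
            exact mul_ne_zero hu hAz this.symm
          obtain ⟨b, hb⟩ := exists_eval_ne_zero (mul_ne_zero (mul_ne_zero hne hg) h_ne_zero)
          simp only [map_mul] at hb
          have hbh := right_ne_zero_of_mul hb
          obtain ⟨y, hy⟩ := exists_isRep (hr b hbh)
          obtain ⟨u', hu', hA''⟩ := hy.exists_evalAt d
          refine ⟨y, ?_, hgen b y (right_ne_zero_of_mul (left_ne_zero_of_mul hb)) hbh hy⟩
          have := left_ne_zero_of_mul (left_ne_zero_of_mul hb)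
          rw [hA'' A hA] at this
          exact right_ne_zero_of_mul this
        exact ⟨⟨z, hzΩ⟩, (hpt ⟨z, hzΩ⟩ a ha hz).1, (hpt ⟨z, hzΩ⟩ a ha hz).2⟩
    isOpen_ne := hopen
    basis := by
      intro x hx V hV
      obtain ⟨A, d, hA, hAx, hAV⟩ := exists_form_of_mem_nhds hV
      refine ⟨bind₁ r A, ?_, fun y hy hAy => hAV y ?_⟩
      · obtain ⟨u, hu, hA'⟩ := (hrep x hx).exists_evalAt d
        rw [hA' A hA]; exact mul_ne_zero hu hAx
      · obtain ⟨u, hu, hA'⟩ := (hrep y hy).exists_evalAt d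
        rw [hA' A hA] at hAy; exact right_ne_zero_of_mul hAy
    regular_iff := by
      intro x hx f
      constructor
      -- Substituting `r` multiplies the values of `A` and `B` by the same unit, because they have
      -- the same multidegree.
      · rintro ⟨A, B, d, hA, hB, h0, hAB⟩
        refine ⟨bind₁ r A, bind₁ r B, ?_, ?_⟩
        · obtain ⟨u, hu, hA'⟩ := (hrep x hx).exists_evalAt d
          rw [hA' B hB]; exact mul_ne_zero hu h0
        · filter_upwards [hAB, hdom.mem_nhds hx] with y hy hyd
          obtain ⟨u, hu, hA'⟩ := (hrep y hyd).exists_evalAt d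
          rw [hA' B hB, hA' A hA, ← hy]; ring
      · rintro ⟨A, B, h0, hAB⟩
        have hB := RegularAt.eval (hreg x hx) B
        refine ((RegularAt.eval (hreg x hx) A).div hB h0).congr ?_
        filter_upwards [hAB, hB.eventually_ne h0] with y hy hy'
        rw [← hy, mul_div_cancel_right₀ _ hy'] }

variable {ι' : Type} {κ' : ι' → Type} {Y : Set (MultiProj k κ')}

/-- Transport of a chart along an isomorphism. -/
def Chart.comap (e : VarIso X Y) (c : Chart Y n) : Chart X n where
  dom := e.toHomeomorph ⁻¹' c.dom
  coord := c.coord ∘ e.toHomeomorph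
  h := c.h
  h_ne_zero := c.h_ne_zero
  injOn := fun x hx y hy hxy => e.toHomeomorph.injective (c.injOn hx hy hxy)
  image := by
    rw [← c.image, Set.image_comp, Set.image_preimage_eq _ e.toHomeomorph.surjective]
  isOpen_ne := fun g => (c.isOpen_ne g).preimage e.toHomeomorph.continuous
  basis := by
    intro x hx V hV
    obtain ⟨g, hg, hgV⟩ := c.basis (e.toHomeomorph x) hx (e.toHomeomorph '' V)
      (e.toHomeomorph.isOpenMap.image_mem_nhds hV)
    refine ⟨g, hg, fun y hy hgy => ?_⟩
    obtain ⟨z, hz, hzy⟩ := hgV _ hy hgy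
    rwa [← e.toHomeomorph.injective hzy]
  regular_iff := by
    intro x hx f
    have h1 := e.regular_iff (f ∘ e.toHomeomorph.symm) x
    have h2 : (f ∘ e.toHomeomorph.symm) ∘ e.toHomeomorph = f := by ext y; simp
    rw [h2] at h1
    rw [← h1, c.regular_iff _ hx]
    refine exists_congr fun A => exists_congr fun B => and_congr Iff.rfl ?_
    rw [← e.toHomeomorph.map_nhds_eq, Filter.eventually_map]
    simp

theorem Chart.regularAt_comp_iff (cX : Chart X n) (cY : Chart Y n) (e : X ≃ₜ Y) {x : X}
    (hx : x ∈ cX.dom) (hdom : ∀ x, x ∈ cX.dom ↔ e x ∈ cY.dom)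
    (hcoord : ∀ x ∈ cX.dom, cX.coord x = cY.coord (e x)) (g : Y → k) :
    RegularAt Y g (e x) ↔ RegularAt X (g ∘ e) x := by
  rw [cX.regular_iff x hx, cY.regular_iff _ ((hdom x).mp hx), ← hcoord x hx]
  refine exists_congr fun A => exists_congr fun B => and_congr Iff.rfl ?_
  rw [← e.map_nhds_eq, Filter.eventually_map]
  refine Filter.eventually_congr ?_
  filter_upwards [cX.dom_mem_nhds hx] with y hy
  rw [hcoord y hy]; rfl

/-- A bijection matching charts is an isomorphism. -/
theorem VarIso.ofCharts {I : Type*} (e : X → Y) (cX : I → Chart X n) (cY : I → Chart Y n)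
    (hdom : ∀ i x, x ∈ (cX i).dom ↔ e x ∈ (cY i).dom)
    (hcoord : ∀ i, ∀ x ∈ (cX i).dom, (cX i).coord x = (cY i).coord (e x))
    (hh : ∀ i, (cX i).h = (cY i).h) (hcover : ∀ y, ∃ i, y ∈ (cY i).dom) :
    ∃ E : VarIso X Y, ∀ x, E.toHomeomorph x = e x := by
  -- In matching charts `e` is the identity on coordinates. Injectivity, surjectivity and continuity
  -- in both directions can all be tested there.
  have hinj : Function.Injective e := by
    intro x x' hxx
    obtain ⟨i, hi⟩ := hcover (e x)
    have hx := (hdom i x).mpr hi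
    have hx' := (hdom i x').mpr (hxx ▸ hi)
    refine (cX i).injOn hx hx' ?_
    rw [hcoord i x hx, hcoord i x' hx', hxx]
  have hsurj : Function.Surjective e := by
    intro y
    obtain ⟨i, hi⟩ := hcover y
    have := (cY i).eval_h hi
    rw [← hh i] at this
    obtain ⟨x, hx, hxy⟩ := (cX i).exists_point this
    exact ⟨x, (cY i).injOn ((hdom i x).mp hx) hi (by rw [← hcoord i x hx, hxy])⟩
  let E := Equiv.ofBijective e ⟨hinj, hsurj⟩
  have hc1 : Continuous e := by
    rw [continuous_iff_continuousAt]
    intro x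
    obtain ⟨i, hi⟩ := hcover (e x)
    have hx := (hdom i x).mpr hi
    intro V hV
    obtain ⟨g, hg, hgV⟩ := (cY i).basis _ hi V hV
    rw [← hcoord i x hx] at hg
    rw [Filter.mem_map]
    refine Filter.mem_of_superset (((cX i).isOpen_ne g).mem_nhds ⟨hx, hg⟩) ?_
    rintro y ⟨hy, hgy⟩
    refine hgV _ ((hdom i y).mp hy) ?_
    rwa [← hcoord i y hy]
  have hc2 : Continuous E.symm := by
    rw [continuous_iff_continuousAt]
    intro y
    obtain ⟨x, rfl⟩ := hsurj y
    obtain ⟨i, hi⟩ := hcover (e x)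
    have hx := (hdom i x).mpr hi
    have hxe : E.symm (e x) = x := E.symm_apply_apply x
    intro V hV
    rw [hxe] at hV
    obtain ⟨g, hg, hgV⟩ := (cX i).basis _ hx V hV
    rw [hcoord i x hx] at hg
    rw [Filter.mem_map]
    refine Filter.mem_of_superset (((cY i).isOpen_ne g).mem_nhds ⟨hi, hg⟩) ?_
    rintro y ⟨hy, hgy⟩
    obtain ⟨z, rfl⟩ := hsurj y
    have hze : E.symm (e z) = z := E.symm_apply_apply z
    have hz := (hdom i z).mpr hy
    rw [Set.mem_preimage, hze]
    refine hgV _ hz ?_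
    rwa [hcoord i z hz]
  let E' : X ≃ₜ Y := { E with continuous_toFun := hc1, continuous_invFun := hc2 }
  refine ⟨⟨E', fun g x => ?_⟩, fun x => rfl⟩
  obtain ⟨i, hi⟩ := hcover (e x)
  exact (cX i).regularAt_comp_iff (cY i) E' ((hdom i x).mpr hi) (hdom i) (hcoord i) g

end Charts

end

end ProjGeom

namespace ProjGeom

noncomputable section

universe u

/-! ### Orders of vanishing in localizations at a prime element -/

section OrderOfVanishing

open nonZeroDivisors

theorem ord_of_maximalIdeal_eq_span {S : Type*} [CommRing S] [IsLocalRing S] {q : S}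
    (hq : IsLocalRing.maximalIdeal S = Ideal.span {q}) : Ring.ord S q = 1 := by
  rw [Ring.ord, Module.length_eq_one_iff, ← hq]
  exact isSimpleModule_iff_isCoatom.mpr
    (Ideal.isMaximal_def.mp (IsLocalRing.maximalIdeal.isMaximal S))

/-- Write `f = q ^ m * g` with `q ∤ g`. In the localization `g` is a unit and `q` generates the
maximal ideal, so the quotient by `q` is simple and each factor `q` contributes one to the length.
-/
theorem ord_algebraMap_atPrime {R S : Type*} [CommRing R] [IsDomain R] [WfDvdMonoid R]
    [CommRing S] [Algebra R S] (P : Ideal R) [P.IsPrime] [IsLocalization.AtPrime S P] {q : R}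
    (hP : P = Ideal.span {q}) (hq : Prime q) {f : R} (hf : f ≠ 0) :
    Ring.ord S (algebraMap R S f) = (multiplicity q f : ℕ) := by
  have : IsDomain S := IsLocalization.isDomain_of_atPrime S P
  have : IsLocalRing S := IsLocalization.AtPrime.isLocalRing S P
  have hinj : Function.Injective (algebraMap R S) :=
    IsLocalization.injective S P.primeCompl_le_nonZeroDivisors
  have hfin : FiniteMultiplicity q f := FiniteMultiplicity.of_not_isUnit hq.not_isUnit hf
  obtain ⟨g, hg, hqg⟩ := hfin.exists_eq_pow_mul_and_not_dvd
  have hgu : IsUnit (algebraMap R S g) :=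
    IsLocalization.map_units S (⟨g, by
      change g ∉ P
      rwa [hP, Ideal.mem_span_singleton]⟩ : P.primeCompl)
  have hqS : algebraMap R S q ∈ S⁰ := by
    rw [mem_nonZeroDivisors_iff_ne_zero]
    exact fun h => hq.ne_zero (hinj (by rw [h, map_zero]))
  have hmax : IsLocalRing.maximalIdeal S = Ideal.span {algebraMap R S q} := by
    rw [← IsLocalization.AtPrime.map_eq_maximalIdeal P, hP, Ideal.map_span, Set.image_singleton]
  conv_lhs => rw [hg, map_mul, Ring.ord_mul_of_isUnit_right hgu, map_pow, Ring.ord_pow hqS,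
    ord_of_maximalIdeal_eq_span hmax]
  simp

/-- Zero is divisible by every power of `q`. This is what excludes zero germs from the fractions
allowed in `HasOrder`, where orders are natural numbers. -/
theorem ord_zero_atPrime {R S : Type*} [CommRing R] [IsDomain R] [WfDvdMonoid R]
    [CommRing S] [Algebra R S] (P : Ideal R) [P.IsPrime] [IsLocalization.AtPrime S P] {q : R}
    (hP : P = Ideal.span {q}) (hq : Prime q) : Ring.ord S (0 : S) = ⊤ := by
  have : IsDomain S := IsLocalization.isDomain_of_atPrime S P
  rw [ENat.eq_top_iff_forall_ge]
  intro n
  have h := ord_algebraMap_atPrime (S := S) P hP hq (pow_ne_zero n hq.ne_zero)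
  rw [multiplicity_pow_self_of_prime hq] at h
  rw [← h]
  exact Ring.ord_le_ord_of_dvd (dvd_zero _)

end OrderOfVanishing

/-! ### Generic neighbourhoods, irreducibility and codimension one -/

section Generic

variable {S : Type*} [TopologicalSpace S]

/-- Irreducibility makes the family of open sets meeting `Z` directed, so the infimum of principal
filters is given by its members. -/
theorem mem_nhdsGeneric {Z : Set S} (hZ : IsIrreducible Z) {V : Set S} :
    V ∈ nhdsGeneric Z ↔ ∃ U, IsOpen U ∧ (U ∩ Z).Nonempty ∧ U ⊆ V := by
  have e : nhdsGeneric Z = ⨅ U ∈ {U : Set S | IsOpen U ∧ (U ∩ Z).Nonempty}, Filter.principal U := rfl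
  rw [e, Filter.mem_biInf_of_directed (s := {U | IsOpen U ∧ (U ∩ Z).Nonempty})]
  · simp [and_assoc]
  · rintro U ⟨hU, hUZ⟩ W ⟨hW, hWZ⟩
    refine ⟨U ∩ W, ⟨hU.inter hW, ?_⟩, ?_, ?_⟩
    · rw [Set.inter_comm] at hUZ hWZ ⊢
      exact hZ.2 U W hU hW hUZ hWZ
    · exact Filter.principal_mono.mpr Set.inter_subset_left
    · exact Filter.principal_mono.mpr Set.inter_subset_right
  · exact ⟨Set.univ, isOpen_univ, by simpa using hZ.1⟩

theorem IsOpen.mem_nhdsGeneric {Z U : Set S} (hU : IsOpen U) (hUZ : (U ∩ Z).Nonempty) :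
    U ∈ nhdsGeneric Z :=
  Filter.mem_iInf_of_mem U (Filter.mem_iInf_of_mem ⟨hU, hUZ⟩ (Filter.mem_principal_self U))

theorem nhdsGeneric_singleton (x : S) : nhdsGeneric {x} = 𝓝 x := by
  ext V
  rw [mem_nhdsGeneric isIrreducible_singleton, mem_nhds_iff]
  constructor
  · rintro ⟨U, hU, ⟨y, hy, rfl⟩, hUV⟩
    exact ⟨U, hUV, hU, hy⟩
  · rintro ⟨U, hUV, hU, hx⟩
    exact ⟨U, hU, ⟨x, hx, rfl⟩, hUV⟩

/-- An open set meeting `Z ∩ U i` also meets `Z ∩ U i ∩ U j`, since `Z ∩ U i` is irreducible; both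
open sets can thus be compared inside `Z ∩ U j`. -/
theorem isIrreducible_of_cover {I : Type*} {Z : Set S} (hZ : Z.Nonempty) (U : I → Set S)
    (hU : ∀ i, IsOpen (U i)) (hcover : ∀ x ∈ Z, ∃ i, x ∈ U i)
    (hirr : ∀ i, IsPreirreducible (Z ∩ U i))
    (hmeet : ∀ i j, (Z ∩ U i).Nonempty → (Z ∩ U j).Nonempty → (Z ∩ (U i ∩ U j)).Nonempty) :
    IsIrreducible Z := by
  refine ⟨hZ, ?_⟩
  rintro V W hV hW ⟨x, hxZ, hxV⟩ ⟨y, hyZ, hyW⟩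
  obtain ⟨i, hi⟩ := hcover x hxZ
  obtain ⟨j, hj⟩ := hcover y hyZ
  obtain ⟨z, hzZ, hzi, hzj⟩ := hmeet i j ⟨x, hxZ, hi⟩ ⟨y, hyZ, hj⟩
  obtain ⟨z', ⟨hz'Z, hz'i⟩, hz'V, hz'j⟩ := hirr i V (U j) hV (hU j) ⟨x, ⟨hxZ, hi⟩, hxV⟩
    ⟨z, ⟨hzZ, hzi⟩, hzj⟩
  obtain ⟨w, hw, hwV, hwW⟩ := hirr j V W hV hW ⟨z', ⟨hz'Z, hz'j⟩, hz'V⟩ ⟨y, ⟨hyZ, hj⟩, hyW⟩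
  exact ⟨w, hw.1, hwV, hwW⟩

/-- The whole space is the largest irreducible closed set, so codimension one means maximal among
the proper ones. -/
theorem coheight_eq_one_iff [IrreducibleSpace S] (Z : TopologicalSpace.IrreducibleCloseds S) :
    Order.coheight Z = 1 ↔ (Z : Set S) ≠ Set.univ ∧
      ∀ W : TopologicalSpace.IrreducibleCloseds S, Z < W → (W : Set S) = Set.univ := by
  let T : TopologicalSpace.IrreducibleCloseds S :=
    ⟨Set.univ, IrreducibleSpace.isIrreducible_univ S, isClosed_univ⟩
  have hT : ∀ W, W ≤ T := fun W => Set.subset_univ _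
  have hmax : ∀ W : TopologicalSpace.IrreducibleCloseds S, IsMax W ↔ (W : Set S) = Set.univ := by
    intro W
    constructor
    · intro h
      exact Set.eq_univ_of_univ_subset (h (hT W))
    · intro h V _
      change (V : Set S) ⊆ W
      rw [h]; exact Set.subset_univ _
  constructor
  · intro h
    refine ⟨fun h' => ?_, fun W hW => ?_⟩
    · rw [← hmax, ← Order.coheight_eq_zero, h] at h'
      exact one_ne_zero h'
    · rw [← hmax, ← Order.coheight_eq_zero]
      have := Order.coheight_add_one_le hW
      rw [h] at this
      have h2 : Order.coheight W + 1 ≤ 0 + 1 := by simpa using this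
      exact nonpos_iff_eq_zero.mp ((ENat.add_le_add_iff_right ENat.one_ne_top).mp h2)
  · rintro ⟨h1, h2⟩
    apply le_antisymm
    · have := (Order.coheight_le_coe_iff (x := Z) (n := 1)).mpr (fun W hW => by
        rw [Order.coheight_eq_zero.mpr ((hmax W).mpr (h2 W hW))]; exact zero_lt_one)
      simpa using this
    · rw [Order.one_le_iff_ne_zero, Order.coheight_ne_zero, hmax]
      exact h1

end Generic

/-! ### Ideals of closed sets in a chart, and the local rings -/

section ChartIdeal

open MvPolynomial

variable {k : Type u} [Field k] {ι : Type} {κ : ι → Type} {X : Set (MultiProj k κ)} {n : ℕ}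

/-- The polynomials vanishing on the part of `Z` covered by the chart. -/
def Chart.ideal (c : Chart X n) (Z : Set X) : Ideal (MvPolynomial (Fin n) k) where
  carrier := {f | ∀ x ∈ Z, x ∈ c.dom → eval (c.coord x) f = 0}
  add_mem' := fun {f g} hf hg x hx hd => by rw [map_add, hf x hx hd, hg x hx hd, add_zero]
  zero_mem' := fun x _ _ => map_zero _
  smul_mem' := fun a f hf x hx hd => by rw [smul_eq_mul, map_mul, hf x hx hd, mul_zero]

theorem Chart.mem_ideal {c : Chart X n} {Z : Set X} {f : MvPolynomial (Fin n) k} :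
    f ∈ c.ideal Z ↔ ∀ x ∈ Z, x ∈ c.dom → eval (c.coord x) f = 0 := Iff.rfl

theorem Chart.ideal_isPrime (c : Chart X n) {Z : Set X} (hZ : IsPreirreducible Z)
    (hm : (c.dom ∩ Z).Nonempty) : (c.ideal Z).IsPrime where
  ne_top' := by
    rw [Ideal.ne_top_iff_one]
    obtain ⟨x, hx, hxZ⟩ := hm
    intro h
    simpa using h x hxZ hx
  mem_or_mem' := by
    intro f g hfg
    by_contra! h
    obtain ⟨hf, hg⟩ := h
    simp only [Chart.mem_ideal, not_forall] at hf hg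
    obtain ⟨x, hxZ, hx, hfx⟩ := hf
    obtain ⟨y, hyZ, hy, hgy⟩ := hg
    obtain ⟨z, hzZ, ⟨hz, hfz⟩, -, hgz⟩ := hZ _ _ (c.isOpen_ne f) (c.isOpen_ne g) ⟨x, hxZ, hx, hfx⟩
      ⟨y, hyZ, hy, hgy⟩
    have := hfg z hzZ hz
    rw [map_mul] at this
    exact mul_ne_zero hfz hgz this

theorem Chart.exists_dom_ne [Infinite k] (c : Chart X n) {f : MvPolynomial (Fin n) k} (hf : f ≠ 0) :
    ∃ x ∈ c.dom, eval (c.coord x) f ≠ 0 := by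
  obtain ⟨a, ha⟩ := exists_eval_ne_zero (mul_ne_zero hf c.h_ne_zero)
  rw [map_mul] at ha
  obtain ⟨x, hx, rfl⟩ := c.exists_point (right_ne_zero_of_mul ha)
  exact ⟨x, hx, left_ne_zero_of_mul ha⟩

/-- A neighbourhood contains a principal open part of the chart, and a nonzero polynomial has
nonzero values there because the field is infinite. -/
theorem Chart.eq_zero_of_eventually [Infinite k] (c : Chart X n) {x : X} (hx : x ∈ c.dom)
    {f : MvPolynomial (Fin n) k} (hf : ∀ᶠ y in 𝓝 x, eval (c.coord y) f = 0) : f = 0 := by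
  obtain ⟨g, hg, hgV⟩ := c.basis x hx _ hf
  by_contra hne
  have hg0 : g ≠ 0 := by rintro rfl; simp at hg
  obtain ⟨y, hy, hfg⟩ := c.exists_dom_ne (mul_ne_zero hne hg0)
  rw [map_mul] at hfg
  exact left_ne_zero_of_mul hfg (hgV y hy (right_ne_zero_of_mul hfg))

theorem Chart.eq_of_eventually [Infinite k] (c : Chart X n) {x : X} (hx : x ∈ c.dom)
    {f g : MvPolynomial (Fin n) k} (hf : ∀ᶠ y in 𝓝 x, eval (c.coord y) f = eval (c.coord y) g) :
    f = g := by
  refine sub_eq_zero.mp (c.eq_zero_of_eventually hx ?_)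
  filter_upwards [hf] with y hy
  rw [map_sub, hy, sub_self]

theorem Chart.eq_of_generic [Infinite k] (c : Chart X n) {Z : Set X} (hZ : IsIrreducible Z)
    (hm : (c.dom ∩ Z).Nonempty) {f g : MvPolynomial (Fin n) k}
    (h : ∀ᶠ y in nhdsGeneric Z, eval (c.coord y) f = eval (c.coord y) g) : f = g := by
  obtain ⟨U, hU, hUZ, hUV⟩ := (mem_nhdsGeneric hZ).mp
    (Filter.inter_mem h (IsOpen.mem_nhdsGeneric c.isOpen_dom hm))
  obtain ⟨x, hxU, hxZ⟩ := hUZ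
  refine c.eq_of_eventually (hUV hxU).2 ?_
  filter_upwards [hU.mem_nhds hxU] with y hy
  exact (hUV hy).1

theorem Chart.isPreirreducible_dom [Infinite k] (c : Chart X n) : IsPreirreducible c.dom := by
  rintro V W hV hW ⟨x, hx, hxV⟩ ⟨y, hy, hyW⟩
  obtain ⟨f, hf, hfV⟩ := c.basis x hx V (hV.mem_nhds hxV)
  obtain ⟨g, hg, hgW⟩ := c.basis y hy W (hW.mem_nhds hyW)
  have hf0 : f ≠ 0 := by rintro rfl; simp at hf
  have hg0 : g ≠ 0 := by rintro rfl; simp at hg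
  obtain ⟨z, hz, hfg⟩ := c.exists_dom_ne (mul_ne_zero hf0 hg0)
  rw [map_mul] at hfg
  exact ⟨z, hz, hfV z hz (left_ne_zero_of_mul hfg), hgW z hz (right_ne_zero_of_mul hfg)⟩

/-- Polynomials in the coordinates, as elements of the local ring along `Z`. -/
def Chart.toLocalRing (c : Chart X n) {Z : Set X} (hm : (c.dom ∩ Z).Nonempty) :
    MvPolynomial (Fin n) k →+* localRing X Z :=
  RingHom.codRestrict ((Filter.Germ.coeRingHom (nhdsGeneric Z)).comp
    (RingHom.pi fun x => eval (c.coord x))) (localRing X Z) fun f => by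
      refine ⟨fun x => eval (c.coord x) f, ?_, rfl⟩
      filter_upwards [IsOpen.mem_nhdsGeneric c.isOpen_dom hm] with y hy
      exact c.regularAt_eval hy f

/-- A polynomial not vanishing identically on `Z` is invertible on an open set meeting `Z`. A germ
is regular at some point of `Z` in the chart, hence a fraction of polynomials. Polynomials with
equal germs agree on a nonempty open set and so coincide. -/
theorem Chart.isLocalization [Infinite k] (c : Chart X n) {Z : Set X} (hZ : IsIrreducible Z)
    (hm : (c.dom ∩ Z).Nonempty) [(c.ideal Z).IsPrime] :
    letI := (c.toLocalRing hm).toAlgebra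
    IsLocalization.AtPrime (localRing X Z) (c.ideal Z) := by
  let := (c.toLocalRing hm).toAlgebra
  have hdom := IsOpen.mem_nhdsGeneric c.isOpen_dom hm
  have hne : ∀ f ∉ c.ideal Z, {x | x ∈ c.dom ∧ eval (c.coord x) f ≠ 0} ∈ nhdsGeneric Z := by
    intro f hf
    simp only [Chart.mem_ideal, not_forall] at hf
    obtain ⟨x, hxZ, hx, hfx⟩ := hf
    exact IsOpen.mem_nhdsGeneric (c.isOpen_ne f) ⟨x, ⟨hx, hfx⟩, hxZ⟩
  refine ⟨?_, ?_, ?_⟩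
  · rintro ⟨f, hf⟩
    have hmem := hne f hf
    refine isUnit_iff_exists_inv.mpr ⟨⟨((fun x => (eval (c.coord x) f)⁻¹ : X → k) :
      Filter.Germ _ k), _, ?_, rfl⟩, ?_⟩
    · filter_upwards [hmem] with y hy
      exact (c.regularAt_eval hy.1 f).inv hy.2
    · apply Subtype.ext
      refine Filter.Germ.coe_eq.mpr ?_
      filter_upwards [hmem] with y hy
      exact mul_inv_cancel₀ hy.2
  · rintro ⟨_, f, hf, rfl⟩
    obtain ⟨U, hU, ⟨x, hxU, hxZ⟩, hUV⟩ := (mem_nhdsGeneric hZ).mp (Filter.inter_mem hf hdom)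
    obtain ⟨A, B, hB, hAB⟩ := (c.regular_iff x (hUV hxU).2 f).mp (hUV hxU).1
    obtain ⟨V, hVsub, hV, hxV⟩ := mem_nhds_iff.mp hAB
    refine ⟨(A, ⟨B, fun h => hB (h x hxZ (hUV hxU).2)⟩), Subtype.ext (Filter.Germ.coe_eq.mpr ?_)⟩
    filter_upwards [IsOpen.mem_nhdsGeneric hV ⟨x, hxV, hxZ⟩] with y hy
    exact hVsub hy
  · intro f g hfg
    -- The map from polynomials to germs is already injective, so no multiplier is needed.
    refine ⟨1, ?_⟩
    have h := Filter.Germ.coe_eq.mp (congrArg Subtype.val hfg)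
    rw [c.eq_of_generic hZ hm h]

end ChartIdeal

/-! ### Prime divisors and their local equations -/

section PrimeDivisors

open MvPolynomial

variable {k : Type u} [Field k] {ι : Type} {κ : ι → Type} {X : Set (MultiProj k κ)} {n : ℕ}

theorem PrimeDivisor.isIrreducible (Z : PrimeDivisor X) : IsIrreducible Z.pts := Z.1.isIrreducible

theorem PrimeDivisor.isClosed (Z : PrimeDivisor X) : IsClosed Z.pts := Z.1.isClosed

theorem PrimeDivisor.pts_injective : Function.Injective (PrimeDivisor.pts (X := X)) :=
  fun _ _ h => Subtype.ext (SetLike.coe_injective h)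

theorem Chart.subset_of_inter_subset (c : Chart X n) {Z W : Set X} (hZ : IsPreirreducible Z)
    (hW : IsClosed W) (hm : (c.dom ∩ Z).Nonempty) (h : Z ∩ c.dom ⊆ W) : Z ⊆ W :=
  (subset_closure_inter_of_isPreirreducible_of_isOpen hZ c.isOpen_dom
    (by rwa [Set.inter_comm])).trans (closure_minimal h hW)

theorem Chart.zeroSet_isClosed_in (c : Chart X n) {Z : Set X} {f : MvPolynomial (Fin n) k}
    (hf : ∀ x ∈ Z, x ∈ c.dom → eval (c.coord x) f = 0) {x : X} (hx : x ∈ closure Z)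
    (hd : x ∈ c.dom) : eval (c.coord x) f = 0 := by
  by_contra hne
  obtain ⟨y, ⟨hy, hfy⟩, hyZ⟩ := mem_closure_iff.mp hx _ (c.isOpen_ne f) ⟨hd, hne⟩
  exact hfy (hf y hyZ hy)

variable [IsAlgClosed k]

/-- The Nullstellensatz for the prime ideal `(q)`, applied to `f * h`: the chart only sees the
points with `h ≠ 0`, and the factor `h` is removed again because `q ∤ h`. -/
theorem Chart.dvd_of_vanishing (c : Chart X n) {q f : MvPolynomial (Fin n) k} (hq : Prime q)
    (hqh : ¬ q ∣ c.h) (h : ∀ x ∈ c.dom, eval (c.coord x) q = 0 → eval (c.coord x) f = 0) :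
    q ∣ f := by
  have hP : (Ideal.span {q}).IsPrime := (Ideal.span_singleton_prime hq.ne_zero).mpr hq
  have hmem : f * c.h ∈ vanishingIdeal k (zeroLocus k (Ideal.span {q})) := by
    rw [mem_vanishingIdeal_iff]
    intro a ha
    have haq : eval a q = 0 := by
      simpa using ha q (Ideal.mem_span_singleton_self q)
    by_cases hah : eval a c.h = 0
    · simp [hah]
    · obtain ⟨x, hx, rfl⟩ := c.exists_point hah
      simp [h x hx haq]
  rw [IsPrime.vanishingIdeal_zeroLocus, Ideal.mem_span_singleton] at hmem
  exact (hq.dvd_or_dvd hmem).resolve_right hqh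

/-- The prime divisor with local equation `q`. -/
theorem Chart.exists_primeDivisor [IrreducibleSpace X] (c : Chart X n)
    {q : MvPolynomial (Fin n) k} (hq : Prime q) (hqh : ¬ q ∣ c.h) :
    ∃ Z : PrimeDivisor X, (c.dom ∩ Z.pts).Nonempty ∧ c.ideal Z.pts = Ideal.span {q} ∧
      ∀ x ∈ c.dom, x ∈ Z.pts ↔ eval (c.coord x) q = 0 := by
  set S : Set X := {x | x ∈ c.dom ∧ eval (c.coord x) q = 0} with hS
  have hdvd : ∀ f, (∀ x ∈ S, eval (c.coord x) f = 0) → q ∣ f := fun f hf =>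
    c.dvd_of_vanishing hq hqh fun x hx hqx => hf x ⟨hx, hqx⟩
  have hne : S.Nonempty := by
    by_contra h
    rw [Set.not_nonempty_iff_eq_empty] at h
    refine hq.not_isUnit (isUnit_of_dvd_one (hdvd 1 ?_))
    simp [h]
  have hirr : IsIrreducible S := by
    refine ⟨hne, ?_⟩
    rintro V W hV hW ⟨x, hx, hxV⟩ ⟨y, hy, hyW⟩
    obtain ⟨f, hf, hfV⟩ := c.basis x hx.1 V (hV.mem_nhds hxV)
    obtain ⟨g, hg, hgW⟩ := c.basis y hy.1 W (hW.mem_nhds hyW)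
    have : ¬ q ∣ f * g := by
      intro h
      rcases hq.dvd_or_dvd h with ⟨r, rfl⟩ | ⟨r, rfl⟩
      · rw [map_mul, hx.2, zero_mul] at hf; exact hf rfl
      · rw [map_mul, hy.2, zero_mul] at hg; exact hg rfl
    have h2 : ¬ ∀ x ∈ S, eval (c.coord x) (f * g) = 0 := fun h => this (hdvd _ h)
    push Not at h2
    obtain ⟨z, hz, hfg⟩ := h2
    rw [map_mul] at hfg
    exact ⟨z, hz, hfV z hz.1 (left_ne_zero_of_mul hfg), hgW z hz.1 (right_ne_zero_of_mul hfg)⟩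
  have hideal : c.ideal (closure S) = Ideal.span {q} := by
    ext f
    rw [Ideal.mem_span_singleton]
    constructor
    · intro hf
      exact hdvd f fun x hx => hf x (subset_closure hx) hx.1
    · rintro ⟨r, rfl⟩ x hx hd
      refine c.zeroSet_isClosed_in (Z := S) (fun y hy _ => ?_) hx hd
      rw [map_mul, hy.2, zero_mul]
  have hmeet : (c.dom ∩ closure S).Nonempty := by
    obtain ⟨x, hx⟩ := hne
    exact ⟨x, hx.1, subset_closure hx⟩
  let T : TopologicalSpace.IrreducibleCloseds X := ⟨closure S, hirr.closure, isClosed_closure⟩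
  have hcoh : Order.coheight T = 1 := by
    rw [coheight_eq_one_iff]
    constructor
    · intro h
      obtain ⟨x, hx, hxq⟩ := c.exists_dom_ne hq.ne_zero
      have hq' : q ∈ c.ideal (closure S) := by rw [hideal]; exact Ideal.mem_span_singleton_self q
      exact hxq (hq' x (by
        change x ∈ (T : Set X)
        rw [h]; trivial) hx)
    · intro W hTW
      have hle : closure S ⊆ W := hTW.le
      have hmW : (c.dom ∩ (W : Set X)).Nonempty := hmeet.mono (Set.inter_subset_inter_right _ hle)
      have hWprime := c.ideal_isPrime W.isIrreducible.2 hmW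
      have hWle : c.ideal W ≤ Ideal.span {q} := by
        rw [← hideal]
        exact fun f hf x hx hd => hf x (hle hx) hd
      have hqW : q ∉ c.ideal W := by
        intro h
        apply hTW.not_ge
        refine c.subset_of_inter_subset W.isIrreducible.2 isClosed_closure hmW ?_
        rintro x ⟨hxW, hx⟩
        exact subset_closure ⟨hx, h x hxW hx⟩
      -- The ideal of `W` is prime, contained in `(q)` and does not contain `q`. If `f = q ^ n * g`
      -- with `q ∤ g` lay in it, then `q` or `g` would, and both are impossible. So `W` contains the
      -- whole chart.
      have hbot : ∀ f ∈ c.ideal W, f = 0 := by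
        intro f hf
        by_contra hf0
        obtain ⟨g, hg, hqg⟩ :=
          (FiniteMultiplicity.of_not_isUnit hq.not_isUnit hf0).exists_eq_pow_mul_and_not_dvd
        rw [hg] at hf
        rcases hWprime.mem_or_mem hf with h | h
        · exact hqW (hWprime.mem_of_pow_mem _ h)
        · exact hqg (Ideal.mem_span_singleton.mp (hWle h))
      have hdomW : c.dom ⊆ W := by
        intro x hx
        by_contra hxW
        obtain ⟨g, hg, hgV⟩ := c.basis x hx _ (W.isClosed.isOpen_compl.mem_nhds hxW)
        have : g ∈ c.ideal W := by
          intro y hy hyd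
          by_contra hgy
          exact hgV y hyd hgy hy
        rw [hbot g this, map_zero] at hg
        exact hg rfl
      refine Set.eq_univ_of_univ_subset ?_
      refine c.subset_of_inter_subset (IrreducibleSpace.isIrreducible_univ X).2 W.isClosed ?_ ?_
      · obtain ⟨x, hx, _⟩ := hmeet
        exact ⟨x, hx, trivial⟩
      · exact fun x hx => hdomW hx.2
  refine ⟨⟨T, hcoh⟩, hmeet, hideal, fun x hx => ⟨fun hxZ => ?_, fun h => subset_closure ⟨hx, h⟩⟩⟩
  have hq' : q ∈ c.ideal (closure S) := by rw [hideal]; exact Ideal.mem_span_singleton_self q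
  exact hq' x hxZ hx

/-- The ideal of `Z` is a nonzero prime of a factorial ring, so it contains a prime element `q`. The
prime divisor of `q` contains `Z`, and equals it because `Z` has codimension one. -/
theorem Chart.exists_eqn [IrreducibleSpace X] (c : Chart X n) (Z : PrimeDivisor X)
    (hm : (c.dom ∩ Z.pts).Nonempty) :
    ∃ q : MvPolynomial (Fin n) k, Prime q ∧ ¬ q ∣ c.h ∧ c.ideal Z.pts = Ideal.span {q} := by
  have hprime := c.ideal_isPrime Z.isIrreducible.2 hm
  obtain ⟨hne, hmax⟩ := (coheight_eq_one_iff Z.1).mp Z.2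
  have hbot : c.ideal Z.pts ≠ ⊥ := by
    intro hbot
    apply hne
    refine Set.eq_univ_of_univ_subset (c.subset_of_inter_subset
      (IrreducibleSpace.isIrreducible_univ X).2 Z.isClosed (hm.mono fun x hx => ⟨hx.1, trivial⟩) ?_)
    rintro x ⟨-, hx⟩
    by_contra hxZ
    obtain ⟨g, hg, hgV⟩ := c.basis x hx _ (Z.isClosed.isOpen_compl.mem_nhds hxZ)
    have : g ∈ c.ideal Z.pts := by
      intro y hy hyd
      by_contra hgy
      exact hgV y hyd hgy hy
    rw [hbot, Ideal.mem_bot] at this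
    rw [this, map_zero] at hg
    exact hg rfl
  obtain ⟨q, hqZ, hq⟩ := hprime.exists_mem_prime_of_ne_bot hbot
  have hqh : ¬ q ∣ c.h := by
    rintro ⟨r, hr⟩
    obtain ⟨x, hx, hxZ⟩ := hm
    have := c.eval_h hx
    rw [hr, map_mul, hqZ x hxZ hx, zero_mul] at this
    exact this rfl
  obtain ⟨W, hmW, hW, hWiff⟩ := c.exists_primeDivisor hq hqh
  have hle : Z.1 ≤ W.1 := by
    refine c.subset_of_inter_subset Z.isIrreducible.2 W.isClosed hm ?_
    rintro x ⟨hxZ, hx⟩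
    exact (hWiff x hx).mpr (hqZ x hxZ hx)
  have heq : Z.1 = W.1 := by
    by_contra h
    exact ((coheight_eq_one_iff W.1).mp W.2).1 (hmax W.1 (lt_of_le_of_ne hle h))
  have : Z = W := Subtype.ext heq
  exact ⟨q, hq, hqh, by rw [this, hW]⟩

/-- The local equation of a prime divisor in a chart meeting it. -/
def Chart.eqn (c : Chart X n) (Z : PrimeDivisor X) : MvPolynomial (Fin n) k :=
  open Classical in
  if h : ∃ q : MvPolynomial (Fin n) k, Prime q ∧ ¬ q ∣ c.h ∧ c.ideal Z.pts = Ideal.span {q} then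
    h.choose else 0

variable [IrreducibleSpace X] (c : Chart X n) {Z : PrimeDivisor X}

theorem Chart.eqn_spec (hm : (c.dom ∩ Z.pts).Nonempty) :
    Prime (c.eqn Z) ∧ ¬ c.eqn Z ∣ c.h ∧ c.ideal Z.pts = Ideal.span {c.eqn Z} := by
  have h := c.exists_eqn Z hm
  rw [Chart.eqn, dif_pos h]
  exact h.choose_spec

theorem Chart.mem_iff_eqn (hm : (c.dom ∩ Z.pts).Nonempty) {x : X} (hx : x ∈ c.dom) :
    x ∈ Z.pts ↔ eval (c.coord x) (c.eqn Z) = 0 := by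
  obtain ⟨hq, hqh, hZ⟩ := c.eqn_spec hm
  constructor
  · intro h
    have : c.eqn Z ∈ c.ideal Z.pts := by rw [hZ]; exact Ideal.mem_span_singleton_self _
    exact this x h hx
  · intro h
    by_contra hxZ
    obtain ⟨g, hg, hgV⟩ := c.basis x hx _ (Z.isClosed.isOpen_compl.mem_nhds hxZ)
    have : g ∈ c.ideal Z.pts := by
      intro y hy hyd
      by_contra hgy
      exact hgV y hyd hgy hy
    rw [hZ, Ideal.mem_span_singleton] at this
    obtain ⟨r, rfl⟩ := this
    rw [map_mul, h, zero_mul] at hg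
    exact hg rfl

theorem Chart.eqn_dvd_iff (hm : (c.dom ∩ Z.pts).Nonempty) {f : MvPolynomial (Fin n) k} :
    c.eqn Z ∣ f ↔ ∀ x ∈ Z.pts, x ∈ c.dom → eval (c.coord x) f = 0 := by
  rw [← Ideal.mem_span_singleton, ← (c.eqn_spec hm).2.2]; rfl

theorem Chart.eq_of_dvd {W : PrimeDivisor X} (hm : (c.dom ∩ Z.pts).Nonempty)
    (hmW : (c.dom ∩ W.pts).Nonempty) (h : c.eqn Z ∣ c.eqn W) : Z = W := by
  have hass := ((c.eqn_spec hm).1.dvd_prime_iff_associated (c.eqn_spec hmW).1).mp h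
  apply PrimeDivisor.pts_injective
  apply Set.Subset.antisymm
  · refine c.subset_of_inter_subset Z.isIrreducible.2 W.isClosed hm ?_
    rintro x ⟨hxZ, hx⟩
    rw [c.mem_iff_eqn hmW hx]
    exact (c.eqn_dvd_iff hm).mp h x hxZ hx
  · refine c.subset_of_inter_subset W.isIrreducible.2 Z.isClosed hmW ?_
    rintro x ⟨hxW, hx⟩
    rw [c.mem_iff_eqn hm hx]
    exact (c.eqn_dvd_iff hmW).mp hass.symm.dvd x hxW hx

theorem Chart.eqn_associated {q : MvPolynomial (Fin n) k} (hm : (c.dom ∩ Z.pts).Nonempty)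
    (h : c.ideal Z.pts = Ideal.span {q}) : Associated (c.eqn Z) q := by
  rw [(c.eqn_spec hm).2.2] at h
  exact Ideal.span_singleton_eq_span_singleton.mp h

end PrimeDivisors

/-! ### The order of a rational function along a prime divisor -/

section Order

open MvPolynomial

variable {k : Type u} [Field k] {ι : Type} {κ : ι → Type} {X : Set (MultiProj k κ)} {n : ℕ}
  [IsAlgClosed k] [IrreducibleSpace X] (c : Chart X n) {Z : PrimeDivisor X}

theorem nhdsGeneric_univ_le {S : Type*} [TopologicalSpace S] (Z : Set S) :
    nhdsGeneric (Set.univ : Set S) ≤ nhdsGeneric Z := by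
  refine le_iInf fun U => le_iInf fun hU => iInf_le_of_le U (iInf_le_of_le ⟨hU.1, ?_⟩ le_rfl)
  exact hU.2.mono fun x hx => ⟨hx.1, trivial⟩

theorem Chart.multiplicity_mul (hm : (c.dom ∩ Z.pts).Nonempty) {f g : MvPolynomial (Fin n) k}
    (hf : f ≠ 0) (hg : g ≠ 0) : multiplicity (c.eqn Z) (f * g) =
      multiplicity (c.eqn Z) f + multiplicity (c.eqn Z) g :=
  _root_.multiplicity_mul (c.eqn_spec hm).1
    (FiniteMultiplicity.of_not_isUnit (c.eqn_spec hm).1.not_isUnit (mul_ne_zero hf hg))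

/-- The definition of `HasOrder` allows any fraction of germs. This shows that the order is unique
and is read off from any polynomial fraction representing `f` generically, in any chart that meets
`Z`. -/
theorem Chart.hasOrder_iff (hm : (c.dom ∩ Z.pts).Nonempty) {f : X → k}
    {N D : MvPolynomial (Fin n) k} (hN : N ≠ 0) (hD : D ≠ 0)
    (hf : ∀ᶠ y in nhdsGeneric (Set.univ : Set X), f y * eval (c.coord y) D = eval (c.coord y) N)
    {m : ℤ} :
    HasOrder f Z m ↔ m = (multiplicity (c.eqn Z) N : ℤ) - multiplicity (c.eqn Z) D := by
  obtain ⟨hq, hqh, hZ⟩ := c.eqn_spec hm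
  have hprime := c.ideal_isPrime Z.isIrreducible.2 hm
  let := (c.toLocalRing hm).toAlgebra
  have hloc : IsLocalization.AtPrime (localRing X Z.pts) (c.ideal Z.pts) :=
    c.isLocalization Z.isIrreducible hm
  have hord : ∀ p : MvPolynomial (Fin n) k, p ≠ 0 →
      Ring.ord (localRing X Z.pts) (c.toLocalRing hm p) = (multiplicity (c.eqn Z) p : ℕ) :=
    fun p hp => ord_algebraMap_atPrime (c.ideal Z.pts) hZ hq hp
  constructor
  · rintro ⟨a, b, fa, fb, r, s, hfa, hfb, hfab, hr, hs, rfl⟩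
    have key : ∀ (a : localRing X Z.pts) (fa : X → k) (r : ℕ),
        (fa : Filter.Germ (nhdsGeneric Z.pts) k) = a.1 → Ring.ord (localRing X Z.pts) a = r →
        ∃ A B : MvPolynomial (Fin n) k, A ≠ 0 ∧ B ≠ 0 ∧ multiplicity (c.eqn Z) A = r ∧
          multiplicity (c.eqn Z) B = 0 ∧
          ∀ᶠ y in nhdsGeneric Z.pts, fa y * eval (c.coord y) B = eval (c.coord y) A := by
      intro a fa r hfa hr
      obtain ⟨⟨A, B, hB⟩, hAB⟩ := IsLocalization.surj (c.ideal Z.pts).primeCompl a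
      have hBq : ¬ c.eqn Z ∣ B := by
        rw [← Ideal.mem_span_singleton, ← hZ]; exact hB
      have hB0 : B ≠ 0 := fun h => hBq (h ▸ dvd_zero _)
      have hBu : IsUnit (c.toLocalRing hm B) := IsLocalization.map_units _ (⟨B, hB⟩ :
        (c.ideal Z.pts).primeCompl)
      have hAB' : a * c.toLocalRing hm B = c.toLocalRing hm A := hAB
      -- The order `r` is finite, while the zero germ has order `⊤`.
      have hA0 : A ≠ 0 := by
        rintro rfl
        rw [map_zero, hBu.mul_left_eq_zero] at hAB'
        rw [hAB', ord_zero_atPrime (c.ideal Z.pts) hZ hq] at hr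
        exact ENat.natCast_ne_top r hr.symm
      refine ⟨A, B, hA0, hB0, ?_, multiplicity_eq_zero.mpr hBq, ?_⟩
      · have := hord A hA0
        rw [← hAB', Ring.ord_mul_of_isUnit_right hBu, hr] at this
        exact_mod_cast this.symm
      · have := congrArg Subtype.val hAB'
        rw [Subring.coe_mul, ← hfa] at this
        exact Filter.Germ.coe_eq.mp this
    obtain ⟨A, B, hA0, hB0, hA, hB, hAB⟩ := key a fa r hfa hr
    obtain ⟨A', B', hA0', hB0', hA', hB', hAB'⟩ := key b fb s hfb hs
    have hle := nhdsGeneric_univ_le Z.pts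
    -- Both fractions represent `f` generically, so the cross products agree on a nonempty open set
    -- and hence as polynomials.
    have heq : N * A' * B = A * (D * B') := by
      refine c.eq_of_generic (IrreducibleSpace.isIrreducible_univ X)
        (hm.mono fun x hx => ⟨hx.1, trivial⟩) ?_
      filter_upwards [hf, hfab, hAB.filter_mono hle, hAB'.filter_mono hle] with y h1 h2 h3 h4
      simp only [map_mul]
      rw [← h1, ← h4, ← h3, ← h2]
      ring
    have hmul := congrArg (multiplicity (c.eqn Z)) heq
    rw [c.multiplicity_mul hm (mul_ne_zero hN hA0') hB0, c.multiplicity_mul hm hN hA0',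
      c.multiplicity_mul hm hA0 (mul_ne_zero hD hB0'), c.multiplicity_mul hm hD hB0', hA, hB, hA',
      hB'] at hmul
    omega
  · rintro rfl
    exact ⟨c.toLocalRing hm N, c.toLocalRing hm D, _, _, _, _, rfl, rfl, hf, hord N hN, hord D hD,
      rfl⟩

end Order

end

end ProjGeom

namespace ProjGeom

noncomputable section

universe u

/-! ### Restriction of polynomials to coordinate lines -/

section LineEval

variable {k : Type u} [Field k]

/-- Restriction of a polynomial in two variables to the line on which the `i`-th coordinate is `a`. -/
def lineEval (i : Fin 2) (a : k) : MvPolynomial (Fin 2) k →ₐ[k] Polynomial k :=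
  MvPolynomial.aeval fun j => if j = i then Polynomial.C a else Polynomial.X

theorem Fin.add_one_ne_two (i : Fin 2) : i + 1 ≠ i := by fin_cases i <;> decide

theorem Fin.eq_or_eq_add_one (i j : Fin 2) : j = i ∨ j = i + 1 := by
  fin_cases i <;> fin_cases j <;> decide

theorem lineEval_X_self (i : Fin 2) (a : k) :
    lineEval i a (MvPolynomial.X i) = Polynomial.C a := by simp [lineEval]

theorem lineEval_X_add_one (i : Fin 2) (a : k) :
    lineEval i a (MvPolynomial.X (i + 1)) = Polynomial.X := by
  simp [lineEval]

theorem lineEval_C (i : Fin 2) (a b : k) :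
    lineEval i a (MvPolynomial.C b) = Polynomial.C b := by simp [lineEval]

/-- The local equation of a coordinate line. -/
def lineEqn (i : Fin 2) (a : k) : MvPolynomial (Fin 2) k := MvPolynomial.X i - MvPolynomial.C a

theorem lineEval_lineEqn (i : Fin 2) (a : k) : lineEval i a (lineEqn i a) = 0 := by
  rw [lineEqn, map_sub, lineEval_X_self, lineEval_C, sub_self]

theorem lineEval_aeval (i : Fin 2) (a : k) (p : Polynomial k) :
    lineEval i a (Polynomial.aeval (MvPolynomial.X (i + 1)) p) = p := by
  rw [← Polynomial.aeval_algHom_apply, lineEval_X_add_one, Polynomial.aeval_X_left_apply]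

/-- Modulo the equation of the line, a polynomial equals its restriction regarded as a polynomial in
the other variable, whose index is `i + 1` in `Fin 2`. Divisibility by the equation is thus the
vanishing of the restriction. -/
theorem lineEqn_dvd_sub (i : Fin 2) (a : k) (f : MvPolynomial (Fin 2) k) :
    lineEqn i a ∣ f - Polynomial.aeval (MvPolynomial.X (i + 1)) (lineEval i a f) := by
  induction f using MvPolynomial.induction_on with
  | C b => rw [lineEval_C, Polynomial.aeval_C]; simp [MvPolynomial.algebraMap_eq]
  | add p q hp hq =>
    rw [map_add, map_add, add_sub_add_comm]
    exact dvd_add hp hq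
  | mul_X p j hp =>
    rw [map_mul, map_mul]
    rcases Fin.eq_or_eq_add_one i j with rfl | rfl
    · rw [lineEval_X_self, Polynomial.aeval_C, MvPolynomial.algebraMap_eq]
      have : p * MvPolynomial.X j - Polynomial.aeval (MvPolynomial.X (j + 1)) (lineEval j a p) *
          MvPolynomial.C a = p * lineEqn j a + (p - Polynomial.aeval (MvPolynomial.X (j + 1))
            (lineEval j a p)) * MvPolynomial.C a := by rw [lineEqn]; ring
      rw [this]
      exact dvd_add (dvd_mul_left _ _) (hp.mul_right _)
    · rw [lineEval_X_add_one, Polynomial.aeval_X, ← sub_mul]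
      exact hp.mul_right _

theorem lineEqn_dvd_iff (i : Fin 2) (a : k) (f : MvPolynomial (Fin 2) k) :
    lineEqn i a ∣ f ↔ lineEval i a f = 0 := by
  constructor
  · rintro ⟨g, rfl⟩
    rw [map_mul, lineEval_lineEqn, zero_mul]
  · intro h
    simpa [h] using lineEqn_dvd_sub i a f

theorem lineEqn_ne_zero (i : Fin 2) (a : k) : lineEqn i a ≠ 0 := by
  intro h
  have := congrArg (MvPolynomial.eval (fun _ => a + 1)) h
  simp [lineEqn] at this

theorem lineEqn_prime (i : Fin 2) (a : k) : Prime (lineEqn i a) := by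
  refine ⟨lineEqn_ne_zero i a, fun h => ?_, fun f g h => ?_⟩
  · have := isUnit_iff_dvd_one.mp h
    rw [lineEqn_dvd_iff, map_one] at this
    exact one_ne_zero this
  · rw [lineEqn_dvd_iff, map_mul, mul_eq_zero] at h
    rwa [lineEqn_dvd_iff, lineEqn_dvd_iff]

theorem eval_lineEval {i : Fin 2} {a : k} {b : Fin 2 → k} (hb : b i = a)
    (f : MvPolynomial (Fin 2) k) :
    (lineEval i a f).eval (b (i + 1)) = MvPolynomial.eval b f := by
  induction f using MvPolynomial.induction_on with
  | C c => simp
  | add p q hp hq => simp [hp, hq]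
  | mul_X p j hp =>
    rw [map_mul, map_mul, Polynomial.eval_mul, hp, MvPolynomial.eval_X]
    rcases Fin.eq_or_eq_add_one i j with rfl | rfl
    · rw [lineEval_X_self, Polynomial.eval_C, hb]
    · rw [lineEval_X_add_one, Polynomial.eval_X]

theorem eval_lineEqn (i : Fin 2) (a : k) (b : Fin 2 → k) :
    MvPolynomial.eval b (lineEqn i a) = b i - a := by simp [lineEqn]

end LineEval

/-! ### Lengths of local intersections with a coordinate line -/

section LocalLength

open MvPolynomial nonZeroDivisors

variable {k : Type u} [Field k]

/-- Divide by `q` first; the length over `S` and over `S ⧸ (q)` is the same because the map between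
these rings is surjective. -/
theorem length_quotient_sup_eq_ord {S : Type*} [CommRing S] (p q : S) :
    Module.length S (S ⧸ (Ideal.span {p} ⊔ Ideal.span {q})) =
      Ring.ord (S ⧸ Ideal.span {q}) (Ideal.Quotient.mk (Ideal.span {q}) p) := by
  rw [Ring.ord, ← Module.length_eq_of_surjective (S := S)
    (Ideal.Quotient.mk_surjective : Function.Surjective (Ideal.Quotient.mk (Ideal.span {q})))]
  have e := (DoubleQuot.quotQuotEquivQuotSupₐ S (Ideal.span {q}) (Ideal.span {p})).toLinearEquiv
  rw [sup_comm, ← e.length_eq, Ideal.map_span, Set.image_singleton]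
  rfl

/-- The local ring of the line at the point is a domain whose maximal ideal is generated by `τ`, the
class of `X - s`. The image of `p` is a power of `τ` times a unit, the exponent being the
multiplicity of the root `s` of the restriction. -/
theorem length_quotient_line {S : Type*} [CommRing S] [Algebra (MvPolynomial (Fin 2) k) S]
    (P : Ideal (MvPolynomial (Fin 2) k)) [P.IsPrime] [IsLocalization.AtPrime S P]
    {b : Fin 2 → k} (hP : ∀ f, f ∈ P ↔ eval b f = 0) {i : Fin 2} {a : k} (hb : b i = a)
    {p : MvPolynomial (Fin 2) k} (hp : lineEval i a p ≠ 0) :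
    Module.length S (S ⧸ (Ideal.span {algebraMap _ S p} ⊔
      Ideal.span {algebraMap _ S (lineEqn i a)})) =
      ((lineEval i a p).rootMultiplicity (b (i + 1)) : ℕ) := by
  set φ := algebraMap (MvPolynomial (Fin 2) k) S
  set q := lineEqn i a
  set s := b (i + 1)
  set J : Ideal S := Ideal.span {φ q}
  have hlocal : IsLocalRing S := IsLocalization.AtPrime.isLocalRing S P
  have hqP : q ∈ P := by rw [hP, eval_lineEqn, hb, sub_self]
  have hJmap : J = Ideal.map φ (Ideal.span {q}) := by rw [Ideal.map_span, Set.image_singleton]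
  have hqprime : (Ideal.span {q}).IsPrime :=
    (Ideal.span_singleton_prime (lineEqn_ne_zero i a)).mpr (lineEqn_prime i a)
  have hdisj : Disjoint (P.primeCompl : Set (MvPolynomial (Fin 2) k)) (Ideal.span {q} : Ideal _) := by
    rw [Set.disjoint_left]
    intro f hf hfq
    exact hf ((Ideal.span_singleton_le_iff_mem _).mpr hqP hfq)
  have hJ : J.IsPrime := by
    rw [hJmap]
    exact IsLocalization.isPrime_of_isPrime_disjoint P.primeCompl S _ hqprime hdisj
  have : IsDomain (S ⧸ J) := Ideal.Quotient.isDomain J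
  have : IsLocalRing (S ⧸ J) := IsLocalRing.of_surjective' _ Ideal.Quotient.mk_surjective
  set ψ : MvPolynomial (Fin 2) k →+* S ⧸ J := (Ideal.Quotient.mk J).comp φ
  have hψq : ψ q = 0 := Ideal.Quotient.eq_zero_iff_mem.mpr (Ideal.mem_span_singleton_self _)
  have hψ0 : ∀ f, q ∣ f → ψ f = 0 := by
    rintro _ ⟨r, rfl⟩
    rw [map_mul, hψq, zero_mul]
  set emb : Polynomial k → MvPolynomial (Fin 2) k := fun r => Polynomial.aeval (X (i + 1)) r
  have hemb : ∀ f, ψ f = ψ (emb (lineEval i a f)) := fun f => by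
    have := hψ0 _ (lineEqn_dvd_sub i a f)
    rwa [map_sub, sub_eq_zero] at this
  set τ := ψ (emb (Polynomial.X - Polynomial.C s))
  have hev : ∀ r : Polynomial k, eval b (emb r) = r.eval s := fun r => by
    rw [← eval_lineEval hb, lineEval_aeval]
  have hunit : ∀ f, eval b f ≠ 0 → IsUnit (ψ f) := fun f hf => by
    have : IsUnit (φ f) := IsLocalization.map_units S (⟨f, fun h => hf ((hP f).mp h)⟩ : P.primeCompl)
    exact this.map (Ideal.Quotient.mk J)
  -- A nonunit is, up to a unit, the class of a polynomial vanishing at the point; its restriction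
  -- to the line has the root `s`.
  have hτmax : IsLocalRing.maximalIdeal (S ⧸ J) = Ideal.span {τ} := by
    apply le_antisymm
    · intro z hz
      obtain ⟨y, rfl⟩ := Ideal.Quotient.mk_surjective z
      obtain ⟨⟨f, u⟩, hfu⟩ := IsLocalization.surj P.primeCompl y
      have hfu' : Ideal.Quotient.mk J y * ψ u = ψ f := congrArg (Ideal.Quotient.mk J) hfu
      have hu : IsUnit (ψ u) := hunit u fun h => u.2 ((hP u).mpr h)
      have hf : eval b f = 0 := by
        by_contra hf
        have h2 := hunit f hf
        rw [← hfu'] at h2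
        exact (IsLocalRing.mem_maximalIdeal _).mp hz (isUnit_of_mul_isUnit_left h2)
      have hdvd : (Polynomial.X - Polynomial.C s) ∣ lineEval i a f := by
        rw [Polynomial.dvd_iff_isRoot, Polynomial.IsRoot, eval_lineEval hb, hf]
      rw [Ideal.mem_span_singleton]
      have : τ ∣ ψ f := by
        obtain ⟨r, hr⟩ := hdvd
        rw [hemb, hr]
        exact ⟨ψ (emb r), by rw [← map_mul]; simp only [emb, map_mul]⟩
      rw [← hfu'] at this
      exact hu.dvd_mul_right.mp this
    · rw [Ideal.span_singleton_le_iff_mem, IsLocalRing.mem_maximalIdeal, mem_nonunits_iff]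
      intro hu
      -- Since `J` lies in the maximal ideal of `S`, units modulo `J` lift to units of `S`.
      have h1 : IsUnit (φ (emb (Polynomial.X - Polynomial.C s))) := by
        have hJle : J ≤ IsLocalRing.maximalIdeal S := IsLocalRing.le_maximalIdeal hJ.ne_top
        by_contra hn
        have hm : φ (emb (Polynomial.X - Polynomial.C s)) ∈ IsLocalRing.maximalIdeal S := hn
        obtain ⟨z, hz⟩ := isUnit_iff_exists_inv.mp hu
        obtain ⟨y, rfl⟩ := Ideal.Quotient.mk_surjective z
        have h1 : φ (emb (Polynomial.X - Polynomial.C s)) * y - 1 ∈ J := by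
          rw [← Ideal.Quotient.eq_zero_iff_mem, map_sub, map_mul, map_one, sub_eq_zero]
          exact hz
        have h2 := Ideal.sub_mem _ (Ideal.mul_mem_right y _ hm) (hJle h1)
        rw [sub_sub_cancel] at h2
        exact (Ideal.ne_top_iff_one _).mp (IsLocalRing.maximalIdeal.isMaximal S).ne_top h2
      have h2 : emb (Polynomial.X - Polynomial.C s) ∈ P := by
        rw [hP, hev]; simp
      exact (IsLocalization.AtPrime.isUnit_to_map_iff S P _).mp h1 h2
  -- `J` contracts to the ideal `(q)` of the polynomial ring, and `X - s` in the other variable is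
  -- not divisible by `q`.
  have hτ0 : τ ≠ 0 := by
    intro h
    have hmem : φ (emb (Polynomial.X - Polynomial.C s)) ∈ J := Ideal.Quotient.eq_zero_iff_mem.mp h
    have hcomap : emb (Polynomial.X - Polynomial.C s) ∈ Ideal.comap φ J := hmem
    have hun : Ideal.comap φ J = Ideal.span {q} := by
      rw [hJmap]
      exact IsLocalization.under_map_of_isPrime_disjoint P.primeCompl S hqprime hdisj
    rw [hun, Ideal.mem_span_singleton, lineEqn_dvd_iff, lineEval_aeval] at hcomap
    exact Polynomial.X_sub_C_ne_zero s hcomap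
  obtain ⟨g, hg, hgs⟩ := Polynomial.exists_eq_pow_rootMultiplicity_mul_and_not_dvd _ hp s
  have hψp : ψ p = τ ^ (lineEval i a p).rootMultiplicity s * ψ (emb g) := by
    rw [hemb p]
    conv_lhs => rw [hg]
    simp only [emb, map_mul, map_pow, τ]
  have hgu : IsUnit (ψ (emb g)) := hunit _ fun h => hgs (by
    rw [hev] at h
    exact Polynomial.dvd_iff_isRoot.mpr h)
  rw [length_quotient_sup_eq_ord]
  change Ring.ord (S ⧸ J) (ψ p) = _
  rw [hψp, Ring.ord_mul_of_isUnit_right hgu, Ring.ord_pow (mem_nonZeroDivisors_of_ne_zero hτ0),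
    ord_of_maximalIdeal_eq_span hτmax]
  simp

end LocalLength

/-! ### Local intersection numbers with a coordinate line -/

section LocalIntersection

open MvPolynomial

variable {k : Type u} [Field k] {ι : Type} {κ : ι → Type} {X : Set (MultiProj k κ)}

/-- The local intersection number at `x`. -/
def localInt (x : X) (Z C : PrimeDivisor X) : ℕ :=
  (Module.length (localRing X {x})
    (localRing X {x} ⧸ (idealAt Z.pts x ⊔ idealAt C.pts x))).toNat

theorem idealAt_eq_top {Z : PrimeDivisor X} {x : X} (hx : x ∉ Z.pts) : idealAt Z.pts x = ⊤ := by
  rw [Ideal.eq_top_iff_one]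
  refine Ideal.subset_span ⟨fun _ => 1, rfl, ?_⟩
  filter_upwards [Z.isClosed.isOpen_compl.mem_nhds hx] with y hy h
  exact absurd h hy

theorem localInt_comm (x : X) (Z C : PrimeDivisor X) : localInt x Z C = localInt x C Z := by
  rw [localInt, localInt, sup_comm]

theorem localInt_eq_zero_left {x : X} {Z : PrimeDivisor X} (C : PrimeDivisor X) (hx : x ∉ Z.pts) :
    localInt x Z C = 0 := by
  rw [localInt, idealAt_eq_top hx, top_sup_eq]
  have : Subsingleton (localRing X {x} ⧸ (⊤ : Ideal (localRing X {x}))) :=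
    Ideal.Quotient.subsingleton_iff.mpr rfl
  rw [Module.length_eq_zero]; rfl

theorem localInt_eq_zero_right {x : X} (Z : PrimeDivisor X) {C : PrimeDivisor X} (hx : x ∉ C.pts) :
    localInt x Z C = 0 := by
  rw [localInt_comm, localInt_eq_zero_left _ hx]

theorem intersectionNumber_eq (Z C : PrimeDivisor X) :
    intersectionNumber Z C = ∑ᶠ x : X, (localInt x Z C : ℤ) := rfl

theorem intersectionNumber_comm (Z C : PrimeDivisor X) :
    intersectionNumber Z C = intersectionNumber C Z := by
  simp only [intersectionNumber_eq, localInt_comm _ Z C]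

theorem intersectionNumber_nonneg (Z C : PrimeDivisor X) : 0 ≤ intersectionNumber Z C := by
  rw [intersectionNumber_eq]
  exact finsum_nonneg fun x => Int.natCast_nonneg _

theorem intersectionNumber_eq_zero {Z C : PrimeDivisor X} (h : ∀ x ∈ Z.pts, x ∉ C.pts) :
    intersectionNumber Z C = 0 := by
  rw [intersectionNumber_eq, ← finsum_zero (α := X)]
  refine finsum_congr fun x => ?_
  by_cases hx : x ∈ Z.pts
  · rw [localInt_eq_zero_right Z (h x hx)]; rfl
  · rw [localInt_eq_zero_left C hx]; rfl

variable {n : ℕ} (c : Chart X n)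

/-- The numerator of a germ that vanishes on `Z` near `x` vanishes on a nonempty open part of the
irreducible set `Z`, hence on all of `Z` in the chart, so it is divisible by `q`. -/
theorem Chart.idealAt_eq_span [Infinite k] {Z : PrimeDivisor X} {x : X} (hx : x ∈ c.dom)
    (hxZ : x ∈ Z.pts) {q : MvPolynomial (Fin n) k} (hq : c.ideal Z.pts = Ideal.span {q})
    (hm : (c.dom ∩ {x}).Nonempty) : idealAt Z.pts x = Ideal.span {c.toLocalRing hm q} := by
  have hxi : IsIrreducible ({x} : Set X) := isIrreducible_singleton
  have hprime := c.ideal_isPrime hxi.2 hm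
  let := (c.toLocalRing hm).toAlgebra
  have hloc : IsLocalization.AtPrime (localRing X {x}) (c.ideal {x}) := c.isLocalization hxi hm
  apply le_antisymm
  · rw [idealAt, Ideal.span_le]
    rintro a ⟨f, hfa, hf⟩
    obtain ⟨⟨A, B⟩, hAB⟩ := IsLocalization.surj (c.ideal {x}).primeCompl a
    have hAB' : a * c.toLocalRing hm B = c.toLocalRing hm A := hAB
    have hBu : IsUnit (c.toLocalRing hm B) := IsLocalization.map_units _ B
    have hAB2 := congrArg Subtype.val hAB'
    rw [Subring.coe_mul, ← hfa] at hAB2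
    have hAB3 : ∀ᶠ y in 𝓝 x, f y * eval (c.coord y) B.1 = eval (c.coord y) A := by
      rw [← nhdsGeneric_singleton]
      exact Filter.Germ.coe_eq.mp hAB2
    have hA : A ∈ c.ideal Z.pts := by
      obtain ⟨V, hVsub, hV, hxV⟩ := mem_nhds_iff.mp (Filter.inter_mem hAB3 hf)
      intro y hyZ hyd
      refine c.zeroSet_isClosed_in (Z := Z.pts ∩ V) ?_ ?_ hyd
      · rintro z ⟨hzZ, hzV⟩ -
        have := (hVsub hzV).1
        rw [Set.mem_ofPred_eq, (hVsub hzV).2 hzZ, zero_mul] at this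
        exact this.symm
      · exact subset_closure_inter_of_isPreirreducible_of_isOpen Z.isIrreducible.2 hV
          ⟨x, hxZ, hxV⟩ hyZ
    rw [hq, Ideal.mem_span_singleton] at hA
    rw [SetLike.mem_coe, Ideal.mem_span_singleton, ← hBu.dvd_mul_right, hAB']
    exact map_dvd _ hA
  · rw [Ideal.span_singleton_le_iff_mem]
    refine Ideal.subset_span ⟨_, rfl, ?_⟩
    filter_upwards [c.dom_mem_nhds hx] with y hy hyZ
    have : q ∈ c.ideal Z.pts := by rw [hq]; exact Ideal.mem_span_singleton_self q
    exact this y hyZ hy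

variable {c : Chart X 2} {C : PrimeDivisor X} {i : Fin 2} {a : k}

/-- In the chart, the curve `C` is the coordinate line on which the `i`-th coordinate is `a`. -/
def IsLine (c : Chart X 2) (C : PrimeDivisor X) (i : Fin 2) (a : k) : Prop :=
  (c.dom ∩ C.pts).Nonempty ∧ ∀ x ∈ c.dom, x ∈ C.pts ↔ c.coord x i = a

theorem IsLine.not_dvd (h : IsLine c C i a) : ¬ lineEqn i a ∣ c.h := by
  rintro ⟨r, hr⟩
  obtain ⟨x, hx, hxC⟩ := h.1
  have := c.eval_h hx
  rw [hr, map_mul, eval_lineEqn, (h.2 x hx).mp hxC, sub_self, zero_mul] at this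
  exact this rfl

theorem IsLine.ideal_eq [IsAlgClosed k] (h : IsLine c C i a) :
    c.ideal C.pts = Ideal.span {lineEqn i a} := by
  ext f
  rw [Ideal.mem_span_singleton]
  constructor
  · intro hf
    refine c.dvd_of_vanishing (lineEqn_prime i a) h.not_dvd fun x hx hxq => ?_
    rw [eval_lineEqn, sub_eq_zero] at hxq
    exact hf x ((h.2 x hx).mpr hxq) hx
  · rintro ⟨r, rfl⟩ x hx hd
    rw [map_mul, eval_lineEqn, (h.2 x hd).mp hx, sub_self, zero_mul]

theorem IsLine.localInt_eq [IsAlgClosed k] (h : IsLine c C i a) {Z : PrimeDivisor X} {x : X}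
    (hx : x ∈ c.dom) (hxC : x ∈ C.pts) (hxZ : x ∈ Z.pts) {q : MvPolynomial (Fin 2) k}
    (hq : c.ideal Z.pts = Ideal.span {q}) (hq0 : lineEval i a q ≠ 0) :
    localInt x Z C = (lineEval i a q).rootMultiplicity (c.coord x (i + 1)) := by
  have hxi : IsIrreducible ({x} : Set X) := isIrreducible_singleton
  have hm : (c.dom ∩ {x}).Nonempty := ⟨x, hx, rfl⟩
  have hprime := c.ideal_isPrime hxi.2 hm
  let := (c.toLocalRing hm).toAlgebra
  have hloc : IsLocalization.AtPrime (localRing X {x}) (c.ideal {x}) := c.isLocalization hxi hm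
  have hP : ∀ f, f ∈ c.ideal {x} ↔ eval (c.coord x) f = 0 := fun f =>
    ⟨fun hf => hf x rfl hx, by rintro hf y rfl _; exact hf⟩
  rw [localInt, c.idealAt_eq_span hx hxZ hq hm, c.idealAt_eq_span hx hxC h.ideal_eq hm]
  have := length_quotient_line (S := localRing X {x}) (c.ideal {x}) hP ((h.2 x hx).mp hxC) hq0
  exact (congrArg ENat.toNat this).trans (ENat.toNat_natCast _)

variable [IsAlgClosed k] [IrreducibleSpace X]

theorem IsLine.lineEval_eqn_ne_zero (h : IsLine c C i a) {Z : PrimeDivisor X} (hZ : Z ≠ C)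
    (hm : (c.dom ∩ Z.pts).Nonempty) : lineEval i a (c.eqn Z) ≠ 0 := by
  rw [Ne, ← lineEqn_dvd_iff]
  intro hdvd
  exact hZ (c.eq_of_dvd h.1 hm (((c.eqn_associated h.1 h.ideal_eq).dvd).trans hdvd)).symm

/-- The points in question are given by roots of the local equation of `Z` restricted to the line;
the restriction is not zero because `Z ≠ C`. -/
theorem IsLine.finite_localInt (h : IsLine c C i a) {Z : PrimeDivisor X} (hZ : Z ≠ C) :
    {x | x ∈ c.dom ∧ localInt x Z C ≠ 0}.Finite := by
  classical
  by_cases hm : (c.dom ∩ Z.pts).Nonempty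
  · have hne := h.lineEval_eqn_ne_zero hZ hm
    refine Set.Finite.of_finite_image (f := fun x => c.coord x (i + 1))
      ((lineEval i a (c.eqn Z)).roots.toFinset.finite_toSet.subset ?_) ?_
    · rintro _ ⟨x, ⟨hx, hxZ⟩, rfl⟩
      have hxZ' : x ∈ Z.pts := by_contra fun h' => hxZ (localInt_eq_zero_left C h')
      have hxC' : x ∈ C.pts := by_contra fun h' => hxZ (localInt_eq_zero_right Z h')
      rw [Finset.mem_coe, Multiset.mem_toFinset, Polynomial.mem_roots hne, Polynomial.IsRoot,
        eval_lineEval ((h.2 x hx).mp hxC')]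
      exact (c.mem_iff_eqn hm hx).mp hxZ'
    · rintro x ⟨hx, hxZ⟩ y ⟨hy, hyZ⟩ hxy
      have hxC' : x ∈ C.pts := by_contra fun h' => hxZ (localInt_eq_zero_right Z h')
      have hyC' : y ∈ C.pts := by_contra fun h' => hyZ (localInt_eq_zero_right Z h')
      refine c.injOn hx hy (funext fun j => ?_)
      rcases Fin.eq_or_eq_add_one i j with rfl | rfl
      · rw [(h.2 x hx).mp hxC', (h.2 y hy).mp hyC']
      · exact hxy
  · refine Set.Finite.subset Set.finite_empty ?_
    rintro x ⟨hx, hxZ⟩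
    exact absurd ⟨x, hx, by_contra fun h' => hxZ (localInt_eq_zero_left C h')⟩ hm

/-- The local intersection numbers with a coordinate line of the components of the divisor of `B`
add up to the order of vanishing of the restriction of `B` to the line. -/
theorem IsLine.sum_localInt (h : IsLine c C i a) {x : X} (hx : x ∈ c.dom) (hxC : x ∈ C.pts)
    (B : MvPolynomial (Fin 2) k) (hB : lineEval i a B ≠ 0) (D : Divisor X)
    (hD : ∀ Z : PrimeDivisor X, x ∈ Z.pts → D Z = multiplicity (c.eqn Z) B) :
    (D.sum fun Z m => m * (localInt x Z C : ℤ)) =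
      (lineEval i a B).rootMultiplicity (c.coord x (i + 1)) := by
  have hm : ∀ Z : PrimeDivisor X, x ∈ Z.pts → (c.dom ∩ Z.pts).Nonempty := fun Z hZ => ⟨x, hx, hZ⟩
  induction B using UniqueFactorizationMonoid.induction_on_prime generalizing D with
  | h₁ => simp at hB
  | h₂ B hu =>
    have h1 : (lineEval i a B).rootMultiplicity (c.coord x (i + 1)) = 0 := by
      apply Polynomial.rootMultiplicity_eq_zero
      intro hroot
      rw [Polynomial.IsRoot, eval_lineEval ((h.2 x hx).mp hxC)] at hroot
      exact (hu.map (eval (c.coord x))).ne_zero hroot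
    rw [h1, Finsupp.sum]
    refine Finset.sum_eq_zero fun Z _ => ?_
    by_cases hxZ : x ∈ Z.pts
    · rw [hD Z hxZ, multiplicity_eq_zero.mpr fun hd =>
        (c.eqn_spec (hm Z hxZ)).1.not_isUnit (isUnit_of_dvd_unit hd hu)]
      simp
    · rw [localInt_eq_zero_left C hxZ]; simp
  | h₃ B p hB0 hp ih =>
    rw [map_mul] at hB
    have hp0 := left_ne_zero_of_mul hB
    have hB' := right_ne_zero_of_mul hB
    have hsum : ∀ D₁ D₂ : Divisor X, ((D₁ + D₂).sum fun Z m => m * (localInt x Z C : ℤ)) =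
        (D₁.sum fun Z m => m * (localInt x Z C : ℤ)) +
          D₂.sum fun Z m => m * (localInt x Z C : ℤ) := fun D₁ D₂ =>
      Finsupp.sum_add_index' (by simp) (by intros; ring)
    -- Split off one prime factor `p`. If `p` vanishes at `x` it contributes the prime divisor with
    -- local equation `p`; otherwise it contributes nothing at `x`. The coefficients of `D` matter
    -- only on components through `x`, so `D - D₁` satisfies the hypothesis for the remaining
    -- factor.
    obtain ⟨D₁, hD₁, hs⟩ : ∃ D₁ : Divisor X,
        (∀ Z : PrimeDivisor X, x ∈ Z.pts → D₁ Z = multiplicity (c.eqn Z) p) ∧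
        (D₁.sum fun Z m => m * (localInt x Z C : ℤ)) =
          (lineEval i a p).rootMultiplicity (c.coord x (i + 1)) := by
      by_cases hpx : eval (c.coord x) p = 0
      · have hph : ¬ p ∣ c.h := by
          rintro ⟨r, hr⟩
          have := c.eval_h hx
          rw [hr, map_mul, hpx, zero_mul] at this
          exact this rfl
        obtain ⟨W, hmW, hW, hWiff⟩ := c.exists_primeDivisor hp hph
        have hass := c.eqn_associated hmW hW
        classical
        refine ⟨Finsupp.single W 1, fun Z hxZ => ?_, ?_⟩
        · rw [Finsupp.single_apply]
          split_ifs with hWZ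
          · subst hWZ
            rw [multiplicity_eq_of_associated_left (hass.symm),
              multiplicity_self]
            rfl
          · rw [multiplicity_eq_zero.mpr fun hd => hWZ
              (c.eq_of_dvd (hm Z hxZ) hmW (hd.trans hass.symm.dvd)).symm]
            rfl
        · rw [Finsupp.sum_single_index (by simp), one_mul,
            h.localInt_eq hx hxC ((hWiff x hx).mpr hpx) hW hp0]
      · refine ⟨0, fun Z hxZ => ?_, ?_⟩
        · refine Eq.symm (Nat.cast_eq_zero.mpr (multiplicity_eq_zero.mpr fun ⟨r, hr⟩ => hpx ?_))
          rw [hr, map_mul, (c.mem_iff_eqn (hm Z hxZ) hx).mp hxZ, zero_mul]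
        · rw [Polynomial.rootMultiplicity_eq_zero]
          · simp
          · rwa [Polynomial.IsRoot, eval_lineEval ((h.2 x hx).mp hxC)]
    have h2 := ih hB' (D - D₁) fun Z hxZ => by
      rw [Finsupp.sub_apply, hD Z hxZ, hD₁ Z hxZ,
        c.multiplicity_mul (hm Z hxZ) hp.ne_zero hB0]
      push_cast; ring
    have h3 := hsum D₁ (D - D₁)
    rw [add_sub_cancel, hs, h2] at h3
    rw [h3, map_mul, Polynomial.rootMultiplicity_mul hB]
    push_cast; rfl

end LocalIntersection

end

end ProjGeom

/-! ### The atlas of the plane blown up at the vertices of four lines -/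

namespace ProjGeom

noncomputable section

universe u

open MvPolynomial

/-- The local equation `1 + w + t w` of the line omitted by the standard charts. -/
def chartEqn (k : Type*) [Field k] : MvPolynomial (Fin 2) k := 1 + MvPolynomial.X 1 + MvPolynomial.X 0 * MvPolynomial.X 1

/-- The blow-up of the plane at the intersection points of four lines, described by the values
`lam` of the equations of the lines, normalized so as to have sum zero, and by homogeneous
coordinates `[ab i j : ab j i]`, extending `[lam i : lam j]`, on the pencils of lines through the
intersection points. -/
structure LinesAtlas {k : Type u} [Field k] {ι : Type} {κ : ι → Type}
    (X : Set (MultiProj k κ)) where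
  chart : Equiv.Perm (Fin 4) → Chart X 2
  lam : X → Fin 4 → k
  ab : X → Fin 4 → Fin 4 → k
  lam_ne_zero : ∀ x, ∃ i, lam x i ≠ 0
  lam_sum : ∀ x, lam x 0 + lam x 1 + lam x 2 + lam x 3 = 0
  ab_ne_zero : ∀ x i j, i ≠ j → ab x i j ≠ 0 ∨ ab x j i ≠ 0
  rel : ∀ x i j, i ≠ j → lam x i * ab x j i = lam x j * ab x i j
  isOpen_lam : ∀ m : Fin 4 → k, IsOpen {x | m ⬝ᵥ lam x ≠ 0}
  isOpen_ab : ∀ i j (u v : k), i ≠ j → IsOpen {x | u * ab x i j + v * ab x j i ≠ 0}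
  -- On the chart the forms `π 2` and `π 3` do not vanish, which leaves only the exceptional curve
  -- over the intersection of the lines `π 0` and `π 1`; the last condition selects one of its two
  -- affine pieces. With `t` extending `lam (π 0) / lam (π 1)` and `w = lam (π 1) / lam (π 2)`, the
  -- forms are proportional to `tw`, `w`, `1` and, as their sum is zero, `-(1 + w + tw)`.
  mem_dom : ∀ π x, x ∈ (chart π).dom ↔ lam x (π 2) ≠ 0 ∧ lam x (π 3) ≠ 0 ∧ ab x (π 1) (π 0) ≠ 0
  coord_eq : ∀ π x, (chart π).coord x =
    ![ab x (π 0) (π 1) / ab x (π 1) (π 0), lam x (π 1) / lam x (π 2)]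
  h_eq : ∀ π, (chart π).h = chartEqn k

section Perm

theorem exists_perm_last {a b : Fin 4} (h : a ≠ b) :
    ∃ π : Equiv.Perm (Fin 4), π 2 = a ∧ π 3 = b := by
  revert a b; decide

theorem exists_perm_first {a b : Fin 4} (h : a ≠ b) :
    ∃ π : Equiv.Perm (Fin 4), π 0 = a ∧ π 1 = b := by
  revert a b; decide

theorem perm_cases (π : Equiv.Perm (Fin 4)) (i : Fin 4) :
    i = π 0 ∨ i = π 1 ∨ i = π 2 ∨ i = π 3 := by
  obtain ⟨j, rfl⟩ := π.surjective i
  fin_cases j <;> simp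

theorem perm_sum {M : Type*} [AddCommMonoid M] (π : Equiv.Perm (Fin 4)) (f : Fin 4 → M) :
    f (π 0) + f (π 1) + f (π 2) + f (π 3) = f 0 + f 1 + f 2 + f 3 := by
  rw [← Fin.sum_univ_four f, ← Equiv.sum_comp π f, Fin.sum_univ_four]

end Perm

variable {k : Type u} [Field k] {ι : Type} {κ : ι → Type} {X : Set (MultiProj k κ)}

/-- The values of the four linear forms in a chart, up to a common factor. -/
def lamPoly (k : Type*) [Field k] (π : Equiv.Perm (Fin 4)) (i : Fin 4) : MvPolynomial (Fin 2) k :=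
  ![MvPolynomial.X 0 * MvPolynomial.X 1, MvPolynomial.X 1, 1, -chartEqn k] (π.symm i)

theorem lamPoly_zero (π : Equiv.Perm (Fin 4)) :
    lamPoly k π (π 0) = MvPolynomial.X 0 * MvPolynomial.X 1 := by simp [lamPoly]

theorem lamPoly_one (π : Equiv.Perm (Fin 4)) : lamPoly k π (π 1) = MvPolynomial.X 1 := by
  simp [lamPoly]

theorem lamPoly_two (π : Equiv.Perm (Fin 4)) : lamPoly k π (π 2) = 1 := by simp [lamPoly]

theorem lamPoly_three (π : Equiv.Perm (Fin 4)) : lamPoly k π (π 3) = -chartEqn k := by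
  simp [lamPoly]

theorem eval_chartEqn (a : Fin 2 → k) : eval a (chartEqn k) = 1 + a 1 + a 0 * a 1 := by
  simp [chartEqn]

namespace LinesAtlas

variable (𝒜 : LinesAtlas X)

theorem lam_sum_perm (π : Equiv.Perm (Fin 4)) (x : X) :
    𝒜.lam x (π 0) + 𝒜.lam x (π 1) + 𝒜.lam x (π 2) + 𝒜.lam x (π 3) = 0 := by
  rw [perm_sum π (𝒜.lam x), 𝒜.lam_sum]

variable {𝒜} in
theorem lam_eq {π : Equiv.Perm (Fin 4)} {x : X} (hx : x ∈ (𝒜.chart π).dom) (i : Fin 4) :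
    𝒜.lam x i = 𝒜.lam x (π 2) * eval ((𝒜.chart π).coord x) (lamPoly k π i) := by
  obtain ⟨h2, h3, h10⟩ := (𝒜.mem_dom π x).mp hx
  have hrel := 𝒜.rel x (π 0) (π 1) (by simp)
  have hsum := 𝒜.lam_sum_perm π x
  have h1 : 𝒜.lam x (π 1) = 𝒜.lam x (π 2) * ((𝒜.chart π).coord x 1) := by
    rw [𝒜.coord_eq]; simp; field_simp
  have h0 : 𝒜.lam x (π 0) = 𝒜.lam x (π 2) * ((𝒜.chart π).coord x 0 * (𝒜.chart π).coord x 1) := by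
    rw [𝒜.coord_eq]; simp; field_simp; rw [hrel, mul_comm]
  rcases perm_cases π i with rfl | rfl | rfl | rfl
  · rw [lamPoly_zero, h0]; simp
  · rw [lamPoly_one, h1]; simp
  · rw [lamPoly_two]; simp
  · rw [lamPoly_three, map_neg, eval_chartEqn]
    linear_combination hsum - h0 - h1

variable {𝒜} in
theorem ab_eq {π : Equiv.Perm (Fin 4)} {x : X} (hx : x ∈ (𝒜.chart π).dom) :
    𝒜.ab x (π 0) (π 1) = (𝒜.chart π).coord x 0 * 𝒜.ab x (π 1) (π 0) := by
  obtain ⟨h2, h3, h10⟩ := (𝒜.mem_dom π x).mp hx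
  rw [𝒜.coord_eq]; simp; field_simp

theorem exists_point (π : Equiv.Perm (Fin 4)) {t w : k} (h : 1 + w + t * w ≠ 0) :
    ∃ x ∈ (𝒜.chart π).dom, (𝒜.chart π).coord x = ![t, w] :=
  (𝒜.chart π).exists_point (by rw [𝒜.h_eq, eval_chartEqn]; simpa using h)

/-- The values of the forms have sum zero and are not all zero, so at least two of them are nonzero;
these are numbered `π 2` and `π 3`. Exchanging `π 0` and `π 1` if necessary gives the remaining
condition. -/
theorem exists_mem_dom (x : X) : ∃ π, x ∈ (𝒜.chart π).dom := by
  obtain ⟨i, hi⟩ := 𝒜.lam_ne_zero x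
  obtain ⟨j, hij, hj⟩ : ∃ j, i ≠ j ∧ 𝒜.lam x j ≠ 0 := by
    by_contra! h
    have hs := 𝒜.lam_sum x
    rw [← Fin.sum_univ_four, Finset.sum_eq_single i (fun j _ hj => h j hj.symm) (by simp)] at hs
    exact hi hs
  obtain ⟨π, rfl, rfl⟩ := exists_perm_last hij
  rcases 𝒜.ab_ne_zero x (π 1) (π 0) (by simp) with h | h
  · exact ⟨π, (𝒜.mem_dom π x).mpr ⟨hi, hj, h⟩⟩
  · refine ⟨π * Equiv.swap 0 1, (𝒜.mem_dom _ x).mpr ⟨?_, ?_, ?_⟩⟩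
    · simpa [Equiv.swap_apply_of_ne_of_ne] using hi
    · simpa [Equiv.swap_apply_of_ne_of_ne] using hj
    · simpa using h

theorem ab_ne_zero_of_lam {x : X} {i j : Fin 4} (hij : i ≠ j) (hi : 𝒜.lam x i ≠ 0) :
    𝒜.ab x i j ≠ 0 := by
  intro h
  have hrel := 𝒜.rel x i j hij
  rw [h, mul_zero, mul_eq_zero] at hrel
  rcases 𝒜.ab_ne_zero x i j hij with h' | h'
  · exact h' h
  · exact hrel.elim hi h'

theorem mem_dom_of_lam {x : X} (h : ∀ i, 𝒜.lam x i ≠ 0) (π : Equiv.Perm (Fin 4)) :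
    x ∈ (𝒜.chart π).dom :=
  (𝒜.mem_dom π x).mpr ⟨h _, h _, 𝒜.ab_ne_zero_of_lam (by simp) (h _)⟩

theorem exists_lam_ne_zero [Infinite k] : ∃ x, ∀ i, 𝒜.lam x i ≠ 0 := by
  obtain ⟨x, hx, hne⟩ := (𝒜.chart 1).exists_dom_ne (f := MvPolynomial.X 0 * MvPolynomial.X 1)
    (mul_ne_zero (X_ne_zero _) (X_ne_zero _))
  simp only [map_mul, eval_X] at hne
  have h2 := ((𝒜.mem_dom 1 x).mp hx).1
  have hh := (𝒜.chart 1).eval_h hx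
  rw [𝒜.h_eq] at hh
  refine ⟨x, fun i => ?_⟩
  rw [lam_eq hx]
  refine mul_ne_zero h2 ?_
  rcases perm_cases 1 i with rfl | rfl | rfl | rfl
  · rw [lamPoly_zero]; simpa using hne
  · rw [lamPoly_one]; simpa using right_ne_zero_of_mul hne
  · rw [lamPoly_two]; simp
  · rw [lamPoly_three, map_neg]; exact neg_ne_zero.mpr hh

/-- A point at which no form vanishes lies in all the charts, so the irreducible charts meet
pairwise. -/
theorem irreducibleSpace [Infinite k] (𝒜 : LinesAtlas X) : IrreducibleSpace X := by
  obtain ⟨x, hx⟩ := 𝒜.exists_lam_ne_zero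
  rw [irreducibleSpace_def]
  refine isIrreducible_of_cover ⟨x, trivial⟩ (fun π => (𝒜.chart π).dom)
    (fun π => (𝒜.chart π).isOpen_dom) (fun y _ => 𝒜.exists_mem_dom y) (fun π => ?_) ?_
  · exact (Set.univ_inter (𝒜.chart π).dom).symm ▸ (𝒜.chart π).isPreirreducible_dom
  · exact fun π σ _ _ => ⟨x, trivial, 𝒜.mem_dom_of_lam hx π, 𝒜.mem_dom_of_lam hx σ⟩

/-- The points `x` and `x'` have the same homogeneous coordinates. -/
def Same {ι' : Type} {κ' : ι' → Type} {Y : Set (MultiProj k κ')} (ℬ : LinesAtlas Y)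
    (x : X) (y : Y) : Prop :=
  (∃ s : k, s ≠ 0 ∧ ∀ i, ℬ.lam y i = s * 𝒜.lam x i) ∧
    ∀ i j, i ≠ j → ∃ u : k, u ≠ 0 ∧ ℬ.ab y i j = u * 𝒜.ab x i j ∧ ℬ.ab y j i = u * 𝒜.ab x j i

section Iso

variable {𝒜} {ι' : Type} {κ' : ι' → Type} {Y : Set (MultiProj k κ')} {ℬ : LinesAtlas Y}

theorem Same.mem_dom_iff {x : X} {y : Y} (h : 𝒜.Same ℬ x y) (π : Equiv.Perm (Fin 4)) :
    x ∈ (𝒜.chart π).dom ↔ y ∈ (ℬ.chart π).dom := by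
  obtain ⟨⟨s, hs, hlam⟩, hab⟩ := h
  obtain ⟨u, hu, -, hu'⟩ := hab (π 0) (π 1) (by simp)
  rw [𝒜.mem_dom, ℬ.mem_dom, hlam, hlam, hu']
  simp [hs, hu]

theorem Same.coord_eq {x : X} {y : Y} (h : 𝒜.Same ℬ x y) (π : Equiv.Perm (Fin 4)) :
    (𝒜.chart π).coord x = (ℬ.chart π).coord y := by
  obtain ⟨⟨s, hs, hlam⟩, hab⟩ := h
  obtain ⟨u, hu, hu1, hu2⟩ := hab (π 0) (π 1) (by simp)
  rw [𝒜.coord_eq, ℬ.coord_eq, hlam, hlam, hu1, hu2, mul_div_mul_left _ _ hs,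
    mul_div_mul_left _ _ hu]

/-- The coordinates determine the forms up to a factor. Where one of `lam i`, `lam j` is nonzero,
the relation determines the pencil coordinate; the only pair of which both can vanish is `{π 0, π
1}`, whose pencil coordinate is the first chart coordinate. -/
theorem Same.of_coord {π : Equiv.Perm (Fin 4)} {x : X} {y : Y} (hx : x ∈ (𝒜.chart π).dom)
    (hy : y ∈ (ℬ.chart π).dom) (h : (𝒜.chart π).coord x = (ℬ.chart π).coord y) :
    𝒜.Same ℬ x y := by
  obtain ⟨hx2, hx3, hx10⟩ := (𝒜.mem_dom π x).mp hx
  obtain ⟨hy2, hy3, hy10⟩ := (ℬ.mem_dom π y).mp hy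
  have hs : ℬ.lam y (π 2) / 𝒜.lam x (π 2) ≠ 0 := div_ne_zero hy2 hx2
  have hlam : ∀ i, ℬ.lam y i = ℬ.lam y (π 2) / 𝒜.lam x (π 2) * 𝒜.lam x i := fun i => by
    rw [lam_eq hx i, lam_eq hy i, h]; field_simp
  refine ⟨⟨_, hs, hlam⟩, ?_⟩
  have key : ∀ i j, i ≠ j → 𝒜.lam x i ≠ 0 → ∃ u : k, u ≠ 0 ∧ ℬ.ab y i j = u * 𝒜.ab x i j ∧
      ℬ.ab y j i = u * 𝒜.ab x j i := by
    intro i j hij hi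
    have hi' : ℬ.lam y i ≠ 0 := by rw [hlam]; exact mul_ne_zero hs hi
    have h1 := 𝒜.ab_ne_zero_of_lam hij hi
    have h2 := ℬ.ab_ne_zero_of_lam hij hi'
    refine ⟨ℬ.ab y i j / 𝒜.ab x i j, div_ne_zero h2 h1, by field_simp, ?_⟩
    have r1 := 𝒜.rel x i j hij
    have r2 := ℬ.rel y i j hij
    rw [hlam i, hlam j] at r2
    have r3 : ℬ.ab y j i * (ℬ.lam y (π 2) / 𝒜.lam x (π 2) * 𝒜.lam x i) * 𝒜.ab x i j =
        ℬ.ab y i j * 𝒜.ab x j i * (ℬ.lam y (π 2) / 𝒜.lam x (π 2) * 𝒜.lam x i) := by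
      linear_combination 𝒜.ab x i j * r2 - ℬ.ab y i j * (ℬ.lam y (π 2) / 𝒜.lam x (π 2)) * r1
    rw [div_mul_eq_mul_div, eq_div_iff h1]
    refine mul_left_cancel₀ (mul_ne_zero hs hi) ?_
    linear_combination r3
  intro i j hij
  by_cases hi : 𝒜.lam x i = 0
  · by_cases hj : 𝒜.lam x j = 0
    · have hmem : ∀ a, 𝒜.lam x a = 0 → a = π 0 ∨ a = π 1 := by
        intro a ha
        rcases perm_cases π a with rfl | rfl | rfl | rfl
        · exact Or.inl rfl
        · exact Or.inr rfl
        · exact absurd ha hx2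
        · exact absurd ha hx3
      have hu : ∃ u : k, u ≠ 0 ∧ ℬ.ab y (π 0) (π 1) = u * 𝒜.ab x (π 0) (π 1) ∧
          ℬ.ab y (π 1) (π 0) = u * 𝒜.ab x (π 1) (π 0) := by
        refine ⟨ℬ.ab y (π 1) (π 0) / 𝒜.ab x (π 1) (π 0), div_ne_zero hy10 hx10, ?_, by field_simp⟩
        rw [ab_eq hx, ab_eq hy, h]; field_simp
      obtain ⟨u, hu0, hu1, hu2⟩ := hu
      rcases hmem i hi with rfl | rfl <;> rcases hmem j hj with rfl | rfl
      · exact absurd rfl hij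
      · exact ⟨u, hu0, hu1, hu2⟩
      · exact ⟨u, hu0, hu2, hu1⟩
      · exact absurd rfl hij
    · obtain ⟨u, hu0, hu1, hu2⟩ := key j i hij.symm hj
      exact ⟨u, hu0, hu2, hu1⟩
  · exact key i j hij hi

/-- All charts of both atlases have the same image, so a point can be sent to the point with the
same coordinates in a chart. The result does not depend on the chart, since one chart fixes all
homogeneous coordinates. -/
theorem nonempty_varIso (𝒜 : LinesAtlas X) (ℬ : LinesAtlas Y) : Nonempty (VarIso X Y) := by
  have hex : ∀ x, ∃ y, 𝒜.Same ℬ x y := by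
    intro x
    obtain ⟨π, hπ⟩ := 𝒜.exists_mem_dom x
    have hh := (𝒜.chart π).eval_h hπ
    rw [𝒜.h_eq, ← ℬ.h_eq π] at hh
    obtain ⟨y, hy, hxy⟩ := (ℬ.chart π).exists_point hh
    exact ⟨y, Same.of_coord hπ hy hxy.symm⟩
  choose e he using hex
  obtain ⟨E, -⟩ := VarIso.ofCharts e 𝒜.chart ℬ.chart (fun π x => (he x).mem_dom_iff π)
    (fun π x _ => (he x).coord_eq π) (fun π => by rw [𝒜.h_eq, ℬ.h_eq]) ℬ.exists_mem_dom
  exact ⟨E⟩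

/-- Transport of an atlas along an isomorphism. -/
def comap (e : VarIso X Y) (ℬ : LinesAtlas Y) : LinesAtlas X where
  chart π := (ℬ.chart π).comap e
  lam x := ℬ.lam (e.toHomeomorph x)
  ab x := ℬ.ab (e.toHomeomorph x)
  lam_ne_zero _ := ℬ.lam_ne_zero _
  lam_sum _ := ℬ.lam_sum _
  ab_ne_zero _ := ℬ.ab_ne_zero _
  rel _ := ℬ.rel _
  isOpen_lam m := (ℬ.isOpen_lam m).preimage e.toHomeomorph.continuous
  isOpen_ab i j u v hij := (ℬ.isOpen_ab i j u v hij).preimage e.toHomeomorph.continuous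
  mem_dom π _ := ℬ.mem_dom π _
  coord_eq π _ := ℬ.coord_eq π _
  h_eq π := ℬ.h_eq π

end Iso

/-! ### Forms and their divisors -/

/-- The local expression of a form in a chart. -/
def localForm (π : Equiv.Perm (Fin 4)) : MvPolynomial (Fin 4) k →ₐ[k] MvPolynomial (Fin 2) k :=
  aeval (lamPoly k π)

theorem localForm_X (π : Equiv.Perm (Fin 4)) (i : Fin 4) :
    localForm (k := k) π (MvPolynomial.X i) = lamPoly k π i := by simp [localForm]

theorem eval_smul_of_isHomogeneous {A : MvPolynomial (Fin 4) k} {d : ℕ} (hA : A.IsHomogeneous d)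
    (s : k) (v : Fin 4 → k) : eval (fun i => s * v i) A = s ^ d * eval v A := by
  rw [eval_eq, eval_eq, Finset.mul_sum]
  refine Finset.sum_congr rfl fun m hm => ?_
  have hw : ∑ i ∈ m.support, m i = d := by
    have := hA (mem_support_iff.mp hm)
    rwa [Finsupp.weight_apply, Finsupp.sum, Finset.sum_congr rfl (g := fun i => m i) (fun i _ => by simp)] at this
  simp only [mul_pow, Finset.prod_mul_distrib]
  rw [Finset.prod_pow_eq_pow_sum, hw]
  ring

variable {𝒜} in
theorem eval_lam {π : Equiv.Perm (Fin 4)} {x : X} (hx : x ∈ (𝒜.chart π).dom)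
    {A : MvPolynomial (Fin 4) k} {d : ℕ} (hA : A.IsHomogeneous d) :
    eval (𝒜.lam x) A = 𝒜.lam x (π 2) ^ d * eval ((𝒜.chart π).coord x) (localForm π A) := by
  have h1 : 𝒜.lam x = fun i => 𝒜.lam x (π 2) * eval ((𝒜.chart π).coord x) (lamPoly k π i) :=
    funext fun i => lam_eq hx i
  have h2 : eval ((𝒜.chart π).coord x) (localForm π A) =
      eval (fun i => eval ((𝒜.chart π).coord x) (lamPoly k π i)) A :=
    eval₂Hom_bind₁ _ _ _ _
  rw [h2, ← eval_smul_of_isHomogeneous hA]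
  exact congrArg (fun v => eval v A) h1

variable {𝒜} in
theorem eval_lam_ne_zero_iff {π : Equiv.Perm (Fin 4)} {x : X} (hx : x ∈ (𝒜.chart π).dom)
    {A : MvPolynomial (Fin 4) k} {d : ℕ} (hA : A.IsHomogeneous d) :
    eval (𝒜.lam x) A ≠ 0 ↔ eval ((𝒜.chart π).coord x) (localForm π A) ≠ 0 := by
  rw [eval_lam hx hA, mul_ne_zero_iff]
  exact and_iff_right (pow_ne_zero _ ((𝒜.mem_dom π x).mp hx).1)

/-- `A` is homogeneous of degree `d` and does not vanish identically. -/
structure IsNonzeroForm (A : MvPolynomial (Fin 4) k) (d : ℕ) : Prop where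
  homogeneous : A.IsHomogeneous d
  ne_zero : ∃ x, eval (𝒜.lam x) A ≠ 0

variable {𝒜}

section Nonzero

theorem IsNonzeroForm.localForm_ne_zero [Infinite k] {A : MvPolynomial (Fin 4) k} {d : ℕ}
    (hA : 𝒜.IsNonzeroForm A d) (π : Equiv.Perm (Fin 4)) : localForm π A ≠ 0 := by
  have : IrreducibleSpace X := 𝒜.irreducibleSpace
  obtain ⟨x, hx⟩ := hA.ne_zero
  obtain ⟨σ, hσ⟩ := 𝒜.exists_mem_dom x
  rw [eval_lam_ne_zero_iff hσ hA.homogeneous] at hx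
  obtain ⟨z, hz⟩ := 𝒜.exists_lam_ne_zero
  obtain ⟨y, -, ⟨hyσ, hyA⟩, hyπ⟩ := (IrreducibleSpace.isIrreducible_univ X).2 _ _
    ((𝒜.chart σ).isOpen_ne (localForm σ A)) (𝒜.chart π).isOpen_dom ⟨x, trivial, hσ, hx⟩
    ⟨z, trivial, 𝒜.mem_dom_of_lam hz π⟩
  rw [← eval_lam_ne_zero_iff hyσ hA.homogeneous, eval_lam_ne_zero_iff hyπ hA.homogeneous] at hyA
  rintro h
  rw [h, map_zero] at hyA
  exact hyA rfl

theorem isNonzeroForm_of_localForm [Infinite k] {A : MvPolynomial (Fin 4) k} {d : ℕ} (hA : A.IsHomogeneous d)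
    (π : Equiv.Perm (Fin 4)) (h : localForm π A ≠ 0) : 𝒜.IsNonzeroForm A d := by
  obtain ⟨x, hx, hne⟩ := (𝒜.chart π).exists_dom_ne h
  exact ⟨hA, x, (eval_lam_ne_zero_iff hx hA).mpr hne⟩

theorem isNonzeroForm_X [Infinite k] (i : Fin 4) : 𝒜.IsNonzeroForm (MvPolynomial.X i) 1 := by
  obtain ⟨x, hx⟩ := 𝒜.exists_lam_ne_zero
  exact ⟨isHomogeneous_X k i, x, by simpa using hx i⟩

theorem IsNonzeroForm.pow {A : MvPolynomial (Fin 4) k} {d : ℕ} (hA : 𝒜.IsNonzeroForm A d)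
    (n : ℕ) : 𝒜.IsNonzeroForm (A ^ n) (n * d) := by
  obtain ⟨x, hx⟩ := hA.ne_zero
  refine ⟨?_, x, by rw [map_pow]; exact pow_ne_zero _ hx⟩
  rw [mul_comm]; exact hA.homogeneous.pow n

/-- In the chart `w * t = lam (π 0) * lam (π 2)` and `w * w = lam (π 1) * lam (π 1)` when `lam (π
2)` is set to one. So `w` times either variable is a quadratic form, and `w ^ K * N` is a form of
degree `2 * K`. Allowing every large `K` gives summands, and later a numerator and a denominator, of
the same degree. -/
theorem exists_form (π : Equiv.Perm (Fin 4)) (N : MvPolynomial (Fin 2) k) :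
    ∃ K₀ : ℕ, ∀ K ≥ K₀, ∃ A : MvPolynomial (Fin 4) k, A.IsHomogeneous (2 * K) ∧
      localForm π A = MvPolynomial.X 1 ^ K * N := by
  induction N using MvPolynomial.induction_on with
  | C a =>
    refine ⟨0, fun K _ => ⟨C a * (MvPolynomial.X (π 1) ^ K * MvPolynomial.X (π 2) ^ K), ?_, ?_⟩⟩
    · have h1 : (MvPolynomial.X (π 1) ^ K * MvPolynomial.X (π 2) ^ K : MvPolynomial (Fin 4) k).IsHomogeneous (1 * K + 1 * K) :=
        ((isHomogeneous_X k _).pow K).mul ((isHomogeneous_X k _).pow K)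
      have h2 := (isHomogeneous_C (Fin 4) a).mul h1
      convert h2 using 1; ring
    · simp only [map_mul, map_pow, localForm_X, lamPoly_one, lamPoly_two, one_pow, mul_one]
      rw [mul_comm]
      congr 1
      simp [localForm]
  | add p q hp hq =>
    obtain ⟨K₁, h₁⟩ := hp
    obtain ⟨K₂, h₂⟩ := hq
    refine ⟨max K₁ K₂, fun K hK => ?_⟩
    obtain ⟨A, hA, hA'⟩ := h₁ K (le_of_max_le_left hK)
    obtain ⟨B, hB, hB'⟩ := h₂ K (le_of_max_le_right hK)
    exact ⟨A + B, hA.add hB, by rw [map_add, hA', hB', mul_add]⟩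
  | mul_X p j hp =>
    obtain ⟨K₁, h₁⟩ := hp
    refine ⟨K₁ + 1, fun K hK => ?_⟩
    obtain ⟨K, rfl⟩ : ∃ K', K = K' + 1 := ⟨K - 1, by omega⟩
    obtain ⟨A, hA, hA'⟩ := h₁ K (by omega)
    rcases Fin.eq_or_eq_add_one 0 j with rfl | rfl
    · refine ⟨A * (MvPolynomial.X (π 0) * MvPolynomial.X (π 2)), ?_, ?_⟩
      · exact hA.mul ((isHomogeneous_X k _).mul (isHomogeneous_X k _))
      · simp only [map_mul, localForm_X, lamPoly_zero, lamPoly_two, hA']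
        ring
    · refine ⟨A * (MvPolynomial.X (π 1) * MvPolynomial.X (π 1)), ?_, ?_⟩
      · exact hA.mul ((isHomogeneous_X k _).mul (isHomogeneous_X k _))
      · simp only [map_mul, localForm_X, lamPoly_one, hA', zero_add]
        ring

end Nonzero

end LinesAtlas

/-- Distinct prime divisors have non-associated local equations, and `B` has finitely many prime
factors. -/
theorem Chart.finite_dvd [IsAlgClosed k] [IrreducibleSpace X] {n : ℕ} (c : Chart X n)
    {B : MvPolynomial (Fin n) k} (hB : B ≠ 0) :
    {Z : PrimeDivisor X | (c.dom ∩ Z.pts).Nonempty ∧ c.eqn Z ∣ B}.Finite := by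
  classical
  have hex : ∀ Z : {Z : PrimeDivisor X | (c.dom ∩ Z.pts).Nonempty ∧ c.eqn Z ∣ B},
      ∃ p ∈ (UniqueFactorizationMonoid.factors B).toFinset, Associated (c.eqn Z.1) p := by
    rintro ⟨Z, hm, hdvd⟩
    obtain ⟨p, hp, hass⟩ := UniqueFactorizationMonoid.exists_mem_factors_of_dvd hB
      (c.eqn_spec hm).1.irreducible hdvd
    exact ⟨p, Multiset.mem_toFinset.mpr hp, hass⟩
  choose p hp hass using hex
  exact Finite.of_injective
    (fun Z => (⟨p Z, hp Z⟩ : (UniqueFactorizationMonoid.factors B).toFinset)) fun Z W h => by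
      have hpe : p Z = p W := congrArg Subtype.val h
      exact Subtype.ext (c.eq_of_dvd Z.2.1 W.2.1
        (((hass Z).trans (hpe ▸ (hass W).symm)).dvd))

end

end ProjGeom

/-! ### Divisors of forms -/

namespace ProjGeom

noncomputable section

universe u

open MvPolynomial

variable {k : Type u} [Field k] {ι : Type} {κ : ι → Type} {X : Set (MultiProj k κ)}
  [IsAlgClosed k] [IrreducibleSpace X]

namespace LinesAtlas

variable (𝒜 : LinesAtlas X) {A B : MvPolynomial (Fin 4) k} {d : ℕ}

theorem exists_chart (Z : PrimeDivisor X) : ∃ π, ((𝒜.chart π).dom ∩ Z.pts).Nonempty := by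
  obtain ⟨x, hx⟩ := Z.isIrreducible.1
  obtain ⟨π, hπ⟩ := 𝒜.exists_mem_dom x
  exact ⟨π, x, hπ, hx⟩

/-- The order of vanishing of a form along a prime divisor. -/
def ord (A : MvPolynomial (Fin 4) k) (Z : PrimeDivisor X) : ℕ :=
  multiplicity ((𝒜.chart (𝒜.exists_chart Z).choose).eqn Z) (localForm (𝒜.exists_chart Z).choose A)

variable {𝒜}

theorem generic_localForm (hA : 𝒜.IsNonzeroForm A d) (hB : 𝒜.IsNonzeroForm B d)
    (π : Equiv.Perm (Fin 4)) : ∀ᶠ y in nhdsGeneric (Set.univ : Set X),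
      y ∈ (𝒜.chart π).dom ∧ eval ((𝒜.chart π).coord y) (localForm π A) ≠ 0 ∧
      eval ((𝒜.chart π).coord y) (localForm π B) ≠ 0 ∧
      eval (𝒜.lam y) A / eval (𝒜.lam y) B * eval ((𝒜.chart π).coord y) (localForm π B) =
        eval ((𝒜.chart π).coord y) (localForm π A) := by
  have hne := mul_ne_zero (hA.localForm_ne_zero π) (hB.localForm_ne_zero π)
  obtain ⟨x, hx, hxne⟩ := (𝒜.chart π).exists_dom_ne hne
  filter_upwards [IsOpen.mem_nhdsGeneric ((𝒜.chart π).isOpen_ne _) ⟨x, ⟨hx, hxne⟩, trivial⟩]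
    with y hy
  obtain ⟨hyd, hyne⟩ := hy
  rw [map_mul] at hyne
  have h1 := left_ne_zero_of_mul hyne
  have h2 := right_ne_zero_of_mul hyne
  refine ⟨hyd, h1, h2, ?_⟩
  have h3 := pow_ne_zero d ((𝒜.mem_dom π y).mp hyd).1
  rw [eval_lam hyd hA.homogeneous, eval_lam hyd hB.homogeneous, mul_div_mul_left _ _ h3,
    div_mul_cancel₀ _ h2]

theorem hasOrder_iff_multiplicity (hA : 𝒜.IsNonzeroForm A d) (hB : 𝒜.IsNonzeroForm B d)
    {π : Equiv.Perm (Fin 4)} {Z : PrimeDivisor X} (hm : ((𝒜.chart π).dom ∩ Z.pts).Nonempty)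
    {n : ℤ} : HasOrder (fun x => eval (𝒜.lam x) A / eval (𝒜.lam x) B) Z n ↔
      n = (multiplicity ((𝒜.chart π).eqn Z) (localForm π A) : ℤ) -
        multiplicity ((𝒜.chart π).eqn Z) (localForm π B) :=
  (𝒜.chart π).hasOrder_iff hm (hA.localForm_ne_zero π) (hB.localForm_ne_zero π)
    ((generic_localForm hA hB π).mono fun _ h => h.2.2.2)

/-- The order is defined in one chosen chart. It is independent of the chart because it is the order
along `Z`, in the intrinsic sense of `HasOrder`, of the quotient of `A` by a form that does not
vanish identically on `Z`. -/
theorem ord_eq_multiplicity (hA : 𝒜.IsNonzeroForm A d) {π : Equiv.Perm (Fin 4)}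
    {Z : PrimeDivisor X} (hm : ((𝒜.chart π).dom ∩ Z.pts).Nonempty) :
    𝒜.ord A Z = multiplicity ((𝒜.chart π).eqn Z) (localForm π A) := by
  set σ := (𝒜.exists_chart Z).choose with hσ
  have hmσ : ((𝒜.chart σ).dom ∩ Z.pts).Nonempty := (𝒜.exists_chart Z).choose_spec
  -- The form `σ 2` vanishes nowhere on the chart `σ`, which meets `Z`; hence its power has
  -- multiplicity zero along `Z` in every chart.
  have hB : 𝒜.IsNonzeroForm (MvPolynomial.X (σ 2) ^ d) (d * 1) := (isNonzeroForm_X (σ 2)).pow d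
  rw [mul_one] at hB
  have h0 : ∀ τ, ((𝒜.chart τ).dom ∩ Z.pts).Nonempty →
      multiplicity ((𝒜.chart τ).eqn Z) (localForm τ (MvPolynomial.X (σ 2) ^ d)) = 0 := by
    intro τ hmτ
    rw [multiplicity_eq_zero]
    intro hdvd
    rw [map_pow] at hdvd
    have hdvd' := ((𝒜.chart τ).eqn_spec hmτ).1.dvd_of_dvd_pow hdvd
    rw [(𝒜.chart τ).eqn_dvd_iff hmτ] at hdvd'
    obtain ⟨y, hyZ, hyτ, hyσ⟩ := Z.isIrreducible.2 _ _ (𝒜.chart τ).isOpen_dom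
      (𝒜.chart σ).isOpen_dom (by rwa [Set.inter_comm]) (by rwa [Set.inter_comm])
    have := hdvd' y hyZ hyτ
    rw [localForm_X] at this
    have h2 := ((𝒜.mem_dom σ y).mp hyσ).1
    rw [lam_eq hyτ, this, mul_zero] at h2
    exact h2 rfl
  have h1 := (hasOrder_iff_multiplicity hA hB hmσ).mpr rfl
  rw [hasOrder_iff_multiplicity hA hB hm, h0 σ hmσ, h0 π hm] at h1
  have h2 : (𝒜.ord A Z : ℤ) = multiplicity ((𝒜.chart σ).eqn Z) (localForm σ A) := rfl
  omega

theorem hasOrder_iff (hA : 𝒜.IsNonzeroForm A d) (hB : 𝒜.IsNonzeroForm B d)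
    {Z : PrimeDivisor X} {n : ℤ} :
    HasOrder (fun x => eval (𝒜.lam x) A / eval (𝒜.lam x) B) Z n ↔
      n = (𝒜.ord A Z : ℤ) - 𝒜.ord B Z := by
  obtain ⟨π, hm⟩ := 𝒜.exists_chart Z
  rw [hasOrder_iff_multiplicity hA hB hm, ord_eq_multiplicity hA hm, ord_eq_multiplicity hB hm]

theorem ord_ne_zero_iff (hA : 𝒜.IsNonzeroForm A d) {Z : PrimeDivisor X} :
    𝒜.ord A Z ≠ 0 ↔ ∀ x ∈ Z.pts, eval (𝒜.lam x) A = 0 := by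
  constructor
  · intro h x hx
    obtain ⟨π, hπ⟩ := 𝒜.exists_mem_dom x
    have hm : ((𝒜.chart π).dom ∩ Z.pts).Nonempty := ⟨x, hπ, hx⟩
    rw [ord_eq_multiplicity hA hm, multiplicity_ne_zero, (𝒜.chart π).eqn_dvd_iff hm] at h
    rw [eval_lam hπ hA.homogeneous, h x hx hπ, mul_zero]
  · intro h
    obtain ⟨π, hm⟩ := 𝒜.exists_chart Z
    rw [ord_eq_multiplicity hA hm, multiplicity_ne_zero, (𝒜.chart π).eqn_dvd_iff hm]
    intro x hx hπ
    have := h x hx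
    by_contra hne
    exact (eval_lam_ne_zero_iff hπ hA.homogeneous).mpr hne this

theorem finite_ord (hA : 𝒜.IsNonzeroForm A d) : {Z | 𝒜.ord A Z ≠ 0}.Finite := by
  refine (Set.finite_iUnion fun π =>
    (𝒜.chart π).finite_dvd (hA.localForm_ne_zero π)).subset fun Z hZ => ?_
  obtain ⟨π, hm⟩ := 𝒜.exists_chart Z
  rw [Set.mem_ofPred_eq, ord_eq_multiplicity hA hm, multiplicity_ne_zero] at hZ
  exact Set.mem_iUnion.mpr ⟨π, hm, hZ⟩

/-- The divisor of a nonzero form. -/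
def div (hA : 𝒜.IsNonzeroForm A d) : Divisor X :=
  Finsupp.ofSupportFinite (fun Z => (𝒜.ord A Z : ℤ)) ((finite_ord hA).subset fun Z hZ => by
    simpa using hZ)

theorem div_apply (hA : 𝒜.IsNonzeroForm A d) (Z : PrimeDivisor X) : div hA Z = 𝒜.ord A Z := rfl

theorem isPrincipal_div_sub (hA : 𝒜.IsNonzeroForm A d) (hB : 𝒜.IsNonzeroForm B d) :
    IsPrincipal (div hA - div hB) := by
  refine ⟨fun x => eval (𝒜.lam x) A / eval (𝒜.lam x) B, ?_, fun Z => ?_⟩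
  · filter_upwards [generic_localForm hA hB 1] with y hy
    obtain ⟨hyd, hA', hB', -⟩ := hy
    constructor
    · refine (((𝒜.chart 1).regularAt_eval hyd (localForm 1 A)).div
        ((𝒜.chart 1).regularAt_eval hyd (localForm 1 B)) hB').congr ?_
      filter_upwards [(𝒜.chart 1).dom_mem_nhds hyd] with z hz
      rw [eval_lam hz hA.homogeneous, eval_lam hz hB.homogeneous,
        mul_div_mul_left _ _ (pow_ne_zero d ((𝒜.mem_dom 1 z).mp hz).1)]
    · exact div_ne_zero ((eval_lam_ne_zero_iff hyd hA.homogeneous).mpr hA')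
        ((eval_lam_ne_zero_iff hyd hB.homogeneous).mpr hB')
  · rw [hasOrder_iff hA hB]; rfl

/-- Near a point of one chart a rational function is a quotient of two polynomials; multiplying both
by the same power of `w` makes them forms of the same degree. -/
theorem exists_div_sub_of_isPrincipal (𝒜 : LinesAtlas X) {D : Divisor X} (hD : IsPrincipal D) :
    ∃ (d : ℕ) (A B : MvPolynomial (Fin 4) k) (hA : 𝒜.IsNonzeroForm A d)
      (hB : 𝒜.IsNonzeroForm B d), D = div hA - div hB := by
  obtain ⟨f, hf, hfD⟩ := hD
  obtain ⟨z, hz⟩ := 𝒜.exists_lam_ne_zero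
  have hirr := IrreducibleSpace.isIrreducible_univ X
  set c := 𝒜.chart 1
  obtain ⟨U, hU, ⟨x, hxU, -⟩, hUf⟩ := (mem_nhdsGeneric hirr).mp (Filter.inter_mem hf
    (IsOpen.mem_nhdsGeneric c.isOpen_dom ⟨z, 𝒜.mem_dom_of_lam hz 1, trivial⟩))
  have hxd : x ∈ c.dom := (hUf hxU).2
  obtain ⟨N, M, hM, hNM⟩ := (c.regular_iff x hxd f).mp (hUf hxU).1.1
  obtain ⟨V, hVsub, hV, hxV⟩ := mem_nhds_iff.mp hNM
  have hgen : ∀ᶠ y in nhdsGeneric (Set.univ : Set X), y ∈ c.dom ∧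
      f y * eval (c.coord y) M = eval (c.coord y) N := by
    filter_upwards [IsOpen.mem_nhdsGeneric hV ⟨x, hxV, trivial⟩,
      IsOpen.mem_nhdsGeneric c.isOpen_dom ⟨x, hxd, trivial⟩] with y hy hy'
    exact ⟨hy', hVsub hy⟩
  have hM0 : M ≠ 0 := by rintro rfl; simp at hM
  have hN0 : N ≠ 0 := by
    rintro rfl
    have := hVsub hxV
    rw [Set.mem_ofPred_eq, map_zero] at this
    exact mul_ne_zero (hUf hxU).1.2 hM this
  obtain ⟨K₁, h₁⟩ := exists_form (1 : Equiv.Perm (Fin 4)) N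
  obtain ⟨K₂, h₂⟩ := exists_form (1 : Equiv.Perm (Fin 4)) M
  obtain ⟨A, hA, hA'⟩ := h₁ (max K₁ K₂) (le_max_left _ _)
  obtain ⟨B, hB, hB'⟩ := h₂ (max K₁ K₂) (le_max_right _ _)
  have hw : (MvPolynomial.X 1 : MvPolynomial (Fin 2) k) ^ max K₁ K₂ ≠ 0 :=
    pow_ne_zero _ (X_ne_zero _)
  have hAn : 𝒜.IsNonzeroForm A (2 * max K₁ K₂) :=
    isNonzeroForm_of_localForm hA 1 (by rw [hA']; exact mul_ne_zero hw hN0)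
  have hBn : 𝒜.IsNonzeroForm B (2 * max K₁ K₂) :=
    isNonzeroForm_of_localForm hB 1 (by rw [hB']; exact mul_ne_zero hw hM0)
  refine ⟨_, A, B, hAn, hBn, Finsupp.ext fun Z => ?_⟩
  obtain ⟨π, hm⟩ := 𝒜.exists_chart Z
  rw [Finsupp.sub_apply, div_apply, div_apply, ord_eq_multiplicity hAn hm,
    ord_eq_multiplicity hBn hm]
  refine ((𝒜.chart π).hasOrder_iff hm (hAn.localForm_ne_zero π) (hBn.localForm_ne_zero π) ?_).mp
    (hfD Z)
  filter_upwards [hgen, generic_localForm hAn hBn π] with y hy₁ hy₂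
  obtain ⟨hyd, hy⟩ := hy₁
  have hyπ := hy₂.1
  have h3 := pow_ne_zero (2 * max K₁ K₂) ((𝒜.mem_dom π y).mp hyπ).1
  have h4 : f y * eval (𝒜.lam y) B = eval (𝒜.lam y) A := by
    rw [eval_lam hyd hB, eval_lam hyd hA, hA', hB', map_mul, map_mul, ← hy]
    ring
  rw [eval_lam hyπ hB, eval_lam hyπ hA] at h4
  refine mul_left_cancel₀ h3 ?_
  linear_combination h4

/-! ### Criteria for divisors of forms -/

omit [IsAlgClosed k] in
theorem _root_.ProjGeom.PrimeDivisor.eq_of_subset {Z W : PrimeDivisor X} (h : Z.pts ⊆ W.pts) :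
    Z = W := by
  by_contra hne
  exact ((coheight_eq_one_iff W.1).mp W.2).1 (((coheight_eq_one_iff Z.1).mp Z.2).2 W.1
    (lt_of_le_of_ne h fun h' => hne (Subtype.ext h')))

omit [IsAlgClosed k] [IrreducibleSpace X] in
theorem _root_.ProjGeom.PrimeDivisor.subset_of_subset_biUnion {Z : PrimeDivisor X}
    {s : Finset (PrimeDivisor X)} (h : Z.pts ⊆ ⋃ C ∈ s, C.pts) : ∃ C ∈ s, Z.pts ⊆ C.pts := by
  classical
  have := isIrreducible_iff_sUnion_isClosed.mp Z.isIrreducible (s.image PrimeDivisor.pts)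
    (by
      intro t ht
      obtain ⟨C, -, rfl⟩ := Finset.mem_image.mp ht
      exact C.isClosed)
    (by
      intro x hx
      obtain ⟨C, hC, hxC⟩ := Set.mem_iUnion₂.mp (h hx)
      exact ⟨C.pts, Finset.mem_coe.mpr (Finset.mem_image_of_mem _ hC), hxC⟩)
  obtain ⟨t, ht, hZt⟩ := this
  obtain ⟨C, hC, rfl⟩ := Finset.mem_image.mp ht
  exact ⟨C, hC, hZt⟩

theorem mem_of_ord_ne_zero (hA : 𝒜.IsNonzeroForm A d) {s : Finset (PrimeDivisor X)}
    (hs : ∀ x, eval (𝒜.lam x) A = 0 → ∃ C ∈ s, x ∈ C.pts) {Z : PrimeDivisor X}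
    (h : 𝒜.ord A Z ≠ 0) : Z ∈ s := by
  rw [ord_ne_zero_iff hA] at h
  obtain ⟨C, hC, hZC⟩ := PrimeDivisor.subset_of_subset_biUnion (Z := Z) (s := s) fun x hx => by
    obtain ⟨C, hC, hxC⟩ := hs x (h x hx)
    exact Set.mem_iUnion₂.mpr ⟨C, hC, hxC⟩
  rwa [PrimeDivisor.eq_of_subset hZC]

/-- A component of the divisor lies in the union of the finite family, hence in one member, and
equals it because both have codimension one. -/
theorem div_eq_sum (hA : 𝒜.IsNonzeroForm A d) {s : Finset (PrimeDivisor X)}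
    (hs : ∀ x, eval (𝒜.lam x) A = 0 → ∃ C ∈ s, x ∈ C.pts) (h1 : ∀ C ∈ s, 𝒜.ord A C = 1) :
    div hA = ∑ C ∈ s, C.toDivisor := by
  classical
  refine Finsupp.ext fun Z => ?_
  rw [div_apply, Finsupp.finsetSum_apply]
  simp only [PrimeDivisor.toDivisor, Finsupp.single_apply]
  rw [Finset.sum_ite_eq' s Z (fun _ => (1 : ℤ))]
  split_ifs with h
  · rw [h1 Z h]; rfl
  · have := mt (mem_of_ord_ne_zero hA hs) h
    rw [not_not] at this
    rw [this]; rfl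

end LinesAtlas

theorem IsLine.multiplicity_eqn {c : Chart X 2} {C : PrimeDivisor X} {i : Fin 2} {a : k}
    (h : IsLine c C i a) (f : MvPolynomial (Fin 2) k) :
    multiplicity (c.eqn C) f = multiplicity (lineEqn i a) f :=
  (multiplicity_eq_of_associated_left (c.eqn_associated h.1 h.ideal_eq)).symm

theorem IsLine.multiplicity_eq_zero {c : Chart X 2} {C : PrimeDivisor X} {i : Fin 2} {a : k}
    (h : IsLine c C i a) {f : MvPolynomial (Fin 2) k} (hf : lineEval i a f ≠ 0) :
    multiplicity (c.eqn C) f = 0 := by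
  rw [h.multiplicity_eqn, _root_.multiplicity_eq_zero, lineEqn_dvd_iff]
  exact hf

theorem IsLine.multiplicity_mul_eq_one {c : Chart X 2} {C : PrimeDivisor X} {i : Fin 2} {a : k}
    (h : IsLine c C i a) {f : MvPolynomial (Fin 2) k} (hf : lineEval i a f ≠ 0) :
    multiplicity (c.eqn C) (lineEqn i a * f) = 1 := by
  have hf0 : f ≠ 0 := by rintro rfl; simp at hf
  rw [c.multiplicity_mul h.1 (lineEqn_ne_zero i a) hf0, h.multiplicity_eq_zero hf,
    h.multiplicity_eqn, multiplicity_self]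

/-- A closed set which is a coordinate line in each of a family of charts covering it. -/
theorem exists_curve {I : Type*} [Nonempty I] (c : I → Chart X 2) {S : Set X} (hS : IsClosed S)
    (hcover : ∀ x ∈ S, ∃ i, x ∈ (c i).dom) {x₀ : X} (hx₀ : x₀ ∈ S) (hx₀' : ∀ i, x₀ ∈ (c i).dom)
    {e : Fin 2} {a : k} (hline : ∀ i, ∀ x ∈ (c i).dom, x ∈ S ↔ (c i).coord x e = a) :
    ∃ C : PrimeDivisor X, C.pts = S ∧ ∀ i, IsLine (c i) C e a := by
  have hex : ∀ i, ∃ Z : PrimeDivisor X, ∀ x ∈ (c i).dom, x ∈ Z.pts ↔ x ∈ S := by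
    intro i
    obtain ⟨Z, -, -, hZ⟩ := (c i).exists_primeDivisor (lineEqn_prime e a) (by
      rintro ⟨r, hr⟩
      have := (c i).eval_h (hx₀' i)
      rw [hr, map_mul, eval_lineEqn, (hline i x₀ (hx₀' i)).mp hx₀, sub_self, zero_mul] at this
      exact this rfl)
    refine ⟨Z, fun x hx => ?_⟩
    rw [hZ x hx, hline i x hx, eval_lineEqn, sub_eq_zero]
  choose Z hZ using hex
  -- In each chart `S` agrees with a prime divisor, and the pieces meet because `x₀` lies in all the
  -- charts.
  have hirr : IsIrreducible S := by
    refine isIrreducible_of_cover ⟨x₀, hx₀⟩ (fun i => (c i).dom) (fun i => (c i).isOpen_dom) hcover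
      (fun i => ?_) (fun i j _ _ => ⟨x₀, hx₀, hx₀' i, hx₀' j⟩)
    rintro V W hV hW ⟨x, ⟨hxS, hx⟩, hxV⟩ ⟨y, ⟨hyS, hy⟩, hyW⟩
    obtain ⟨z, hzZ, ⟨hzV, hz⟩, hzW, -⟩ := (Z i).isIrreducible.2 _ _
      (hV.inter (c i).isOpen_dom) (hW.inter (c i).isOpen_dom) ⟨x, (hZ i x hx).mpr hxS, hxV, hx⟩
      ⟨y, (hZ i y hy).mpr hyS, hyW, hy⟩
    exact ⟨z, ⟨(hZ i z hz).mp hzZ, hz⟩, hzV, hzW⟩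
  obtain ⟨i₀⟩ := ‹Nonempty I›
  have hSZ : (Z i₀).pts = S := by
    apply Set.Subset.antisymm
    · exact (c i₀).subset_of_inter_subset (Z i₀).isIrreducible.2 hS
        ⟨x₀, hx₀' i₀, (hZ i₀ x₀ (hx₀' i₀)).mpr hx₀⟩ fun x hx => (hZ i₀ x hx.2).mp hx.1
    · exact (c i₀).subset_of_inter_subset hirr.2 (Z i₀).isClosed
        ⟨x₀, hx₀' i₀, hx₀⟩ fun x hx => (hZ i₀ x hx.2).mpr hx.1
  exact ⟨Z i₀, hSZ, fun i => ⟨⟨x₀, hx₀' i, hSZ ▸ hx₀⟩, fun x hx => by rw [hSZ, hline i x hx]⟩⟩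

end

end ProjGeom

namespace ProjGeom

noncomputable section

universe u

open MvPolynomial

/-! ### Curves on the surface that are projective lines -/

section Restriction

variable {k : Type u} [Field k] {ι : Type} {κ : ι → Type} {X : Set (MultiProj k κ)}

/-- The inclusion of a subset of `X`, regarded as a subset of the ambient space. -/
def incl (C : Set X) (y : (Subtype.val '' C : Set (MultiProj k κ))) : X :=
  ⟨y.1, by obtain ⟨x, -, h⟩ := y.2; exact h ▸ x.2⟩

theorem incl_mem {C : Set X} (y : (Subtype.val '' C : Set (MultiProj k κ))) : incl C y ∈ C := by
  obtain ⟨_, x, hx, rfl⟩ := y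
  exact hx

theorem exists_incl {C : Set X} {x : X} (hx : x ∈ C) : ∃ y, incl C y = x := ⟨⟨x.1, x, hx, rfl⟩, rfl⟩

theorem isInducing_incl (C : Set X) : Topology.IsInducing (incl C) :=
  (Topology.IsInducing.subtypeVal.of_comp_iff).mp Topology.IsInducing.subtypeVal

theorem incl_injective (C : Set X) : Function.Injective (incl C) := fun _ _ h =>
  Subtype.ext (congrArg (fun x : X => x.1) h)

/-- The quotient of forms that represents a function on the subset makes sense on all of `X` near
the point. -/
theorem regularAt_restrict_iff {C : Set X} {f : (Subtype.val '' C : Set (MultiProj k κ)) → k}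
    {y : (Subtype.val '' C : Set (MultiProj k κ))} : RegularAt _ f y ↔
      ∃ F : X → k, RegularAt X F (incl C y) ∧ ∀ᶠ z in 𝓝 y, f z = F (incl C z) := by
  constructor
  · rintro ⟨A, B, d, hA, hB, h0, h⟩
    refine ⟨fun x => evalAt A x.1 / evalAt B x.1, ⟨A, B, d, hA, hB, h0, ?_⟩, ?_⟩
    · filter_upwards [(isOpen_evalAt_ne_zero hB).mem_nhds h0] with x hx
      exact div_mul_cancel₀ _ hx
    · filter_upwards [h, (isOpen_evalAt_ne_zero hB).mem_nhds h0] with z hz hz'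
      exact (eq_div_iff hz').mpr hz
  · rintro ⟨F, ⟨A, B, d, hA, hB, h0, h⟩, hF⟩
    refine ⟨A, B, d, hA, hB, h0, ?_⟩
    filter_upwards [hF, (isInducing_incl C).continuous.continuousAt.eventually h] with z hz hz'
    rw [hz]
    exact hz'

theorem eval_aeval_X (p : Polynomial k) (b : Fin 1 → k) :
    eval b (Polynomial.aeval (MvPolynomial.X 0 : MvPolynomial (Fin 1) k) p) = p.eval (b 0) := by
  rw [Polynomial.aeval_def, Polynomial.eval₂_eq_sum_range, Polynomial.eval_eq_sum_range]
  simp [MvPolynomial.algebraMap_eq]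

variable {c : Chart X 2} {C : PrimeDivisor X} {i : Fin 2} {a : k}

/-- The chart induced on a coordinate line. -/
def IsLine.chart (h : IsLine c C i a) : Chart (Subtype.val '' C.pts) 1 where
  dom := incl C.pts ⁻¹' c.dom
  coord y _ := c.coord (incl C.pts y) (i + 1)
  h := Polynomial.aeval (MvPolynomial.X 0) (lineEval i a c.h)
  h_ne_zero := by
    obtain ⟨x, hx, hxC⟩ := h.1
    intro h0
    have h1 := eval_aeval_X (lineEval i a c.h) fun _ => c.coord x (i + 1)
    rw [h0, map_zero, eval_lineEval ((h.2 x hx).mp hxC)] at h1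
    exact c.eval_h hx h1.symm
  injOn := by
    intro y hy z hz hyz
    refine incl_injective _ (c.injOn hy hz (funext fun j => ?_))
    rcases Fin.eq_or_eq_add_one i j with rfl | rfl
    · rw [(h.2 _ hy).mp (incl_mem y), (h.2 _ hz).mp (incl_mem z)]
    · exact congrFun hyz 0
  image := by
    ext b
    constructor
    · rintro ⟨y, hy, rfl⟩
      rw [Set.mem_ofPred_eq, eval_aeval_X, eval_lineEval ((h.2 _ hy).mp (incl_mem y))]
      exact c.eval_h hy
    · intro hb
      rw [Set.mem_ofPred_eq, eval_aeval_X] at hb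
      let b' : Fin 2 → k := fun j => if j = i then a else b 0
      have h1 : b' i = a := if_pos rfl
      have h2 : b' (i + 1) = b 0 := if_neg (Fin.add_one_ne_two i)
      rw [← h2, eval_lineEval h1] at hb
      obtain ⟨x, hx, hxb⟩ := c.exists_point hb
      obtain ⟨y, rfl⟩ := exists_incl ((h.2 x hx).mpr (by rw [hxb, h1]))
      refine ⟨y, hx, funext fun j => ?_⟩
      rw [Subsingleton.elim j 0, ← h2, ← hxb]
  isOpen_ne g := by
    have := (c.isOpen_ne (rename (fun _ : Fin 1 => i + 1) g)).preimage (isInducing_incl C.pts).continuous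
    convert this using 1
    ext y
    simp only [Set.mem_ofPred_eq, Set.mem_preimage, eval_rename]
    rfl
  basis := by
    intro y hy V hV
    rw [(isInducing_incl C.pts).nhds_eq_comap, Filter.mem_comap] at hV
    obtain ⟨W, hW, hWV⟩ := hV
    obtain ⟨g, hg, hgW⟩ := c.basis _ hy W hW
    refine ⟨Polynomial.aeval (MvPolynomial.X 0) (lineEval i a g), ?_, fun z hz hgz => hWV ?_⟩
    · rw [eval_aeval_X, eval_lineEval ((h.2 _ hy).mp (incl_mem y))]
      exact hg
    · rw [eval_aeval_X, eval_lineEval ((h.2 _ hz).mp (incl_mem z))] at hgz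
      exact hgW _ hz hgz
  regular_iff := by
    intro y hy f
    rw [regularAt_restrict_iff]
    constructor
    · rintro ⟨F, hF, hfF⟩
      obtain ⟨A, B, hB, hAB⟩ := (c.regular_iff _ hy F).mp hF
      refine ⟨Polynomial.aeval (MvPolynomial.X 0) (lineEval i a A),
        Polynomial.aeval (MvPolynomial.X 0) (lineEval i a B), ?_, ?_⟩
      · rw [eval_aeval_X, eval_lineEval ((h.2 _ hy).mp (incl_mem y))]
        exact hB
      · have hcont := (isInducing_incl C.pts).continuous.continuousAt (x := y)
        filter_upwards [hfF, hcont.eventually hAB, hcont.eventually (c.dom_mem_nhds hy)]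
          with z hz hz' hzd
        rw [eval_aeval_X, eval_aeval_X, eval_lineEval ((h.2 _ hzd).mp (incl_mem z)),
          eval_lineEval ((h.2 _ hzd).mp (incl_mem z)), hz]
        exact hz'
    · rintro ⟨A, B, hB, hAB⟩
      have hev : ∀ (g : MvPolynomial (Fin 1) k) z, eval (fun _ => c.coord (incl C.pts z) (i + 1)) g =
          eval (c.coord (incl C.pts z)) (rename (fun _ : Fin 1 => i + 1) g) := fun g z => by
        rw [eval_rename]; rfl
      rw [hev] at hB
      refine ⟨fun x => eval (c.coord x) (rename (fun _ : Fin 1 => i + 1) A) /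
        eval (c.coord x) (rename (fun _ : Fin 1 => i + 1) B),
        (c.regularAt_eval hy _).div (c.regularAt_eval hy _) hB, ?_⟩
      have hcont := (isInducing_incl C.pts).continuous.continuousAt (x := y)
      filter_upwards [hAB, hcont.eventually ((c.regularAt_eval hy _).eventually_ne hB)] with z hz hz'
      rw [hev, hev] at hz
      exact (eq_div_iff hz').mpr hz

/-- Homogeneous coordinates on a subset of the projective line. -/
def lineRep {Y : Set (MultiProj k (fun _ : Unit => Fin 2))} (y : Y) : Fin 2 → k := (y.1 ()).rep

theorem isOpen_lineRep {Y : Set (MultiProj k (fun _ : Unit => Fin 2))} (n : Fin 2 → k) :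
    IsOpen {y : Y | n ⬝ᵥ lineRep y ≠ 0} :=
  isOpen_dotProduct_ne_zero (κ := fun _ : Unit => Fin 2) () n

theorem regularAt_lineRep {Y : Set (MultiProj k (fun _ : Unit => Fin 2))} (m n : Fin 2 → k)
    {x : Y} (hx : n ⬝ᵥ lineRep x ≠ 0) :
    RegularAt Y (fun y => m ⬝ᵥ lineRep y / n ⬝ᵥ lineRep y) x :=
  RegularAt.linear_div (κ := fun _ : Unit => Fin 2) () m n hx

/-- The chart of the projective line given by the quotient of two linear forms. -/
def projLineChart [Infinite k] (m n : Fin 2 → k) (hmn : m 0 * n 1 - m 1 * n 0 ≠ 0)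
    (p : Polynomial k) (hp : p ≠ 0) :
    Chart (closure (Set.univ : Set (MultiProj k (fun _ : Unit => Fin 2)))) 1 :=
  Chart.ofClosure Set.univ
    {x | n ⬝ᵥ lineRep x ≠ 0 ∧ p.eval (m ⬝ᵥ lineRep x / n ⬝ᵥ lineRep x) ≠ 0}
    (by
      refine isOpen_iff_mem_nhds.mpr fun x hx => ?_
      have h1 := RegularAt.eval (c := fun y (_ : Fin 1) => m ⬝ᵥ lineRep y / n ⬝ᵥ lineRep y)
        (fun _ => regularAt_lineRep m n hx.1) (Polynomial.aeval (MvPolynomial.X 0 : MvPolynomial (Fin 1) k) p)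
      simp only [eval_aeval_X] at h1
      filter_upwards [(isOpen_lineRep n).mem_nhds hx.1, h1.eventually_ne hx.2]
        with y hy hy'
      exact ⟨hy, hy'⟩)
    (fun x (_ : Fin 1) => m ⬝ᵥ lineRep x / n ⬝ᵥ lineRep x) (fun x hx _ => regularAt_lineRep m n hx.1)
    (Polynomial.aeval (MvPolynomial.X 0) p)
    (by
      intro h
      refine hp (Polynomial.funext fun s => ?_)
      rw [← eval_aeval_X p fun _ => s, h]; simp)
    -- This inverts the fractional linear map: at these coordinates `n` takes the constant value `m
    -- 0 * n 1 - m 1 * n 0` and `m` takes the parameter times it.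
    (fun s => ![MvPolynomial.C (n 1) * MvPolynomial.X 0 - MvPolynomial.C (m 1),
      MvPolynomial.C (m 0) - MvPolynomial.C (n 0) * MvPolynomial.X 0] s.2)
    (by
      intro a _ _
      by_contra! h
      have h0 := h 0
      have h1 := h 1
      simp at h0 h1
      exact hmn (by linear_combination n 0 * h0 + n 1 * h1))
    (by
      intro x hx
      rw [eval_aeval_X]
      exact hx.2)
    (by
      intro x hx _ _ j j'
      obtain ⟨t, ht⟩ : ∃ t, t = m ⬝ᵥ lineRep x / n ⬝ᵥ lineRep x := ⟨_, rfl⟩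
      have ht' := (eq_div_iff hx.1).mp ht
      simp only [dotProduct, Fin.sum_univ_two] at ht'
      change lineRep x j * eval (fun _ => m ⬝ᵥ lineRep x / n ⬝ᵥ lineRep x) _ =
        lineRep x j' * eval (fun _ => m ⬝ᵥ lineRep x / n ⬝ᵥ lineRep x) _
      rw [← ht]
      fin_cases j <;> fin_cases j' <;> simp
      · linear_combination -ht'
      · linear_combination ht')
    1 one_ne_zero (fun _ _ _ _ _ => trivial)
    (by
      intro x a ha hrep
      obtain ⟨c, hc, hcr⟩ := hrep ()
      have h0 : _ = c * lineRep x 0 := hcr 0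
      have h1 : _ = c * lineRep x 1 := hcr 1
      simp at h0 h1
      have hn : c * (n ⬝ᵥ lineRep x) = m 0 * n 1 - m 1 * n 0 := by
        simp only [dotProduct, Fin.sum_univ_two]
        linear_combination -n 0 * h0 - n 1 * h1
      have hm : c * (m ⬝ᵥ lineRep x) = a 0 * (m 0 * n 1 - m 1 * n 0) := by
        simp only [dotProduct, Fin.sum_univ_two]
        linear_combination -m 0 * h0 - m 1 * h1
      have hn0 : n ⬝ᵥ lineRep x ≠ 0 := by
        intro h; rw [h, mul_zero] at hn; exact hmn hn.symm
      have ha' : m ⬝ᵥ lineRep x / n ⬝ᵥ lineRep x = a 0 := by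
        rw [div_eq_iff hn0]
        refine mul_left_cancel₀ hc ?_
        rw [hm, ← hn]; ring
      refine ⟨⟨hn0, ?_⟩, funext fun j => ?_⟩
      · rw [ha', ← eval_aeval_X p a]; exact ha
      · rw [Subsingleton.elim j 0]; exact ha')

theorem exists_projLine_chart [Infinite k] (m n : Fin 2 → k) (hmn : m 0 * n 1 - m 1 * n 0 ≠ 0)
    (p : Polynomial k) (hp : p ≠ 0) : ∃ c : Chart (projLine k) 1,
      c.h = Polynomial.aeval (MvPolynomial.X 0) p ∧
      (∀ x : projLine k, x ∈ c.dom ↔ n ⬝ᵥ lineRep x ≠ 0 ∧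
        p.eval (m ⬝ᵥ lineRep x / n ⬝ᵥ lineRep x) ≠ 0) ∧
      ∀ x, c.coord x = fun _ => m ⬝ᵥ lineRep x / n ⬝ᵥ lineRep x := by
  -- The charts are built on a closure; the whole line is the closure of itself, and quantifying
  -- over `Y` allows the substitution.
  have key : ∀ Y : Set (MultiProj k (fun _ : Unit => Fin 2)), Y = closure Set.univ →
      ∃ c : Chart Y 1, c.h = Polynomial.aeval (MvPolynomial.X 0) p ∧
      (∀ x : Y, x ∈ c.dom ↔ n ⬝ᵥ lineRep x ≠ 0 ∧
        p.eval (m ⬝ᵥ lineRep x / n ⬝ᵥ lineRep x) ≠ 0) ∧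
      ∀ x, c.coord x = fun _ => m ⬝ᵥ lineRep x / n ⬝ᵥ lineRep x := by
    rintro Y rfl
    exact ⟨projLineChart m n hmn p hp, rfl, fun x => Iff.rfl, fun x => rfl⟩
  exact key _ closure_univ.symm

/-- A curve which is a coordinate line in charts compatible with homogeneous coordinates `v` is
isomorphic to the projective line. -/
theorem nonempty_varIso_projLine [Infinite k] {I : Type*} (c : I → Chart X 2)
    (h : ∀ j, IsLine (c j) C i a)
    (v : X → Fin 2 → k) (hv : ∀ x ∈ C.pts, v x ≠ 0) (m n : I → Fin 2 → k)
    (hmn : ∀ j, m j 0 * n j 1 - m j 1 * n j 0 ≠ 0)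
    (hdom : ∀ j, ∀ x ∈ C.pts, x ∈ (c j).dom ↔ n j ⬝ᵥ v x ≠ 0 ∧
      (lineEval i a (c j).h).eval (m j ⬝ᵥ v x / n j ⬝ᵥ v x) ≠ 0)
    (hcoord : ∀ j, ∀ x ∈ C.pts, x ∈ (c j).dom →
      (c j).coord x (i + 1) = m j ⬝ᵥ v x / n j ⬝ᵥ v x)
    (hcover : ∀ w : Fin 2 → k, w ≠ 0 → ∃ j, n j ⬝ᵥ w ≠ 0 ∧
      (lineEval i a (c j).h).eval (m j ⬝ᵥ w / n j ⬝ᵥ w) ≠ 0) :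
    Nonempty (VarIso (Subtype.val '' C.pts) (projLine k)) := by
  have hp : ∀ j, lineEval i a (c j).h ≠ 0 := fun j => by
    rw [Ne, ← lineEqn_dvd_iff]; exact (h j).not_dvd
  choose d hdh hddom hdcoord using fun j => exists_projLine_chart (m j) (n j) (hmn j) _ (hp j)
  let e : (Subtype.val '' C.pts : Set (MultiProj k κ)) → projLine k := fun y =>
    ⟨fun _ => Projectivization.mk k (v (incl C.pts y)) (hv _ (incl_mem y)), trivial⟩
  have hrep : ∀ y, ∃ u : k, u ≠ 0 ∧ lineRep (e y) = u • v (incl C.pts y) := fun y => by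
    obtain ⟨u, hu⟩ := Projectivization.exists_smul_eq_mk_rep k (v (incl C.pts y)) (hv _ (incl_mem y))
    exact ⟨u, u.ne_zero, hu.symm⟩
  have hquot : ∀ j y, m j ⬝ᵥ lineRep (e y) / n j ⬝ᵥ lineRep (e y) =
      m j ⬝ᵥ v (incl C.pts y) / n j ⬝ᵥ v (incl C.pts y) := fun j y => by
    obtain ⟨u, hu, hu'⟩ := hrep y
    rw [hu', dotProduct_smul, dotProduct_smul, smul_eq_mul, smul_eq_mul, mul_div_mul_left _ _ hu]
  obtain ⟨E, -⟩ := VarIso.ofCharts e (fun j => (h j).chart) d (fun j y => by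
      rw [hddom, hquot]
      obtain ⟨u, hu, hu'⟩ := hrep y
      rw [hu', dotProduct_smul, smul_eq_mul, mul_ne_zero_iff, and_iff_right hu]
      exact hdom j _ (incl_mem y)) (fun j y hy => by
      rw [hdcoord, hquot]
      exact funext fun _ => hcoord j _ (incl_mem y) hy) (fun j => (hdh j).symm) (fun z => by
      obtain ⟨j, hj⟩ := hcover (lineRep z) (Projectivization.rep_nonzero _)
      exact ⟨j, (hddom j z).mpr hj⟩)
  exact ⟨E⟩

end Restriction

end

end ProjGeom

namespace ProjGeom

noncomputable section

universe u

/-! ### Counting zeros on a projective line -/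

section RootMultiplicity

open Polynomial

variable {k : Type*} [Field k]

theorem eq_of_eval_eq_off_finite [Infinite k] {p q : k[X]} (s : Finset k)
    (h : ∀ t ∉ s, p.eval t = q.eval t) : p = q :=
  Polynomial.eq_of_infinite_eval_eq p q ((Finset.finite_toSet s).infinite_compl.mono fun t ht =>
    h t (by simpa using ht))

theorem rootMultiplicity_eq_of_eq {p q : k[X]} {a : k} {n : ℕ} (h : p = (X - C a) ^ n * q)
    (hq : q.eval a ≠ 0) : p.rootMultiplicity a = n := by
  have hq0 : q ≠ 0 := by rintro rfl; simp at hq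
  rw [h, mul_comm, rootMultiplicity_mul_X_sub_C_pow hq0,
    rootMultiplicity_eq_zero (by simpa using hq), zero_add]

/-- Here `p` and `q` express the same section in the coordinates `t` and `1 / t`. Zeros of `q` at
the origin are zeros at infinity, so the total number of zeros is `n`. -/
theorem natDegree_add_rootMultiplicity [Infinite k] {p q : k[X]} (hp : p ≠ 0) (hq : q ≠ 0)
    {c : k} (hc : c ≠ 0) {n : ℕ} (h : ∀ t, t ≠ 0 → 1 + t ≠ 0 → p.eval t = c * t ^ n * q.eval t⁻¹) :
    p.natDegree + q.rootMultiplicity 0 = n := by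
  classical
  -- Clearing denominators with the reversed polynomial gives an identity off two points, hence
  -- everywhere; the multiplicity of `q` at zero is then read off from degrees.
  have key : X ^ q.natDegree * p = C c * (X ^ n * q.reverse) := by
    refine eq_of_eval_eq_off_finite {0, -1} fun t ht' => ?_
    simp only [Finset.mem_insert, Finset.mem_singleton, not_or] at ht'
    obtain ⟨ht, ht1⟩ := ht'
    have ht1 : 1 + t ≠ 0 := fun h0 => ht1 (by linear_combination h0)
    have : Invertible t⁻¹ := invertibleOfNonzero (inv_ne_zero ht)
    have h1 := eval₂_reverse_mul_pow (RingHom.id k) t⁻¹ q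
    rw [invOf_eq_inv, inv_inv] at h1
    change q.reverse.eval t * _ = q.eval t⁻¹ at h1
    simp only [eval_mul, eval_pow, eval_X, eval_C]
    rw [h t ht ht1, ← h1]
    have h2 : t ^ q.natDegree * t⁻¹ ^ q.natDegree = 1 := by
      rw [← mul_pow, mul_inv_cancel₀ ht, one_pow]
    linear_combination c * t ^ n * eval t q.reverse * h2
  have hr : q.reverse ≠ 0 := by simpa using hq
  have h1 := congrArg natDegree key
  rw [natDegree_mul (pow_ne_zero _ X_ne_zero) hp, natDegree_C_mul hc,
    natDegree_mul (pow_ne_zero _ X_ne_zero) hr, natDegree_X_pow, natDegree_X_pow,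
    reverse_natDegree] at h1
  rw [rootMultiplicity_eq_natTrailingDegree']
  have := q.natTrailingDegree_le_natDegree
  omega

/-- The substitution `t ↦ -(1 + t)` takes `-1` to `0`, and `-t` is a unit there. Compare the
multiplicities of the root `-1` on both sides. -/
theorem rootMultiplicity_reflect [Infinite k] {p q : k[X]} (hp : p ≠ 0) (hq : q ≠ 0) {n : ℕ}
    (h : ∀ t, t ≠ 0 → 1 + t ≠ 0 → (1 + t) ^ n * p.eval t = (-t) ^ n * q.eval (-(1 + t))) :
    n + p.rootMultiplicity (-1) = q.rootMultiplicity 0 := by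
  classical
  obtain ⟨p', hp', hpd⟩ := exists_eq_pow_rootMultiplicity_mul_and_not_dvd p hp (-1)
  obtain ⟨q', hq', hqd⟩ := exists_eq_pow_rootMultiplicity_mul_and_not_dvd q hq 0
  rw [dvd_iff_isRoot, IsRoot] at hpd hqd
  have hid : (X - C (-1)) ^ (n + p.rootMultiplicity (-1)) * p' =
      (X - C (-1)) ^ q.rootMultiplicity 0 *
        ((-X) ^ n * ((-1) ^ q.rootMultiplicity 0 * q'.comp (-(1 + X)))) := by
    refine eq_of_eval_eq_off_finite {0, -1} fun t ht => ?_
    simp only [Finset.mem_insert, Finset.mem_singleton, not_or] at ht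
    have ht1 : 1 + t ≠ 0 := fun h0 => ht.2 (by linear_combination h0)
    have h1 := h t ht.1 ht1
    conv at h1 => lhs; rw [hp']
    conv at h1 => rhs; rw [hq']
    simp only [eval_mul, eval_pow, eval_sub, eval_X, eval_C, eval_neg, eval_comp, eval_add,
      eval_one, sub_neg_eq_add, sub_zero] at h1 ⊢
    rw [neg_pow (1 + t)] at h1
    rw [pow_add, add_comm t 1]
    linear_combination h1
  have h1 := rootMultiplicity_eq_of_eq rfl hpd (n := n + p.rootMultiplicity (-1))
  rw [hid] at h1
  rw [← h1]
  refine (rootMultiplicity_eq_of_eq rfl ?_)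
  have h2 : eval 0 q' ≠ 0 := hqd
  simp [h2]

theorem finsum_ne_add {α : Type*} {f : α → ℤ} (hf : (Function.support f).Finite) (a : α) :
    (∑ᶠ t ∈ {t | t ≠ a}, f t) + f a = ∑ᶠ t, f t := by
  have h : {t | t ≠ a} ∪ {a} = Set.univ := by
    ext t; simpa using em (t = a)
  have h1 := finsum_mem_union' (f := f) (s := {t | t ≠ a}) (t := {a}) (by simp)
    (hf.subset Set.inter_subset_right) (hf.subset Set.inter_subset_right)
  rw [h, finsum_mem_univ, finsum_mem_singleton] at h1
  exact h1.symm

theorem finite_support_rootMultiplicity (p : k[X]) :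
    (Function.support fun t => (p.rootMultiplicity t : ℤ)).Finite := by
  classical
  refine p.roots.toFinset.finite_toSet.subset fun t ht => ?_
  rw [Function.mem_support, Nat.cast_ne_zero, ← count_roots, ← Nat.pos_iff_ne_zero,
    Multiset.count_pos] at ht
  simpa using ht

theorem finsum_rootMultiplicity [IsAlgClosed k] {p : k[X]} :
    ∑ᶠ t, (p.rootMultiplicity t : ℤ) = p.natDegree := by
  classical
  rw [finsum_eq_sum_of_support_subset (s := p.roots.toFinset)]
  · simp_rw [← count_roots]
    rw [← Nat.cast_sum, Multiset.toFinset_sum_count_eq]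
    exact congrArg Nat.cast (IsAlgClosed.splits p).natDegree_eq_card_roots.symm
  · intro t ht
    rw [Function.mem_support, Nat.cast_ne_zero, ← count_roots, ← Nat.pos_iff_ne_zero,
      Multiset.count_pos] at ht
    simpa using ht

end RootMultiplicity

open MvPolynomial

variable {k : Type u} [Field k] {ι : Type} {κ : ι → Type} {X : Set (MultiProj k κ)}

/-- The numerator times `q` is a polynomial vanishing near `x`, hence zero. This allows division by
the local equation of a curve even at points of the curve. -/
theorem Chart.eq_zero_of_mul_eventually [Infinite k] {n : ℕ} (c : Chart X n) {x : X} (hx : x ∈ c.dom)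
    {f : X → k} (hf : RegularAt X f x) {q : MvPolynomial (Fin n) k} (hq : q ≠ 0)
    (h : ∀ᶠ z in 𝓝 x, f z * eval (c.coord z) q = 0) : f x = 0 := by
  obtain ⟨A, B, hB, hAB⟩ := (c.regular_iff x hx f).mp hf
  have hA : A * q = 0 := c.eq_zero_of_eventually hx (by
    filter_upwards [h, hAB] with z hz hz'
    rw [map_mul, ← hz', mul_right_comm, hz, zero_mul])
  have hA0 := (mul_eq_zero.mp hA).resolve_right hq
  have := hAB.self_of_nhds
  rw [hA0, map_zero] at this
  exact (mul_eq_zero.mp this).resolve_right hB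

/-- The intersection number of `C` with the part of `D` not supported on `C`. -/
def properInt (C : PrimeDivisor X) (D : Divisor X) : ℤ :=
  (D.erase C).sum fun Z m => m * intersectionNumber Z C

namespace LinesAtlas

variable [IsAlgClosed k] [IrreducibleSpace X]
variable {𝒜 : LinesAtlas X} {A B B' : MvPolynomial (Fin 4) k} {d : ℕ}
  {C : PrimeDivisor X} {e : Fin 2} {a : k} {π π' : Equiv.Perm (Fin 4)}

/-- Removing the full power of the equation of `C` leaves a polynomial that can be restricted to
`C`; its zeros there are the intersections of `C` with the other components. -/
theorem exists_restr (hA : 𝒜.IsNonzeroForm A d) (h : IsLine (𝒜.chart π) C e a) :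
    ∃ B, localForm π A = lineEqn e a ^ 𝒜.ord A C * B ∧ lineEval e a B ≠ 0 := by
  rw [ord_eq_multiplicity hA h.1, h.multiplicity_eqn]
  obtain ⟨B, hB, hB'⟩ := (FiniteMultiplicity.of_prime_left (lineEqn_prime e a)
    (hA.localForm_ne_zero π)).exists_eq_pow_mul_and_not_dvd
  exact ⟨B, hB, by rwa [Ne, ← lineEqn_dvd_iff]⟩

theorem sum_localInt_erase (hA : 𝒜.IsNonzeroForm A d) (h : IsLine (𝒜.chart π) C e a)
    {B : MvPolynomial (Fin 2) k} (hB : localForm π A = lineEqn e a ^ 𝒜.ord A C * B)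
    (hB0 : lineEval e a B ≠ 0) {x : X} (hx : x ∈ (𝒜.chart π).dom) (hxC : x ∈ C.pts) :
    (((div hA).erase C).sum fun Z m => m * (localInt x Z C : ℤ)) =
      (lineEval e a B).rootMultiplicity ((𝒜.chart π).coord x (e + 1)) := by
  classical
  refine h.sum_localInt hx hxC B hB0 _ fun Z hxZ => ?_
  have hm : ((𝒜.chart π).dom ∩ Z.pts).Nonempty := ⟨x, hx, hxZ⟩
  rw [Finsupp.erase_apply]
  split_ifs with hZC
  · subst hZC
    rw [h.multiplicity_eq_zero hB0]; rfl
  · have hB1 : B ≠ 0 := by rintro rfl; simp at hB0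
    rw [div_apply, ord_eq_multiplicity hA hm, hB,
      (𝒜.chart π).multiplicity_mul hm (pow_ne_zero _ (lineEqn_ne_zero e a)) hB1]
    have : multiplicity ((𝒜.chart π).eqn Z) (lineEqn e a ^ 𝒜.ord A C) = 0 := by
      rw [multiplicity_eq_zero]
      intro hd
      have hd' := ((𝒜.chart π).eqn_spec hm).1.dvd_of_dvd_pow hd
      exact hZC ((𝒜.chart π).eq_of_dvd hm h.1
        (hd'.trans ((𝒜.chart π).eqn_associated h.1 h.ideal_eq).symm.dvd))
    rw [this, zero_add]

/-- The local expressions of a form on a curve in two charts. -/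
theorem eval_transition (hA : 𝒜.IsNonzeroForm A d) {B B' : MvPolynomial (Fin 2) k}
    (hB : localForm π A = lineEqn e a ^ 𝒜.ord A C * B)
    (hB' : localForm π' A = lineEqn e a ^ 𝒜.ord A C * B') (N D : MvPolynomial (Fin 2) k)
    (hND : ∀ z ∈ (𝒜.chart π).dom, z ∈ (𝒜.chart π').dom →
      ((𝒜.chart π').coord z e - a) * eval ((𝒜.chart π).coord z) D =
        eval ((𝒜.chart π).coord z) N * ((𝒜.chart π).coord z e - a)) {y : X}
    (hy : y ∈ (𝒜.chart π).dom) (hy' : y ∈ (𝒜.chart π').dom)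
    (hD : eval ((𝒜.chart π).coord y) D ≠ 0) :
    eval ((𝒜.chart π).coord y) B = eval ((𝒜.chart π).coord y) (lamPoly k π (π' 2)) ^ d *
      (eval ((𝒜.chart π).coord y) N / eval ((𝒜.chart π).coord y) D) ^ 𝒜.ord A C *
        eval ((𝒜.chart π').coord y) B' := by
  have hreg := fun p => (𝒜.chart π).regularAt_eval hy p
  have hq : lineEqn e a ^ 𝒜.ord A C ≠ 0 := pow_ne_zero _ (lineEqn_ne_zero e a)
  have hf := ((𝒜.chart π).regularAt_eval hy B).sub ((((hreg (lamPoly k π (π' 2))).pow d).mul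
    (((hreg N).div (hreg D) hD).pow (𝒜.ord A C))).mul ((𝒜.chart π').regularAt_eval hy' B'))
  -- Multiplied by the power of the local equation of `C`, the identity compares two expressions of
  -- the same form. Here `N / D` is the ratio of the local equations of `C` in the two charts, that
  -- is, the transition function of its normal bundle.
  refine sub_eq_zero.mp ((𝒜.chart π).eq_zero_of_mul_eventually hy hf hq ?_)
  filter_upwards [(𝒜.chart π).dom_mem_nhds hy, (𝒜.chart π').dom_mem_nhds hy',
    (hreg D).eventually_ne hD] with z hz hz' hzD
  have h1 := eval_lam hz hA.homogeneous
  rw [eval_lam hz' hA.homogeneous, lam_eq hz (π' 2), mul_pow, mul_assoc] at h1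
  have h2 := mul_left_cancel₀ (pow_ne_zero d ((𝒜.mem_dom π z).mp hz).1) h1
  rw [hB, hB', map_mul, map_mul, map_pow, map_pow, eval_lineEqn, eval_lineEqn] at h2
  have h3 : (𝒜.chart π').coord z e - a = eval ((𝒜.chart π).coord z) N /
      eval ((𝒜.chart π).coord z) D * ((𝒜.chart π).coord z e - a) := by
    rw [div_mul_eq_mul_div, eq_div_iff hzD, hND z hz hz']
  rw [h3, mul_pow] at h2
  simp only [Pi.sub_apply, Pi.mul_apply, map_pow, eval_lineEqn]
  linear_combination -h2

section Total

variable {I : Type*} [Finite I] {ρ : I → Equiv.Perm (Fin 4)}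

theorem finite_support_localInt (h : ∀ i, IsLine (𝒜.chart (ρ i)) C e a)
    (hcover : ∀ x ∈ C.pts, ∃ i, x ∈ (𝒜.chart (ρ i)).dom) {Z : PrimeDivisor X} (hZ : Z ≠ C) :
    {x | localInt x Z C ≠ 0}.Finite := by
  refine (Set.finite_iUnion fun i => (h i).finite_localInt hZ).subset fun x hx => ?_
  have hxC' : x ∈ C.pts := by_contra fun h' => hx (localInt_eq_zero_right Z h')
  obtain ⟨i, hi⟩ := hcover x hxC'
  exact Set.mem_iUnion.mpr ⟨i, hi, hx⟩

theorem properInt_eq_finsum (h : ∀ i, IsLine (𝒜.chart (ρ i)) C e a)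
    (hcover : ∀ x ∈ C.pts, ∃ i, x ∈ (𝒜.chart (ρ i)).dom) (D : Divisor X) :
    properInt C D = ∑ᶠ x, (D.erase C).sum fun Z m => m * (localInt x Z C : ℤ) := by
  classical
  rw [properInt, Finsupp.sum]
  simp only [Finsupp.sum]
  rw [finsum_sum_comm]
  · exact Finset.sum_congr rfl fun Z _ => by rw [intersectionNumber_eq, mul_finsum]
  · intro Z hZ
    have hZC : Z ≠ C := by rintro rfl; simp at hZ
    refine (finite_support_localInt h hcover hZC).subset fun x hx => ?_
    intro h0
    exact hx (by simp [h0])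

theorem finite_support_sum (h : ∀ i, IsLine (𝒜.chart (ρ i)) C e a)
    (hcover : ∀ x ∈ C.pts, ∃ i, x ∈ (𝒜.chart (ρ i)).dom) (D : Divisor X) :
    (Function.support fun x => (D.erase C).sum fun Z m => m * (localInt x Z C : ℤ)).Finite := by
  classical
  refine ((D.erase C).support.finite_toSet.biUnion (t := fun Z => {x | Z ≠ C ∧ localInt x Z C ≠ 0})
    fun Z _ => ?_).subset fun x hx => ?_
  · by_cases hZ : Z = C
    · simp [hZ]
    · exact (finite_support_localInt h hcover hZ).subset fun x hx => hx.2
  · by_contra hcon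
    refine hx (Finset.sum_eq_zero fun Z hZ => ?_)
    have hZC : Z ≠ C := by rintro rfl; simp at hZ
    have : localInt x Z C = 0 := by
      by_contra h0
      exact hcon (Set.mem_biUnion (Finset.mem_coe.mpr hZ) ⟨hZC, h0⟩)
    simp [this]

/-- The intersection number as a sum over one chart and the remaining points. -/
theorem properInt_div_eq (hA : 𝒜.IsNonzeroForm A d) (h : ∀ i, IsLine (𝒜.chart (ρ i)) C e a)
    (hcover : ∀ x ∈ C.pts, ∃ i, x ∈ (𝒜.chart (ρ i)).dom) (i : I)
    {B : MvPolynomial (Fin 2) k} (hB : localForm (ρ i) A = lineEqn e a ^ 𝒜.ord A C * B)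
    (hB0 : lineEval e a B ≠ 0) :
    properInt C (div hA) =
      (∑ᶠ t ∈ {t | (lineEval e a (𝒜.chart (ρ i)).h).eval t ≠ 0},
        ((lineEval e a B).rootMultiplicity t : ℤ)) +
      ∑ᶠ x ∈ C.pts \ (𝒜.chart (ρ i)).dom,
        ((div hA).erase C).sum fun Z m => m * (localInt x Z C : ℤ) := by
  have hfin := finite_support_sum h hcover (div hA)
  have h1 : (∑ᶠ t ∈ {t | (lineEval e a (𝒜.chart (ρ i)).h).eval t ≠ 0},
      ((lineEval e a B).rootMultiplicity t : ℤ)) =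
      ∑ᶠ x ∈ C.pts ∩ (𝒜.chart (ρ i)).dom,
        ((div hA).erase C).sum fun Z m => m * (localInt x Z C : ℤ) := by
    symm
    refine finsum_mem_eq_of_bijOn (fun x => (𝒜.chart (ρ i)).coord x (e + 1)) ⟨?_, ?_, ?_⟩ ?_
    · rintro x ⟨hxC, hx⟩
      rw [Set.mem_ofPred_eq, eval_lineEval (((h i).2 x hx).mp hxC)]
      exact (𝒜.chart (ρ i)).eval_h hx
    · rintro x ⟨hxC, hx⟩ y ⟨hyC, hy⟩ hxy
      refine (𝒜.chart (ρ i)).injOn hx hy (funext fun j => ?_)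
      rcases Fin.eq_or_eq_add_one e j with rfl | rfl
      · rw [((h i).2 x hx).mp hxC, ((h i).2 y hy).mp hyC]
      · exact hxy
    · intro t ht
      let b : Fin 2 → k := fun j => if j = e then a else t
      have hb1 : b e = a := if_pos rfl
      have hb2 : b (e + 1) = t := if_neg (Fin.add_one_ne_two e)
      rw [Set.mem_ofPred_eq, ← hb2, eval_lineEval hb1] at ht
      obtain ⟨x, hx, hxb⟩ := (𝒜.chart (ρ i)).exists_point ht
      refine ⟨x, ⟨((h i).2 x hx).mpr (by rw [hxb, hb1]), hx⟩, ?_⟩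
      change (𝒜.chart (ρ i)).coord x (e + 1) = t
      rw [hxb, hb2]
    · rintro x ⟨hxC, hx⟩
      exact sum_localInt_erase hA (h i) hB hB0 hx hxC
  rw [properInt_eq_finsum h hcover, h1, ← finsum_mem_union' (Set.disjoint_left.mpr fun x hx hx' => hx'.2 hx.2)
    (hfin.subset Set.inter_subset_right) (hfin.subset Set.inter_subset_right), Set.inter_union_sdiff]
  rw [← finsum_mem_inter_support, Set.inter_eq_right.mpr, finsum_mem_support]
  intro x hx
  by_contra hxC
  refine hx (Finset.sum_eq_zero fun Z _ => ?_)
  simp [localInt_eq_zero_right Z hxC]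

end Total

end LinesAtlas

end

end ProjGeom

/-! ### The thirteen curves as coordinate lines -/

namespace ProjGeom

noncomputable section

universe u

open MvPolynomial

section Perm

variable (π : Equiv.Perm (Fin 4))

/-- Exchange of the first two indices. -/
def swapFirst : Equiv.Perm (Fin 4) := π * Equiv.swap 0 1

/-- Exchange of the two middle indices. -/
def swapMiddle : Equiv.Perm (Fin 4) := π * Equiv.swap 1 2

/-- Exchange of the second and the last index. -/
def swapOuter : Equiv.Perm (Fin 4) := π * Equiv.swap 1 3

/-- Exchange of the first two indices with the last two. -/
def swapPairs : Equiv.Perm (Fin 4) := π * (Equiv.swap 0 2 * Equiv.swap 1 3)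

@[simp] theorem swapFirst_zero : swapFirst π 0 = π 1 := rfl
@[simp] theorem swapFirst_one : swapFirst π 1 = π 0 := rfl
@[simp] theorem swapFirst_two : swapFirst π 2 = π 2 := rfl
@[simp] theorem swapFirst_three : swapFirst π 3 = π 3 := rfl
@[simp] theorem swapMiddle_zero : swapMiddle π 0 = π 0 := rfl
@[simp] theorem swapMiddle_one : swapMiddle π 1 = π 2 := rfl
@[simp] theorem swapMiddle_two : swapMiddle π 2 = π 1 := rfl
@[simp] theorem swapMiddle_three : swapMiddle π 3 = π 3 := rfl
@[simp] theorem swapOuter_zero : swapOuter π 0 = π 0 := rfl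
@[simp] theorem swapOuter_one : swapOuter π 1 = π 3 := rfl
@[simp] theorem swapOuter_two : swapOuter π 2 = π 2 := rfl
@[simp] theorem swapOuter_three : swapOuter π 3 = π 1 := rfl
@[simp] theorem swapPairs_zero : swapPairs π 0 = π 2 := rfl
@[simp] theorem swapPairs_one : swapPairs π 1 = π 3 := rfl
@[simp] theorem swapPairs_two : swapPairs π 2 = π 0 := rfl
@[simp] theorem swapPairs_three : swapPairs π 3 = π 1 := rfl

end Perm

variable {k : Type u} [Field k] {ι : Type} {κ : ι → Type} {X : Set (MultiProj k κ)}

namespace LinesAtlas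

section Sets

variable (𝒜 : LinesAtlas X) (π : Equiv.Perm (Fin 4))

/-- The exceptional curve over the intersection point of two of the lines. -/
def gSet : Set X := {x | 𝒜.lam x (π 0) = 0 ∧ 𝒜.lam x (π 1) = 0}

/-- The proper transform of one of the lines. -/
def lSet : Set X := {x | 𝒜.lam x (π 0) = 0 ∧ 𝒜.ab x (π 0) (π 1) = 0 ∧ 𝒜.ab x (π 0) (π 2) = 0 ∧
  𝒜.ab x (π 0) (π 3) = 0}

/-- The proper transform of the line through two opposite intersection points. -/
def mSet : Set X := {x | 𝒜.lam x (π 0) + 𝒜.lam x (π 1) = 0 ∧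
  𝒜.ab x (π 0) (π 1) + 𝒜.ab x (π 1) (π 0) = 0 ∧ 𝒜.ab x (π 2) (π 3) + 𝒜.ab x (π 3) (π 2) = 0}

variable {𝒜 π}

theorem isClosed_lam (m : Fin 4 → k) : IsClosed {x | m ⬝ᵥ 𝒜.lam x = 0} := by
  have := (𝒜.isOpen_lam m).isClosed_compl
  convert this using 1
  ext x; simp

theorem isClosed_lam_eq (i : Fin 4) : IsClosed {x | 𝒜.lam x i = 0} := by
  have := 𝒜.isClosed_lam (Pi.single i 1)
  simpa using this

theorem isClosed_ab {i j : Fin 4} (hij : i ≠ j) (u v : k) :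
    IsClosed {x | u * 𝒜.ab x i j + v * 𝒜.ab x j i = 0} := by
  have := (𝒜.isOpen_ab i j u v hij).isClosed_compl
  convert this using 1
  ext x; simp

theorem isClosed_gSet : IsClosed (𝒜.gSet π) :=
  (isClosed_lam_eq (π 0)).inter (isClosed_lam_eq (π 1))

theorem isClosed_lSet : IsClosed (𝒜.lSet π) := by
  have h : ∀ {i j : Fin 4}, i ≠ j → IsClosed {x | 𝒜.ab x i j = 0} := fun hij => by
    simpa using 𝒜.isClosed_ab hij 1 0
  exact (isClosed_lam_eq (π 0)).inter ((h (by simp)).inter ((h (by simp)).inter (h (by simp))))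

theorem isClosed_mSet : IsClosed (𝒜.mSet π) := by
  have h : ∀ {i j : Fin 4}, i ≠ j → IsClosed {x | 𝒜.ab x i j + 𝒜.ab x j i = 0} := fun hij => by
    simpa using 𝒜.isClosed_ab hij 1 1
  have h' : IsClosed {x | 𝒜.lam x (π 0) + 𝒜.lam x (π 1) = 0} := by
    convert 𝒜.isClosed_lam (Pi.single (π 0) 1 + Pi.single (π 1) 1) using 1
    ext x
    rw [Set.mem_ofPred_eq, Set.mem_ofPred_eq, add_dotProduct, single_dotProduct, single_dotProduct,
      one_mul, one_mul]
  exact h'.inter ((h (by simp)).inter (h (by simp)))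

/-- The four forms have sum zero, so `lam (π 0) + lam (π 1)` and `lam (π 2) + lam (π 3)` vanish
together. -/
theorem mSet_swapPairs : 𝒜.mSet (swapPairs π) = 𝒜.mSet π := by
  ext x
  have hs := 𝒜.lam_sum_perm π x
  simp only [mSet, swapPairs_zero, swapPairs_one, swapPairs_two, swapPairs_three, Set.mem_ofPred_eq]
  constructor
  · rintro ⟨h1, h2, h3⟩
    exact ⟨by linear_combination hs - h1, h3, h2⟩
  · rintro ⟨h1, h2, h3⟩
    exact ⟨by linear_combination hs - h1, h3, h2⟩

theorem gSet_swapFirst : 𝒜.gSet (swapFirst π) = 𝒜.gSet π := by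
  ext x
  simp only [gSet, swapFirst_zero, swapFirst_one, Set.mem_ofPred_eq]
  exact and_comm

theorem lSet_swapMiddle : 𝒜.lSet (swapMiddle π) = 𝒜.lSet π := by
  ext x
  simp only [lSet, swapMiddle_zero, swapMiddle_one, swapMiddle_two, swapMiddle_three,
    Set.mem_ofPred_eq]
  tauto

theorem lSet_swapOuter : 𝒜.lSet (swapOuter π) = 𝒜.lSet π := by
  ext x
  simp only [lSet, swapOuter_zero, swapOuter_one, swapOuter_two, swapOuter_three,
    Set.mem_ofPred_eq]
  tauto

/-! ### Coordinates in different charts -/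

variable {x : X}

theorem coord_one_eq (hx : x ∈ (𝒜.chart π).dom) (σ : Equiv.Perm (Fin 4)) :
    (𝒜.chart σ).coord x 1 = eval ((𝒜.chart π).coord x) (lamPoly k π (σ 1)) /
      eval ((𝒜.chart π).coord x) (lamPoly k π (σ 2)) := by
  rw [𝒜.coord_eq σ, lam_eq hx (σ 1), lam_eq hx (σ 2)]
  exact mul_div_mul_left _ _ ((𝒜.mem_dom π x).mp hx).1

theorem coord_zero_eq_div {σ : Equiv.Perm (Fin 4)} (h : 𝒜.lam x (σ 1) ≠ 0) :
    (𝒜.chart σ).coord x 0 = 𝒜.lam x (σ 0) / 𝒜.lam x (σ 1) := by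
  have h1 := 𝒜.ab_ne_zero_of_lam (j := σ 0) (by simp) h
  have h2 := 𝒜.rel x (σ 0) (σ 1) (by simp)
  rw [𝒜.coord_eq σ]
  change _ / _ = _
  rw [div_eq_div_iff h1 h]
  linear_combination -h2

theorem coord_zero_eq (hx : x ∈ (𝒜.chart π).dom) {σ : Equiv.Perm (Fin 4)}
    (h : 𝒜.lam x (σ 1) ≠ 0) :
    (𝒜.chart σ).coord x 0 = eval ((𝒜.chart π).coord x) (lamPoly k π (σ 0)) /
      eval ((𝒜.chart π).coord x) (lamPoly k π (σ 1)) := by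
  rw [coord_zero_eq_div h, lam_eq hx (σ 0), lam_eq hx (σ 1)]
  exact mul_div_mul_left _ _ ((𝒜.mem_dom π x).mp hx).1

theorem coord_zero_swapFirst : (𝒜.chart (swapFirst π)).coord x 0 = ((𝒜.chart π).coord x 0)⁻¹ := by
  rw [𝒜.coord_eq, 𝒜.coord_eq]
  simp

theorem chartEqn_ne_zero (hx : x ∈ (𝒜.chart π).dom) :
    1 + (𝒜.chart π).coord x 1 + (𝒜.chart π).coord x 0 * (𝒜.chart π).coord x 1 ≠ 0 := by
  have := (𝒜.chart π).eval_h hx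
  rwa [𝒜.h_eq, eval_chartEqn] at this

/-! ### The curves as coordinate lines -/

theorem mem_gSet_iff (hx : x ∈ (𝒜.chart π).dom) :
    x ∈ 𝒜.gSet π ↔ (𝒜.chart π).coord x 1 = 0 := by
  have h2 := ((𝒜.mem_dom π x).mp hx).1
  have h0 := lam_eq hx (π 0)
  have h1 := lam_eq hx (π 1)
  rw [lamPoly_zero] at h0
  rw [lamPoly_one] at h1
  simp only [map_mul, eval_X] at h0 h1
  rw [gSet, Set.mem_ofPred_eq, h0, h1]
  simp only [mul_eq_zero, h2, false_or]
  tauto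

theorem mem_lSet_iff (hx : x ∈ (𝒜.chart π).dom) :
    x ∈ 𝒜.lSet π ↔ (𝒜.chart π).coord x 0 = 0 := by
  obtain ⟨h2, h3, h10⟩ := (𝒜.mem_dom π x).mp hx
  have hab := ab_eq hx
  have r1 := 𝒜.rel x (π 0) (π 1) (by simp)
  have r2 := 𝒜.rel x (π 0) (π 2) (by simp)
  have r3 := 𝒜.rel x (π 0) (π 3) (by simp)
  constructor
  · rintro ⟨-, h, -⟩
    rw [h, eq_comm, mul_eq_zero] at hab
    exact hab.resolve_right h10
  · intro h
    rw [h, zero_mul] at hab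
    rw [hab, mul_zero, mul_eq_zero] at r1
    have h0 := r1.resolve_right h10
    rw [h0, zero_mul, eq_comm, mul_eq_zero] at r2 r3
    exact ⟨h0, hab, r2.resolve_left h2, r3.resolve_left h3⟩

/-- In the chart `lam (π 0) + lam (π 1)` is `lam (π 2) * w * (1 + t)`. The factor `w` belongs to the
exceptional curve, and `1 + t` to the proper transform. -/
theorem mem_mSet_iff (hx : x ∈ (𝒜.chart π).dom) :
    x ∈ 𝒜.mSet π ↔ (𝒜.chart π).coord x 0 = -1 := by
  obtain ⟨h2, h3, h10⟩ := (𝒜.mem_dom π x).mp hx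
  have hab := ab_eq hx
  have hs := 𝒜.lam_sum_perm π x
  have r1 := 𝒜.rel x (π 0) (π 1) (by simp)
  have r2 := 𝒜.rel x (π 2) (π 3) (by simp)
  constructor
  · rintro ⟨-, h, -⟩
    refine mul_right_cancel₀ h10 ?_
    linear_combination h - hab
  · intro h
    rw [h] at hab
    have h1 : 𝒜.lam x (π 0) + 𝒜.lam x (π 1) = 0 := by
      refine mul_right_cancel₀ h10 ?_
      linear_combination r1 + 𝒜.lam x (π 1) * hab
    refine ⟨h1, by linear_combination hab, ?_⟩
    refine mul_left_cancel₀ h2 ?_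
    linear_combination r2 + 𝒜.ab x (π 2) (π 3) * (hs - h1)

/-- The charts meeting an exceptional curve. -/
def gChart (π : Equiv.Perm (Fin 4)) : Fin 2 → Equiv.Perm (Fin 4) := ![π, swapFirst π]

/-- The charts meeting the proper transform of one of the lines. -/
def lChart (π : Equiv.Perm (Fin 4)) : Fin 3 → Equiv.Perm (Fin 4) := ![π, swapMiddle π, swapOuter π]

/-- The charts meeting the proper transform of a line through two opposite points. -/
def mChart (π : Equiv.Perm (Fin 4)) : Fin 2 → Equiv.Perm (Fin 4) := ![π, swapPairs π]

theorem mem_gSet_iff_gChart (i : Fin 2) (hx : x ∈ (𝒜.chart (gChart π i)).dom) :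
    x ∈ 𝒜.gSet π ↔ (𝒜.chart (gChart π i)).coord x 1 = 0 := by
  fin_cases i
  · exact mem_gSet_iff hx
  · rw [← gSet_swapFirst]; exact mem_gSet_iff hx

theorem mem_lSet_iff_lChart (i : Fin 3) (hx : x ∈ (𝒜.chart (lChart π i)).dom) :
    x ∈ 𝒜.lSet π ↔ (𝒜.chart (lChart π i)).coord x 0 = 0 := by
  fin_cases i
  · exact mem_lSet_iff hx
  · rw [← lSet_swapMiddle]; exact mem_lSet_iff hx
  · rw [← lSet_swapOuter]; exact mem_lSet_iff hx

theorem mem_mSet_iff_mChart (i : Fin 2) (hx : x ∈ (𝒜.chart (mChart π i)).dom) :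
    x ∈ 𝒜.mSet π ↔ (𝒜.chart (mChart π i)).coord x 0 = -1 := by
  fin_cases i
  · exact mem_mSet_iff hx
  · rw [← mSet_swapPairs]; exact mem_mSet_iff hx

theorem lam_ne_zero_of_mem_gSet (hx : x ∈ 𝒜.gSet π) : 𝒜.lam x (π 2) ≠ 0 ∧ 𝒜.lam x (π 3) ≠ 0 := by
  obtain ⟨h0, h1⟩ := hx
  have hs := 𝒜.lam_sum_perm π x
  rw [h0, h1, zero_add, zero_add] at hs
  have : ¬ (𝒜.lam x (π 2) = 0 ∧ 𝒜.lam x (π 3) = 0) := by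
    rintro ⟨h2, h3⟩
    obtain ⟨i, hi⟩ := 𝒜.lam_ne_zero x
    rcases perm_cases π i with rfl | rfl | rfl | rfl <;> contradiction
  constructor
  · intro h; exact this ⟨h, by linear_combination hs - h⟩
  · intro h; exact this ⟨by linear_combination hs - h, h⟩

theorem mem_dom_of_mem_gSet (hx : x ∈ 𝒜.gSet π) :
    x ∈ (𝒜.chart π).dom ↔ 𝒜.ab x (π 1) (π 0) ≠ 0 := by
  obtain ⟨h2, h3⟩ := lam_ne_zero_of_mem_gSet hx
  simp [𝒜.mem_dom, h2, h3]

theorem gSet_cover (hx : x ∈ 𝒜.gSet π) : ∃ i, x ∈ (𝒜.chart (gChart π i)).dom := by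
  rcases 𝒜.ab_ne_zero x (π 1) (π 0) (by simp) with h | h
  · exact ⟨0, (mem_dom_of_mem_gSet hx).mpr h⟩
  · exact ⟨1, (mem_dom_of_mem_gSet (π := swapFirst π) (by rwa [gSet_swapFirst])).mpr h⟩

theorem mem_dom_of_mem_lSet (hx : x ∈ 𝒜.lSet π) :
    x ∈ (𝒜.chart π).dom ↔ 𝒜.lam x (π 2) ≠ 0 ∧ 𝒜.lam x (π 3) ≠ 0 := by
  have h := 𝒜.ab_ne_zero x (π 0) (π 1) (by simp)
  rw [hx.2.1] at h
  have h' := h.resolve_left fun h => h rfl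
  simp [𝒜.mem_dom, h']

/-- On the line `π 0` the other three forms have sum zero and do not all vanish, so two of them are
nonzero. The three charts correspond to the choice of these two. -/
theorem lSet_cover (hx : x ∈ 𝒜.lSet π) : ∃ i, x ∈ (𝒜.chart (lChart π i)).dom := by
  have hs := 𝒜.lam_sum_perm π x
  rw [hx.1, zero_add] at hs
  obtain ⟨i, hi⟩ := 𝒜.lam_ne_zero x
  have h1 : x ∈ (𝒜.chart π).dom ↔ _ := mem_dom_of_mem_lSet hx
  have h2 : x ∈ (𝒜.chart (swapMiddle π)).dom ↔ _ :=
    mem_dom_of_mem_lSet (by rwa [lSet_swapMiddle])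
  have h3 : x ∈ (𝒜.chart (swapOuter π)).dom ↔ _ :=
    mem_dom_of_mem_lSet (by rwa [lSet_swapOuter])
  simp only [swapMiddle_two, swapMiddle_three, swapOuter_two, swapOuter_three] at h2 h3
  by_cases hy : 𝒜.lam x (π 1) = 0
  · refine ⟨0, h1.mpr ?_⟩
    by_contra hcon
    have h23 : 𝒜.lam x (π 2) = 0 ∧ 𝒜.lam x (π 3) = 0 := by
      by_cases h2 : 𝒜.lam x (π 2) = 0
      · exact ⟨h2, by linear_combination hs - hy - h2⟩
      · by_cases h3 : 𝒜.lam x (π 3) = 0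
        · exact ⟨by linear_combination hs - hy - h3, h3⟩
        · exact absurd ⟨h2, h3⟩ hcon
    have h0 := hx.1
    obtain ⟨h2, h3⟩ := h23
    rcases perm_cases π i with rfl | rfl | rfl | rfl <;> contradiction
  · by_cases h3' : 𝒜.lam x (π 3) = 0
    · refine ⟨2, h3.mpr ⟨fun h => hy ?_, hy⟩⟩
      linear_combination hs - h - h3'
    · exact ⟨1, h2.mpr ⟨hy, h3'⟩⟩

theorem mem_dom_of_mem_mSet (hx : x ∈ 𝒜.mSet π) :
    x ∈ (𝒜.chart π).dom ↔ 𝒜.lam x (π 2) ≠ 0 := by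
  obtain ⟨h0, h1, -⟩ := hx
  have hs := 𝒜.lam_sum_perm π x
  rw [𝒜.mem_dom]
  constructor
  · exact fun h => h.1
  · intro h
    refine ⟨h, fun h3 => h (by linear_combination hs - h0 - h3), fun h10 => ?_⟩
    rw [h10, add_zero] at h1
    exact (𝒜.ab_ne_zero x (π 0) (π 1) (by simp)).elim (fun h => h h1) (fun h => h h10)

theorem mSet_cover (hx : x ∈ 𝒜.mSet π) : ∃ i, x ∈ (𝒜.chart (mChart π i)).dom := by
  by_cases h : 𝒜.lam x (π 2) = 0
  · refine ⟨1, (mem_dom_of_mem_mSet (π := swapPairs π) (by rwa [mSet_swapPairs])).mpr ?_⟩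
    intro h0
    rw [swapPairs_two] at h0
    have hs := 𝒜.lam_sum_perm π x
    have h1 : 𝒜.lam x (π 1) = 0 := by linear_combination hx.1 - h0
    have h3 : 𝒜.lam x (π 3) = 0 := by linear_combination hs - h0 - h1 - h
    obtain ⟨i, hi⟩ := 𝒜.lam_ne_zero x
    rcases perm_cases π i with rfl | rfl | rfl | rfl <;> contradiction
  · exact ⟨0, (mem_dom_of_mem_mSet hx).mpr h⟩

/-- A point of an exceptional curve. -/
theorem exists_mem_gSet (𝒜 : LinesAtlas X) (π : Equiv.Perm (Fin 4)) :
    ∃ x ∈ 𝒜.gSet π, ∀ i, x ∈ (𝒜.chart (gChart π i)).dom := by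
  obtain ⟨x, hx, hc⟩ := 𝒜.exists_point π (t := 1) (w := 0) (by simp)
  have hG : x ∈ 𝒜.gSet π := (mem_gSet_iff hx).mpr (by rw [hc]; rfl)
  refine ⟨x, hG, fun i => ?_⟩
  fin_cases i
  · exact hx
  · refine (mem_dom_of_mem_gSet (π := swapFirst π) (by rwa [gSet_swapFirst])).mpr ?_
    have := ab_eq hx
    rw [hc] at this
    simp only [swapFirst_one, swapFirst_zero, this]
    simpa using ((𝒜.mem_dom π x).mp hx).2.2

theorem exists_mem_lSet [Infinite k] (𝒜 : LinesAtlas X) (π : Equiv.Perm (Fin 4)) :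
    ∃ x ∈ 𝒜.lSet π, ∀ i, i ≠ π 0 → 𝒜.lam x i ≠ 0 := by
  classical
  obtain ⟨w, hw⟩ := Infinite.exists_notMem_finset ({0, -1} : Finset k)
  simp only [Finset.mem_insert, Finset.mem_singleton, not_or] at hw
  have hw1 : 1 + w ≠ 0 := fun h => hw.2 (by linear_combination h)
  obtain ⟨x, hx, hc⟩ := 𝒜.exists_point π (t := 0) (w := w) (by simpa using hw1)
  refine ⟨x, (mem_lSet_iff hx).mpr (by rw [hc]; rfl), fun i hi => ?_⟩
  have h2 := ((𝒜.mem_dom π x).mp hx).1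
  rcases perm_cases π i with rfl | rfl | rfl | rfl
  · exact absurd rfl hi
  · rw [lam_eq hx, lamPoly_one, hc]
    exact mul_ne_zero h2 (by simpa using hw.1)
  · exact h2
  · exact ((𝒜.mem_dom π x).mp hx).2.1

theorem exists_mem_mSet [Infinite k] (𝒜 : LinesAtlas X) (π : Equiv.Perm (Fin 4)) :
    ∃ x ∈ 𝒜.mSet π, (∀ i, 𝒜.lam x i ≠ 0) ∧ 𝒜.lam x (π 0) + 𝒜.lam x (π 2) ≠ 0 ∧
      𝒜.lam x (π 0) + 𝒜.lam x (π 3) ≠ 0 := by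
  classical
  -- On `t = -1` the forms are proportional to `(-w, w, 1, -1)`. The excluded values are those at
  -- which one of them, or a sum defining another diagonal, vanishes.
  obtain ⟨w, hw⟩ := Infinite.exists_notMem_finset ({0, 1, -1} : Finset k)
  simp only [Finset.mem_insert, Finset.mem_singleton, not_or] at hw
  obtain ⟨hw0, hw1, hw2⟩ := hw
  obtain ⟨x, hx, hc⟩ := 𝒜.exists_point π (t := -1) (w := w) (by simp)
  have h2 := ((𝒜.mem_dom π x).mp hx).1
  have e0 : 𝒜.lam x (π 0) = 𝒜.lam x (π 2) * -w := by rw [lam_eq hx (π 0), lamPoly_zero, hc]; simp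
  have e1 : 𝒜.lam x (π 1) = 𝒜.lam x (π 2) * w := by rw [lam_eq hx (π 1), lamPoly_one, hc]; simp
  have e3 : 𝒜.lam x (π 3) = 𝒜.lam x (π 2) * -1 := by
    rw [lam_eq hx (π 3), lamPoly_three, hc, map_neg, eval_chartEqn]; simp
  refine ⟨x, (mem_mSet_iff hx).mpr (by rw [hc]; rfl), fun i => ?_, ?_, ?_⟩
  · rcases perm_cases π i with rfl | rfl | rfl | rfl
    · rw [e0]; exact mul_ne_zero h2 (neg_ne_zero.mpr hw0)
    · rw [e1]; exact mul_ne_zero h2 hw0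
    · exact h2
    · exact ((𝒜.mem_dom π x).mp hx).2.1
  · rw [e0]
    have : 𝒜.lam x (π 2) * (1 - w) ≠ 0 := mul_ne_zero h2 (sub_ne_zero.mpr (Ne.symm hw1))
    intro h; exact this (by linear_combination h)
  · rw [e0, e3]
    have : 𝒜.lam x (π 2) * (w - -1) ≠ 0 := mul_ne_zero h2 (sub_ne_zero.mpr hw2)
    intro h; exact this (by linear_combination -h)

end Sets

section Curves

variable [IsAlgClosed k] [IrreducibleSpace X] (𝒜 : LinesAtlas X) (π : Equiv.Perm (Fin 4))

theorem exists_gCurve : ∃ C : PrimeDivisor X, C.pts = 𝒜.gSet π ∧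
    ∀ i, IsLine (𝒜.chart (gChart π i)) C 1 0 := by
  obtain ⟨x, hx, hx'⟩ := 𝒜.exists_mem_gSet π
  exact exists_curve (fun i => 𝒜.chart (gChart π i)) isClosed_gSet (fun _ => gSet_cover) hx hx'
    fun i x => mem_gSet_iff_gChart i

theorem exists_lCurve : ∃ C : PrimeDivisor X, C.pts = 𝒜.lSet π ∧
    ∀ i, IsLine (𝒜.chart (lChart π i)) C 0 0 := by
  obtain ⟨x, hx, hx'⟩ := 𝒜.exists_mem_lSet π
  refine exists_curve (fun i => 𝒜.chart (lChart π i)) isClosed_lSet (fun _ => lSet_cover) hx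
    (fun i => ?_) fun i x => mem_lSet_iff_lChart i
  fin_cases i
  · exact (mem_dom_of_mem_lSet hx).mpr ⟨hx' _ (by simp), hx' _ (by simp)⟩
  · exact (mem_dom_of_mem_lSet (π := swapMiddle π) (by rwa [lSet_swapMiddle])).mpr
      ⟨hx' _ (by simp), hx' _ (by simp)⟩
  · exact (mem_dom_of_mem_lSet (π := swapOuter π) (by rwa [lSet_swapOuter])).mpr
      ⟨hx' _ (by simp), hx' _ (by simp)⟩

theorem exists_mCurve : ∃ C : PrimeDivisor X, C.pts = 𝒜.mSet π ∧
    ∀ i, IsLine (𝒜.chart (mChart π i)) C 0 (-1) := by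
  obtain ⟨x, hx, hx', -⟩ := 𝒜.exists_mem_mSet π
  exact exists_curve (fun i => 𝒜.chart (mChart π i)) isClosed_mSet (fun _ => mSet_cover) hx
    (fun i => 𝒜.mem_dom_of_lam hx' _) fun i x => mem_mSet_iff_mChart i

/-- The exceptional curve over the intersection point of two of the lines. -/
def gCurve : PrimeDivisor X := (𝒜.exists_gCurve π).choose

/-- The proper transform of one of the lines. -/
def lCurve : PrimeDivisor X := (𝒜.exists_lCurve π).choose

/-- The proper transform of the line through two opposite intersection points. -/
def mCurve : PrimeDivisor X := (𝒜.exists_mCurve π).choose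

theorem gCurve_pts : (𝒜.gCurve π).pts = 𝒜.gSet π := (𝒜.exists_gCurve π).choose_spec.1

theorem lCurve_pts : (𝒜.lCurve π).pts = 𝒜.lSet π := (𝒜.exists_lCurve π).choose_spec.1

theorem mCurve_pts : (𝒜.mCurve π).pts = 𝒜.mSet π := (𝒜.exists_mCurve π).choose_spec.1

theorem gCurve_isLine (i : Fin 2) : IsLine (𝒜.chart (gChart π i)) (𝒜.gCurve π) 1 0 :=
  (𝒜.exists_gCurve π).choose_spec.2 i

theorem lCurve_isLine (i : Fin 3) : IsLine (𝒜.chart (lChart π i)) (𝒜.lCurve π) 0 0 :=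
  (𝒜.exists_lCurve π).choose_spec.2 i

theorem mCurve_isLine (i : Fin 2) : IsLine (𝒜.chart (mChart π i)) (𝒜.mCurve π) 0 (-1) :=
  (𝒜.exists_mCurve π).choose_spec.2 i

end Curves

end LinesAtlas

end

end ProjGeom

/-! ### Degrees of forms on the curves and self-intersection numbers -/

namespace ProjGeom

noncomputable section

universe u

open MvPolynomial

variable {k : Type u} [Field k] {ι : Type} {κ : ι → Type} {X : Set (MultiProj k κ)}

theorem lineEval_one_chartEqn : lineEval 1 0 (chartEqn k) = 1 := by
  have h := lineEval_X_self (k := k) 1 0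
  simp [chartEqn, h]

theorem lineEval_zero_chartEqn : lineEval 0 0 (chartEqn k) = 1 + Polynomial.X := by
  have h := lineEval_X_self (k := k) 0 0
  have h' := lineEval_X_add_one (k := k) 0 0
  rw [show (0 : Fin 2) + 1 = 1 from rfl] at h'
  simp [chartEqn, h, h']

theorem lineEval_neg_one_chartEqn : lineEval 0 (-1) (chartEqn k) = 1 := by
  have h := lineEval_X_self (k := k) 0 (-1)
  have h' := lineEval_X_add_one (k := k) 0 (-1)
  rw [show (0 : Fin 2) + 1 = 1 from rfl] at h'
  simp [chartEqn, h, h']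

theorem properInt_add (C : PrimeDivisor X) (D E : Divisor X) :
    properInt C (D + E) = properInt C D + properInt C E := by
  classical
  rw [properInt, Finsupp.erase_add]
  exact Finsupp.sum_add_index' (by simp) (by intros; ring)

/-- The intersection number with `C` as an additive function, given the degree `n` of the normal
bundle. -/
def degreeOn (C : PrimeDivisor X) (n : ℤ) : Divisor X →+ ℤ :=
  AddMonoidHom.mk' (fun D => properInt C D + D C * n) fun D E => by
    rw [properInt_add, Finsupp.add_apply]; ring

theorem degreeOn_apply (C : PrimeDivisor X) (n : ℤ) (D : Divisor X) :
    degreeOn C n D = properInt C D + D C * n := rfl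

theorem degreeOn_toDivisor_self (C : PrimeDivisor X) (n : ℤ) : degreeOn C n C.toDivisor = n := by
  simp [degreeOn_apply, properInt, PrimeDivisor.toDivisor]

theorem degreeOn_toDivisor {C Z : PrimeDivisor X} (n : ℤ) (h : Z ≠ C) :
    degreeOn C n Z.toDivisor = intersectionNumber Z C := by
  classical
  rw [degreeOn_apply, properInt, PrimeDivisor.toDivisor, Finsupp.erase_single_ne (Ne.symm h),
    Finsupp.sum_single_index (by simp), Finsupp.single_apply, if_neg h]
  ring

namespace LinesAtlas

variable [IsAlgClosed k] [IrreducibleSpace X] {𝒜 : LinesAtlas X}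

/-- Forms have degree `h` on `C` and the normal bundle of `C` has degree `n`. -/
def HasDegree (𝒜 : LinesAtlas X) (C : PrimeDivisor X) (h n : ℤ) : Prop :=
  ∀ (d : ℕ) (A : MvPolynomial (Fin 4) k) (hA : 𝒜.IsNonzeroForm A d),
    degreeOn C n (div hA) = d * h

section

variable {C : PrimeDivisor X} {h n : ℤ}

theorem HasDegree.eq_zero (hC : 𝒜.HasDegree C h n) {D : Divisor X} (hD : IsPrincipal D) :
    degreeOn C n D = 0 := by
  obtain ⟨d, A, B, hA, hB, rfl⟩ := 𝒜.exists_div_sub_of_isPrincipal hD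
  rw [map_sub, hC d A hA, hC d B hB, sub_self]

/-- `degreeOn C n` kills principal divisors and takes the value `n` on `C`, so any divisor linearly
equivalent to `C` and not containing it meets `C` in `n`. Since `A` vanishes simply along `C` and
`B` does not vanish on it, `C + div B - div A` is such a divisor. -/
theorem HasDegree.hasSelfIntersection (hC : 𝒜.HasDegree C h n) {A B : MvPolynomial (Fin 4) k}
    {d : ℕ} (hA : 𝒜.IsNonzeroForm A d) (hB : 𝒜.IsNonzeroForm B d) (h1 : 𝒜.ord A C = 1)
    (h0 : 𝒜.ord B C = 0) : HasSelfIntersection C n := by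
  classical
  constructor
  · refine ⟨C.toDivisor + (div hB - div hA), ?_, ?_⟩
    · rw [add_sub_cancel_left]; exact isPrincipal_div_sub hB hA
    · simp [div_apply, h1, h0, PrimeDivisor.toDivisor]
  · intro D hD hDC
    have h2 := hC.eq_zero hD
    rw [map_sub, degreeOn_toDivisor_self, degreeOn_apply, hDC, zero_mul, add_zero, properInt,
      Finsupp.erase_of_notMem_support (by simpa using hDC)] at h2
    exact sub_eq_zero.mp h2

end

variable (π : Equiv.Perm (Fin 4))

theorem localForm_X_zero : localForm (k := k) π (MvPolynomial.X (π 0)) =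
    lineEqn 0 0 * MvPolynomial.X 1 := by
  rw [localForm_X, lamPoly_zero, lineEqn, C_0, sub_zero]

theorem localForm_X_zero' : localForm (k := k) π (MvPolynomial.X (π 0)) =
    lineEqn 1 0 * MvPolynomial.X 0 := by
  rw [localForm_X, lamPoly_zero, lineEqn, C_0, sub_zero, mul_comm]

theorem localForm_X_add_X : localForm (k := k) π (MvPolynomial.X (π 0) + MvPolynomial.X (π 1)) =
    lineEqn 0 (-1) * MvPolynomial.X 1 := by
  rw [map_add, localForm_X, localForm_X, lamPoly_zero, lamPoly_one, lineEqn, C_neg, C_1]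
  ring

theorem localForm_X_add_X' : localForm (k := k) π (MvPolynomial.X (π 0) + MvPolynomial.X (π 1)) =
    lineEqn 1 0 * (MvPolynomial.X 0 + 1) := by
  rw [map_add, localForm_X, localForm_X, lamPoly_zero, lamPoly_one, lineEqn, C_0]
  ring

theorem localForm_X_add_X_swapPairs : localForm (k := k) (swapPairs π)
    (MvPolynomial.X (π 0) + MvPolynomial.X (π 1)) = lineEqn 1 0 * -(MvPolynomial.X 0 + 1) := by
  have h0 := lamPoly_two (k := k) (swapPairs π)
  have h1 := lamPoly_three (k := k) (swapPairs π)
  rw [swapPairs_two] at h0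
  rw [swapPairs_three] at h1
  rw [map_add, localForm_X, localForm_X, h0, h1, lineEqn, C_0, chartEqn]
  ring

theorem isNonzeroForm_X_add_X :
    𝒜.IsNonzeroForm (MvPolynomial.X (π 0) + MvPolynomial.X (π 1)) 1 := by
  refine isNonzeroForm_of_localForm ((isHomogeneous_X k _).add (isHomogeneous_X k _)) π ?_
  rw [localForm_X_add_X]
  exact mul_ne_zero (lineEqn_ne_zero _ _) (X_ne_zero _)

theorem ord_gCurve_X : 𝒜.ord (MvPolynomial.X (π 0)) (𝒜.gCurve π) = 1 := by
  have h : IsLine (𝒜.chart π) _ _ _ := 𝒜.gCurve_isLine π 0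
  rw [ord_eq_multiplicity (isNonzeroForm_X _) h.1, localForm_X_zero']
  refine h.multiplicity_mul_eq_one ?_
  rw [show (0 : Fin 2) = 1 + 1 from rfl, lineEval_X_add_one]
  exact Polynomial.X_ne_zero

theorem ord_lCurve_X : 𝒜.ord (MvPolynomial.X (π 0)) (𝒜.lCurve π) = 1 := by
  have h : IsLine (𝒜.chart π) _ _ _ := 𝒜.lCurve_isLine π 0
  rw [ord_eq_multiplicity (isNonzeroForm_X _) h.1, localForm_X_zero]
  refine h.multiplicity_mul_eq_one ?_
  rw [show (1 : Fin 2) = 0 + 1 from rfl, lineEval_X_add_one]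
  exact Polynomial.X_ne_zero

theorem ord_mCurve_X_add_X :
    𝒜.ord (MvPolynomial.X (π 0) + MvPolynomial.X (π 1)) (𝒜.mCurve π) = 1 := by
  have h : IsLine (𝒜.chart π) _ _ _ := 𝒜.mCurve_isLine π 0
  rw [ord_eq_multiplicity (isNonzeroForm_X_add_X π) h.1, localForm_X_add_X]
  refine h.multiplicity_mul_eq_one ?_
  rw [show (1 : Fin 2) = 0 + 1 from rfl, lineEval_X_add_one]
  exact Polynomial.X_ne_zero

theorem lineEval_X_add_one_ne_zero :
    lineEval 1 0 (MvPolynomial.X 0 + 1 : MvPolynomial (Fin 2) k) ≠ 0 := by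
  rw [map_add, map_one, show (0 : Fin 2) = 1 + 1 from rfl, lineEval_X_add_one]
  exact Polynomial.X_add_C_ne_zero (1 : k)

theorem ord_gCurve_X_add_X :
    𝒜.ord (MvPolynomial.X (π 0) + MvPolynomial.X (π 1)) (𝒜.gCurve π) = 1 := by
  have h : IsLine (𝒜.chart π) _ _ _ := 𝒜.gCurve_isLine π 0
  rw [ord_eq_multiplicity (isNonzeroForm_X_add_X π) h.1, localForm_X_add_X']
  exact h.multiplicity_mul_eq_one lineEval_X_add_one_ne_zero

theorem ord_gCurve_swapPairs_X_add_X :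
    𝒜.ord (MvPolynomial.X (π 0) + MvPolynomial.X (π 1)) (𝒜.gCurve (swapPairs π)) = 1 := by
  have h : IsLine (𝒜.chart (swapPairs π)) _ _ _ := 𝒜.gCurve_isLine (swapPairs π) 0
  rw [ord_eq_multiplicity (isNonzeroForm_X_add_X π) h.1, localForm_X_add_X_swapPairs]
  refine h.multiplicity_mul_eq_one ?_
  rw [map_neg, neg_ne_zero]
  exact lineEval_X_add_one_ne_zero

theorem ord_eq_zero {A : MvPolynomial (Fin 4) k} {d : ℕ} (hA : 𝒜.IsNonzeroForm A d)
    {C : PrimeDivisor X} {x : X} (hx : x ∈ C.pts) (h : eval (𝒜.lam x) A ≠ 0) : 𝒜.ord A C = 0 := by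
  by_contra h0
  exact h ((ord_ne_zero_iff hA).mp h0 x hx)

/-! ### Degrees of the curves -/

/-- The two charts have parameters `t` and `1 / t` on the curve, and the restrictions satisfy `B(t)
= t ^ ord * B'(1 / t)`. Hence the other components meet `G` in `ord` points, counted with
multiplicity, which the normal degree `-1` cancels. -/
theorem hasDegree_gCurve : 𝒜.HasDegree (𝒜.gCurve π) 0 (-1) := by
  intro d A hA
  have h := 𝒜.gCurve_isLine π
  have hcover : ∀ x ∈ (𝒜.gCurve π).pts, ∃ i, x ∈ (𝒜.chart (gChart π i)).dom := fun x hx =>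
    gSet_cover (by rwa [gCurve_pts] at hx)
  obtain ⟨B, hB, hB0⟩ := exists_restr hA (h 0)
  obtain ⟨B', hB', hB0'⟩ := exists_restr hA (h 1)
  obtain ⟨p, hp, hpc⟩ := 𝒜.exists_point (swapFirst π) (t := 0) (w := 0) (by simp)
  have hpG : p ∈ 𝒜.gSet π := (mem_gSet_iff_gChart 1 hp).mpr (by
    change (𝒜.chart (swapFirst π)).coord p 1 = 0; rw [hpc]; rfl)
  have hmiss : (𝒜.gCurve π).pts \ (𝒜.chart π).dom = {p} := by
    rw [gCurve_pts]
    ext x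
    constructor
    · rintro ⟨hx, hxd⟩
      rw [mem_dom_of_mem_gSet hx, not_not] at hxd
      obtain ⟨i, hi⟩ := gSet_cover hx
      fin_cases i
      · exact absurd hxd (((𝒜.mem_dom π x).mp hi).2.2)
      · refine (𝒜.chart (swapFirst π)).injOn hi hp (funext fun j => ?_)
        rw [hpc]
        fin_cases j
        · simp [𝒜.coord_eq, hxd]
        · exact (mem_gSet_iff_gChart 1 hi).mp hx
    · rintro rfl
      refine ⟨hpG, ?_⟩
      rw [mem_dom_of_mem_gSet hpG, not_not]
      have := ab_eq hp
      rw [hpc] at this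
      simpa using this
  rw [degreeOn_apply, div_apply, properInt_div_eq hA h hcover 0 hB hB0]
  have hmiss' : (𝒜.gCurve π).pts \ (𝒜.chart (gChart π 0)).dom = {p} := hmiss
  have huniv : {t | ((lineEval 1 0 (𝒜.chart (gChart π 0)).h).eval t) ≠ 0} = Set.univ := by
    rw [𝒜.h_eq, lineEval_one_chartEqn]; simp
  rw [hmiss', finsum_mem_singleton, huniv, finsum_mem_univ, finsum_rootMultiplicity,
    sum_localInt_erase hA (h 1) hB' hB0' (x := p) hp (by rw [gCurve_pts]; exact hpG)]
  have hp0 : (𝒜.chart (gChart π 1)).coord p (1 + 1) = 0 := by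
    change (𝒜.chart (swapFirst π)).coord p 0 = 0; rw [hpc]; rfl
  have key := natDegree_add_rootMultiplicity hB0 hB0' (c := 1) one_ne_zero
    (n := 𝒜.ord A (𝒜.gCurve π)) (by
      intro t ht _
      obtain ⟨y, hy, hyc⟩ := 𝒜.exists_point π (t := t) (w := 0) (by simp)
      have hyG : y ∈ 𝒜.gSet π := (mem_gSet_iff hy).mpr (by rw [hyc]; rfl)
      have hy' : y ∈ (𝒜.chart (swapFirst π)).dom := by
        refine (mem_dom_of_mem_gSet (π := swapFirst π) (by rwa [gSet_swapFirst])).mpr ?_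
        have := ab_eq hy
        rw [hyc] at this
        simp only [swapFirst_one, swapFirst_zero, this]
        simpa [ht] using ((𝒜.mem_dom π y).mp hy).2.2
      -- The second coordinate of the other chart is `lam (π 0) / lam (π 2) = t * w`, so the local
      -- equations differ by the factor `t`.
      have htr := eval_transition hA hB hB' (MvPolynomial.X 0) 1 (fun z hz hz' => by
        rw [show gChart π 0 = π from rfl] at hz ⊢
        have := coord_one_eq hz (swapFirst π)
        rw [swapFirst_one, swapFirst_two, lamPoly_zero, lamPoly_two] at this
        rw [show gChart π 1 = swapFirst π from rfl, this]; simp) hy hy' (by simp)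
      rw [← eval_lineEval ((h 0).2 y hy |>.mp (by rw [gCurve_pts]; exact hyG)),
        ← eval_lineEval ((h 1).2 y hy' |>.mp (by rw [gCurve_pts]; exact hyG))] at htr
      have e1 : (𝒜.chart (gChart π 0)).coord y (1 + 1) = t := by
        change (𝒜.chart π).coord y 0 = t; rw [hyc]; rfl
      have e2 : (𝒜.chart (gChart π 1)).coord y (1 + 1) = t⁻¹ := by
        change (𝒜.chart (swapFirst π)).coord y 0 = t⁻¹; rw [coord_zero_swapFirst, hyc]; rfl
      rw [e1, e2] at htr
      rw [htr]
      have e3 : eval ((𝒜.chart (gChart π 0)).coord y) (lamPoly k (gChart π 0) (gChart π 1 2)) = 1 := by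
        change eval _ (lamPoly k π (π 2)) = 1; rw [lamPoly_two]; simp
      have e4 : (𝒜.chart (gChart π 0)).coord y 0 = t := e1
      rw [e3]; simp [e4])
  rw [hp0, ← key]
  push_cast
  ring

/-- Now the normalizing form changes too, from `π 2` to `π 0`, with ratio `-t` on the curve: `B(t) =
(-1) ^ d * t ^ (d + ord) * B'(1 / t)`. The zero count is `d + ord`, and the normal degree `-1`
leaves `d`. -/
theorem hasDegree_mCurve : 𝒜.HasDegree (𝒜.mCurve π) 1 (-1) := by
  intro d A hA
  have h := 𝒜.mCurve_isLine π
  have hcover : ∀ x ∈ (𝒜.mCurve π).pts, ∃ i, x ∈ (𝒜.chart (mChart π i)).dom := fun x hx =>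
    mSet_cover (by rwa [mCurve_pts] at hx)
  obtain ⟨B, hB, hB0⟩ := exists_restr hA (h 0)
  obtain ⟨B', hB', hB0'⟩ := exists_restr hA (h 1)
  obtain ⟨p, hp, hpc⟩ := 𝒜.exists_point (swapPairs π) (t := -1) (w := 0) (by simp)
  have hpM : p ∈ 𝒜.mSet π := (mem_mSet_iff_mChart 1 hp).mpr (by
    change (𝒜.chart (swapPairs π)).coord p 0 = -1; rw [hpc]; rfl)
  have hmiss : (𝒜.mCurve π).pts \ (𝒜.chart π).dom = {p} := by
    rw [mCurve_pts]
    ext x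
    constructor
    · rintro ⟨hx, hxd⟩
      rw [mem_dom_of_mem_mSet hx, not_not] at hxd
      obtain ⟨i, hi⟩ := mSet_cover hx
      fin_cases i
      · exact absurd hxd (((𝒜.mem_dom π x).mp hi).1)
      · refine (𝒜.chart (swapPairs π)).injOn hi hp (funext fun j => ?_)
        rw [hpc]
        fin_cases j
        · exact (mem_mSet_iff_mChart 1 hi).mp hx
        · have hs := 𝒜.lam_sum_perm π x
          have h3 : 𝒜.lam x (π 3) = 0 := by linear_combination hs - hx.1 - hxd
          simp [𝒜.coord_eq, h3]
    · rintro rfl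
      refine ⟨hpM, ?_⟩
      rw [mem_dom_of_mem_mSet hpM, not_not]
      have := lam_eq hp (swapPairs π 0)
      rw [lamPoly_zero, hpc] at this
      simpa using this
  rw [degreeOn_apply, div_apply, properInt_div_eq hA h hcover 0 hB hB0]
  have hmiss' : (𝒜.mCurve π).pts \ (𝒜.chart (mChart π 0)).dom = {p} := hmiss
  have huniv : {t | ((lineEval 0 (-1) (𝒜.chart (mChart π 0)).h).eval t) ≠ 0} = Set.univ := by
    rw [𝒜.h_eq, lineEval_neg_one_chartEqn]; simp
  rw [hmiss', finsum_mem_singleton, huniv, finsum_mem_univ, finsum_rootMultiplicity,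
    sum_localInt_erase hA (h 1) hB' hB0' (x := p) hp (by rw [mCurve_pts]; exact hpM)]
  have hp0 : (𝒜.chart (mChart π 1)).coord p (0 + 1) = 0 := by
    change (𝒜.chart (swapPairs π)).coord p 1 = 0; rw [hpc]; rfl
  have key := natDegree_add_rootMultiplicity hB0 hB0' (c := (-1) ^ d)
    (pow_ne_zero _ (neg_ne_zero.mpr one_ne_zero))
    (n := d + 𝒜.ord A (𝒜.mCurve π)) (by
      intro t ht _
      obtain ⟨y, hy, hyc⟩ := 𝒜.exists_point π (t := -1) (w := t) (by simp)
      have hyM : y ∈ 𝒜.mSet π := (mem_mSet_iff hy).mpr (by rw [hyc]; rfl)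
      have hy' : y ∈ (𝒜.chart (swapPairs π)).dom := by
        refine (mem_dom_of_mem_mSet (π := swapPairs π) (by rwa [mSet_swapPairs])).mpr ?_
        rw [swapPairs_two, lam_eq hy, lamPoly_zero, hyc]
        simpa [ht] using ((𝒜.mem_dom π y).mp hy).1
      -- In the other chart the first coordinate is `lam (π 2) / lam (π 3) = -1 / h` with `h = 1 + w
      -- + t * w`. Adding one gives `w * (t + 1) / h`.
      have htr := eval_transition hA hB hB' (MvPolynomial.X 1) (chartEqn k) (fun z hz hz' => by
        rw [show mChart π 0 = π from rfl] at hz ⊢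
        rw [show mChart π 1 = swapPairs π from rfl]
        have := coord_zero_eq hz (σ := swapPairs π) ((𝒜.mem_dom π z).mp hz).2.1
        rw [swapPairs_zero, swapPairs_one, lamPoly_two, lamPoly_three] at this
        have hne := chartEqn_ne_zero hz
        rw [this, map_neg, eval_chartEqn, map_one, eval_X]
        rw [div_neg, sub_neg_eq_add, add_mul, neg_mul, one_div, inv_mul_cancel₀ hne]
        ring) hy hy' (by
          have := chartEqn_ne_zero hy
          rwa [← eval_chartEqn] at this)
      rw [← eval_lineEval ((h 0).2 y hy |>.mp (by rw [mCurve_pts]; exact hyM)),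
        ← eval_lineEval ((h 1).2 y hy' |>.mp (by rw [mCurve_pts]; exact hyM))] at htr
      have e0 : (𝒜.chart (mChart π 0)).coord y = ![-1, t] := hyc
      have e1 : (𝒜.chart (mChart π 0)).coord y (0 + 1) = t := by rw [e0]; rfl
      have e2 : (𝒜.chart (mChart π 1)).coord y (0 + 1) = t⁻¹ := by
        change (𝒜.chart (swapPairs π)).coord y 1 = t⁻¹
        rw [coord_one_eq hy, swapPairs_one, swapPairs_two, lamPoly_three, lamPoly_zero, hyc,
          map_neg, eval_chartEqn]
        simp [neg_div_neg_eq]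
      rw [e1, e2] at htr
      rw [htr]
      have e3 : eval ((𝒜.chart (mChart π 0)).coord y) (lamPoly k (mChart π 0) (mChart π 1 2)) =
          -1 * t := by
        change eval _ (lamPoly k π (π 0)) = _; rw [lamPoly_zero, e0]; simp
      have e4 : eval (![-1, t] : Fin 2 → k) (chartEqn k) = 1 := by rw [eval_chartEqn]; simp
      have e5 : eval (![-1, t] : Fin 2 → k) (MvPolynomial.X 1) = t := by simp
      rw [e3, e0, e4, e5, mul_pow, pow_add, div_one]
      ring)
  rw [hp0]
  have key' := congrArg (Nat.cast (R := ℤ)) key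
  push_cast at key'
  linear_combination key'

/-- The first chart misses two points of the curve, where `π 2` or `π 3` vanishes, the latter being
`w = -1`. Passing to the second chart counts the zeros at infinity, total `d + ord`. In the third
chart the multiplicity at the missing point exceeds that of `B` at `-1` by `ord`. Altogether there
are `d + 2 * ord` zeros, whence the normal degree `-2`. -/
theorem hasDegree_lCurve : 𝒜.HasDegree (𝒜.lCurve π) 1 (-2) := by
  intro d A hA
  have h := 𝒜.lCurve_isLine π
  have hcover : ∀ x ∈ (𝒜.lCurve π).pts, ∃ i, x ∈ (𝒜.chart (lChart π i)).dom := fun x hx =>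
    lSet_cover (by rwa [lCurve_pts] at hx)
  obtain ⟨B, hB, hB0⟩ := exists_restr hA (h 0)
  obtain ⟨B', hB', hB0'⟩ := exists_restr hA (h 1)
  obtain ⟨B'', hB'', hB0''⟩ := exists_restr hA (h 2)
  obtain ⟨p, hp, hpc⟩ := 𝒜.exists_point (swapMiddle π) (t := 0) (w := 0) (by simp)
  obtain ⟨q, hq, hqc⟩ := 𝒜.exists_point (swapOuter π) (t := 0) (w := 0) (by simp)
  have hpL : p ∈ 𝒜.lSet π := (mem_lSet_iff_lChart 1 hp).mpr (by
    change (𝒜.chart (swapMiddle π)).coord p 0 = 0; rw [hpc]; rfl)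
  have hqL : q ∈ 𝒜.lSet π := (mem_lSet_iff_lChart 2 hq).mpr (by
    change (𝒜.chart (swapOuter π)).coord q 0 = 0; rw [hqc]; rfl)
  have hp2 : 𝒜.lam p (π 2) = 0 := by
    have := lam_eq hp (swapMiddle π 1)
    rw [lamPoly_one, hpc] at this
    simpa using this
  have hq3 : 𝒜.lam q (π 3) = 0 := by
    have := lam_eq hq (swapOuter π 1)
    rw [lamPoly_one, hqc] at this
    simpa using this
  have hpq : p ≠ q := by
    rintro rfl
    exact ((𝒜.mem_dom _ p).mp hp).2.1 hq3
  have hmiss : (𝒜.lCurve π).pts \ (𝒜.chart π).dom = {p, q} := by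
    rw [lCurve_pts]
    ext x
    constructor
    · rintro ⟨hx, hxd⟩
      rw [mem_dom_of_mem_lSet hx, not_and_or, not_not, not_not] at hxd
      have hs := 𝒜.lam_sum_perm π x
      rw [hx.1, zero_add] at hs
      rcases hxd with h2 | h3
      · left
        have hi : x ∈ (𝒜.chart (swapMiddle π)).dom := by
          obtain ⟨i, hi⟩ := lSet_cover hx
          fin_cases i
          · exact absurd h2 ((𝒜.mem_dom _ x).mp hi).1
          · exact hi
          · exact absurd h2 ((𝒜.mem_dom _ x).mp hi).1
        refine (𝒜.chart (swapMiddle π)).injOn hi hp (funext fun j => ?_)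
        rw [hpc]
        fin_cases j
        · exact (mem_lSet_iff_lChart 1 hi).mp hx
        · simp [𝒜.coord_eq, h2]
      · right
        have hi : x ∈ (𝒜.chart (swapOuter π)).dom := by
          obtain ⟨i, hi⟩ := lSet_cover hx
          fin_cases i
          · exact absurd h3 ((𝒜.mem_dom _ x).mp hi).2.1
          · exact absurd h3 ((𝒜.mem_dom _ x).mp hi).2.1
          · exact hi
        refine (𝒜.chart (swapOuter π)).injOn hi hq (funext fun j => ?_)
        rw [hqc]
        fin_cases j
        · exact (mem_lSet_iff_lChart 2 hi).mp hx
        · simp [𝒜.coord_eq, h3]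
    · rintro (rfl | rfl)
      · refine ⟨hpL, ?_⟩
        rw [mem_dom_of_mem_lSet hpL]
        exact fun h => h.1 hp2
      · refine ⟨hqL, ?_⟩
        rw [mem_dom_of_mem_lSet hqL]
        exact fun h => h.2 hq3
  rw [degreeOn_apply, div_apply, properInt_div_eq hA h hcover 0 hB hB0]
  have hmiss' : (𝒜.lCurve π).pts \ (𝒜.chart (lChart π 0)).dom = {p, q} := hmiss
  have hset : {t | ((lineEval 0 0 (𝒜.chart (lChart π 0)).h).eval t) ≠ 0} = {t : k | t ≠ -1} := by
    rw [𝒜.h_eq, lineEval_zero_chartEqn]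
    ext t
    simp only [Polynomial.eval_add, Polynomial.eval_one, Polynomial.eval_X, Set.mem_ofPred_eq]
    rw [add_comm, ne_eq, add_eq_zero_iff_eq_neg]
  have hsplit : (∑ᶠ t ∈ {t : k | t ≠ -1}, ((lineEval 0 0 B).rootMultiplicity t : ℤ)) +
      (lineEval 0 0 B).rootMultiplicity (-1) = (lineEval 0 0 B).natDegree := by
    rw [← finsum_rootMultiplicity]
    exact finsum_ne_add (finite_support_rootMultiplicity _) (-1)
  rw [hmiss', finsum_mem_pair hpq, hset,
    sum_localInt_erase hA (h 1) hB' hB0' (x := p) hp (by rw [lCurve_pts]; exact hpL),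
    sum_localInt_erase hA (h 2) hB'' hB0'' (x := q) hq (by rw [lCurve_pts]; exact hqL)]
  have hp0 : (𝒜.chart (lChart π 1)).coord p (0 + 1) = 0 := by
    change (𝒜.chart (swapMiddle π)).coord p 1 = 0; rw [hpc]; rfl
  have hq0 : (𝒜.chart (lChart π 2)).coord q (0 + 1) = 0 := by
    change (𝒜.chart (swapOuter π)).coord q 1 = 0; rw [hqc]; rfl
  rw [hp0, hq0]
  have hpoint : ∀ t : k, t ≠ 0 → 1 + t ≠ 0 → ∃ y ∈ 𝒜.lSet π, y ∈ (𝒜.chart π).dom ∧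
      y ∈ (𝒜.chart (swapMiddle π)).dom ∧ y ∈ (𝒜.chart (swapOuter π)).dom ∧
      (𝒜.chart π).coord y = ![0, t] := by
    intro t ht ht1
    obtain ⟨y, hy, hyc⟩ := 𝒜.exists_point π (t := 0) (w := t) (by simpa using ht1)
    have hyL : y ∈ 𝒜.lSet π := (mem_lSet_iff hy).mpr (by rw [hyc]; rfl)
    obtain ⟨h2, h3, -⟩ := (𝒜.mem_dom π y).mp hy
    have h1 : 𝒜.lam y (π 1) ≠ 0 := by
      rw [lam_eq hy, lamPoly_one, hyc]
      simpa [ht] using h2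
    exact ⟨y, hyL, hy, (mem_dom_of_mem_lSet (π := swapMiddle π) (by rwa [lSet_swapMiddle])).mpr
      ⟨h1, h3⟩, (mem_dom_of_mem_lSet (π := swapOuter π) (by rwa [lSet_swapOuter])).mpr
      ⟨h2, h1⟩, hyc⟩
  have key1 : (lineEval 0 0 B).natDegree + (lineEval 0 0 B').rootMultiplicity 0 =
      d + 𝒜.ord A (𝒜.lCurve π) := by
    refine natDegree_add_rootMultiplicity hB0 hB0' (c := 1) one_ne_zero fun t ht ht1 => ?_
    obtain ⟨y, hyL, hy, hy', -, hyc⟩ := hpoint t ht ht1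
    have htr := eval_transition hA hB hB' (MvPolynomial.X 1) 1 (fun z hz hz' => by
      rw [show lChart π 0 = π from rfl] at hz ⊢
      rw [show lChart π 1 = swapMiddle π from rfl]
      have := coord_zero_eq hz (σ := swapMiddle π) ((𝒜.mem_dom π z).mp hz).1
      rw [swapMiddle_zero, swapMiddle_one, lamPoly_zero, lamPoly_two] at this
      rw [this]
      simp [mul_comm]) hy hy' (by simp)
    rw [← eval_lineEval ((h 0).2 y hy |>.mp (by rw [lCurve_pts]; exact hyL)),
      ← eval_lineEval ((h 1).2 y hy' |>.mp (by rw [lCurve_pts]; exact hyL))] at htr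
    have e0 : (𝒜.chart (lChart π 0)).coord y = ![0, t] := hyc
    have e1 : (𝒜.chart (lChart π 0)).coord y (0 + 1) = t := by rw [e0]; rfl
    have e2 : (𝒜.chart (lChart π 1)).coord y (0 + 1) = t⁻¹ := by
      change (𝒜.chart (swapMiddle π)).coord y 1 = _
      rw [coord_one_eq hy, swapMiddle_one, swapMiddle_two, lamPoly_two, lamPoly_one, hyc]
      simp
    rw [e1, e2] at htr
    rw [htr]
    have e3 : eval ((𝒜.chart (lChart π 0)).coord y) (lamPoly k (lChart π 0) (lChart π 1 2)) =
        t := by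
      change eval _ (lamPoly k π (π 1)) = _; rw [lamPoly_one, e0]; simp
    have e4 : eval (![0, t] : Fin 2 → k) (MvPolynomial.X 1) = t := by simp
    rw [e3, e0, e4, pow_add, map_one, div_one]
    ring
  have key2 : 𝒜.ord A (𝒜.lCurve π) + (lineEval 0 0 B).rootMultiplicity (-1) =
      (lineEval 0 0 B'').rootMultiplicity 0 := by
    refine rootMultiplicity_reflect hB0 hB0'' fun t ht ht1 => ?_
    obtain ⟨y, hyL, hy, -, hy', hyc⟩ := hpoint t ht ht1
    -- The first coordinate of the third chart is `lam (π 0) / lam (π 3) = -(t * w) / h`, and `h = 1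
    -- + w` on the curve.
    have htr := eval_transition hA hB hB'' (-MvPolynomial.X 1) (chartEqn k) (fun z hz hz' => by
      rw [show lChart π 0 = π from rfl] at hz ⊢
      rw [show lChart π 2 = swapOuter π from rfl]
      have := coord_zero_eq hz (σ := swapOuter π) ((𝒜.mem_dom π z).mp hz).2.1
      rw [swapOuter_zero, swapOuter_one, lamPoly_zero, lamPoly_three] at this
      have hne := chartEqn_ne_zero hz
      rw [this, map_neg, eval_chartEqn, map_mul, eval_X, eval_X, map_neg, eval_X]
      rw [div_neg, sub_zero, sub_zero, neg_mul, div_mul_cancel₀ _ hne]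
      ring) hy hy' (by
        have := chartEqn_ne_zero hy
        rwa [← eval_chartEqn] at this)
    rw [← eval_lineEval ((h 0).2 y hy |>.mp (by rw [lCurve_pts]; exact hyL)),
      ← eval_lineEval ((h 2).2 y hy' |>.mp (by rw [lCurve_pts]; exact hyL))] at htr
    have e0 : (𝒜.chart (lChart π 0)).coord y = ![0, t] := hyc
    have e1 : (𝒜.chart (lChart π 0)).coord y (0 + 1) = t := by rw [e0]; rfl
    have e2 : (𝒜.chart (lChart π 2)).coord y (0 + 1) = -(1 + t) := by
      change (𝒜.chart (swapOuter π)).coord y 1 = _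
      rw [coord_one_eq hy, swapOuter_one, swapOuter_two, lamPoly_three, lamPoly_two, hyc,
        map_neg, eval_chartEqn]
      simp
    rw [e1, e2] at htr
    rw [htr]
    have e3 : eval ((𝒜.chart (lChart π 0)).coord y) (lamPoly k (lChart π 0) (lChart π 2 2)) =
        1 := by
      change eval _ (lamPoly k π (π 2)) = _; rw [lamPoly_two]; simp
    have e4 : eval (![0, t] : Fin 2 → k) (chartEqn k) = 1 + t := by rw [eval_chartEqn]; simp
    rw [e3, e0, e4, div_pow]
    have := pow_ne_zero (𝒜.ord A (𝒜.lCurve π)) ht1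
    simp
    field_simp
  have key1' := congrArg (Nat.cast (R := ℤ)) key1
  have key2' := congrArg (Nat.cast (R := ℤ)) key2
  push_cast at key1' key2'
  linear_combination hsplit + key1' - key2'

end LinesAtlas

end

end ProjGeom

/-! ### Rationality of the curves, their indexing, and the divisors of linear forms -/

namespace ProjGeom

noncomputable section

universe u

open MvPolynomial

variable {k : Type u} [Field k] {ι : Type} {κ : ι → Type} {X : Set (MultiProj k κ)}

namespace LinesAtlas

variable [IsAlgClosed k] [IrreducibleSpace X]

section Rational

variable {𝒜 : LinesAtlas X} (π : Equiv.Perm (Fin 4))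

theorem gCurve_isSmoothRationalCurve : IsSmoothRationalCurve (𝒜.gCurve π) (-1) := by
  constructor
  · refine nonempty_varIso_projLine (fun i => 𝒜.chart (gChart π i)) (𝒜.gCurve_isLine π)
      (fun x => ![𝒜.ab x (π 0) (π 1), 𝒜.ab x (π 1) (π 0)]) ?_ ![![1, 0], ![0, 1]]
      ![![0, 1], ![1, 0]] ?_ ?_ ?_ ?_
    · intro x _ h
      exact (𝒜.ab_ne_zero x (π 0) (π 1) (by simp)).elim (fun h' => h' (congrFun h 0))
        (fun h' => h' (congrFun h 1))
    · intro j; fin_cases j <;> simp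
    · intro j x hx
      rw [gCurve_pts] at hx
      rw [𝒜.h_eq, lineEval_one_chartEqn]
      fin_cases j
      · have := mem_dom_of_mem_gSet hx
        simpa [gChart] using this
      · have := mem_dom_of_mem_gSet (𝒜 := 𝒜) (x := x) (π := swapFirst π) (by rwa [gSet_swapFirst])
        simpa [gChart] using this
    · intro j x hx hxd
      rw [𝒜.coord_eq]
      fin_cases j <;> simp [gChart]
    · intro w hw
      obtain ⟨a, b, rfl⟩ : ∃ a b, w = ![a, b] :=
        ⟨w 0, w 1, funext fun j => by fin_cases j <;> rfl⟩
      by_cases h : b = 0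
      · refine ⟨1, ?_, by rw [𝒜.h_eq, lineEval_one_chartEqn]; simp⟩
        intro h0
        have h0 : a = 0 := by simpa using h0
        exact hw (by rw [h, h0]; simp)
      · exact ⟨0, by simpa using h, by rw [𝒜.h_eq, lineEval_one_chartEqn]; simp⟩
  · obtain ⟨x, hx, -⟩ := 𝒜.exists_mem_gSet π
    exact (hasDegree_gCurve π).hasSelfIntersection (isNonzeroForm_X (π 0)) (isNonzeroForm_X (π 2))
      (ord_gCurve_X π) (ord_eq_zero (isNonzeroForm_X (π 2)) (x := x) (by rwa [gCurve_pts])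
        (by simpa using (lam_ne_zero_of_mem_gSet hx).1))

theorem mCurve_isSmoothRationalCurve : IsSmoothRationalCurve (𝒜.mCurve π) (-1) := by
  constructor
  · refine nonempty_varIso_projLine (fun i => 𝒜.chart (mChart π i)) (𝒜.mCurve_isLine π)
      (fun x => ![𝒜.lam x (π 1), 𝒜.lam x (π 2)]) ?_ ![![1, 0], ![0, 1]]
      ![![0, 1], ![1, 0]] ?_ ?_ ?_ ?_
    · intro x hx h
      rw [mCurve_pts] at hx
      have h1 : 𝒜.lam x (π 1) = 0 := congrFun h 0
      have h2 : 𝒜.lam x (π 2) = 0 := congrFun h 1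
      obtain ⟨i, hi⟩ := mSet_cover hx
      fin_cases i
      · exact ((𝒜.mem_dom _ x).mp hi).1 h2
      · exact ((𝒜.mem_dom _ x).mp hi).2.1 h1
    · intro j; fin_cases j <;> simp
    · intro j x hx
      rw [mCurve_pts] at hx
      rw [𝒜.h_eq, lineEval_neg_one_chartEqn]
      fin_cases j
      · have := mem_dom_of_mem_mSet hx
        simpa [mChart] using this
      · have := mem_dom_of_mem_mSet (𝒜 := 𝒜) (x := x) (π := swapPairs π) (by rwa [mSet_swapPairs])
        have h0 : 𝒜.lam x (π 0) = -𝒜.lam x (π 1) := eq_neg_of_add_eq_zero_left hx.1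
        simpa [mChart, h0] using this
    · intro j x hx hxd
      rw [mCurve_pts] at hx
      rw [𝒜.coord_eq]
      fin_cases j
      · simp [mChart]
      · have h0 : 𝒜.lam x (π 0) = -𝒜.lam x (π 1) := eq_neg_of_add_eq_zero_left hx.1
        have hs := 𝒜.lam_sum_perm π x
        have h3 : 𝒜.lam x (π 3) = -𝒜.lam x (π 2) := by linear_combination hs - hx.1
        simp [mChart, h0, h3, neg_div_neg_eq]
    · intro w hw
      obtain ⟨a, b, rfl⟩ : ∃ a b, w = ![a, b] :=
        ⟨w 0, w 1, funext fun j => by fin_cases j <;> rfl⟩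
      by_cases h : b = 0
      · refine ⟨1, ?_, by rw [𝒜.h_eq, lineEval_neg_one_chartEqn]; simp⟩
        intro h0
        have h0 : a = 0 := by simpa using h0
        exact hw (by rw [h, h0]; simp)
      · exact ⟨0, by simpa using h, by rw [𝒜.h_eq, lineEval_neg_one_chartEqn]; simp⟩
  · obtain ⟨x, hx, hx', -⟩ := 𝒜.exists_mem_mSet π
    exact (hasDegree_mCurve π).hasSelfIntersection (isNonzeroForm_X_add_X π)
      (isNonzeroForm_X (π 0)) (ord_mCurve_X_add_X π)
      (ord_eq_zero (isNonzeroForm_X (π 0)) (x := x) (by rwa [mCurve_pts])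
        (by simpa using hx' (π 0)))

theorem lCurve_isSmoothRationalCurve : IsSmoothRationalCurve (𝒜.lCurve π) (-2) := by
  constructor
  -- The three chart parameters on the line are `lam (π 1) / lam (π 2)`, its inverse and `lam (π 3)
  -- / lam (π 2)`, the last rewritten through `lam (π 3) = -lam (π 1) - lam (π 2)`.
  · refine nonempty_varIso_projLine (fun i => 𝒜.chart (lChart π i)) (𝒜.lCurve_isLine π)
      (fun x => ![𝒜.lam x (π 1), 𝒜.lam x (π 2)]) ?_ ![![1, 0], ![0, 1], ![-1, -1]]
      ![![0, 1], ![1, 0], ![0, 1]] ?_ ?_ ?_ ?_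
    · intro x hx h
      rw [lCurve_pts] at hx
      have h1 : 𝒜.lam x (π 1) = 0 := congrFun h 0
      have h2 : 𝒜.lam x (π 2) = 0 := congrFun h 1
      obtain ⟨i, hi⟩ := lSet_cover hx
      fin_cases i
      · exact ((𝒜.mem_dom _ x).mp hi).1 h2
      · exact ((𝒜.mem_dom _ x).mp hi).1 h1
      · exact ((𝒜.mem_dom _ x).mp hi).1 h2
    · intro j; fin_cases j <;> simp
    · intro j x hx
      rw [lCurve_pts] at hx
      rw [𝒜.h_eq, lineEval_zero_chartEqn]
      have hs := 𝒜.lam_sum_perm π x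
      rw [hx.1, zero_add] at hs
      have key : ∀ a b c : k, a + b + c = 0 → ((a ≠ 0 ∧ c ≠ 0) ↔ (a ≠ 0 ∧ 1 + b / a ≠ 0)) := by
        intro a b c habc
        refine and_congr_right fun ha => not_congr ?_
        have : 1 + b / a = -c / a := by field_simp; linear_combination habc
        rw [this, div_eq_zero_iff, neg_eq_zero, or_iff_left ha]
      fin_cases j
      · have h1 := mem_dom_of_mem_lSet hx
        rw [key (𝒜.lam x (π 2)) (𝒜.lam x (π 1)) (𝒜.lam x (π 3)) (by linear_combination hs)] at h1
        simpa [lChart] using h1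
      · have h1 := mem_dom_of_mem_lSet (𝒜 := 𝒜) (x := x) (π := swapMiddle π) (by rwa [lSet_swapMiddle])
        rw [swapMiddle_two, swapMiddle_three,
          key (𝒜.lam x (π 1)) (𝒜.lam x (π 2)) (𝒜.lam x (π 3)) (by linear_combination hs)] at h1
        simpa [lChart] using h1
      · have h1 := mem_dom_of_mem_lSet (𝒜 := 𝒜) (x := x) (π := swapOuter π) (by rwa [lSet_swapOuter])
        rw [swapOuter_two, swapOuter_three,
          key (𝒜.lam x (π 2)) (𝒜.lam x (π 3)) (𝒜.lam x (π 1)) (by linear_combination hs)] at h1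
        have h3 : 𝒜.lam x (π 3) = -𝒜.lam x (π 1) + -𝒜.lam x (π 2) := by linear_combination hs
        rw [h3] at h1
        simpa [lChart] using h1
    · intro j x hx hxd
      rw [lCurve_pts] at hx
      have hs := 𝒜.lam_sum_perm π x
      rw [hx.1, zero_add] at hs
      have h3 : 𝒜.lam x (π 3) = -𝒜.lam x (π 1) + -𝒜.lam x (π 2) := by linear_combination hs
      rw [𝒜.coord_eq]
      fin_cases j <;> simp [lChart, h3]
    · intro w hw
      obtain ⟨a, b, rfl⟩ : ∃ a b, w = ![a, b] :=
        ⟨w 0, w 1, funext fun j => by fin_cases j <;> rfl⟩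
      simp only [𝒜.h_eq, lineEval_zero_chartEqn]
      by_cases h : b = 0
      · have h0 : a ≠ 0 := by
          intro h0
          exact hw (by rw [h, h0]; simp)
        exact ⟨1, by simpa using h0, by simp [h]⟩
      · by_cases h' : a + b = 0
        · refine ⟨2, by simpa using h, ?_⟩
          have : -a + -b = 0 := by linear_combination -h'
          simp [this]
        · refine ⟨0, by simpa using h, ?_⟩
          have : 1 + a / b = (a + b) / b := by field_simp; ring
          simpa [this, h] using h'
  · obtain ⟨x, hx, hx'⟩ := 𝒜.exists_mem_lSet π
    exact (hasDegree_lCurve π).hasSelfIntersection (isNonzeroForm_X (π 0)) (isNonzeroForm_X (π 1))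
      (ord_lCurve_X π) (ord_eq_zero (isNonzeroForm_X (π 1)) (x := x) (by rwa [lCurve_pts])
        (by simpa using hx' (π 1) (by simp)))

end Rational

section Indexed

variable (𝒜 : LinesAtlas X)

/-- A permutation with prescribed first two values. -/
def permFirst (i j : Fin 4) : Equiv.Perm (Fin 4) :=
  -- The value for `i = j` is chosen only so that the first entry is always `i`.
  if h : i ≠ j then (exists_perm_first h).choose else Equiv.swap 0 i

theorem permFirst_zero (i j : Fin 4) : permFirst i j 0 = i := by
  unfold permFirst
  split_ifs with h
  · exact (exists_perm_first h).choose_spec.1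
  · exact Equiv.swap_apply_left 0 i

theorem permFirst_one {i j : Fin 4} (h : i ≠ j) : permFirst i j 1 = j := by
  unfold permFirst
  rw [dif_pos h]
  exact (exists_perm_first h).choose_spec.2

theorem perm_last_eq {π σ : Equiv.Perm (Fin 4)} (h0 : π 0 = σ 0) (h1 : π 1 = σ 1) :
    (π 2 = σ 2 ∧ π 3 = σ 3) ∨ (π 2 = σ 3 ∧ π 3 = σ 2) := by
  have h2 := perm_cases σ (π 2)
  have h3 := perm_cases σ (π 3)
  rw [← h0, ← h1] at h2 h3
  simp only [EmbeddingLike.apply_eq_iff_eq, Fin.reduceEq, false_or] at h2 h3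
  rcases h2 with h2 | h2 <;> rcases h3 with h3 | h3
  · exact absurd (h2.trans h3.symm) (by simp)
  · exact Or.inl ⟨h2, h3⟩
  · exact Or.inr ⟨h2, h3⟩
  · exact absurd (h2.trans h3.symm) (by simp)

/-- The exceptional curve over the intersection point of the lines `i` and `j`. -/
def G (i j : Fin 4) : PrimeDivisor X := 𝒜.gCurve (permFirst i j)

/-- The proper transform of the line joining the intersection point of the lines `i` and `j` with
the opposite one. -/
def M (i j : Fin 4) : PrimeDivisor X := 𝒜.mCurve (permFirst i j)

/-- The proper transform of the line `i`. -/
def L (i : Fin 4) : PrimeDivisor X := 𝒜.lCurve (Equiv.swap 0 i)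

variable {𝒜}

theorem G_pts {i j : Fin 4} (h : i ≠ j) : (𝒜.G i j).pts = {x | 𝒜.lam x i = 0 ∧ 𝒜.lam x j = 0} := by
  rw [G, gCurve_pts, gSet, permFirst_zero, permFirst_one h]

/-- A prime divisor is determined by its points, so the chosen permutation does not matter. -/
theorem G_perm (π : Equiv.Perm (Fin 4)) : 𝒜.G (π 0) (π 1) = 𝒜.gCurve π :=
  PrimeDivisor.pts_injective (by rw [G_pts (by simp), gCurve_pts, gSet])

theorem G_comm {i j : Fin 4} (h : i ≠ j) : 𝒜.G i j = 𝒜.G j i :=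
  PrimeDivisor.pts_injective (by
    rw [G_pts h, G_pts h.symm]; ext x; exact and_comm)

theorem M_perm (π : Equiv.Perm (Fin 4)) : 𝒜.M (π 0) (π 1) = 𝒜.mCurve π :=
  PrimeDivisor.pts_injective (by
    have h0 := permFirst_zero (π 0) (π 1)
    have h1 := permFirst_one (i := π 0) (j := π 1) (by simp)
    rw [M, mCurve_pts, mCurve_pts, mSet, mSet, h0, h1]
    rcases perm_last_eq h0 h1 with ⟨h2, h3⟩ | ⟨h2, h3⟩
    · rw [h2, h3]
    · rw [h2, h3]
      ext x
      simp only [Set.mem_ofPred_eq, add_comm (𝒜.ab x (π 3) (π 2))])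

theorem L_perm (π : Equiv.Perm (Fin 4)) : 𝒜.L (π 0) = 𝒜.lCurve π :=
  PrimeDivisor.pts_injective (by
    have key : ∀ σ : Equiv.Perm (Fin 4), 𝒜.lSet σ =
        {x | 𝒜.lam x (σ 0) = 0 ∧ ∀ i, i ≠ σ 0 → 𝒜.ab x (σ 0) i = 0} := by
      intro σ
      ext x
      constructor
      · rintro ⟨h0, h1, h2, h3⟩
        refine ⟨h0, fun i hi => ?_⟩
        rcases perm_cases σ i with rfl | rfl | rfl | rfl
        · exact absurd rfl hi
        all_goals assumption
      · rintro ⟨h0, h⟩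
        exact ⟨h0, h _ (by simp), h _ (by simp), h _ (by simp)⟩
    rw [L, lCurve_pts, lCurve_pts, key, key, Equiv.swap_apply_left])

theorem M_swapPairs (π : Equiv.Perm (Fin 4)) : 𝒜.M (π 2) (π 3) = 𝒜.M (π 0) (π 1) := by
  have h := 𝒜.M_perm (swapPairs π)
  rw [swapPairs_zero, swapPairs_one] at h
  rw [h, M_perm]
  exact PrimeDivisor.pts_injective (by rw [mCurve_pts, mCurve_pts, mSet_swapPairs])

theorem M_comm (π : Equiv.Perm (Fin 4)) : 𝒜.M (π 1) (π 0) = 𝒜.M (π 0) (π 1) := by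
  have h := 𝒜.M_perm (swapFirst π)
  rw [swapFirst_zero, swapFirst_one] at h
  rw [h, M_perm]
  refine PrimeDivisor.pts_injective ?_
  rw [mCurve_pts, mCurve_pts, mSet, mSet]
  ext x
  simp only [swapFirst_zero, swapFirst_one, swapFirst_two, swapFirst_three, Set.mem_ofPred_eq,
    add_comm (𝒜.lam x (π 1)), add_comm (𝒜.ab x (π 1) (π 0))]

variable (π : Equiv.Perm (Fin 4))

theorem G_zero_two : 𝒜.G (π 0) (π 2) = 𝒜.gCurve (swapMiddle π) := 𝒜.G_perm (swapMiddle π)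

theorem G_zero_three : 𝒜.G (π 0) (π 3) = 𝒜.gCurve (swapOuter π) := 𝒜.G_perm (swapOuter π)

theorem G_two_three : 𝒜.G (π 2) (π 3) = 𝒜.gCurve (swapPairs π) := 𝒜.G_perm (swapPairs π)

/-! ### Disjointness and distinctness -/

omit [IsAlgClosed k] [IrreducibleSpace X] in
theorem lam_three {x : X} (π : Equiv.Perm (Fin 4)) (h0 : 𝒜.lam x (π 0) = 0)
    (h1 : 𝒜.lam x (π 1) = 0) (h2 : 𝒜.lam x (π 2) = 0) : False := by
  have hs := 𝒜.lam_sum_perm π x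
  rw [h0, h1, h2, add_zero, add_zero, zero_add] at hs
  obtain ⟨i, hi⟩ := 𝒜.lam_ne_zero x
  rcases perm_cases π i with rfl | rfl | rfl | rfl <;> contradiction

theorem G_disjoint_middle {x : X} (hx : x ∈ (𝒜.G (π 0) (π 1)).pts)
    (hx' : x ∈ (𝒜.G (π 0) (π 2)).pts) : False := by
  rw [G_pts (by simp)] at hx hx'
  exact lam_three π hx.1 hx.2 hx'.2

theorem G_disjoint_opposite {x : X} (hx : x ∈ (𝒜.G (π 0) (π 1)).pts)
    (hx' : x ∈ (𝒜.G (π 2) (π 3)).pts) : False := by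
  rw [G_pts (by simp)] at hx hx'
  exact lam_three π hx.1 hx.2 hx'.1

theorem L_disjoint {x : X} (hx : x ∈ (𝒜.L (π 0)).pts) (hx' : x ∈ (𝒜.L (π 1)).pts) : False := by
  have h' := 𝒜.L_perm (swapFirst π)
  rw [swapFirst_zero] at h'
  rw [L_perm, lCurve_pts] at hx
  rw [h', lCurve_pts] at hx'
  have h1 := hx'.2.1
  rw [swapFirst_zero, swapFirst_one] at h1
  exact (𝒜.ab_ne_zero x (π 0) (π 1) (by simp)).elim (fun h => h hx.2.1) (fun h => h h1)

theorem L_G_disjoint {x : X} (hx : x ∈ (𝒜.L (π 0)).pts) (hx' : x ∈ (𝒜.G (π 1) (π 2)).pts) :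
    False := by
  rw [L_perm, lCurve_pts] at hx
  rw [G_pts (by simp)] at hx'
  exact lam_three π hx.1 hx'.1 hx'.2

/-- The generic point of each curve lies on the expected lines only. -/
theorem exists_mem_G {i j : Fin 4} (h : i ≠ j) :
    ∃ x ∈ (𝒜.G i j).pts, ∀ l, 𝒜.lam x l = 0 ↔ l = i ∨ l = j := by
  obtain ⟨π, rfl, rfl⟩ := exists_perm_first h
  obtain ⟨x, hx, -⟩ := 𝒜.exists_mem_gSet π
  refine ⟨x, by rwa [G_perm, gCurve_pts], fun l => ?_⟩
  obtain ⟨h2, h3⟩ := lam_ne_zero_of_mem_gSet hx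
  rcases perm_cases π l with rfl | rfl | rfl | rfl
  · simpa using hx.1
  · simpa using hx.2
  · simpa using h2
  · simpa using h3

theorem exists_mem_L (i : Fin 4) : ∃ x ∈ (𝒜.L i).pts, ∀ l, 𝒜.lam x l = 0 ↔ l = i := by
  obtain ⟨x, hx, hx'⟩ := 𝒜.exists_mem_lSet (Equiv.swap 0 i)
  rw [Equiv.swap_apply_left] at hx'
  refine ⟨x, by rwa [L, lCurve_pts], fun l => ⟨fun h => by_contra fun h' => hx' l h' h, ?_⟩⟩
  rintro rfl
  have := hx.1
  rwa [Equiv.swap_apply_left] at this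

theorem G_ne_L {i j l : Fin 4} (h : i ≠ j) : 𝒜.G i j ≠ 𝒜.L l := by
  intro heq
  obtain ⟨x, hx, hx'⟩ := exists_mem_L (𝒜 := 𝒜) l
  rw [← heq, G_pts h] at hx
  exact h (((hx' i).mp hx.1).trans ((hx' j).mp hx.2).symm)

theorem G_ne_M (π : Equiv.Perm (Fin 4)) {i j : Fin 4} (h : i ≠ j) : 𝒜.G i j ≠ 𝒜.M (π 0) (π 1) := by
  intro heq
  obtain ⟨x, hx, hx', -⟩ := 𝒜.exists_mem_mSet π
  rw [← mCurve_pts, ← M_perm, ← heq, G_pts h] at hx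
  exact hx' i hx.1

theorem L_ne_M (π : Equiv.Perm (Fin 4)) (i : Fin 4) : 𝒜.L i ≠ 𝒜.M (π 0) (π 1) := by
  intro heq
  obtain ⟨x, hx, hx', -⟩ := 𝒜.exists_mem_mSet π
  rw [← mCurve_pts, ← M_perm, ← heq, L, lCurve_pts] at hx
  exact hx' _ hx.1

theorem L_injective : Function.Injective 𝒜.L := by
  intro i j h
  obtain ⟨x, hx, hx'⟩ := exists_mem_L (𝒜 := 𝒜) j
  rw [← h, L, lCurve_pts] at hx
  have := hx.1
  rw [Equiv.swap_apply_left, hx'] at this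
  exact this

theorem G_eq_iff {i j p q : Fin 4} (h : i ≠ j) (h' : p ≠ q) :
    𝒜.G i j = 𝒜.G p q ↔ (i = p ∧ j = q) ∨ (i = q ∧ j = p) := by
  constructor
  · intro heq
    obtain ⟨x, hx, hx'⟩ := exists_mem_G (𝒜 := 𝒜) h'
    rw [← heq, G_pts h] at hx
    have h1 := (hx' i).mp hx.1
    have h2 := (hx' j).mp hx.2
    rcases h1 with rfl | rfl <;> rcases h2 with rfl | rfl <;> simp_all
  · rintro (⟨rfl, rfl⟩ | ⟨rfl, rfl⟩)
    · rfl
    · exact G_comm h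

theorem M_ne_middle : 𝒜.M (π 0) (π 1) ≠ 𝒜.M (π 0) (π 2) := by
  intro heq
  obtain ⟨x, hx, -, hx', -⟩ := 𝒜.exists_mem_mSet π
  have h' := 𝒜.M_perm (swapMiddle π)
  rw [swapMiddle_zero, swapMiddle_one] at h'
  rw [← mCurve_pts, ← M_perm, heq, h', mCurve_pts] at hx
  exact hx' hx.1

/-! ### Divisors of linear forms -/

/-- At a zero of the form `π 0` outside the proper transform, some pencil coordinate `ab (π 0) i` is
nonzero; the relation then forces `lam i = 0`, so the point lies on an exceptional curve. All
multiplicities are one by the local equations. -/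
theorem div_X : div (isNonzeroForm_X (𝒜 := 𝒜) (π 0)) = (𝒜.L (π 0)).toDivisor +
    (𝒜.G (π 0) (π 1)).toDivisor + (𝒜.G (π 0) (π 2)).toDivisor + (𝒜.G (π 0) (π 3)).toDivisor := by
  classical
  have h1 : 𝒜.L (π 0) ∉ ({𝒜.G (π 0) (π 1), 𝒜.G (π 0) (π 2), 𝒜.G (π 0) (π 3)} : Finset _) := by
    simp only [Finset.mem_insert, Finset.mem_singleton, not_or]
    exact ⟨(G_ne_L (by simp)).symm, (G_ne_L (by simp)).symm, (G_ne_L (by simp)).symm⟩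
  have h2 : 𝒜.G (π 0) (π 1) ∉ ({𝒜.G (π 0) (π 2), 𝒜.G (π 0) (π 3)} : Finset _) := by
    simp [G_eq_iff]
  have h3 : 𝒜.G (π 0) (π 2) ∉ ({𝒜.G (π 0) (π 3)} : Finset _) := by
    simp [G_eq_iff]
  rw [div_eq_sum (isNonzeroForm_X (π 0))
    (s := {𝒜.L (π 0), 𝒜.G (π 0) (π 1), 𝒜.G (π 0) (π 2), 𝒜.G (π 0) (π 3)}),
    Finset.sum_insert h1, Finset.sum_insert h2, Finset.sum_insert h3, Finset.sum_singleton]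
  · abel
  · intro x hx
    rw [eval_X] at hx
    by_cases h : x ∈ (𝒜.L (π 0)).pts
    · exact ⟨_, by simp, h⟩
    · have : ∃ i, i ≠ π 0 ∧ 𝒜.lam x i = 0 := by
        by_contra! hcon
        refine h ?_
        rw [L_perm, lCurve_pts]
        have key : ∀ i, i ≠ π 0 → 𝒜.ab x (π 0) i = 0 := fun i hi => by
          have r := 𝒜.rel x (π 0) i hi.symm
          rw [hx, zero_mul, eq_comm, mul_eq_zero] at r
          exact r.resolve_left (hcon i hi)
        exact ⟨hx, key _ (by simp), key _ (by simp), key _ (by simp)⟩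
      obtain ⟨i, hi, hi0⟩ := this
      refine ⟨𝒜.G (π 0) i, ?_, by rw [G_pts hi.symm]; exact ⟨hx, hi0⟩⟩
      rcases perm_cases π i with rfl | rfl | rfl | rfl
      · exact absurd rfl hi
      all_goals simp
  · intro C hC
    simp only [Finset.mem_insert, Finset.mem_singleton] at hC
    rcases hC with rfl | rfl | rfl | rfl
    · rw [L_perm]; exact ord_lCurve_X π
    · rw [G_perm]; exact ord_gCurve_X π
    · rw [G_zero_two]; exact ord_gCurve_X (swapMiddle π)
    · rw [G_zero_three]; exact ord_gCurve_X (swapOuter π)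

/-- The diagonal passes through two opposite vertices. Off their exceptional curves `lam (π 0)` and
`lam (π 2)` do not vanish, and cancelling them in the relations gives the conditions on the pencils.
-/
theorem div_X_add_X : div (isNonzeroForm_X_add_X (𝒜 := 𝒜) π) = (𝒜.M (π 0) (π 1)).toDivisor +
    (𝒜.G (π 0) (π 1)).toDivisor + (𝒜.G (π 2) (π 3)).toDivisor := by
  classical
  have h1 : 𝒜.M (π 0) (π 1) ∉ ({𝒜.G (π 0) (π 1), 𝒜.G (π 2) (π 3)} : Finset _) := by
    simp only [Finset.mem_insert, Finset.mem_singleton, not_or]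
    exact ⟨(G_ne_M π (by simp)).symm, (G_ne_M π (by simp)).symm⟩
  have h2 : 𝒜.G (π 0) (π 1) ∉ ({𝒜.G (π 2) (π 3)} : Finset _) := by
    simp [G_eq_iff]
  rw [div_eq_sum (isNonzeroForm_X_add_X π)
    (s := {𝒜.M (π 0) (π 1), 𝒜.G (π 0) (π 1), 𝒜.G (π 2) (π 3)}),
    Finset.sum_insert h1, Finset.sum_insert h2, Finset.sum_singleton]
  · abel
  · intro x hx
    rw [map_add, eval_X, eval_X] at hx
    have hs := 𝒜.lam_sum_perm π x
    by_cases hG : x ∈ (𝒜.G (π 0) (π 1)).pts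
    · exact ⟨_, by simp, hG⟩
    by_cases hG' : x ∈ (𝒜.G (π 2) (π 3)).pts
    · exact ⟨_, by simp, hG'⟩
    refine ⟨𝒜.M (π 0) (π 1), by simp, ?_⟩
    rw [G_pts (by simp)] at hG hG'
    rw [M_perm, mCurve_pts]
    have r1 := 𝒜.rel x (π 0) (π 1) (by simp)
    have r2 := 𝒜.rel x (π 2) (π 3) (by simp)
    have e1 : 𝒜.lam x (π 1) = -𝒜.lam x (π 0) := by linear_combination hx
    have e3 : 𝒜.lam x (π 3) = -𝒜.lam x (π 2) := by linear_combination hs - hx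
    have h0 : 𝒜.lam x (π 0) ≠ 0 := fun h => hG ⟨h, by rw [e1, h, neg_zero]⟩
    have h2 : 𝒜.lam x (π 2) ≠ 0 := fun h => hG' ⟨h, by rw [e3, h, neg_zero]⟩
    refine ⟨hx, mul_left_cancel₀ h0 ?_, mul_left_cancel₀ h2 ?_⟩
    · linear_combination r1 + 𝒜.ab x (π 0) (π 1) * e1
    · linear_combination r2 + 𝒜.ab x (π 2) (π 3) * e3
  · intro C hC
    simp only [Finset.mem_insert, Finset.mem_singleton] at hC
    rcases hC with rfl | rfl | rfl
    · rw [M_perm]; exact ord_mCurve_X_add_X π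
    · rw [G_perm]; exact ord_gCurve_X_add_X π
    · rw [G_two_three]; exact ord_gCurve_swapPairs_X_add_X π

end Indexed

end LinesAtlas

end

end ProjGeom

/-! ### Intersection numbers, and forms cutting out a given curve -/

namespace ProjGeom

noncomputable section

universe u

open MvPolynomial

/-- Exchange of the last two indices. -/
def swapLast (π : Equiv.Perm (Fin 4)) : Equiv.Perm (Fin 4) := π * Equiv.swap 2 3

section

variable (π : Equiv.Perm (Fin 4))

@[simp] theorem swapLast_zero : swapLast π 0 = π 0 := rfl
@[simp] theorem swapLast_one : swapLast π 1 = π 1 := rfl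
@[simp] theorem swapLast_two : swapLast π 2 = π 3 := rfl
@[simp] theorem swapLast_three : swapLast π 3 = π 2 := rfl

end

variable {k : Type u} [Field k] {ι : Type} {κ : ι → Type} {X : Set (MultiProj k κ)}

theorem degreeOn_toDivisor_nonneg {C Z : PrimeDivisor X} (n : ℤ) (h : Z ≠ C) :
    0 ≤ degreeOn C n Z.toDivisor := by
  rw [degreeOn_toDivisor n h]
  exact intersectionNumber_nonneg Z C

theorem degreeOn_toDivisor_eq_zero {C Z : PrimeDivisor X} (n : ℤ) (hne : Z ≠ C)
    (h : ∀ x ∈ Z.pts, x ∉ C.pts) : degreeOn C n Z.toDivisor = 0 := by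
  rw [degreeOn_toDivisor n hne, intersectionNumber_eq_zero h]

namespace LinesAtlas

variable [IsAlgClosed k] [IrreducibleSpace X] {𝒜 : LinesAtlas X} (π : Equiv.Perm (Fin 4))

theorem hasDegree_G : 𝒜.HasDegree (𝒜.G (π 0) (π 1)) 0 (-1) := by
  rw [G_perm]; exact hasDegree_gCurve π

theorem hasDegree_L : 𝒜.HasDegree (𝒜.L (π 0)) 1 (-2) := by
  rw [L_perm]; exact hasDegree_lCurve π

/-! ### The intersection numbers of the curves -/

theorem degreeOn_L_L : degreeOn (𝒜.L (π 0)) (-2) (𝒜.L (π 1)).toDivisor = 0 :=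
  degreeOn_toDivisor_eq_zero _ (fun h => by simpa using L_injective h)
    fun _ hx hx' => L_disjoint π hx' hx

theorem degreeOn_L_G_disjoint : degreeOn (𝒜.L (π 0)) (-2) (𝒜.G (π 1) (π 2)).toDivisor = 0 :=
  degreeOn_toDivisor_eq_zero _ (G_ne_L (by simp)) fun _ hx hx' => L_G_disjoint π hx' hx

/-- No local computation is needed: the form `π 1` has degree one on `L (π 0)`, and of the four
components of its divisor only `G (π 0) (π 1)` meets this curve. -/
theorem degreeOn_L_G : degreeOn (𝒜.L (π 0)) (-2) (𝒜.G (π 0) (π 1)).toDivisor = 1 := by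
  have h := hasDegree_L (𝒜 := 𝒜) π _ _ (isNonzeroForm_X (swapFirst π 0))
  have h1 := degreeOn_L_L (𝒜 := 𝒜) π
  have h2 := degreeOn_L_G_disjoint (𝒜 := 𝒜) π
  have h3 := degreeOn_L_G_disjoint (𝒜 := 𝒜) (swapLast π)
  simp only [swapLast_zero, swapLast_one, swapLast_two] at h3
  rw [div_X, map_add, map_add, map_add] at h
  simp only [swapFirst_zero, swapFirst_one, swapFirst_two, swapFirst_three] at h
  rw [G_comm (by simp)]
  push_cast at h
  linarith

theorem degreeOn_G_L : degreeOn (𝒜.G (π 0) (π 1)) (-1) (𝒜.L (π 0)).toDivisor = 1 := by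
  rw [degreeOn_toDivisor _ (G_ne_L (by simp)).symm, intersectionNumber_comm,
    ← degreeOn_toDivisor (-2) (G_ne_L (by simp)), degreeOn_L_G]

theorem degreeOn_G_L' : degreeOn (𝒜.G (π 0) (π 1)) (-1) (𝒜.L (π 1)).toDivisor = 1 := by
  have := degreeOn_G_L (𝒜 := 𝒜) (swapFirst π)
  rwa [swapFirst_zero, swapFirst_one, G_comm (by simp)] at this

theorem degreeOn_G_L_disjoint : degreeOn (𝒜.G (π 0) (π 1)) (-1) (𝒜.L (π 2)).toDivisor = 0 := by
  rw [degreeOn_toDivisor _ (G_ne_L (by simp)).symm, intersectionNumber_comm,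
    ← degreeOn_toDivisor (-2) (G_ne_L (by simp))]
  have h := degreeOn_L_G_disjoint (𝒜 := 𝒜) (swapFirst (swapMiddle π))
  have e1 : swapFirst (swapMiddle π) 0 = π 2 := rfl
  have e2 : swapFirst (swapMiddle π) 1 = π 0 := rfl
  have e3 : swapFirst (swapMiddle π) 2 = π 1 := rfl
  rwa [e1, e2, e3] at h

theorem degreeOn_G_middle : degreeOn (𝒜.G (π 0) (π 1)) (-1) (𝒜.G (π 0) (π 2)).toDivisor = 0 :=
  degreeOn_toDivisor_eq_zero _ (by simp [G_eq_iff]) fun _ hx hx' => G_disjoint_middle π hx' hx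

theorem degreeOn_G_opposite : degreeOn (𝒜.G (π 0) (π 1)) (-1) (𝒜.G (π 2) (π 3)).toDivisor = 0 :=
  degreeOn_toDivisor_eq_zero _ (by simp [G_eq_iff]) fun _ hx hx' => G_disjoint_opposite π hx' hx

theorem degreeOn_G_middle' :
    degreeOn (𝒜.G (π 0) (π 1)) (-1) (𝒜.G (π 1) (π 2)).toDivisor = 0 := by
  have := degreeOn_G_middle (𝒜 := 𝒜) (swapFirst π)
  rwa [swapFirst_zero, swapFirst_one, swapFirst_two, G_comm (i := π 1) (j := π 0) (by simp)] at this

/-! ### The relations between the classes of a curve and of the thirteen curves -/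

theorem div_eq_sum_ord {A : MvPolynomial (Fin 4) k} {d : ℕ} (hA : 𝒜.IsNonzeroForm A d)
    {s : Finset (PrimeDivisor X)} (hs : ∀ Z, 𝒜.ord A Z ≠ 0 → Z ∈ s) :
    div hA = ∑ C ∈ s, (𝒜.ord A C : ℤ) • C.toDivisor := by
  classical
  refine Finsupp.ext fun Z => ?_
  rw [div_apply, Finsupp.finsetSum_apply]
  simp only [PrimeDivisor.toDivisor, Finsupp.smul_single, Finsupp.single_apply, smul_eq_mul, mul_one]
  rw [Finset.sum_ite_eq' s Z]
  split_ifs with h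
  · rfl
  · have := mt (hs Z) h
    rw [not_not] at this
    rw [this]; rfl

theorem eq_of_ord_X_ne_zero {Z : PrimeDivisor X} (h : 𝒜.ord (MvPolynomial.X (π 0)) Z ≠ 0) :
    Z = 𝒜.L (π 0) ∨ ∃ i j, i ≠ j ∧ Z = 𝒜.G i j := by
  classical
  by_contra! hcon
  have h1 := congrArg (fun D : Divisor X => D Z) (div_X (𝒜 := 𝒜) π)
  simp only [div_apply, Finsupp.add_apply, PrimeDivisor.toDivisor, Finsupp.single_apply] at h1
  rw [if_neg hcon.1.symm, if_neg (hcon.2 _ _ (by simp)).symm, if_neg (hcon.2 _ _ (by simp)).symm,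
    if_neg (hcon.2 _ _ (by simp)).symm] at h1
  exact h (by exact_mod_cast h1)

theorem ord_X_eq_zero {Z : PrimeDivisor X} (hG : ∀ i j, i ≠ j → Z ≠ 𝒜.G i j)
    (hL : ∀ i, Z ≠ 𝒜.L i) (i : Fin 4) : 𝒜.ord (MvPolynomial.X i) Z = 0 := by
  by_contra h
  have h' : 𝒜.ord (MvPolynomial.X (Equiv.swap 0 i 0)) Z ≠ 0 := by
    rwa [Equiv.swap_apply_left]
  rcases eq_of_ord_X_ne_zero _ h' with h1 | ⟨p, q, hpq, h1⟩
  · exact hL _ h1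
  · exact hG _ _ hpq h1

theorem exists_lam_ne_zero_of_ne {Z : PrimeDivisor X} (hG : ∀ i j, i ≠ j → Z ≠ 𝒜.G i j)
    (hL : ∀ i, Z ≠ 𝒜.L i) (i : Fin 4) : ∃ x ∈ Z.pts, 𝒜.lam x i ≠ 0 := by
  have h := ord_X_eq_zero hG hL i
  by_contra! hcon
  exact (ord_ne_zero_iff (isNonzeroForm_X i)).mpr (fun x hx => by rw [eval_X]; exact hcon x hx) h

/-- No linear form `lam i` vanishes identically on such a `Z`, since the components of its divisor
are among the `G` and `L`. By irreducibility some point of `Z` avoids the forms `π 1`, `π 2` and `π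
3` at once. -/
theorem meets_dom {Z : PrimeDivisor X} (hG : ∀ i j, i ≠ j → Z ≠ 𝒜.G i j) (hL : ∀ i, Z ≠ 𝒜.L i) :
    ((𝒜.chart π).dom ∩ Z.pts).Nonempty := by
  have hopen : ∀ i, IsOpen {x | 𝒜.lam x i ≠ 0} := fun i => by
    simpa using 𝒜.isOpen_lam (Pi.single i 1)
  have hne : ∀ i, (Z.pts ∩ {x | 𝒜.lam x i ≠ 0}).Nonempty := fun i => by
    obtain ⟨x, hx, h⟩ := exists_lam_ne_zero_of_ne hG hL i
    exact ⟨x, hx, h⟩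
  have h12 := Z.isIrreducible.2 _ _ (hopen (π 1)) (hopen (π 2)) (hne _) (hne _)
  obtain ⟨x, hx, ⟨h1, h2⟩, h3⟩ := Z.isIrreducible.2 _ _ ((hopen (π 1)).inter (hopen (π 2)))
    (hopen (π 3)) h12 (hne _)
  exact ⟨x, (𝒜.mem_dom π x).mpr ⟨h2, h3, 𝒜.ab_ne_zero_of_lam (by simp) h1⟩, hx⟩

/-- A form vanishing, apart from the exceptional curves and the four lines, only on `Z`. -/
theorem exists_form_vanishing {Z : PrimeDivisor X} (hG : ∀ i j, i ≠ j → Z ≠ 𝒜.G i j)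
    (hL : ∀ i, Z ≠ 𝒜.L i) : ∃ (d : ℕ) (A : MvPolynomial (Fin 4) k) (_ : 𝒜.IsNonzeroForm A d),
      𝒜.ord A Z ≠ 0 ∧ ∀ W, 𝒜.ord A W ≠ 0 →
        W = Z ∨ (∃ i j, i ≠ j ∧ W = 𝒜.G i j) ∨ ∃ i, W = 𝒜.L i := by
  have hm := meets_dom (1 : Equiv.Perm (Fin 4)) hG hL
  set q := (𝒜.chart 1).eqn Z with hq
  have hqp : Prime q := ((𝒜.chart 1).eqn_spec hm).1
  -- The form equals `w ^ K * q` in one chart. Every prime divisor other than the `G` and `L` meets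
  -- that chart and does not divide `w`, so it can only be the divisor of `q`, which is `Z`.
  obtain ⟨K, hK⟩ := exists_form (1 : Equiv.Perm (Fin 4)) q
  obtain ⟨A, hA, hAl⟩ := hK K le_rfl
  have hAn : 𝒜.IsNonzeroForm A (2 * K) := isNonzeroForm_of_localForm hA 1 (by
    rw [hAl]; exact mul_ne_zero (pow_ne_zero _ (X_ne_zero _)) hqp.ne_zero)
  refine ⟨2 * K, A, hAn, ?_, fun W hW => ?_⟩
  · rw [ord_eq_multiplicity hAn hm, hAl, multiplicity_ne_zero]
    exact dvd_mul_left _ _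
  · by_contra! hcon
    obtain ⟨hWZ, hWG, hWL⟩ := hcon
    have hmW := meets_dom (1 : Equiv.Perm (Fin 4)) hWG hWL
    rw [ord_eq_multiplicity hAn hmW, hAl, multiplicity_ne_zero] at hW
    have hWp := ((𝒜.chart 1).eqn_spec hmW).1
    rcases hWp.dvd_or_dvd hW with h | h
    · have h1 := hWp.dvd_of_dvd_pow h
      have h2 := ord_X_eq_zero hWG hWL ((1 : Equiv.Perm (Fin 4)) 1)
      rw [ord_eq_multiplicity (isNonzeroForm_X _) hmW, localForm_X, lamPoly_one,
        multiplicity_eq_zero] at h2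
      exact h2 h1
    · exact hWZ ((𝒜.chart 1).eq_of_dvd hmW hm h)

theorem div_eq_of_vanishing {Z : PrimeDivisor X} (hG : ∀ i j, i ≠ j → Z ≠ 𝒜.G i j)
    (hL : ∀ i, Z ≠ 𝒜.L i) {A : MvPolynomial (Fin 4) k} {d : ℕ} (hA : 𝒜.IsNonzeroForm A d)
    (hv : ∀ W, 𝒜.ord A W ≠ 0 → W = Z ∨ (∃ i j, i ≠ j ∧ W = 𝒜.G i j) ∨ ∃ i, W = 𝒜.L i) :
    div hA = (𝒜.ord A Z : ℤ) • Z.toDivisor +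
      ((𝒜.ord A (𝒜.L (π 0)) : ℤ) • (𝒜.L (π 0)).toDivisor +
      (𝒜.ord A (𝒜.L (π 1)) : ℤ) • (𝒜.L (π 1)).toDivisor +
      (𝒜.ord A (𝒜.L (π 2)) : ℤ) • (𝒜.L (π 2)).toDivisor +
      (𝒜.ord A (𝒜.L (π 3)) : ℤ) • (𝒜.L (π 3)).toDivisor) +
      ((𝒜.ord A (𝒜.G (π 0) (π 1)) : ℤ) • (𝒜.G (π 0) (π 1)).toDivisor +
      (𝒜.ord A (𝒜.G (π 0) (π 2)) : ℤ) • (𝒜.G (π 0) (π 2)).toDivisor +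
      (𝒜.ord A (𝒜.G (π 0) (π 3)) : ℤ) • (𝒜.G (π 0) (π 3)).toDivisor +
      (𝒜.ord A (𝒜.G (π 1) (π 2)) : ℤ) • (𝒜.G (π 1) (π 2)).toDivisor +
      (𝒜.ord A (𝒜.G (π 1) (π 3)) : ℤ) • (𝒜.G (π 1) (π 3)).toDivisor +
      (𝒜.ord A (𝒜.G (π 2) (π 3)) : ℤ) • (𝒜.G (π 2) (π 3)).toDivisor) := by
  classical
  have hLG : ∀ (l : Fin 4) {i j : Fin 4}, i ≠ j → 𝒜.L l ≠ 𝒜.G i j := fun l i j h => (G_ne_L h).symm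
  have hZG : ∀ i j : Fin 4, i ≠ j → (Z = 𝒜.G i j) = False := fun i j h => eq_false (hG i j h)
  have hZL : ∀ i : Fin 4, (Z = 𝒜.L i) = False := fun i => eq_false (hL i)
  have h := div_eq_sum_ord hA (s := {Z, 𝒜.L (π 0), 𝒜.L (π 1), 𝒜.L (π 2), 𝒜.L (π 3),
    𝒜.G (π 0) (π 1), 𝒜.G (π 0) (π 2), 𝒜.G (π 0) (π 3), 𝒜.G (π 1) (π 2), 𝒜.G (π 1) (π 3),
    𝒜.G (π 2) (π 3)}) (by
      intro W hW
      rcases hv W hW with rfl | ⟨i, j, hij, rfl⟩ | ⟨i, rfl⟩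
      · simp
      · rcases perm_cases π i with rfl | rfl | rfl | rfl <;>
          rcases perm_cases π j with rfl | rfl | rfl | rfl <;>
          first
          | exact absurd rfl hij
          | simp; done
          | (rw [G_comm hij]; simp)
      · rcases perm_cases π i with rfl | rfl | rfl | rfl <;> simp)
  rw [h]
  repeat rw [Finset.sum_insert]
  · rw [Finset.sum_singleton]
    abel
  all_goals
    simp only [Finset.mem_insert, Finset.mem_singleton, not_or]
    simp [G_eq_iff, L_injective.eq_iff, hLG, hG, hL]

end LinesAtlas

end

end ProjGeom

/-! ### Convex geometry of the cone -/

namespace ProjGeom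

noncomputable section

universe u

open MvPolynomial

/-! ### Finitely generated cones are closed -/

section Cone

variable {V : Type*} [AddCommGroup V] [Module ℝ V]

theorem mem_hull_finset {T : Finset V} {x : V} (c : V → ℝ) (hc : ∀ s ∈ T, 0 ≤ c s)
    (hx : ∑ s ∈ T, c s • s = x) : x ∈ PointedCone.hull ℝ (T : Set V) := by
  rw [← hx]
  exact Submodule.sum_mem _ fun s hs =>
    PointedCone.smul_mem _ (hc s hs) (Submodule.subset_span hs)

theorem exists_coeff_of_mem_hull {T : Finset V} {x : V}
    (hx : x ∈ PointedCone.hull ℝ (T : Set V)) :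
    ∃ c : V → ℝ, (∀ s, 0 ≤ c s) ∧ ∑ s ∈ T, c s • s = x := by
  obtain ⟨c, -, hc⟩ := Submodule.mem_span_finset.mp hx
  exact ⟨fun s => c s, fun s => (c s).2, hc⟩

/-- Carathéodory's reduction: subtract a multiple of a linear relation until the first coefficient
reaches zero. -/
theorem exists_mem_hull_erase [DecidableEq V] {T : Finset V} {x : V}
    (hx : x ∈ PointedCone.hull ℝ (T : Set V))
    (hT : ¬ LinearIndepOn ℝ id (T : Set V)) :
    ∃ s ∈ T, x ∈ PointedCone.hull ℝ (T.erase s : Set V) := by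
  obtain ⟨c, hc, rfl⟩ := exists_coeff_of_mem_hull hx
  obtain ⟨d, hd, hpos⟩ : ∃ d : V → ℝ, ∑ s ∈ T, d s • s = 0 ∧ ∃ s ∈ T, 0 < d s := by
    rw [linearIndepOn_finset_iff] at hT
    push Not at hT
    obtain ⟨d, hd, s, hs, hds⟩ := hT
    simp only [id] at hd
    rcases lt_or_gt_of_ne hds with h | h
    · exact ⟨-d, by simp [hd], s, hs, by simpa using h⟩
    · exact ⟨d, hd, s, hs, h⟩
  obtain ⟨s₁, hs₁, hd₁⟩ := hpos
  -- The smallest ratio `c s / d s` with `d s > 0` is the largest multiple of the relation that can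
  -- be subtracted with all coefficients staying nonnegative.
  obtain ⟨s₀, hs₀, hmin⟩ := (T.filter fun s => 0 < d s).exists_min_image (fun s => c s / d s)
    ⟨s₁, Finset.mem_filter.mpr ⟨hs₁, hd₁⟩⟩
  obtain ⟨hs₀T, hd₀⟩ := Finset.mem_filter.mp hs₀
  refine ⟨s₀, hs₀T, mem_hull_finset (fun s => c s - c s₀ / d s₀ * d s) (fun s hs => ?_) ?_⟩
  · have hsT := Finset.mem_of_mem_erase hs
    rcases lt_or_ge 0 (d s) with h | h
    · have := hmin s (Finset.mem_filter.mpr ⟨hsT, h⟩)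
      rw [le_div_iff₀ h] at this
      linarith
    · have h1 : 0 ≤ c s₀ / d s₀ := div_nonneg (hc s₀) hd₀.le
      have := mul_nonpos_of_nonneg_of_nonpos h1 h
      have := hc s
      linarith
  · have h0 : (c s₀ - c s₀ / d s₀ * d s₀) • s₀ = 0 := by
      rw [div_mul_cancel₀ _ hd₀.ne', sub_self, zero_smul]
    have := Finset.sum_erase T (f := fun s => (c s - c s₀ / d s₀ * d s) • s) h0
    rw [this]
    simp only [sub_smul, mul_smul, Finset.sum_sub_distrib, ← Finset.smul_sum, hd, smul_zero,
      sub_zero]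

theorem exists_linearIndepOn_of_mem_hull (T : Finset V) {x : V}
    (hx : x ∈ PointedCone.hull ℝ (T : Set V)) :
    ∃ T' ⊆ T, LinearIndepOn ℝ id (T' : Set V) ∧ x ∈ PointedCone.hull ℝ (T' : Set V) := by
  classical
  induction T using Finset.strongInduction with
  | H T ih =>
    by_cases hT : LinearIndepOn ℝ id (T : Set V)
    · exact ⟨T, subset_rfl, hT, hx⟩
    · obtain ⟨s, hs, hxs⟩ := exists_mem_hull_erase hx hT
      obtain ⟨T', hT', h⟩ := ih _ (Finset.erase_ssubset hs) hxs
      exact ⟨T', hT'.trans (Finset.erase_subset _ _), h⟩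

variable [TopologicalSpace V] [IsModuleTopology ℝ V]

theorem t2Space_of_isModuleTopology [Module.Finite ℝ V] : T2Space V := by
  have := IsModuleTopology.topologicalAddGroup ℝ V
  let b := Module.finBasis ℝ V
  exact T2Space.of_injective_continuous b.equivFun.injective
    (IsModuleTopology.continuous_of_linearMap (R := ℝ) b.equivFun.toLinearMap)

/-- Linear independence makes the cone the image of the closed orthant under a closed embedding. -/
theorem isClosed_hull_of_linearIndepOn [Module.Finite ℝ V] {T : Finset V}
    (hT : LinearIndepOn ℝ id (T : Set V)) :
    IsClosed (PointedCone.hull ℝ (T : Set V) : Set V) := by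
  have := t2Space_of_isModuleTopology (V := V)
  have := IsModuleTopology.topologicalAddGroup ℝ V
  let f : (T → ℝ) →ₗ[ℝ] V := Fintype.linearCombination ℝ (fun s : T => (s : V))
  have hf : LinearMap.ker f = ⊥ := LinearMap.ker_eq_bot.mpr
    (LinearIndependent.fintypeLinearCombination_injective hT)
  have hcl := (LinearMap.isClosedEmbedding_of_injective hf).isClosedMap {c | 0 ≤ c} isClosed_Ici
  convert hcl
  ext x
  constructor
  · intro hx
    obtain ⟨c, hc, rfl⟩ := exists_coeff_of_mem_hull hx
    refine ⟨fun s => c s, fun s => hc s, ?_⟩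
    rw [Fintype.linearCombination_apply]
    exact Finset.sum_coe_sort T fun s => c s • s
  · rintro ⟨c, hc, rfl⟩
    rw [Fintype.linearCombination_apply]
    exact Submodule.sum_mem _ fun s _ =>
      PointedCone.smul_mem _ (hc s) (Submodule.subset_span s.2)

/-- A finitely generated cone is closed. -/
theorem isClosed_hull [Module.Finite ℝ V] {S : Set V} (hS : S.Finite) :
    IsClosed (PointedCone.hull ℝ S : Set V) := by
  classical
  obtain ⟨T, rfl⟩ := hS.exists_finset_coe
  have h : (PointedCone.hull ℝ (T : Set V) : Set V) =
      ⋃ T' ∈ T.powerset.filter (fun T' : Finset V => LinearIndepOn ℝ id (T' : Set V)),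
        (PointedCone.hull ℝ (T' : Set V) : Set V) := by
    ext x
    simp only [Set.mem_iUnion, Finset.mem_filter, Finset.mem_powerset, exists_prop]
    constructor
    · intro hx
      obtain ⟨T', h1, h2, h3⟩ := exists_linearIndepOn_of_mem_hull T hx
      exact ⟨T', ⟨h1, h2⟩, h3⟩
    · rintro ⟨T', ⟨h1, -⟩, h3⟩
      exact Submodule.span_mono (Finset.coe_subset.mpr h1) h3
  rw [h]
  exact isClosed_biUnion_finset fun T' hT' =>
    isClosed_hull_of_linearIndepOn (Finset.mem_filter.mp hT').2

end Cone

/-! ### The thirteen classes -/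

/-- There are three differences of opposite entries. The Klein four-group changes the signs of two
of them at a time, so the first two can be made nonnegative; exchanging the two middle indices then
orders them. The sign of the third remains free. -/
theorem exists_perm_le {m : Fin 4 → Fin 4 → ℝ} (hm : ∀ i j, m i j = m j i) :
    ∃ π : Equiv.Perm (Fin 4), m (π 2) (π 3) ≤ m (π 0) (π 1) ∧ m (π 1) (π 3) ≤ m (π 0) (π 2) ∧
      m (π 0) (π 1) - m (π 2) (π 3) ≤ m (π 0) (π 2) - m (π 1) (π 3) := by
  have key : ∀ π : Equiv.Perm (Fin 4), m (π 2) (π 3) ≤ m (π 0) (π 1) →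
      m (π 1) (π 3) ≤ m (π 0) (π 2) → ∃ π : Equiv.Perm (Fin 4),
        m (π 2) (π 3) ≤ m (π 0) (π 1) ∧ m (π 1) (π 3) ≤ m (π 0) (π 2) ∧
        m (π 0) (π 1) - m (π 2) (π 3) ≤ m (π 0) (π 2) - m (π 1) (π 3) := by
    intro π h1 h2
    rcases le_total (m (π 0) (π 1) - m (π 2) (π 3)) (m (π 0) (π 2) - m (π 1) (π 3)) with h | h
    · exact ⟨π, h1, h2, h⟩
    · exact ⟨swapMiddle π, by simpa using h2, by simpa using h1, by simpa using h⟩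
  rcases le_total (m 2 3) (m 0 1) with h1 | h1 <;> rcases le_total (m 1 3) (m 0 2) with h2 | h2
  · exact key 1 h1 h2
  · refine key (Equiv.swap 0 1 * Equiv.swap 2 3) ?_ ?_
    · change m 3 2 ≤ m 1 0; rwa [hm 3 2, hm 1 0]
    · exact h2
  · refine key (Equiv.swap 0 2 * Equiv.swap 1 3) ?_ ?_
    · exact h1
    · change m 3 1 ≤ m 2 0; rwa [hm 3 1, hm 2 0]
  · refine key (Equiv.swap 0 3 * Equiv.swap 1 2) ?_ ?_
    · change m 1 0 ≤ m 3 2; rwa [hm 3 2, hm 1 0]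
    · change m 2 0 ≤ m 3 1; rwa [hm 3 1, hm 2 0]

section Classes

variable {V : Type*} [AddCommGroup V] [Module ℝ V] {P : PointedCone ℝ V}

/-- A class with nonnegative degrees on the exceptional curves, on the proper transforms of the four
lines and on those of the diagonals lies in the cone generated by these curves. -/
theorem mem_of_nonneg_of_perm {H : V} {l : Fin 4 → V} {g n : Fin 4 → Fin 4 → V}
    (hg : ∀ i j, i ≠ j → g i j = g j i)
    (hl : ∀ π : Equiv.Perm (Fin 4), l (π 0) = H - g (π 0) (π 1) - g (π 0) (π 2) - g (π 0) (π 3))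
    (hn : ∀ π : Equiv.Perm (Fin 4), n (π 0) (π 1) = H - g (π 0) (π 1) - g (π 2) (π 3))
    (hgP : ∀ π : Equiv.Perm (Fin 4), g (π 0) (π 1) ∈ P)
    (hlP : ∀ i, l i ∈ P) (hnP : ∀ π : Equiv.Perm (Fin 4), n (π 0) (π 1) ∈ P)
    (π : Equiv.Perm (Fin 4)) {d m01 m02 m03 m12 m13 m23 : ℝ}
    (p12 : 0 ≤ m12) (p13 : 0 ≤ m13) (p23 : 0 ≤ m23)
    (s0 : m01 + m02 + m03 ≤ d) (s2 : m02 + m12 + m23 ≤ d)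
    (h01 : m23 ≤ m01) (h02 : m13 ≤ m02) (h : m01 - m23 ≤ m02 - m13) :
    d • H - (m01 • g (π 0) (π 1) + m02 • g (π 0) (π 2) + m03 • g (π 0) (π 3) +
      m12 • g (π 1) (π 2) + m13 • g (π 1) (π 3) + m23 • g (π 2) (π 3)) ∈ P := by
  have g01 : g (π 0) (π 1) ∈ P := hgP π
  have g02 : g (π 0) (π 2) ∈ P := hgP (swapMiddle π)
  have g03 : g (π 0) (π 3) ∈ P := hgP (swapOuter π)
  have g23 : g (π 2) (π 3) ∈ P := hgP (swapPairs π)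
  have g13 : g (π 1) (π 3) ∈ P := hgP (swapPairs (swapMiddle π))
  have h21 : g (π 2) (π 1) = g (π 1) (π 2) := hg _ _ (by simp)
  have g12 : g (π 1) (π 2) ∈ P := h21 ▸ hgP (swapPairs (swapOuter π))
  have n01 := hnP π
  have n02 := hnP (swapMiddle π)
  have n03 := hnP (swapOuter π)
  have l0 := hlP (π 0)
  have e1 := hn π
  have e2 := hn (swapMiddle π)
  have e3 := hn (swapOuter π)
  simp only [swapOuter_zero, swapOuter_one, swapOuter_two, swapOuter_three, swapMiddle_zero,
    swapMiddle_one, swapMiddle_two, swapMiddle_three] at n02 n03 e2 e3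
  have e0 := hl π
  have hH : H ∈ P := by
    have : H = n (π 0) (π 1) + g (π 0) (π 1) + g (π 2) (π 3) := by rw [e1]; abel
    rw [this]
    exact P.add_mem (P.add_mem n01 g01) g23
  have sm := fun (r : ℝ) (x : V) (hr : 0 ≤ r) (hx : x ∈ P) =>
    PointedCone.smul_mem P hr hx
  -- The free sign of the third difference decides the decomposition. If it is nonnegative, the
  -- diagonals through `π 0` take the coefficients `m01`, `m02`, `m03`, the surplus is exceptional,
  -- and the remaining multiple of `H` is nonnegative by the degree on the line `π 0`.
  rcases le_total m12 m03 with h03 | h03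
  · have key : d • H - (m01 • g (π 0) (π 1) + m02 • g (π 0) (π 2) + m03 • g (π 0) (π 3) +
        m12 • g (π 1) (π 2) + m13 • g (π 1) (π 3) + m23 • g (π 2) (π 3)) =
        (d - (m01 + m02 + m03)) • H + m01 • n (π 0) (π 1) + m02 • n (π 0) (π 2) +
        m03 • n (π 0) (π 3) + (m01 - m23) • g (π 2) (π 3) + (m02 - m13) • g (π 1) (π 3) +
        (m03 - m12) • g (π 1) (π 2) := by
      rw [e1, e2, e3, h21]; module
    rw [key]
    refine P.add_mem (P.add_mem (P.add_mem (P.add_mem (P.add_mem (P.add_mem ?_ ?_) ?_) ?_) ?_) ?_) ?_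
    all_goals refine sm _ _ (by linarith) (by assumption)
  -- Otherwise the smallest difference `m01 - m23` is used as a multiple of the line `π 0`; the
  -- remaining multiple of `H` is now bounded by the degree on the line `π 2`.
  · have key : d • H - (m01 • g (π 0) (π 1) + m02 • g (π 0) (π 2) + m03 • g (π 0) (π 3) +
        m12 • g (π 1) (π 2) + m13 • g (π 1) (π 3) + m23 • g (π 2) (π 3)) =
        (d - (m02 + m12 + m23)) • H + (m01 - m23) • l (π 0) + m23 • n (π 0) (π 1) +
        (m02 - (m01 - m23)) • n (π 0) (π 2) + m12 • n (π 0) (π 3) +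
        ((m01 - m23) + (m12 - m03)) • g (π 0) (π 3) +
        ((m02 - m13) - (m01 - m23)) • g (π 1) (π 3) := by
      rw [e0, e1, e2, e3, h21]; module
    rw [key]
    refine P.add_mem (P.add_mem (P.add_mem (P.add_mem (P.add_mem (P.add_mem ?_ ?_) ?_) ?_) ?_) ?_) ?_
    all_goals refine sm _ _ (by linarith) (by assumption)

/-- `d H - ∑ aᵢ lᵢ - ∑ bᵢⱼ gᵢⱼ` lies in the cone if its degrees on the thirteen curves are
nonnegative. -/
theorem exists_perm_mem_of_nonneg {H : V} {l : Fin 4 → V} {g n : Fin 4 → Fin 4 → V}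
    (hg : ∀ i j, i ≠ j → g i j = g j i)
    (hl : ∀ π : Equiv.Perm (Fin 4), l (π 0) = H - g (π 0) (π 1) - g (π 0) (π 2) - g (π 0) (π 3))
    (hn : ∀ π : Equiv.Perm (Fin 4), n (π 0) (π 1) = H - g (π 0) (π 1) - g (π 2) (π 3))
    (hgP : ∀ π : Equiv.Perm (Fin 4), g (π 0) (π 1) ∈ P)
    (hlP : ∀ i, l i ∈ P) (hnP : ∀ π : Equiv.Perm (Fin 4), n (π 0) (π 1) ∈ P)
    {d : ℝ} {a : Fin 4 → ℝ} {b : Fin 4 → Fin 4 → ℝ} (hb : ∀ i j, b i j = b j i)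
    (tg : ∀ π : Equiv.Perm (Fin 4), a (π 0) + a (π 1) ≤ b (π 0) (π 1))
    (tl : ∀ π : Equiv.Perm (Fin 4),
      b (π 0) (π 1) + b (π 0) (π 2) + b (π 0) (π 3) ≤ d + 2 * a (π 0)) :
    ∃ π : Equiv.Perm (Fin 4),
      d • H - (a (π 0) • l (π 0) + a (π 1) • l (π 1) + a (π 2) • l (π 2) + a (π 3) • l (π 3)) -
      (b (π 0) (π 1) • g (π 0) (π 1) + b (π 0) (π 2) • g (π 0) (π 2) +
        b (π 0) (π 3) • g (π 0) (π 3) + b (π 1) (π 2) • g (π 1) (π 2) +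
        b (π 1) (π 3) • g (π 1) (π 3) + b (π 2) (π 3) • g (π 2) (π 3)) ∈ P := by
  -- Substituting `lᵢ = H - ∑ gᵢⱼ` gives the coefficients `d - ∑ aᵢ` of `H` and `bᵢⱼ - aᵢ - aⱼ` of
  -- `-gᵢⱼ`; the latter are the degrees on the exceptional curves. The degrees on the diagonals do
  -- not enter.
  obtain ⟨π, h1, h2, h3⟩ := exists_perm_le (m := fun i j => b i j - a i - a j)
    fun i j => by rw [hb]; ring
  refine ⟨π, ?_⟩
  have t12 := tg (swapPairs (swapOuter π))
  have t13 := tg (swapPairs (swapMiddle π))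
  have t23 := tg (swapPairs π)
  have s0 := tl π
  have s2 := tl (swapPairs π)
  have l1 := hl (swapPairs (swapMiddle π))
  have l2 := hl (swapPairs π)
  have l3 := hl (swapFirst (swapOuter π))
  simp only [swapPairs_zero, swapPairs_one, swapPairs_two, swapPairs_three, swapOuter_zero,
    swapOuter_one, swapOuter_two, swapOuter_three, swapMiddle_zero, swapMiddle_one, swapMiddle_two,
    swapMiddle_three, swapFirst_zero, swapFirst_one, swapFirst_two, swapFirst_three]
    at t12 t13 t23 s2 l1 l2 l3
  rw [hg (π 1) (π 0) (by simp)] at l1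
  rw [hg (π 2) (π 0) (by simp), hg (π 2) (π 1) (by simp)] at l2
  rw [hg (π 3) (π 0) (by simp), hg (π 3) (π 1) (by simp), hg (π 3) (π 2) (by simp)] at l3
  rw [hb (π 2) (π 0), hb (π 2) (π 1)] at s2
  rw [hb (π 2) (π 1)] at t12
  convert mem_of_nonneg_of_perm hg hl hn hgP hlP hnP π (d := d - (a (π 0) + a (π 1) + a (π 2) + a (π 3)))
    (m01 := b (π 0) (π 1) - a (π 0) - a (π 1)) (m02 := b (π 0) (π 2) - a (π 0) - a (π 2))
    (m03 := b (π 0) (π 3) - a (π 0) - a (π 3)) (m12 := b (π 1) (π 2) - a (π 1) - a (π 2))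
    (m13 := b (π 1) (π 3) - a (π 1) - a (π 3)) (m23 := b (π 2) (π 3) - a (π 2) - a (π 3))
    (by linarith) (by linarith) (by linarith) (by linarith) (by linarith) h1 h2 h3 using 1
  rw [hl π, l1, l2, l3]
  module

end Classes

end

end ProjGeom

/-! ### The closed effective cone -/

namespace ProjGeom

noncomputable section

universe u

open MvPolynomial

variable {k : Type u} [Field k] {ι : Type} {κ : ι → Type} {X : Set (MultiProj k κ)}

/-- The class of a divisor in the real Néron–Severi space. -/
def realClass (X : Set (MultiProj k κ)) : Divisor X →+ ℝ ⊗[ℤ] NS X :=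
  (TensorProduct.mk ℤ ℝ (NS X) 1).toAddMonoidHom.comp (QuotientAddGroup.mk' (algEquivZero X))

theorem realClass_apply (D : Divisor X) : realClass X D = 1 ⊗ₜ nsClass D := rfl

theorem nsClass_eq {D E : Divisor X} (h : IsPrincipal (D - E)) : nsClass D = nsClass E :=
  (QuotientAddGroup.eq_iff_sub_mem).mpr (AddSubgroup.subset_closure (Or.inl h))

theorem realClass_natCast_smul (n : ℕ) (D : Divisor X) :
    realClass X ((n : ℤ) • D) = (n : ℝ) • realClass X D := by
  rw [natCast_zsmul, map_nsmul, Nat.cast_smul_eq_nsmul]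

theorem realClass_eq_sum (D : Divisor X) :
    realClass X D = D.sum fun Z n => (n : ℝ) • realClass X Z.toDivisor := by
  conv_lhs => rw [← Finsupp.sum_single D]
  rw [map_finsuppSum]
  refine Finsupp.sum_congr fun Z _ => ?_
  rw [Int.cast_smul_eq_zsmul, ← map_zsmul, PrimeDivisor.toDivisor, Finsupp.smul_single, smul_eq_mul, mul_one]

/-- If the classes of all prime divisors lie in the cone generated by the classes of finitely many
of them, then this is the closed effective cone. -/
theorem effectiveCone_eq {Γ : Set (PrimeDivisor X)} (hΓ : Γ.Finite)
    (h : ∀ Z : PrimeDivisor X, realClass X Z.toDivisor ∈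
      PointedCone.hull ℝ ((fun C : PrimeDivisor X => (1 : ℝ) ⊗ₜ[ℤ] C.nsClass) '' Γ)) :
    effectiveCone X = (PointedCone.hull ℝ ((fun C => (1 : ℝ) ⊗ₜ[ℤ] C.nsClass) '' Γ) :
      Set (ℝ ⊗[ℤ] NS X)) := by
  set S := (fun C : PrimeDivisor X => (1 : ℝ) ⊗ₜ[ℤ] C.nsClass) '' Γ with hS
  have hSf : S.Finite := hΓ.image _
  -- The finitely many classes span the real Néron–Severi space, which is therefore
  -- finite-dimensional, so that the cone they generate is closed.
  have hspan : Submodule.span ℝ S = ⊤ := by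
    rw [eq_top_iff]
    intro v _
    induction v using TensorProduct.induction_on with
    | zero => exact Submodule.zero_mem _
    | add x y hx hy => exact Submodule.add_mem _ (hx trivial) (hy trivial)
    | tmul r c =>
      obtain ⟨D, rfl⟩ := QuotientAddGroup.mk_surjective c
      have : r ⊗ₜ[ℤ] (QuotientAddGroup.mk D : NS X) = r • realClass X D := by
        rw [realClass_apply, TensorProduct.smul_tmul', smul_eq_mul, mul_one]; rfl
      rw [this, realClass_eq_sum]
      exact Submodule.smul_mem _ _ (Submodule.sum_mem _ fun Z _ => Submodule.smul_mem _ _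
        (PointedCone.hull_le_span ℝ S (h Z)))
  have : Module.Finite ℝ (ℝ ⊗[ℤ] NS X) := ⟨⟨hSf.toFinset, by simpa using hspan⟩⟩
  let : TopologicalSpace (ℝ ⊗[ℤ] NS X) := moduleTopology ℝ _
  have : IsModuleTopology ℝ (ℝ ⊗[ℤ] NS X) := ⟨rfl⟩
  refine Set.Subset.antisymm ?_ ?_
  · refine closure_minimal ?_ (isClosed_hull hSf)
    refine Submodule.span_le.mpr ?_
    rintro _ ⟨D, hD, rfl⟩
    rw [← realClass_apply, realClass_eq_sum]
    exact Submodule.sum_mem _ fun Z _ => PointedCone.smul_mem _ (by exact_mod_cast hD Z) (h Z)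
  · refine Set.Subset.trans (Submodule.span_mono ?_) subset_closure
    rintro _ ⟨C, -, rfl⟩
    refine ⟨C.toDivisor, ?_, rfl⟩
    exact Finsupp.single_nonneg.mpr zero_le_one

namespace LinesAtlas

variable [IsAlgClosed k] [IrreducibleSpace X] {𝒜 : LinesAtlas X} (π : Equiv.Perm (Fin 4))

theorem ord_pow {A : MvPolynomial (Fin 4) k} {d : ℕ} (hA : 𝒜.IsNonzeroForm A d) (n : ℕ)
    (Z : PrimeDivisor X) : 𝒜.ord (A ^ n) Z = n * 𝒜.ord A Z := by
  obtain ⟨π, hm⟩ := 𝒜.exists_chart Z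
  rw [ord_eq_multiplicity (hA.pow n) hm, ord_eq_multiplicity hA hm, map_pow]
  have hp := ((𝒜.chart π).eqn_spec hm).1
  exact (FiniteMultiplicity.of_prime_left hp (hA.localForm_ne_zero π)).multiplicity_pow hp

theorem nsClass_div_eq {A B : MvPolynomial (Fin 4) k} {d : ℕ} (hA : 𝒜.IsNonzeroForm A d)
    (hB : 𝒜.IsNonzeroForm B d) : nsClass (div hA) = nsClass (div hB) :=
  nsClass_eq (isPrincipal_div_sub hA hB)

variable (𝒜) in
/-- The class of the pull-back of a line. -/
def lineClass : NS X := nsClass (div (isNonzeroForm_X (𝒜 := 𝒜) 0))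

/-- A form of degree `d` has the same class as the `d`-th power of a linear form. -/
theorem realClass_div {A : MvPolynomial (Fin 4) k} {d : ℕ} (hA : 𝒜.IsNonzeroForm A d) :
    realClass X (div hA) = (d : ℝ) • (1 ⊗ₜ 𝒜.lineClass) := by
  have hX : 𝒜.IsNonzeroForm (MvPolynomial.X 0 ^ d) d := by
    simpa using (isNonzeroForm_X (𝒜 := 𝒜) 0).pow d
  have e : div hX = (d : ℤ) • div (isNonzeroForm_X (𝒜 := 𝒜) 0) := Finsupp.ext fun Z => by
    rw [Finsupp.smul_apply, div_apply, div_apply, ord_pow (isNonzeroForm_X 0)]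
    simp
  rw [realClass_apply, nsClass_div_eq hA hX, e, ← realClass_apply, realClass_natCast_smul]
  rfl

theorem nsClass_L : (𝒜.L (π 0)).nsClass = 𝒜.lineClass - (𝒜.G (π 0) (π 1)).nsClass -
    (𝒜.G (π 0) (π 2)).nsClass - (𝒜.G (π 0) (π 3)).nsClass := by
  have h := nsClass_div_eq (isNonzeroForm_X (𝒜 := 𝒜) 0) (isNonzeroForm_X (π 0))
  rw [div_X] at h
  change 𝒜.lineClass = (𝒜.L (π 0)).nsClass + (𝒜.G (π 0) (π 1)).nsClass +
    (𝒜.G (π 0) (π 2)).nsClass + (𝒜.G (π 0) (π 3)).nsClass at h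
  rw [h]; abel

theorem nsClass_M : (𝒜.M (π 0) (π 1)).nsClass = 𝒜.lineClass - (𝒜.G (π 0) (π 1)).nsClass -
    (𝒜.G (π 2) (π 3)).nsClass := by
  have h := nsClass_div_eq (isNonzeroForm_X (𝒜 := 𝒜) 0) (isNonzeroForm_X_add_X π)
  rw [div_X_add_X] at h
  change 𝒜.lineClass = (𝒜.M (π 0) (π 1)).nsClass + (𝒜.G (π 0) (π 1)).nsClass +
    (𝒜.G (π 2) (π 3)).nsClass at h
  rw [h]; abel

variable (𝒜) in
/-- The thirteen curves. -/
def curves : Set (PrimeDivisor X) :=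
  {C | ∃ i j, i ≠ j ∧ (C = 𝒜.G i j ∨ C = 𝒜.M i j)} ∪ Set.range 𝒜.L

theorem finite_curves : 𝒜.curves.Finite := by
  refine Set.Finite.union ?_ (Set.finite_range _)
  refine ((Set.finite_range fun p : Fin 4 × Fin 4 => 𝒜.G p.1 p.2).union
    (Set.finite_range fun p : Fin 4 × Fin 4 => 𝒜.M p.1 p.2)).subset ?_
  rintro C ⟨i, j, -, rfl | rfl⟩
  · exact Or.inl ⟨(i, j), rfl⟩
  · exact Or.inr ⟨(i, j), rfl⟩

/-- For `Z` other than the `G` and `L`, take a form vanishing on `Z` and otherwise only on those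
curves. The degree of its divisor on `G` is zero and on `L` is `d`, and the contribution of `Z` to
each is nonnegative; these are the inequalities needed by `exists_perm_mem_of_nonneg`. -/
theorem realClass_mem (Z : PrimeDivisor X) : realClass X Z.toDivisor ∈
    PointedCone.hull ℝ ((fun C : PrimeDivisor X => (1 : ℝ) ⊗ₜ[ℤ] C.nsClass) '' 𝒜.curves) := by
  by_cases hG : ∀ i j, i ≠ j → Z ≠ 𝒜.G i j
  swap
  · push Not at hG
    obtain ⟨i, j, hij, rfl⟩ := hG
    exact Submodule.subset_span ⟨_, Or.inl ⟨i, j, hij, Or.inl rfl⟩, rfl⟩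
  by_cases hL : ∀ i, Z ≠ 𝒜.L i
  swap
  · push Not at hL
    obtain ⟨i, rfl⟩ := hL
    exact Submodule.subset_span ⟨_, Or.inr ⟨i, rfl⟩, rfl⟩
  obtain ⟨d, A, hA, hAZ, hv⟩ := exists_form_vanishing hG hL
  have hdiv := fun π => div_eq_of_vanishing π hG hL hA hv
  set ν := 𝒜.ord A Z
  have hν : (0 : ℝ) < ν := by exact_mod_cast Nat.pos_of_ne_zero hAZ
  obtain ⟨π, hπ⟩ := exists_perm_mem_of_nonneg
    (P := PointedCone.hull ℝ ((fun C : PrimeDivisor X => (1 : ℝ) ⊗ₜ[ℤ] C.nsClass) '' 𝒜.curves))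
    (H := 1 ⊗ₜ 𝒜.lineClass) (l := fun i => realClass X (𝒜.L i).toDivisor)
    (g := fun i j => realClass X (𝒜.G i j).toDivisor)
    (n := fun i j => realClass X (𝒜.M i j).toDivisor)
    (fun i j hij => by simp only [G_comm hij])
    (fun π => by
      change (1 : ℝ) ⊗ₜ[ℤ] (𝒜.L (π 0)).nsClass = _
      rw [nsClass_L, TensorProduct.tmul_sub, TensorProduct.tmul_sub, TensorProduct.tmul_sub]; rfl)
    (fun π => by
      change (1 : ℝ) ⊗ₜ[ℤ] (𝒜.M (π 0) (π 1)).nsClass = _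
      rw [nsClass_M, TensorProduct.tmul_sub, TensorProduct.tmul_sub]; rfl)
    (fun π => Submodule.subset_span ⟨_, Or.inl ⟨π 0, π 1, by simp, Or.inl rfl⟩, rfl⟩)
    (fun i => Submodule.subset_span ⟨_, Or.inr ⟨i, rfl⟩, rfl⟩)
    (fun π => Submodule.subset_span ⟨_, Or.inl ⟨π 0, π 1, by simp, Or.inr rfl⟩, rfl⟩)
    (d := d) (a := fun i => 𝒜.ord A (𝒜.L i))
    (b := fun i j => if i = j then 0 else 𝒜.ord A (𝒜.G i j))
    (fun i j => by
      by_cases hij : i = j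
      · simp [hij]
      · simp [hij, Ne.symm hij, G_comm hij])
    (fun π => by
      have h := hasDegree_G (𝒜 := 𝒜) π d A hA
      rw [hdiv π] at h
      simp only [map_add, map_zsmul, degreeOn_toDivisor_self, degreeOn_G_L, degreeOn_G_L',
        degreeOn_G_L_disjoint, degreeOn_G_middle, degreeOn_G_opposite, degreeOn_G_middle'] at h
      have h1 := degreeOn_G_L_disjoint (𝒜 := 𝒜) (swapLast π)
      have h2 := degreeOn_G_middle (𝒜 := 𝒜) (swapLast π)
      have h3 := degreeOn_G_middle' (𝒜 := 𝒜) (swapLast π)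
      simp only [swapLast_zero, swapLast_one, swapLast_two] at h1 h2 h3
      rw [h1, h2, h3] at h
      have h0 := degreeOn_toDivisor_nonneg (-1) (hG (π 0) (π 1) (by simp))
      have h4 := mul_nonneg (Int.natCast_nonneg ν) h0
      simp only [smul_eq_mul, mul_zero, mul_one, mul_neg, add_zero] at h
      simp only [EmbeddingLike.apply_eq_iff_eq, zero_ne_one, if_false]
      have : (𝒜.ord A (𝒜.L (π 0)) : ℤ) + 𝒜.ord A (𝒜.L (π 1)) ≤ 𝒜.ord A (𝒜.G (π 0) (π 1)) := by
        linarith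
      exact_mod_cast this)
    (fun π => by
      have h := hasDegree_L (𝒜 := 𝒜) π d A hA
      rw [hdiv π] at h
      simp only [map_add, map_zsmul, degreeOn_toDivisor_self, degreeOn_L_L, degreeOn_L_G,
        degreeOn_L_G_disjoint] at h
      have h1 := degreeOn_L_L (𝒜 := 𝒜) (swapMiddle π)
      have h2 := degreeOn_L_L (𝒜 := 𝒜) (swapOuter π)
      have h3 := degreeOn_L_G (𝒜 := 𝒜) (swapMiddle π)
      have h4 := degreeOn_L_G (𝒜 := 𝒜) (swapOuter π)
      have h5 := degreeOn_L_G_disjoint (𝒜 := 𝒜) (swapLast π)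
      have h6 := degreeOn_L_G_disjoint (𝒜 := 𝒜) (swapLast (swapMiddle π))
      simp only [swapLast_zero, swapLast_one, swapLast_two, swapMiddle_zero, swapMiddle_one,
        swapMiddle_three, swapOuter_zero, swapOuter_one] at h1 h2 h3 h4 h5 h6
      rw [h1, h2, h3, h4, h5, h6] at h
      have h0 := degreeOn_toDivisor_nonneg (-2) (hL (π 0))
      have h4 := mul_nonneg (Int.natCast_nonneg ν) h0
      simp only [smul_eq_mul, mul_zero, mul_one, mul_neg, add_zero] at h
      have e1 : (0 : Fin 4) ≠ 1 := by decide
      have e2 : (0 : Fin 4) ≠ 2 := by decide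
      have e3 : (0 : Fin 4) ≠ 3 := by decide
      simp only [EmbeddingLike.apply_eq_iff_eq, e1, e2, e3, if_false]
      have : (𝒜.ord A (𝒜.G (π 0) (π 1)) : ℤ) + 𝒜.ord A (𝒜.G (π 0) (π 2)) +
          𝒜.ord A (𝒜.G (π 0) (π 3)) ≤ d + 2 * 𝒜.ord A (𝒜.L (π 0)) := by
        linarith
      exact_mod_cast this)
  -- The divisor of the form has class `d H`, so its equation expresses `ν` times the class of `Z`;
  -- dividing by `ν > 0` stays in the cone.
  have e1 := congrArg (realClass X) (hdiv π)
  rw [realClass_div] at e1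
  simp only [map_add, realClass_natCast_smul] at e1
  have hmem : (ν : ℝ) • realClass X Z.toDivisor ∈
      PointedCone.hull ℝ ((fun C : PrimeDivisor X => (1 : ℝ) ⊗ₜ[ℤ] C.nsClass) '' 𝒜.curves) := by
    convert hπ using 1
    simp only [EmbeddingLike.apply_eq_iff_eq, Fin.reduceEq, if_false]
    rw [e1]
    abel
  have := PointedCone.smul_mem _ (inv_nonneg.mpr hν.le) hmem
  rwa [smul_smul, inv_mul_cancel₀ hν.ne', one_smul] at this

end LinesAtlas

end

end ProjGeom

/-! ### The count of the curves and the pull-back of lines -/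

namespace ProjGeom

noncomputable section

universe u

open MvPolynomial

variable {k : Type u} [Field k] {ι : Type} {κ : ι → Type} {X : Set (MultiProj k κ)}

namespace LinesAtlas

variable [IsAlgClosed k] [IrreducibleSpace X] {𝒜 : LinesAtlas X}

theorem M_eq {i j : Fin 4} (hij : i ≠ j) :
    𝒜.M i j = 𝒜.M 0 1 ∨ 𝒜.M i j = 𝒜.M 0 2 ∨ 𝒜.M i j = 𝒜.M 0 3 := by
  have hc : ∀ i j : Fin 4, i ≠ j → 𝒜.M i j = 𝒜.M j i := fun i j h => by
    obtain ⟨π, rfl, rfl⟩ := exists_perm_first h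
    exact (M_comm π).symm
  have h23 : 𝒜.M 2 3 = 𝒜.M 0 1 := M_swapPairs 1
  have h13 : 𝒜.M 1 3 = 𝒜.M 0 2 := M_swapPairs (swapMiddle 1)
  have h21 : 𝒜.M 2 1 = 𝒜.M 0 3 := M_swapPairs (swapOuter 1)
  fin_cases i <;> fin_cases j <;>
  first
  | exact absurd rfl hij
  | simp; done
  | (simp [h23, h13, h21]; done)
  | (rw [hc _ _ (by decide)]; simp [h23, h13, h21])

theorem ncard_curves : 𝒜.curves.ncard = 13 := by
  classical
  have h01 : ∀ {i j : Fin 4}, i ≠ j → 𝒜.G i j ≠ 𝒜.M 0 1 := fun h => G_ne_M 1 h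
  have h02 : ∀ {i j : Fin 4}, i ≠ j → 𝒜.G i j ≠ 𝒜.M 0 2 := fun h => G_ne_M (swapMiddle 1) h
  have h03 : ∀ {i j : Fin 4}, i ≠ j → 𝒜.G i j ≠ 𝒜.M 0 3 := fun h => G_ne_M (swapOuter 1) h
  have l01 : ∀ i, 𝒜.M 0 1 ≠ 𝒜.L i := fun i => (L_ne_M 1 i).symm
  have l02 : ∀ i, 𝒜.M 0 2 ≠ 𝒜.L i := fun i => (L_ne_M (swapMiddle 1) i).symm
  have l03 : ∀ i, 𝒜.M 0 3 ≠ 𝒜.L i := fun i => (L_ne_M (swapOuter 1) i).symm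
  have m12 : 𝒜.M 0 1 ≠ 𝒜.M 0 2 := M_ne_middle 1
  have m13 : 𝒜.M 0 1 ≠ 𝒜.M 0 3 := M_ne_middle (swapLast 1)
  have m23 : 𝒜.M 0 2 ≠ 𝒜.M 0 3 := M_ne_middle (swapLast (swapMiddle 1))
  have hGL : ∀ {i j l : Fin 4}, i ≠ j → 𝒜.G i j ≠ 𝒜.L l := fun h => G_ne_L h
  have h : 𝒜.curves = (({𝒜.G 0 1, 𝒜.G 0 2, 𝒜.G 0 3, 𝒜.G 1 2, 𝒜.G 1 3, 𝒜.G 2 3, 𝒜.M 0 1, 𝒜.M 0 2,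
      𝒜.M 0 3, 𝒜.L 0, 𝒜.L 1, 𝒜.L 2, 𝒜.L 3} : Finset (PrimeDivisor X)) :
      Set (PrimeDivisor X)) := by
    ext C
    simp only [Finset.coe_insert, Finset.coe_singleton, Set.mem_insert_iff, Set.mem_singleton_iff]
    constructor
    · rintro (⟨i, j, hij, rfl | rfl⟩ | ⟨i, rfl⟩)
      · fin_cases i <;> fin_cases j <;>
        first
        | exact absurd rfl hij
        | simp; done
        | (rw [G_comm hij]; simp)
      · rcases M_eq (𝒜 := 𝒜) hij with h | h | h <;> rw [h] <;> simp
      · fin_cases i <;> simp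
    · rintro (rfl | rfl | rfl | rfl | rfl | rfl | rfl | rfl | rfl | rfl | rfl | rfl | rfl)
      all_goals
        first
        | exact Or.inr ⟨_, rfl⟩
        | exact Or.inl ⟨_, _, by decide, Or.inl rfl⟩
        | exact Or.inl ⟨_, _, by decide, Or.inr rfl⟩
  rw [h, Set.ncard_coe_finset]
  repeat rw [Finset.card_insert_of_notMem]
  · rfl
  all_goals
    simp [G_eq_iff, L_injective.eq_iff, h01, h02, h03, l01, l02, l03, m12, m13, m23, hGL]

section LinePullback

variable {φ : X → ℙ k (Fin 3 → k)} {ℓ : Fin 4 → Fin 3 → k} {c : Fin 4 → k}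

/-- The equations `ℓ 0`, `ℓ 1`, `ℓ 2` span all linear forms on the plane, so every `m` is a linear
form in the values `lam`. -/
theorem exists_linearForm (hℓ : LinearIndependent k ![ℓ 0, ℓ 1, ℓ 2]) (hc : ∀ i, c i ≠ 0)
    (hφ : ∀ x i, 𝒜.lam x i = c i * (ℓ i ⬝ᵥ (φ x).rep)) {m : Fin 3 → k} (hm : m ≠ 0) :
    ∃ A : MvPolynomial (Fin 4) k, 𝒜.IsNonzeroForm A 1 ∧
      ∀ x, m ⬝ᵥ (φ x).rep = eval (𝒜.lam x) A := by
  have hspan : m ∈ Submodule.span k (Set.range ![ℓ 0, ℓ 1, ℓ 2]) := by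
    rw [hℓ.span_eq_top_of_card_eq_finrank (by simp)]; trivial
  obtain ⟨a, ha⟩ := (Submodule.mem_span_range_iff_exists_fun k).mp hspan
  simp only [Fin.sum_univ_three, Matrix.cons_val_zero, Matrix.cons_val_one, Matrix.cons_val] at ha
  set A : MvPolynomial (Fin 4) k := C (a 0 / c 0) * MvPolynomial.X 0 +
    C (a 1 / c 1) * MvPolynomial.X 1 + C (a 2 / c 2) * MvPolynomial.X 2 with hA
  have hev : ∀ x, m ⬝ᵥ (φ x).rep = eval (𝒜.lam x) A := fun x => by
    have h0 := hc 0
    have h1 := hc 1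
    have h2 := hc 2
    simp only [hA, map_add, map_mul, eval_C, eval_X, hφ]
    rw [← ha, add_dotProduct, add_dotProduct, smul_dotProduct, smul_dotProduct, smul_dotProduct]
    simp only [smul_eq_mul]
    field_simp
  have hhom : A.IsHomogeneous 1 := by
    have := fun i (b : k) => (isHomogeneous_C (Fin 4) b).mul (isHomogeneous_X k i)
    simp only [zero_add] at this
    exact ((this _ _).add (this _ _)).add (this _ _)
  refine ⟨A, isNonzeroForm_of_localForm hhom 1 fun h0 => hm ?_, hev⟩
  have hl : localForm (1 : Equiv.Perm (Fin 4)) A = C (a 0 / c 0) * (MvPolynomial.X 0 * MvPolynomial.X 1) +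
      C (a 1 / c 1) * MvPolynomial.X 1 + C (a 2 / c 2) := by
    have e0 := lamPoly_zero (k := k) 1
    have e1 := lamPoly_one (k := k) 1
    have e2 := lamPoly_two (k := k) 1
    simp only [Equiv.Perm.coe_one, id] at e0 e1 e2
    have hC : ∀ b : k, localForm (1 : Equiv.Perm (Fin 4)) (C b : MvPolynomial (Fin 4) k) = C b :=
      fun b => by simp [localForm]
    simp only [hA, map_add, map_mul, localForm_X, hC, e0, e1, e2, mul_one]
  rw [hl] at h0
  have key := fun v : Fin 2 → k => congrArg (eval v) h0
  simp only [map_add, map_mul, eval_C, eval_X, map_zero] at key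
  -- The values of `a₀ tw + a₁ w + a₂` at `(0, 0)`, `(0, 1)` and `(1, 1)` recover the three
  -- coefficients.
  have k2 := key ![0, 0]
  have k1 := key ![0, 1]
  have k0 := key ![1, 1]
  simp only [Matrix.cons_val_zero, Matrix.cons_val_one, mul_zero, mul_one, zero_add]
    at k0 k1 k2
  rw [k2, add_zero] at k0 k1
  rw [k1, add_zero] at k0
  rw [← ha, (div_eq_zero_iff.mp k0).resolve_right (hc _), (div_eq_zero_iff.mp k1).resolve_right (hc _),
    (div_eq_zero_iff.mp k2).resolve_right (hc _)]
  simp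

theorem exists_isLinePullback (hℓ : LinearIndependent k ![ℓ 0, ℓ 1, ℓ 2]) (hc : ∀ i, c i ≠ 0)
    (hφ : ∀ x i, 𝒜.lam x i = c i * (ℓ i ⬝ᵥ (φ x).rep)) {m : Fin 3 → k} (hm : m ≠ 0) :
    ∃ D : Divisor X, IsLinePullback φ m D ∧ nsClass D = 𝒜.lineClass := by
  obtain ⟨A, hA, hAφ⟩ := exists_linearForm hℓ hc hφ hm
  refine ⟨div hA, fun Z m' hm' => ?_, nsClass_div_eq hA _⟩
  obtain ⟨x, hx, hne⟩ := hm'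
  obtain ⟨B, hB, hBφ⟩ := exists_linearForm hℓ hc hφ (m := m') (by rintro rfl; simp at hne)
  simp only [hAφ, hBφ]
  rw [hasOrder_iff hA hB]
  have : 𝒜.ord B Z = 0 := by
    by_contra h
    exact hne ((hBφ x).trans ((ord_ne_zero_iff hB).mp h x hx))
  rw [this, div_apply]
  simp

/-- The curves on the blow-up of the plane at the intersection points of four lines. -/
theorem exists_curves (𝒜 : LinesAtlas X) (hℓ : LinearIndependent k ![ℓ 0, ℓ 1, ℓ 2])
    (hc : ∀ i, c i ≠ 0) (hφ : ∀ x i, 𝒜.lam x i = c i * (ℓ i ⬝ᵥ (φ x).rep)) :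
    ∃ (H : NS X) (G M : Fin 4 → Fin 4 → PrimeDivisor X) (L : Fin 4 → PrimeDivisor X)
      (Γ : Set (PrimeDivisor X)),
      (∀ m : Fin 3 → k, m ≠ 0 → ∃ D : Divisor X, IsLinePullback φ m D ∧ nsClass D = H) ∧
      (∀ i j, i ≠ j →
        (G i j).pts = {x | ℓ i ⬝ᵥ (φ x).rep = 0 ∧ ℓ j ⬝ᵥ (φ x).rep = 0} ∧
        IsSmoothRationalCurve (G i j) (-1)) ∧
      (∀ π : Equiv.Perm (Fin 4),
        (M (π 0) (π 1)).nsClass = H - (G (π 0) (π 1)).nsClass - (G (π 2) (π 3)).nsClass ∧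
        IsSmoothRationalCurve (M (π 0) (π 1)) (-1)) ∧
      (∀ π : Equiv.Perm (Fin 4),
        (L (π 0)).nsClass =
          H - (G (π 0) (π 1)).nsClass - (G (π 0) (π 2)).nsClass - (G (π 0) (π 3)).nsClass ∧
        IsSmoothRationalCurve (L (π 0)) (-2)) ∧
      Γ = {C | ∃ i j, i ≠ j ∧ (C = G i j ∨ C = M i j)} ∪ Set.range L ∧
      Γ.ncard = 13 ∧
      effectiveCone X = (PointedCone.hull ℝ ((fun C => (1 : ℝ) ⊗ₜ[ℤ] C.nsClass) '' Γ) :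
        Set (ℝ ⊗[ℤ] NS X)) := by
  refine ⟨𝒜.lineClass, 𝒜.G, 𝒜.M, 𝒜.L, 𝒜.curves, fun m hm => exists_isLinePullback hℓ hc hφ hm,
    fun i j hij => ⟨?_, ?_⟩, fun π => ⟨nsClass_M π, ?_⟩, fun π => ⟨nsClass_L π, ?_⟩, rfl,
    ncard_curves, effectiveCone_eq finite_curves realClass_mem⟩
  · rw [G_pts hij]
    simp [hφ, hc]
  · obtain ⟨π, rfl, rfl⟩ := exists_perm_first hij
    rw [G_perm]
    exact gCurve_isSmoothRationalCurve π
  · rw [M_perm]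
    exact mCurve_isSmoothRationalCurve π
  · rw [L_perm]
    exact lCurve_isSmoothRationalCurve π

end LinePullback

end LinesAtlas

end

end ProjGeom

/-! ### Atlases of closures from homogeneous coordinates -/

namespace ProjGeom

noncomputable section

universe u

open MvPolynomial

variable {k : Type u} [Field k] {ι : Type} {κ : ι → Type}

/-- Data on a set of points from which an atlas of its closure is obtained: linear homogeneous
coordinates satisfying the relations on the given set, and polynomial homogeneous coordinates `r` of
the points of the charts. -/
structure LinesPresentation [∀ i, Fintype (κ i)] (Ω : Set (MultiProj k κ)) where
  lam : closure Ω → Fin 4 → k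
  ab : closure Ω → Fin 4 → Fin 4 → k
  lam_linear : ∃ (s : ι) (l : Fin 4 → κ s → k), ∀ x i, lam x i = l i ⬝ᵥ (x.1 s).rep
  ab_linear : ∀ i j, i ≠ j → ∃ (s : ι) (l m : κ s → k), ∀ x,
    ab x i j = l ⬝ᵥ (x.1 s).rep ∧ ab x j i = m ⬝ᵥ (x.1 s).rep
  lam_ne_zero : ∀ x, ∃ i, lam x i ≠ 0
  ab_ne_zero : ∀ x i j, i ≠ j → ab x i j ≠ 0 ∨ ab x j i ≠ 0
  lam_sum : ∀ x, x.1 ∈ Ω → lam x 0 + lam x 1 + lam x 2 + lam x 3 = 0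
  rel : ∀ x, x.1 ∈ Ω → ∀ i j, i ≠ j → lam x i * ab x j i = lam x j * ab x i j
  r : Equiv.Perm (Fin 4) → (Σ i, κ i) → MvPolynomial (Fin 2) k
  r_ne_zero : ∀ π a, eval a (chartEqn k) ≠ 0 → ∀ i, ∃ j, eval a (r π ⟨i, j⟩) ≠ 0
  minor : ∀ π x, x.1 ∈ Ω → lam x (π 2) ≠ 0 → lam x (π 3) ≠ 0 → ab x (π 1) (π 0) ≠ 0 →
    ∀ i j j', (x.1 i).rep j *
        eval ![ab x (π 0) (π 1) / ab x (π 1) (π 0), lam x (π 1) / lam x (π 2)] (r π ⟨i, j'⟩) =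
      (x.1 i).rep j' *
        eval ![ab x (π 0) (π 1) / ab x (π 1) (π 0), lam x (π 1) / lam x (π 2)] (r π ⟨i, j⟩)
  g : Equiv.Perm (Fin 4) → MvPolynomial (Fin 2) k
  g_ne_zero : ∀ π, g π ≠ 0
  mem_of_isRep : ∀ π a z, eval a (g π) ≠ 0 → eval a (chartEqn k) ≠ 0 → IsRep (r π) a z → z ∈ Ω
  lam_of_isRep : ∀ π a (x : closure Ω), eval a (chartEqn k) ≠ 0 → IsRep (r π) a x.1 →
    ∃ c, c ≠ 0 ∧ ∀ i, lam x i = c * eval a (lamPoly k π i)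
  ab_of_isRep : ∀ π a (x : closure Ω), eval a (chartEqn k) ≠ 0 → IsRep (r π) a x.1 →
    ∃ c, c ≠ 0 ∧ ab x (π 0) (π 1) = c * a 0 ∧ ab x (π 1) (π 0) = c

namespace LinesPresentation

variable [∀ i, Fintype (κ i)] {Ω : Set (MultiProj k κ)} (P : LinesPresentation Ω)

theorem isOpen_lam (m : Fin 4 → k) : IsOpen {x | m ⬝ᵥ P.lam x ≠ 0} := by
  obtain ⟨s, l, hl⟩ := P.lam_linear
  convert isOpen_dotProduct_ne_zero (X := closure Ω) s (∑ i, m i • l i) using 4 with x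
  rw [sum_dotProduct, dotProduct]
  exact Finset.sum_congr rfl fun i _ => by rw [hl, smul_dotProduct, smul_eq_mul]

theorem isOpen_ab (i j : Fin 4) (u v : k) (h : i ≠ j) :
    IsOpen {x | u * P.ab x i j + v * P.ab x j i ≠ 0} := by
  obtain ⟨s, l, m, hl⟩ := P.ab_linear i j h
  convert isOpen_dotProduct_ne_zero (X := closure Ω) s (u • l + v • m) using 4 with x
  rw [(hl x).1, (hl x).2, add_dotProduct, smul_dotProduct, smul_dotProduct, smul_eq_mul, smul_eq_mul]

theorem lam_sum_closure (x : closure Ω) :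
    P.lam x 0 + P.lam x 1 + P.lam x 2 + P.lam x 3 = 0 := by
  by_contra h
  have ho := P.isOpen_lam 1
  obtain ⟨y, hy, hyΩ⟩ := exists_mem_of_mem_nhds_closure (ho.mem_nhds (x := x)
    (by simpa [dotProduct, Fin.sum_univ_four] using h))
  exact hy (by simpa [dotProduct, Fin.sum_univ_four] using P.lam_sum y hyΩ)

/-- Divided by coordinates that do not vanish at `x`, the relation is the vanishing of a regular
function, so it extends from `Ω` to the closure. -/
theorem rel_closure (x : closure Ω) (i j : Fin 4) (hij : i ≠ j) :
    P.lam x i * P.ab x j i = P.lam x j * P.ab x i j := by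
  classical
  obtain ⟨s, l, hl⟩ := P.lam_linear
  obtain ⟨t, v, w, hvw⟩ := P.ab_linear i j hij
  obtain ⟨p, hp⟩ := exists_rep_ne_zero x.1 s
  obtain ⟨q, hq⟩ := exists_rep_ne_zero x.1 t
  have h1 := fun a => RegularAt.linear_div (X := closure Ω) (x := x) s (l a) (Pi.single p 1)
    (by simpa using hp)
  have h2 := fun a => RegularAt.linear_div (X := closure Ω) (x := x) t a (Pi.single q 1)
    (by simpa using hq)
  have := (((h1 i).mul (h2 w)).sub ((h1 j).mul (h2 v))).eq_zero_of_closure Filter.univ_mem (by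
    intro y _ hy
    have := P.rel y hy i j hij
    rw [hl, hl, (hvw y).1, (hvw y).2] at this
    simp only [Pi.sub_apply, Pi.mul_apply]
    rw [div_mul_div_comm, div_mul_div_comm, this, sub_self])
  simp only [Pi.sub_apply, Pi.mul_apply, single_dotProduct, one_mul] at this
  rw [div_mul_div_comm, div_mul_div_comm, ← sub_div, div_eq_zero_iff] at this
  rw [hl, hl, (hvw x).1, (hvw x).2]
  exact sub_eq_zero.mp (this.resolve_right (mul_ne_zero hp hq))

/-- The domain of a chart. -/
def dom (π : Equiv.Perm (Fin 4)) : Set (closure Ω) :=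
  {x | (P.lam x (π 2) ≠ 0 ∧ P.lam x (π 3) ≠ 0) ∧ P.ab x (π 1) (π 0) ≠ 0}

/-- The coordinates of a chart. -/
def coord (π : Equiv.Perm (Fin 4)) (x : closure Ω) : Fin 2 → k :=
  ![P.ab x (π 0) (π 1) / P.ab x (π 1) (π 0), P.lam x (π 1) / P.lam x (π 2)]

theorem isOpen_dom (π : Equiv.Perm (Fin 4)) : IsOpen (P.dom π) := by
  have h : ∀ i, IsOpen {x | P.lam x i ≠ 0} := fun i => by
    simpa using P.isOpen_lam (Pi.single i 1)
  have h' := P.isOpen_ab (π 1) (π 0) 1 0 (by simp)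
  simp only [one_mul, zero_mul, add_zero] at h'
  exact ((h _).inter (h _)).inter h'

theorem regularAt_coord {π : Equiv.Perm (Fin 4)} {x : closure Ω} (hx : x ∈ P.dom π) (a : Fin 2) :
    RegularAt (closure Ω) (fun y => P.coord π y a) x := by
  obtain ⟨⟨h2, h3⟩, h10⟩ := hx
  obtain ⟨s, l, hl⟩ := P.lam_linear
  obtain ⟨t, v, w, hvw⟩ := P.ab_linear (π 0) (π 1) (by simp)
  rcases Fin.eq_or_eq_add_one 0 a with rfl | rfl
  · rw [(hvw x).2] at h10
    simpa [coord, (hvw _).1, (hvw _).2] using RegularAt.linear_div t v w h10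
  · rw [hl] at h2
    simpa [coord, hl] using RegularAt.linear_div s (l (π 1)) (l (π 2)) h2

/-- The value is `-lam (π 3) / lam (π 2)`: the curve omitted by a chart is where the form `π 3`
vanishes. -/
theorem eval_coord_chartEqn {π : Equiv.Perm (Fin 4)} {x : closure Ω} (hx : x ∈ P.dom π) :
    eval (P.coord π x) (chartEqn k) ≠ 0 := by
  obtain ⟨⟨h2, h3⟩, h10⟩ := hx
  have hrel := P.rel_closure x (π 0) (π 1) (by simp)
  have hsum := P.lam_sum_closure x
  rw [← perm_sum π] at hsum
  have : eval (P.coord π x) (chartEqn k) = - P.lam x (π 3) / P.lam x (π 2) := by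
    simp only [eval_chartEqn, coord, Matrix.cons_val_zero, Matrix.cons_val_one, Matrix.cons_val_fin_one]
    field_simp
    linear_combination P.ab x (π 1) (π 0) * hsum - hrel
  rw [this]
  exact div_ne_zero (neg_ne_zero.mpr h3) h2

theorem mem_dom_of_isRep {π : Equiv.Perm (Fin 4)} {x : closure Ω} {a : Fin 2 → k}
    (ha : eval a (chartEqn k) ≠ 0) (h : IsRep (P.r π) a x.1) :
    x ∈ P.dom π ∧ P.coord π x = a := by
  obtain ⟨c, hc, hlam⟩ := P.lam_of_isRep π a x ha h
  obtain ⟨d, hd, hd0, hd1⟩ := P.ab_of_isRep π a x ha h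
  refine ⟨⟨⟨?_, ?_⟩, by rwa [hd1]⟩, ?_⟩
  · rw [hlam, lamPoly_two]; simpa using hc
  · rw [hlam, lamPoly_three, map_neg]
    exact mul_ne_zero hc (neg_ne_zero.mpr ha)
  · rw [coord, hd0, hd1, hlam, hlam, lamPoly_one, lamPoly_two]
    ext i
    fin_cases i <;> simp [hc, hd]

/-- The chart obtained from a presentation. -/
def chart [Infinite k] (π : Equiv.Perm (Fin 4)) : Chart (closure Ω) 2 :=
  Chart.ofClosure Ω (P.dom π) (P.isOpen_dom π) (P.coord π) (fun _ hx a => P.regularAt_coord hx a)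
    (chartEqn k) (fun h => by have := congrArg (eval 0) h; simp [chartEqn] at this)
    (P.r π) (P.r_ne_zero π) (fun _ hx => P.eval_coord_chartEqn hx)
    (fun x hx hxΩ => P.minor π x hxΩ hx.1.1 hx.1.2 hx.2) (P.g π) (P.g_ne_zero π)
    (P.mem_of_isRep π) (fun _ _ ha h => P.mem_dom_of_isRep ha h)

/-- The atlas obtained from a presentation. -/
def toAtlas [Infinite k] : LinesAtlas (closure Ω) where
  chart := P.chart
  lam := P.lam
  ab := P.ab
  lam_ne_zero := P.lam_ne_zero
  lam_sum := P.lam_sum_closure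
  ab_ne_zero := P.ab_ne_zero
  rel := P.rel_closure
  isOpen_lam := P.isOpen_lam
  isOpen_ab := P.isOpen_ab
  mem_dom _ _ := and_assoc
  coord_eq _ _ := rfl
  h_eq _ := rfl

end LinesPresentation

end

end ProjGeom

/-! ### The atlas of the blow-up of the plane -/

namespace ProjGeom

noncomputable section

universe u

open MvPolynomial

variable {k : Type u} [Field k]

theorem eq_mk_of_eq_smul_rep {V : Type*} [AddCommGroup V] [Module k V] {z : ℙ k V} {v : V}
    (hv : v ≠ 0) {c : k} (h : v = c • z.rep) : z = Projectivization.mk k v hv := by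
  rw [← z.mk_rep, Projectivization.mk_eq_mk_iff']
  have hc : c ≠ 0 := by rintro rfl; simp at h; exact hv h
  exact ⟨c⁻¹, by rw [h, smul_smul, inv_mul_cancel₀ hc, one_smul]⟩

theorem exists_rep_eq_smul {V : Type*} [AddCommGroup V] [Module k V] {v : V} (hv : v ≠ 0) :
    ∃ c : k, c ≠ 0 ∧ (Projectivization.mk k v hv).rep = c • v := by
  obtain ⟨c, hc⟩ := Projectivization.exists_smul_eq_mk_rep k v hv
  exact ⟨c, c.ne_zero, hc.symm⟩

/-! ### Homogeneous coordinates in the standard charts -/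

/-- The homogeneous coordinates on the pencils of lines in a chart. -/
def abPoly (k : Type*) [Field k] (π : Equiv.Perm (Fin 4)) (i j : Fin 4) : MvPolynomial (Fin 2) k :=
  -- For any pair of distinct lines other than `{π 0, π 1}` one of the two forms vanishes nowhere on
  -- the chart, so the forms themselves are pencil coordinates. For `{π 0, π 1}` the common factor
  -- `w` is removed.
  if i = π 0 ∧ j = π 1 then MvPolynomial.X 0 else if i = π 1 ∧ j = π 0 then 1 else lamPoly k π i

section

variable (π : Equiv.Perm (Fin 4))

theorem sum_lamPoly : lamPoly k π 0 + lamPoly k π 1 + lamPoly k π 2 + lamPoly k π 3 = 0 := by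
  rw [← perm_sum π, lamPoly_zero, lamPoly_one, lamPoly_two, lamPoly_three, chartEqn]
  ring

theorem abPoly_zero_one : abPoly k π (π 0) (π 1) = MvPolynomial.X 0 := by simp [abPoly]

theorem abPoly_one_zero : abPoly k π (π 1) (π 0) = 1 := by simp [abPoly]

theorem abPoly_eq_lamPoly {i j : Fin 4} (h : ¬(i = π 0 ∧ j = π 1)) (h' : ¬(i = π 1 ∧ j = π 0)) :
    abPoly k π i j = lamPoly k π i := by
  rw [abPoly, if_neg h, if_neg h']

theorem exists_lamPoly_eq_mul_abPoly (i j : Fin 4) :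
    ∃ e : MvPolynomial (Fin 2) k, lamPoly k π i = e * abPoly k π i j ∧
      lamPoly k π j = e * abPoly k π j i := by
  by_cases h : i = π 0 ∧ j = π 1
  · obtain ⟨rfl, rfl⟩ := h
    exact ⟨MvPolynomial.X 1, by rw [lamPoly_zero, abPoly_zero_one, mul_comm],
      by rw [lamPoly_one, abPoly_one_zero, mul_one]⟩
  by_cases h' : i = π 1 ∧ j = π 0
  · obtain ⟨rfl, rfl⟩ := h'
    exact ⟨MvPolynomial.X 1, by rw [lamPoly_one, abPoly_one_zero, mul_one],
      by rw [lamPoly_zero, abPoly_zero_one, mul_comm]⟩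
  exact ⟨1, by rw [abPoly_eq_lamPoly π h h', one_mul],
    by rw [abPoly_eq_lamPoly π (fun e => h' e.symm) (fun e => h e.symm), one_mul]⟩

theorem eval_lamPoly_ne_zero {a : Fin 2 → k} (ha : eval a (chartEqn k) ≠ 0) {i : Fin 4}
    (h0 : i ≠ π 0) (h1 : i ≠ π 1) : eval a (lamPoly k π i) ≠ 0 := by
  rcases perm_cases π i with rfl | rfl | rfl | rfl
  · exact absurd rfl h0
  · exact absurd rfl h1
  · rw [lamPoly_two]; simp
  · rw [lamPoly_three, map_neg]; exact neg_ne_zero.mpr ha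

theorem eval_lamPoly_ne_zero_of_mul {a : Fin 2 → k} (ha : eval a (chartEqn k) ≠ 0)
    (h : eval a (MvPolynomial.X 0 * MvPolynomial.X 1 : MvPolynomial (Fin 2) k) ≠ 0) (i : Fin 4) :
    eval a (lamPoly k π i) ≠ 0 := by
  rcases perm_cases π i with rfl | rfl | rfl | rfl
  · rwa [lamPoly_zero]
  · rw [lamPoly_one]; rw [map_mul] at h; exact right_ne_zero_of_mul h
  · rw [lamPoly_two]; simp
  · rw [lamPoly_three, map_neg]; exact neg_ne_zero.mpr ha

theorem eval_abPoly_ne_zero {a : Fin 2 → k} (ha : eval a (chartEqn k) ≠ 0) {i j : Fin 4}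
    (hij : i ≠ j) : eval a (abPoly k π i j) ≠ 0 ∨ eval a (abPoly k π j i) ≠ 0 := by
  by_cases h : i = π 0 ∧ j = π 1
  · obtain ⟨rfl, rfl⟩ := h
    right; rw [abPoly_one_zero]; simp
  by_cases h' : i = π 1 ∧ j = π 0
  · obtain ⟨rfl, rfl⟩ := h'
    left; rw [abPoly_one_zero]; simp
  rw [abPoly_eq_lamPoly π h h', abPoly_eq_lamPoly π (fun e => h' e.symm) (fun e => h e.symm)]
  by_cases hi : i = π 0 ∨ i = π 1
  · right
    refine eval_lamPoly_ne_zero π ha ?_ ?_ <;> rintro rfl <;> rcases hi with rfl | rfl <;>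
      simp at hij h h'
  · push Not at hi
    exact Or.inl (eval_lamPoly_ne_zero π ha hi.1 hi.2)

variable {π} in
theorem eq_mul_eval_lamPoly {lam : Fin 4 → k} {α β : k}
    (hsum : lam 0 + lam 1 + lam 2 + lam 3 = 0) (hrel : lam (π 0) * β = lam (π 1) * α) (hβ : β ≠ 0)
    (h2 : lam (π 2) ≠ 0) (i : Fin 4) :
    lam i = lam (π 2) * eval ![α / β, lam (π 1) / lam (π 2)] (lamPoly k π i) := by
  rw [← perm_sum π] at hsum
  have h0 : lam (π 0) = lam (π 2) * (α / β * (lam (π 1) / lam (π 2))) := by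
    field_simp; rw [hrel, mul_comm]
  rcases perm_cases π i with rfl | rfl | rfl | rfl
  · rw [lamPoly_zero]; simpa using h0
  · rw [lamPoly_one]; simp; field_simp
  · rw [lamPoly_two]; simp
  · rw [lamPoly_three, map_neg, eval_chartEqn]
    simp only [Matrix.cons_val_zero, Matrix.cons_val_one, Matrix.cons_val_fin_one]
    have h1 : lam (π 2) * (lam (π 1) / lam (π 2)) = lam (π 1) := by field_simp
    linear_combination hsum - h0 + h1

variable {π} in
theorem exists_eq_mul_eval_abPoly {lam : Fin 4 → k} {ab : Fin 4 → Fin 4 → k}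
    (hsum : lam 0 + lam 1 + lam 2 + lam 3 = 0)
    (hab : ∀ i j, i ≠ j → ∃ e, ab i j = e * lam i ∧ ab j i = e * lam j)
    (h10 : ab (π 1) (π 0) ≠ 0) (h2 : lam (π 2) ≠ 0) {i j : Fin 4} (hij : i ≠ j) :
    ∃ d, ab i j = d * eval ![ab (π 0) (π 1) / ab (π 1) (π 0), lam (π 1) / lam (π 2)] (abPoly k π i j) ∧
      ab j i = d * eval ![ab (π 0) (π 1) / ab (π 1) (π 0), lam (π 1) / lam (π 2)] (abPoly k π j i) := by
  have hrel : lam (π 0) * ab (π 1) (π 0) = lam (π 1) * ab (π 0) (π 1) := by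
    obtain ⟨e, h, h'⟩ := hab (π 0) (π 1) (by simp)
    rw [h, h']; ring
  by_cases h : i = π 0 ∧ j = π 1
  · obtain ⟨rfl, rfl⟩ := h
    refine ⟨ab (π 1) (π 0), ?_, ?_⟩
    · rw [abPoly_zero_one]; simp; field_simp
    · rw [abPoly_one_zero]; simp
  by_cases h' : i = π 1 ∧ j = π 0
  · obtain ⟨rfl, rfl⟩ := h'
    refine ⟨ab (π 1) (π 0), ?_, ?_⟩
    · rw [abPoly_one_zero]; simp
    · rw [abPoly_zero_one]; simp; field_simp
  obtain ⟨e, he, he'⟩ := hab i j hij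
  rw [abPoly_eq_lamPoly π h h', abPoly_eq_lamPoly π (fun e => h' e.symm) (fun e => h e.symm)]
  refine ⟨e * lam (π 2), ?_, ?_⟩
  · rw [he, mul_assoc, ← eq_mul_eval_lamPoly hsum hrel h10 h2]
  · rw [he', mul_assoc, ← eq_mul_eval_lamPoly hsum hrel h10 h2]

end

/-! ### The blow-up of the plane -/

/-- Four vectors in a three-dimensional space satisfy a linear relation, and since any three are
independent no coefficient vanishes. Scaling by these coefficients gives the normalization with sum
zero. -/
theorem exists_sum_smul_eq_zero {ℓ : Fin 4 → Fin 3 → k}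
    (hℓ : ∀ i j l, i ≠ j → i ≠ l → j ≠ l → LinearIndependent k ![ℓ i, ℓ j, ℓ l]) :
    ∃ c : Fin 4 → k, (∀ i, c i ≠ 0) ∧
      c 0 • ℓ 0 + c 1 • ℓ 1 + c 2 • ℓ 2 + c 3 • ℓ 3 = 0 := by
  have hspan : ℓ 3 ∈ Submodule.span k (Set.range ![ℓ 0, ℓ 1, ℓ 2]) := by
    rw [(hℓ 0 1 2 (by decide) (by decide) (by decide)).span_eq_top_of_card_eq_finrank (by simp)]
    trivial
  obtain ⟨a, ha⟩ := (Submodule.mem_span_range_iff_exists_fun k).mp hspan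
  simp only [Fin.sum_univ_three, Matrix.cons_val_zero, Matrix.cons_val_one, Matrix.cons_val] at ha
  have key : ∀ i j, i ≠ j → i ≠ 3 → j ≠ 3 → ∀ b d : k, b • ℓ i + d • ℓ j ≠ ℓ 3 := by
    intro i j hij hi hj b d h
    have := Fintype.linearIndependent_iff.mp (hℓ i j 3 hij hi hj) ![b, d, -1] (by
      simp [Fin.sum_univ_three, h]) 2
    simp at this
  refine ⟨![a 0, a 1, a 2, -1], fun i => ?_, ?_⟩
  · fin_cases i
    · rintro (h : a 0 = 0)
      exact key 1 2 (by decide) (by decide) (by decide) (a 1) (a 2) (by rw [← ha, h]; simp)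
    · rintro (h : a 1 = 0)
      exact key 0 2 (by decide) (by decide) (by decide) (a 0) (a 2) (by rw [← ha, h]; simp)
    · rintro (h : a 2 = 0)
      exact key 0 1 (by decide) (by decide) (by decide) (a 0) (a 1) (by rw [← ha, h]; simp)
    · simp
  · simp [ha]

namespace BlowUpPlane

instance (o : Option Pair) : Fintype (blowUpCoord o) :=
  match o with
  | none => inferInstanceAs (Fintype (Fin 3))
  | some _ => inferInstanceAs (Fintype (Fin 2))

/-- The graph of the projections. -/
def graph (ℓ : Fin 4 → Fin 3 → k) : Set (MultiProj k blowUpCoord) :=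
  {z | ∃ (v : Fin 3 → k) (hv : v ≠ 0), z none = Projectivization.mk k v hv ∧
    ∀ p : Pair, ∃ h : ![ℓ p.1.1 ⬝ᵥ v, ℓ p.1.2 ⬝ᵥ v] ≠ 0,
      z (some p) = Projectivization.mk k ![ℓ p.1.1 ⬝ᵥ v, ℓ p.1.2 ⬝ᵥ v] h}

/-- The coordinates on the plane of a point. -/
def planeRep (z : MultiProj k blowUpCoord) : Fin 3 → k := (z none).rep

/-- The coordinates of a point on the pencil of lines through an intersection point. -/
def pencilRep (z : MultiProj k blowUpCoord) (p : Pair) : Fin 2 → k := (z (some p)).rep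

/-- Homogeneous coordinates on the pencils, indexed by ordered pairs of lines. -/
def ab (c : Fin 4 → k) (z : MultiProj k blowUpCoord) (i j : Fin 4) : k :=
  if h : i < j then c i * pencilRep z ⟨(i, j), h⟩ 0
  else if h : j < i then c i * pencilRep z ⟨(j, i), h⟩ 1 else 0

theorem ab_of_lt (c : Fin 4 → k) (z : MultiProj k blowUpCoord) {i j : Fin 4} (h : i < j) :
    ab c z i j = c i * pencilRep z ⟨(i, j), h⟩ 0 := by rw [ab, dif_pos h]

theorem ab_of_gt (c : Fin 4 → k) (z : MultiProj k blowUpCoord) {i j : Fin 4} (h : i < j) :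
    ab c z j i = c j * pencilRep z ⟨(i, j), h⟩ 1 := by rw [ab, dif_neg h.not_gt, dif_pos h]

theorem exists_lt {C : Fin 4 → Fin 4 → Prop} (h : ∀ i j, i < j → C i j) (h' : ∀ i j, C i j → C j i)
    {i j : Fin 4} (hij : i ≠ j) : C i j :=
  (lt_or_gt_of_ne hij).elim (h i j) fun hji => h' _ _ (h j i hji)

section

variable {ℓ : Fin 4 → Fin 3 → k} {c : Fin 4 → k} {W : Matrix (Fin 3) (Fin 3) k}

/-- Polynomial homogeneous coordinates in the charts. -/
def r (c : Fin 4 → k) (W : Matrix (Fin 3) (Fin 3) k) (π : Equiv.Perm (Fin 4)) :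
    (Σ o, blowUpCoord o) → MvPolynomial (Fin 2) k
  | ⟨none, (j : Fin 3)⟩ => ∑ i : Fin 3, C (W j i) * lamPoly k π i.castSucc
  | ⟨some p, (j : Fin 2)⟩ => ![C (c p.1.1)⁻¹ * abPoly k π p.1.1 p.1.2,
      C (c p.1.2)⁻¹ * abPoly k π p.1.2 p.1.1] j

/-- The point of the plane with given coordinates in a chart. -/
def point (W : Matrix (Fin 3) (Fin 3) k) (π : Equiv.Perm (Fin 4)) (a : Fin 2 → k) : Fin 3 → k :=
  W.mulVec fun i => eval a (lamPoly k π i.castSucc)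

theorem eval_r_none (π : Equiv.Perm (Fin 4)) (a : Fin 2 → k) (j : Fin 3) :
    eval a (r c W π ⟨none, j⟩) = point W π a j := by
  simp [r, point, Matrix.mulVec, dotProduct]

/-- The first three values hold by the choice of `W`; the fourth follows because both sides have sum
zero. -/
theorem dotProduct_point (h : ∀ y (i : Fin 3), c i.castSucc * (ℓ i.castSucc ⬝ᵥ W.mulVec y) = y i)
    (hsum : c 0 • ℓ 0 + c 1 • ℓ 1 + c 2 • ℓ 2 + c 3 • ℓ 3 = 0) (π : Equiv.Perm (Fin 4))
    (a : Fin 2 → k) (i : Fin 4) : c i * (ℓ i ⬝ᵥ point W π a) = eval a (lamPoly k π i) := by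
  have h3 : ∀ i : Fin 3, c i.castSucc * (ℓ i.castSucc ⬝ᵥ point W π a) =
      eval a (lamPoly k π i.castSucc) := fun i => h _ i
  have hs := congrArg (· ⬝ᵥ point W π a) hsum
  simp only [add_dotProduct, smul_dotProduct, zero_dotProduct, smul_eq_mul] at hs
  have hp := congrArg (eval a) (sum_lamPoly (k := k) π)
  simp only [map_add, map_zero] at hp
  have e0 : c 0 * (ℓ 0 ⬝ᵥ point W π a) = eval a (lamPoly k π 0) := h3 0
  have e1 : c 1 * (ℓ 1 ⬝ᵥ point W π a) = eval a (lamPoly k π 1) := h3 1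
  have e2 : c 2 * (ℓ 2 ⬝ᵥ point W π a) = eval a (lamPoly k π 2) := h3 2
  fin_cases i
  · exact e0
  · exact e1
  · exact e2
  · change c 3 * (ℓ 3 ⬝ᵥ point W π a) = eval a (lamPoly k π 3)
    linear_combination hs - hp - e0 - e1 - e2

/-- The first three scaled equations are coordinates on the plane; `W` recovers a vector from them.
-/
theorem exists_inverse (hℓ : LinearIndependent k ![ℓ 0, ℓ 1, ℓ 2]) (hc : ∀ i, c i ≠ 0) :
    ∃ W : Matrix (Fin 3) (Fin 3) k,
      (∀ y (i : Fin 3), c i.castSucc * (ℓ i.castSucc ⬝ᵥ W.mulVec y) = y i) ∧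
      ∀ v, W.mulVec (fun i => c i.castSucc * (ℓ i.castSucc ⬝ᵥ v)) = v := by
  set N : Matrix (Fin 3) (Fin 3) k := fun i => c i.castSucc • ℓ i.castSucc with hN
  have hNi : LinearIndependent k N.row := by
    have := hℓ.units_smul fun i : Fin 3 => Units.mk0 (c i.castSucc) (hc _)
    convert this using 1
    ext i j
    fin_cases i <;> rfl
  have hu : IsUnit N.det := (Matrix.isUnit_iff_isUnit_det N).mp
    (Matrix.linearIndependent_rows_iff_isUnit.mp hNi)
  have hv : ∀ v, (fun i : Fin 3 => c i.castSucc * (ℓ i.castSucc ⬝ᵥ v)) = N.mulVec v := fun v => by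
    ext i
    rw [Matrix.mulVec, hN, smul_dotProduct, smul_eq_mul]
  refine ⟨N⁻¹, fun y i => ?_, fun v => ?_⟩
  · refine (congrFun (hv _) i).trans ?_
    rw [Matrix.mulVec_mulVec, Matrix.mul_nonsing_inv _ hu, Matrix.one_mulVec]
  · rw [hv, Matrix.mulVec_mulVec, Matrix.nonsing_inv_mul _ hu, Matrix.one_mulVec]

end

end BlowUpPlane

end

end ProjGeom

namespace ProjGeom

noncomputable section

universe u

open MvPolynomial

variable {k : Type u} [Field k]

namespace BlowUpPlane

variable {ℓ : Fin 4 → Fin 3 → k} {c : Fin 4 → k} {W : Matrix (Fin 3) (Fin 3) k}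

theorem pencilRep_ne_zero (z : MultiProj k blowUpCoord) (p : Pair) : pencilRep z p ≠ 0 :=
  Projectivization.rep_nonzero (K := k) (V := Fin 2 → k) (z (some p))

theorem planeRep_ne_zero (z : MultiProj k blowUpCoord) : planeRep z ≠ 0 :=
  Projectivization.rep_nonzero (K := k) (V := Fin 3 → k) (z none)

theorem eval_r_some_zero (π : Equiv.Perm (Fin 4)) (a : Fin 2 → k) (p : Pair) :
    eval a (r c W π ⟨some p, (0 : Fin 2)⟩) = (c p.1.1)⁻¹ * eval a (abPoly k π p.1.1 p.1.2) := by
  simp [r]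

theorem eval_r_some_one (π : Equiv.Perm (Fin 4)) (a : Fin 2 → k) (p : Pair) :
    eval a (r c W π ⟨some p, (1 : Fin 2)⟩) = (c p.1.2)⁻¹ * eval a (abPoly k π p.1.2 p.1.1) := by
  simp [r]

theorem exists_planeRep {z : MultiProj k blowUpCoord} (hz : z ∈ graph ℓ) :
    ∃ v : Fin 3 → k, (∃ b : k, b ≠ 0 ∧ planeRep z = b • v) ∧
      ∀ i j, i ≠ j → ∃ e, ab c z i j = e * (c i * (ℓ i ⬝ᵥ v)) ∧ ab c z j i = e * (c j * (ℓ j ⬝ᵥ v)) := by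
  obtain ⟨v, hv, hz0, hz1⟩ := hz
  refine ⟨v, ?_, ?_⟩
  · obtain ⟨b, hb, h⟩ := exists_rep_eq_smul (k := k) hv
    exact ⟨b, hb, (congrArg (fun y : ℙ k (Fin 3 → k) => y.rep) hz0).trans h⟩
  · intro i j hij
    revert i j
    refine fun i j => exists_lt (C := fun i j => ∃ e, ab c z i j = e * (c i * (ℓ i ⬝ᵥ v)) ∧
      ab c z j i = e * (c j * (ℓ j ⬝ᵥ v))) ?_ fun i j ⟨e, h1, h2⟩ => ⟨e, h2, h1⟩
    intro i j hij
    obtain ⟨h, hp⟩ := hz1 ⟨(i, j), hij⟩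
    obtain ⟨b, -, hb⟩ := exists_rep_eq_smul (k := k) h
    have hr : pencilRep z ⟨(i, j), hij⟩ = b • ![ℓ i ⬝ᵥ v, ℓ j ⬝ᵥ v] :=
      (congrArg (fun y : ℙ k (Fin 2 → k) => y.rep) hp).trans hb
    refine ⟨b, ?_, ?_⟩
    · rw [ab_of_lt c z hij, hr]; simp; ring
    · rw [ab_of_gt c z hij, hr]; simp; ring

theorem exists_planeRep' {z : MultiProj k blowUpCoord} (hz : z ∈ graph ℓ) {i j : Fin 4}
    (hij : i ≠ j) : ∃ e, ab c z i j = e * (c i * (ℓ i ⬝ᵥ planeRep z)) ∧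
      ab c z j i = e * (c j * (ℓ j ⬝ᵥ planeRep z)) := by
  obtain ⟨v, ⟨b, hb, hv⟩, h⟩ := exists_planeRep (c := c) hz
  obtain ⟨e, h1, h2⟩ := h i j hij
  refine ⟨e / b, ?_, ?_⟩
  · rw [h1, hv, dotProduct_smul, smul_eq_mul]; field_simp
  · rw [h2, hv, dotProduct_smul, smul_eq_mul]; field_simp

theorem lam_sum (hsum : c 0 • ℓ 0 + c 1 • ℓ 1 + c 2 • ℓ 2 + c 3 • ℓ 3 = 0) (v : Fin 3 → k) :
    c 0 * (ℓ 0 ⬝ᵥ v) + c 1 * (ℓ 1 ⬝ᵥ v) + c 2 * (ℓ 2 ⬝ᵥ v) + c 3 * (ℓ 3 ⬝ᵥ v) = 0 := by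
  have hs := congrArg (· ⬝ᵥ v) hsum
  simpa only [add_dotProduct, smul_dotProduct, zero_dotProduct, smul_eq_mul] using hs

theorem point_ne_zero
    (hW : ∀ y (i : Fin 3), c i.castSucc * (ℓ i.castSucc ⬝ᵥ W.mulVec y) = y i)
    (hsum : c 0 • ℓ 0 + c 1 • ℓ 1 + c 2 • ℓ 2 + c 3 • ℓ 3 = 0) (π : Equiv.Perm (Fin 4))
    (a : Fin 2 → k) : point W π a ≠ 0 := by
  intro h
  have := dotProduct_point hW hsum π a (π 2)
  rw [h, lamPoly_two] at this
  simp at this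

theorem ab_of_isRep (hc : ∀ i, c i ≠ 0) {π : Equiv.Perm (Fin 4)} {a : Fin 2 → k}
    {z : MultiProj k blowUpCoord} (h : IsRep (r c W π) a z) {i j : Fin 4} (hij : i ≠ j) :
    ∃ d, d ≠ 0 ∧ ab c z i j = d * eval a (abPoly k π i j) ∧
      ab c z j i = d * eval a (abPoly k π j i) := by
  revert i j
  refine fun {i j} => exists_lt (C := fun i j => ∃ d, d ≠ 0 ∧ ab c z i j = d * eval a (abPoly k π i j) ∧
    ab c z j i = d * eval a (abPoly k π j i)) ?_ fun i j ⟨e, h0, h1, h2⟩ => ⟨e, h0, h2, h1⟩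
  intro i j hij
  obtain ⟨b, hb, hr⟩ := h (some ⟨(i, j), hij⟩)
  have hci := hc i
  have hcj := hc j
  have h0 : (c i)⁻¹ * eval a (abPoly k π i j) = b * pencilRep z ⟨(i, j), hij⟩ 0 :=
    (eval_r_some_zero π a _).symm.trans (hr (0 : Fin 2))
  have h1 : (c j)⁻¹ * eval a (abPoly k π j i) = b * pencilRep z ⟨(i, j), hij⟩ 1 :=
    (eval_r_some_one π a _).symm.trans (hr (1 : Fin 2))
  refine ⟨b⁻¹, inv_ne_zero hb, ?_, ?_⟩
  · rw [ab_of_lt c z hij]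
    field_simp at h0 ⊢
    linear_combination -h0
  · rw [ab_of_gt c z hij]
    field_simp at h1 ⊢
    linear_combination -h1

theorem planeRep_of_isRep {π : Equiv.Perm (Fin 4)} {a : Fin 2 → k}
    {z : MultiProj k blowUpCoord} (h : IsRep (r c W π) a z) :
    ∃ b : k, b ≠ 0 ∧ point W π a = b • planeRep z := by
  obtain ⟨b, hb, hr⟩ := h none
  refine ⟨b, hb, funext fun j => ?_⟩
  rw [← eval_r_none (c := c)]
  exact hr j

/-- If `t`, `w` and `1 + w + tw` are nonzero, the point lies on none of the four lines, so all the
projections are defined there and their values are the coordinates of `z`. -/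
theorem mem_graph_of_isRep (hc : ∀ i, c i ≠ 0)
    (hW : ∀ y (i : Fin 3), c i.castSucc * (ℓ i.castSucc ⬝ᵥ W.mulVec y) = y i)
    (hsum : c 0 • ℓ 0 + c 1 • ℓ 1 + c 2 • ℓ 2 + c 3 • ℓ 3 = 0) {π : Equiv.Perm (Fin 4)}
    {a : Fin 2 → k} {z : MultiProj k blowUpCoord}
    (ha : eval a (MvPolynomial.X 0 * MvPolynomial.X 1 : MvPolynomial (Fin 2) k) ≠ 0)
    (hh : eval a (chartEqn k) ≠ 0) (h : IsRep (r c W π) a z) : z ∈ graph ℓ := by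
  have hl : ∀ i, ℓ i ⬝ᵥ point W π a = (c i)⁻¹ * eval a (lamPoly k π i) := fun i => by
    rw [← dotProduct_point hW hsum π a i, inv_mul_cancel_left₀ (hc i)]
  refine ⟨point W π a, point_ne_zero hW hsum π a, ?_, fun p => ?_⟩
  · obtain ⟨b, -, hb⟩ := planeRep_of_isRep h
    exact eq_mk_of_eq_smul_rep (V := Fin 3 → k) (z := z none) _ hb
  · have hne : ![ℓ p.1.1 ⬝ᵥ point W π a, ℓ p.1.2 ⬝ᵥ point W π a] ≠ 0 := fun h0 => by
      have := congrFun h0 0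
      simp only [Matrix.cons_val_zero, Pi.zero_apply, hl] at this
      exact mul_ne_zero (inv_ne_zero (hc _)) (eval_lamPoly_ne_zero_of_mul π hh ha _) this
    refine ⟨hne, ?_⟩
    obtain ⟨b, -, hr⟩ := h (some p)
    obtain ⟨e, he, he'⟩ := exists_lamPoly_eq_mul_abPoly (k := k) π p.1.1 p.1.2
    have h0 : (c p.1.1)⁻¹ * eval a (abPoly k π p.1.1 p.1.2) = b * pencilRep z p 0 :=
      (eval_r_some_zero π a _).symm.trans (hr (0 : Fin 2))
    have h1 : (c p.1.2)⁻¹ * eval a (abPoly k π p.1.2 p.1.1) = b * pencilRep z p 1 :=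
      (eval_r_some_one π a _).symm.trans (hr (1 : Fin 2))
    refine eq_mk_of_eq_smul_rep (V := Fin 2 → k) (z := z (some p)) (c := eval a e * b) hne ?_
    ext j
    fin_cases j
    · change ℓ p.1.1 ⬝ᵥ point W π a = eval a e * b * pencilRep z p 0
      rw [hl, he, map_mul, mul_assoc, ← h0]; ring
    · change ℓ p.1.2 ⬝ᵥ point W π a = eval a e * b * pencilRep z p 1
      rw [hl, he', map_mul, mul_assoc, ← h1]; ring

theorem ab_linear (c : Fin 4 → k) {i j : Fin 4} (hij : i ≠ j) :
    ∃ (s : Option Pair) (l m : blowUpCoord s → k), ∀ z : MultiProj k blowUpCoord,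
      ab c z i j = l ⬝ᵥ (z s).rep ∧ ab c z j i = m ⬝ᵥ (z s).rep := by
  revert i j
  refine fun {i j} => exists_lt (C := fun i j => ∃ (s : Option Pair) (l m : blowUpCoord s → k),
    ∀ z : MultiProj k blowUpCoord, ab c z i j = l ⬝ᵥ (z s).rep ∧ ab c z j i = m ⬝ᵥ (z s).rep) ?_
    fun i j ⟨s, l, m, h⟩ => ⟨s, m, l, fun z => (h z).symm⟩
  intro i j hij
  refine ⟨some ⟨(i, j), hij⟩, (![c i, 0] : Fin 2 → k), (![0, c j] : Fin 2 → k), fun z => ⟨?_, ?_⟩⟩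
  · rw [ab_of_lt c z hij]
    change _ = (![c i, 0] : Fin 2 → k) ⬝ᵥ pencilRep z ⟨(i, j), hij⟩
    simp [dotProduct]
  · rw [ab_of_gt c z hij]
    change _ = (![0, c j] : Fin 2 → k) ⬝ᵥ pencilRep z ⟨(i, j), hij⟩
    simp [dotProduct]

theorem ab_ne_zero (hc : ∀ i, c i ≠ 0) (z : MultiProj k blowUpCoord) {i j : Fin 4} (hij : i ≠ j) :
    ab c z i j ≠ 0 ∨ ab c z j i ≠ 0 := by
  revert i j
  refine fun {i j} => exists_lt (C := fun i j => ab c z i j ≠ 0 ∨ ab c z j i ≠ 0) ?_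
    fun i j h => h.symm
  intro i j hij
  rw [ab_of_lt c z hij, ab_of_gt c z hij]
  by_contra! h
  have h0 := (mul_eq_zero.mp h.1).resolve_left (hc _)
  have h1 := (mul_eq_zero.mp h.2).resolve_left (hc _)
  refine pencilRep_ne_zero z ⟨(i, j), hij⟩ (funext fun a => ?_)
  fin_cases a
  · exact h0
  · exact h1

theorem eval_r_ne_zero (hc : ∀ i, c i ≠ 0)
    (hW : ∀ y (i : Fin 3), c i.castSucc * (ℓ i.castSucc ⬝ᵥ W.mulVec y) = y i)
    (hsum : c 0 • ℓ 0 + c 1 • ℓ 1 + c 2 • ℓ 2 + c 3 • ℓ 3 = 0) (π : Equiv.Perm (Fin 4))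
    {a : Fin 2 → k} (ha : eval a (chartEqn k) ≠ 0) (o : Option Pair) :
    ∃ j, eval a (r c W π ⟨o, j⟩) ≠ 0 := by
  rcases o with _ | p
  · by_contra! h
    have hj : ∀ j : Fin 3, point W π a j = 0 := fun j => by
      rw [← eval_r_none (c := c)]; exact h j
    exact point_ne_zero hW hsum π a (funext hj)
  · rcases eval_abPoly_ne_zero π ha p.2.ne with h | h
    · exact ⟨(0 : Fin 2), by
        rw [eval_r_some_zero]; exact mul_ne_zero (inv_ne_zero (hc _)) h⟩
    · exact ⟨(1 : Fin 2), by
        rw [eval_r_some_one]; exact mul_ne_zero (inv_ne_zero (hc _)) h⟩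

theorem minor (hc : ∀ i, c i ≠ 0)
    (hW : ∀ v, W.mulVec (fun i => c i.castSucc * (ℓ i.castSucc ⬝ᵥ v)) = v)
    (hsum : c 0 • ℓ 0 + c 1 • ℓ 1 + c 2 • ℓ 2 + c 3 • ℓ 3 = 0) (π : Equiv.Perm (Fin 4))
    {z : MultiProj k blowUpCoord} (hz : z ∈ graph ℓ) (h2 : c (π 2) * (ℓ (π 2) ⬝ᵥ planeRep z) ≠ 0)
    (h10 : ab c z (π 1) (π 0) ≠ 0) (o : Option Pair) :
    ∃ d, ∀ j, (z o).rep j = d * eval ![ab c z (π 0) (π 1) / ab c z (π 1) (π 0),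
      c (π 1) * (ℓ (π 1) ⬝ᵥ planeRep z) / (c (π 2) * (ℓ (π 2) ⬝ᵥ planeRep z))] (r c W π ⟨o, j⟩) := by
  have hs := lam_sum hsum (planeRep z)
  have hab := fun i j hij => exists_planeRep' (c := c) hz (i := i) (j := j) hij
  have hrel : c (π 0) * (ℓ (π 0) ⬝ᵥ planeRep z) * ab c z (π 1) (π 0) =
      c (π 1) * (ℓ (π 1) ⬝ᵥ planeRep z) * ab c z (π 0) (π 1) := by
    obtain ⟨e, h, h'⟩ := hab (π 0) (π 1) (by simp)
    rw [h, h']; ring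
  rcases o with _ | p
  · refine ⟨c (π 2) * (ℓ (π 2) ⬝ᵥ planeRep z), fun j => ?_⟩
    rw [eval_r_none]
    conv_lhs => rw [show (z none).rep = planeRep z from rfl, ← hW (planeRep z)]
    rw [point, ← smul_eq_mul, ← Pi.smul_apply, ← Matrix.mulVec_smul]
    congr 1
    ext i
    exact eq_mul_eval_lamPoly (lam := fun i => c i * (ℓ i ⬝ᵥ planeRep z)) hs hrel h10 h2 _
  · obtain ⟨d, hd, hd'⟩ := exists_eq_mul_eval_abPoly (lam := fun i => c i * (ℓ i ⬝ᵥ planeRep z))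
      (ab := ab c z) hs hab h10 h2 p.2.ne
    refine ⟨d, fun (j : Fin 2) => ?_⟩
    rw [ab_of_lt c z p.2] at hd
    rw [ab_of_gt c z p.2] at hd'
    fin_cases j
    · refine Eq.trans ?_ (congrArg (d * ·) (eval_r_some_zero π _ p).symm)
      change pencilRep z p 0 = _
      rw [mul_left_comm, ← hd, inv_mul_cancel_left₀ (hc _)]
    · refine Eq.trans ?_ (congrArg (d * ·) (eval_r_some_one π _ p).symm)
      change pencilRep z p 1 = _
      rw [mul_left_comm, ← hd', inv_mul_cancel_left₀ (hc _)]

end BlowUpPlane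

end

end ProjGeom

namespace ProjGeom

noncomputable section

universe u

open MvPolynomial

variable {k : Type u} [Field k]

namespace BlowUpPlane

variable {ℓ : Fin 4 → Fin 3 → k} {c : Fin 4 → k} {W : Matrix (Fin 3) (Fin 3) k}

/-- The presentation of the blow-up of the plane. -/
def presentation (hc : ∀ i, c i ≠ 0)
    (hsum : c 0 • ℓ 0 + c 1 • ℓ 1 + c 2 • ℓ 2 + c 3 • ℓ 3 = 0)
    (hW : ∀ y (i : Fin 3), c i.castSucc * (ℓ i.castSucc ⬝ᵥ W.mulVec y) = y i)
    (hW' : ∀ v, W.mulVec (fun i => c i.castSucc * (ℓ i.castSucc ⬝ᵥ v)) = v) :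
    LinesPresentation (graph ℓ) where
  lam x i := c i * (ℓ i ⬝ᵥ planeRep x.1)
  ab x := ab c x.1
  lam_linear := ⟨none, fun i => (c i • ℓ i : Fin 3 → k), fun x i =>
    (smul_dotProduct (c i) (ℓ i) (planeRep x.1)).symm⟩
  ab_linear i j hij := by
    obtain ⟨s, l, m, h⟩ := ab_linear c hij
    exact ⟨s, l, m, fun x => h x.1⟩
  lam_ne_zero x := by
    by_contra! h
    refine planeRep_ne_zero x.1 ?_
    rw [← hW' (planeRep x.1), funext fun i : Fin 3 => h i.castSucc]
    exact Matrix.mulVec_zero W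
  ab_ne_zero x i j hij := ab_ne_zero hc x.1 hij
  lam_sum x _ := lam_sum hsum _
  rel x hx i j hij := by
    obtain ⟨e, h, h'⟩ := exists_planeRep' (c := c) hx hij
    rw [h, h']; ring
  r := r c W
  r_ne_zero π _ ha := eval_r_ne_zero hc hW hsum π ha
  minor π x hx h2 _ h10 o j j' := by
    obtain ⟨d, hd⟩ := minor hc hW' hsum π hx h2 h10 o
    rw [hd, hd]; ring
  g _ := MvPolynomial.X 0 * MvPolynomial.X 1
  g_ne_zero _ := mul_ne_zero (X_ne_zero _) (X_ne_zero _)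
  mem_of_isRep _ _ _ ha hh h := mem_graph_of_isRep hc hW hsum ha hh h
  lam_of_isRep π a x _ h := by
    obtain ⟨b, hb, hp⟩ := planeRep_of_isRep h
    refine ⟨b⁻¹, inv_ne_zero hb, fun i => ?_⟩
    rw [← dotProduct_point hW hsum π a i, hp, dotProduct_smul, smul_eq_mul]
    field_simp
  ab_of_isRep π a x _ h := by
    obtain ⟨d, hd, h0, h1⟩ := ab_of_isRep hc h (i := π 0) (j := π 1) (by simp)
    rw [abPoly_zero_one, eval_X] at h0
    rw [abPoly_one_zero, map_one (eval a), mul_one] at h1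
    exact ⟨d, hd, h0, h1⟩

theorem exists_atlas [Infinite k]
    (hℓ : ∀ i j l, i ≠ j → i ≠ l → j ≠ l → LinearIndependent k ![ℓ i, ℓ j, ℓ l]) :
    ∃ (𝒜 : LinesAtlas (blowUpPlane ℓ)) (c : Fin 4 → k), (∀ i, c i ≠ 0) ∧
      ∀ x i, 𝒜.lam x i = c i * (ℓ i ⬝ᵥ (blowDown ℓ x).rep) := by
  obtain ⟨c, hc, hsum⟩ := exists_sum_smul_eq_zero hℓ
  obtain ⟨W, hW, hW'⟩ := exists_inverse (hℓ 0 1 2 (by decide) (by decide) (by decide)) hc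
  exact ⟨(presentation hc hsum hW hW').toAtlas, c, hc, fun _ _ => rfl⟩

end BlowUpPlane

end

end ProjGeom

/-! ### The equation of the fixed surface -/

namespace ProjGeom

noncomputable section

universe u

open MvPolynomial

variable {k : Type u} [Field k]

/-! ### Six-pointed lines with an involution -/

theorem mk_eq_mk_iff_mul_eq {v w : Fin 2 → k} (hv : v ≠ 0) (hw : w ≠ 0) :
    Projectivization.mk k v hv = Projectivization.mk k w hw ↔ v 0 * w 1 = v 1 * w 0 := by
  rw [Projectivization.mk_eq_mk_iff']
  constructor
  · rintro ⟨c, rfl⟩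
    simp; ring
  · intro h
    by_cases h0 : w 0 = 0
    · have h1 : w 1 ≠ 0 := fun h1 => hw (funext fun i => by fin_cases i <;> assumption)
      have hv0 : v 0 = 0 := by simpa [h0, h1] using h
      refine ⟨v 1 / w 1, funext fun i => ?_⟩
      fin_cases i
      · simp [h0, hv0]
      · simp [h1]
    · refine ⟨v 0 / w 0, funext fun i => ?_⟩
      fin_cases i
      · simp [h0]
      · simp only [Fin.mk_one, Pi.smul_apply, smul_eq_mul]
        rw [div_mul_eq_mul_div, h]; field_simp

theorem markedPoints_castSucc (s : Fin 5 → k) (i : Fin 5) :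
    markedPoints s i.castSucc =
      Projectivization.mk k ![s i, 1] (by intro h; simpa using congrFun h 1) := by
  simp [markedPoints]

theorem markedPoints_last (s : Fin 5 → k) :
    markedPoints s (Fin.last 5) =
      Projectivization.mk k ![1, 0] (by intro h; simpa using congrFun h 0) := by
  rw [markedPoints, Fin.snoc_last]

section

variable (g : GL (Fin 2) k) (s : Fin 5 → k)

theorem smul_eq_iff {v w : Fin 2 → k} (hv : v ≠ 0) (hw : w ≠ 0) :
    g • Projectivization.mk k v hv = Projectivization.mk k w hw ↔
      (g 0 0 * v 0 + g 0 1 * v 1) * w 1 = (g 1 0 * v 0 + g 1 1 * v 1) * w 0 := by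
  rw [Projectivization.smul_mk, mk_eq_mk_iff_mul_eq]
  have h : ∀ i, (g • v) i = g i 0 * v 0 + g i 1 * v 1 := fun i => by
    change g.1.mulVec v i = _
    simp [Matrix.mulVec, dotProduct, Fin.sum_univ_two]
  rw [h, h]

theorem smul_castSucc_eq_castSucc (i j : Fin 5) :
    g • markedPoints s i.castSucc = markedPoints s j.castSucc ↔
      g 0 0 * s i + g 0 1 = (g 1 0 * s i + g 1 1) * s j := by
  rw [markedPoints_castSucc, markedPoints_castSucc, smul_eq_iff]
  simp

theorem smul_castSucc_eq_last (i : Fin 5) :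
    g • markedPoints s i.castSucc = markedPoints s (Fin.last 5) ↔ g 1 0 * s i + g 1 1 = 0 := by
  rw [markedPoints_castSucc, markedPoints_last, smul_eq_iff]
  simp [eq_comm]

theorem smul_last_eq_castSucc (i : Fin 5) :
    g • markedPoints s (Fin.last 5) = markedPoints s i.castSucc ↔ g 0 0 = g 1 0 * s i := by
  rw [markedPoints_castSucc, markedPoints_last, smul_eq_iff]
  simp

end

/-- The involution `σ` exchanges the last index with `τ 0`, `τ 1` with `τ 2` and `τ 3` with `τ 4`. -/
structure IsLabeling (σ : Equiv.Perm (Fin 6)) (τ : Equiv.Perm (Fin 5)) : Prop where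
  sq : ∀ i, σ (σ i) = i
  last : σ (Fin.last 5) = (τ 0).castSucc
  one : σ (τ 1).castSucc = (τ 2).castSucc
  three : σ (τ 3).castSucc = (τ 4).castSucc

/-- The cycle type makes `σ` an involution, and it has no fixed point because the cycle lengths add
up to six. The orbits are then chosen one after another. -/
theorem exists_isLabeling {σ : Equiv.Perm (Fin 6)} (hσ : σ.cycleType = {2, 2, 2}) :
    ∃ τ, IsLabeling σ τ := by
  have hsq : ∀ i, σ (σ i) = i := fun i => by
    have h : σ ^ 2 = 1 := by
      have := pow_orderOf_eq_one σ
      rwa [← Equiv.Perm.lcm_cycleType, hσ] at this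
    rw [← Equiv.Perm.mul_apply, ← sq, h, Equiv.Perm.one_apply]
  have hne : ∀ i, σ i ≠ i := fun i => by
    have h := Equiv.Perm.sum_cycleType σ
    rw [hσ] at h
    have : σ.support = Finset.univ := (Finset.card_eq_iff_eq_univ _).mp (by rw [← h]; rfl)
    exact Equiv.Perm.mem_support.mp (this ▸ Finset.mem_univ i)
  have hcast : ∀ {x : Fin 6}, x ≠ Fin.last 5 → ∃ y : Fin 5, x = y.castSucc := fun {x} h =>
    ⟨x.castPred h, by simp⟩
  obtain ⟨a, ha⟩ := hcast (hne (Fin.last 5))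
  have ha' : σ a.castSucc = Fin.last 5 := by rw [← ha, hsq]
  have hinj : ∀ {x y}, σ x = y → σ y = x := fun {x y} h => by rw [← h, hsq]
  obtain ⟨b, hb⟩ : ∃ b : Fin 5, b ≠ a := exists_ne a
  obtain ⟨c, hc⟩ := hcast (x := σ b.castSucc) (fun h => hb (by
    have := hinj h; rw [ha] at this; exact (Fin.castSucc_injective _ this).symm))
  have hcb : c ≠ b := fun h => hne b.castSucc (by rw [hc, h])
  have hca : c ≠ a := fun h => by
    rw [h] at hc; have := hinj hc; rw [ha'] at this; exact absurd this.symm (Fin.castSucc_ne_last b)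
  obtain ⟨d, hd⟩ : ∃ d, d ∉ ({a, b, c} : Finset (Fin 5)) := by
    by_contra! h
    have := Finset.card_le_card (fun d _ => h d : (Finset.univ : Finset (Fin 5)) ⊆ {a, b, c})
    have h3 := Finset.card_le_three (a := a) (b := b) (c := c)
    simp at this
    omega
  simp only [Finset.mem_insert, Finset.mem_singleton, not_or] at hd
  obtain ⟨hda, hdb, hdc⟩ := hd
  obtain ⟨e, he⟩ := hcast (x := σ d.castSucc) (fun h => hda (by
    have := hinj h; rw [ha] at this; exact (Fin.castSucc_injective _ this).symm))
  have hed : e ≠ d := fun h => hne d.castSucc (by rw [he, h])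
  have hea : e ≠ a := fun h => by
    rw [h] at he; have := hinj he; rw [ha'] at this; exact absurd this.symm (Fin.castSucc_ne_last d)
  have heb : e ≠ b := fun h => by
    rw [h] at he; have := hinj he; rw [hc] at this
    exact hdc (Fin.castSucc_injective _ this).symm
  have hec : e ≠ c := fun h => by
    rw [h, ← hc] at he
    exact hdb (Fin.castSucc_injective _ (σ.injective he))
  have hτ : Function.Injective ![a, b, c, d, e] := by
    intro i j h
    fin_cases i <;> fin_cases j <;>
    first
    | rfl
    | exact absurd h hb
    | exact absurd h.symm hb
    | exact absurd h hca
    | exact absurd h.symm hca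
    | exact absurd h hcb
    | exact absurd h.symm hcb
    | exact absurd h hda
    | exact absurd h.symm hda
    | exact absurd h hdb
    | exact absurd h.symm hdb
    | exact absurd h hdc
    | exact absurd h.symm hdc
    | exact absurd h hea
    | exact absurd h.symm hea
    | exact absurd h heb
    | exact absurd h.symm heb
    | exact absurd h hec
    | exact absurd h.symm hec
    | exact absurd h hed
    | exact absurd h.symm hed
  exact ⟨Equiv.ofBijective _ (Finite.injective_iff_bijective.mp hτ), hsq, ha, hc, he⟩

/-- A projectivity exchanging `∞` and `s₀` has the form `x ↦ s₀ + P / (x - s₀)`, and it exchanges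
`x` and `y` exactly when `(x - s₀)(y - s₀) = P`. Both remaining pairs must give the same `P`. -/
theorem IsLabeling.exists_smul_iff {σ : Equiv.Perm (Fin 6)} {τ : Equiv.Perm (Fin 5)}
    (h : IsLabeling σ τ) {s : Fin 5 → k} (hs : Function.Injective s) :
    (∃ g : GL (Fin 2) k, ∀ i, g • markedPoints s i = markedPoints s (σ i)) ↔
      (s (τ 0) - s (τ 1)) * (s (τ 0) - s (τ 2)) = (s (τ 0) - s (τ 3)) * (s (τ 0) - s (τ 4)) := by
  have h0 : σ (τ 0).castSucc = Fin.last 5 := by rw [← h.last, h.sq]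
  have h2 : σ (τ 2).castSucc = (τ 1).castSucc := by rw [← h.one, h.sq]
  have h4 : σ (τ 4).castSucc = (τ 3).castSucc := by rw [← h.three, h.sq]
  constructor
  · rintro ⟨g, hg⟩
    have e5 := hg (Fin.last 5)
    have e0 := hg (τ 0).castSucc
    have e1 := hg (τ 1).castSucc
    have e3 := hg (τ 3).castSucc
    rw [h.last, smul_last_eq_castSucc] at e5
    rw [h0, smul_castSucc_eq_last] at e0
    rw [h.one, smul_castSucc_eq_castSucc] at e1
    rw [h.three, smul_castSucc_eq_castSucc] at e3
    -- If the lower left entry were zero, the conditions at `∞` and `s₀` would make both diagonal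
    -- entries zero and `g` singular.
    have hr : g 1 0 ≠ 0 := by
      intro hr
      rw [hr] at e5 e0
      have hd : g.1.det ≠ 0 := ((Matrix.isUnit_iff_isUnit_det _).mp g.isUnit).ne_zero
      rw [Matrix.det_fin_two] at hd
      simp only [zero_mul, zero_add] at e5 e0
      apply hd
      change g 0 0 * g 1 1 - g 0 1 * g 1 0 = 0
      rw [e5, hr]; ring
    refine mul_left_cancel₀ hr ?_
    linear_combination e3 - e1 + (s (τ 1) - s (τ 3)) * e5 - (s (τ 2) - s (τ 4)) * e0
  · intro hP
    have hne : ∀ i j : Fin 5, i ≠ j → s (τ i) - s (τ j) ≠ 0 := fun i j hij =>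
      sub_ne_zero.mpr fun e => hij (τ.injective (hs e))
    set P := (s (τ 0) - s (τ 1)) * (s (τ 0) - s (τ 2)) with hPdef
    have hP0 : P ≠ 0 := mul_ne_zero (hne _ _ (by decide)) (hne _ _ (by decide))
    -- The matrix of `x ↦ s₀ + P / (x - s₀)`, with determinant `-P`.
    obtain ⟨g, hg⟩ : ∃ g : GL (Fin 2) k, g.1 = !![s (τ 0), P - s (τ 0) ^ 2; 1, -s (τ 0)] :=
      ⟨Matrix.GeneralLinearGroup.mkOfDetNeZero _ (by
        rw [Matrix.det_fin_two]
        simp only [Matrix.of_apply, Matrix.cons_val_zero, Matrix.cons_val_one,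
          Matrix.cons_val_fin_one]
        intro e
        exact hP0 (by linear_combination -e)), rfl⟩
    have g00 : g 0 0 = s (τ 0) := by rw [hg]; rfl
    have g01 : g 0 1 = P - s (τ 0) ^ 2 := by rw [hg]; rfl
    have g10 : g 1 0 = 1 := by rw [hg]; rfl
    have g11 : g 1 1 = -s (τ 0) := by rw [hg]; rfl
    refine ⟨g, fun i => ?_⟩
    have hi : i = Fin.last 5 ∨ ∃ j, i = (τ j).castSucc := by
      rcases Fin.eq_castSucc_or_eq_last i with ⟨j, rfl⟩ | rfl
      · exact Or.inr ⟨τ.symm j, by simp⟩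
      · exact Or.inl rfl
    rcases hi with rfl | ⟨j, rfl⟩
    · rw [h.last, smul_last_eq_castSucc, g00, g10, one_mul]
    · fin_cases j
      · change g • markedPoints s (τ 0).castSucc = markedPoints s (σ (τ 0).castSucc)
        rw [h0, smul_castSucc_eq_last, g10, g11]; ring
      · change g • markedPoints s (τ 1).castSucc = markedPoints s (σ (τ 1).castSucc)
        rw [h.one, smul_castSucc_eq_castSucc, g00, g01, g10, g11, hPdef]; ring
      · change g • markedPoints s (τ 2).castSucc = markedPoints s (σ (τ 2).castSucc)
        rw [h2, smul_castSucc_eq_castSucc, g00, g01, g10, g11, hPdef]; ring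
      · change g • markedPoints s (τ 3).castSucc = markedPoints s (σ (τ 3).castSucc)
        rw [h.three, smul_castSucc_eq_castSucc, g00, g01, g10, g11, hP]; ring
      · change g • markedPoints s (τ 4).castSucc = markedPoints s (σ (τ 4).castSucc)
        rw [h4, smul_castSucc_eq_castSucc, g00, g01, g10, g11, hP]; ring

end

end ProjGeom

/-! ### The quadric of marked points, parametrized by the plane -/

namespace ProjGeom

noncomputable section

universe u

open MvPolynomial

variable {k : Type u} [Field k]

namespace FixedSurface

/-! ### Marked points with an involution, in terms of four linear forms -/

section Ring

variable {R : Type*} [CommRing R]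

/-- The marked points with given values of the four linear forms. -/
def points (l : Fin 4 → R) : Fin 5 → R :=
  ![0, l 0 * l 1, l 2 * l 3, -(l 0 * l 2), -(l 1 * l 3)]

/-- The four linear forms. -/
def lines (s : Fin 5 → R) : Fin 4 → R := ![s 1 - s 3, -(s 1 - s 4), -(s 2 - s 3), s 2 - s 4]

theorem sum_lines (s : Fin 5 → R) : lines s 0 + lines s 1 + lines s 2 + lines s 3 = 0 := by
  simp only [lines, Matrix.cons_val_zero, Matrix.cons_val_one, Matrix.cons_val]
  ring

/-- On the quadric, `points` inverts the projection `lines` up to translation and the scalar `lines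
s 1 + lines s 2`, whose vanishing defines the tangent plane at the centre of projection. -/
theorem mul_sub_eq_points_sub {s : Fin 5 → R}
    (hs : (s 0 - s 1) * (s 0 - s 2) = (s 0 - s 3) * (s 0 - s 4)) (i j : Fin 5) :
    (lines s 1 + lines s 2) * (s i - s j) = points (lines s) i - points (lines s) j := by
  have key : ∀ i, (lines s 1 + lines s 2) * (s i - s 0) = points (lines s) i := by
    intro i
    fin_cases i <;>
    simp only [lines, points, Matrix.cons_val_zero, Matrix.cons_val_one, Matrix.cons_val,
      Fin.zero_eta, Fin.mk_one, Fin.reduceFinMk]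
    · ring
    · linear_combination -hs
    · linear_combination -hs
    · linear_combination -hs
    · linear_combination -hs
  linear_combination key i - key j

theorem points_mul_eq (l : Fin 4 → R) :
    (points l 0 - points l 1) * (points l 0 - points l 2) =
      (points l 0 - points l 3) * (points l 0 - points l 4) := by
  simp only [points, Matrix.cons_val_zero, Matrix.cons_val_one, Matrix.cons_val]
  ring

theorem points_smul (c : R) (l : Fin 4 → R) (i : Fin 5) :
    points (fun i => c * l i) i = c ^ 2 * points l i := by
  fin_cases i <;>
  simp only [points, Matrix.cons_val_zero, Matrix.cons_val_one, Matrix.cons_val, Fin.zero_eta,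
    Fin.mk_one, Fin.reduceFinMk] <;> ring

theorem map_points {T : Type*} [CommRing T] (f : R →+* T) (l : Fin 4 → R) (i : Fin 5) :
    f (points l i) = points (fun i => f (l i)) i := by
  fin_cases i <;> simp [points]

/-- The differences of the marked points. -/
theorem points_sub_eq {l : Fin 4 → R} (h : l 0 + l 1 + l 2 + l 3 = 0) :
    points l 1 - points l 3 = (l 1 + l 2) * l 0 ∧ points l 1 - points l 4 = -((l 1 + l 2) * l 1) ∧
    points l 2 - points l 3 = -((l 1 + l 2) * l 2) ∧ points l 2 - points l 4 = (l 1 + l 2) * l 3 ∧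
    points l 1 - points l 2 = (l 1 + l 2) * (l 0 + l 2) ∧
    points l 3 - points l 4 = -((l 1 + l 2) * (l 0 + l 1)) := by
  obtain rfl' : l 3 = -(l 0 + l 1 + l 2) := by linear_combination h
  simp only [points, Matrix.cons_val_zero, Matrix.cons_val_one, Matrix.cons_val, rfl']
  refine ⟨by ring, by ring, by ring, by ring, by ring, by ring⟩

/-- The first vertex of the triangle of marked points related to a pair of lines. -/
def apex : Fin 4 → Fin 4 → Fin 5 := ![![0, 1, 3, 0], ![1, 0, 0, 4], ![3, 0, 0, 2], ![0, 4, 2, 0]]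

/-- The other vertices. -/
def leg : Fin 4 → Fin 4 → Fin 5 := ![![0, 3, 1, 1], ![4, 0, 1, 1], ![2, 3, 0, 3], ![4, 2, 4, 0]]

/-- The sign of a pair of lines. -/
def sgn (i j : Fin 4) : R := if i < j then 1 else -1

end Ring

/-! ### Homogeneous coordinates in the charts -/

section Poly

variable (π : Equiv.Perm (Fin 4))

theorem lamPoly_ne_zero (i : Fin 4) : lamPoly k π i ≠ 0 := by
  rcases perm_cases π i with rfl | rfl | rfl | rfl
  · rw [lamPoly_zero]; exact mul_ne_zero (X_ne_zero _) (X_ne_zero _)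
  · rw [lamPoly_one]; exact X_ne_zero _
  · rw [lamPoly_two]; exact one_ne_zero
  · rw [lamPoly_three]
    intro h
    have := congrArg (eval 0) h
    simp [chartEqn] at this

theorem lamPoly_add_ne_zero {i j : Fin 4} (hij : i ≠ j) : lamPoly k π i + lamPoly k π j ≠ 0 := by
  intro h
  have h0 := congrArg (eval ![0, 0]) h
  have h1 := congrArg (eval ![0, 1]) h
  rcases perm_cases π i with rfl | rfl | rfl | rfl <;>
    rcases perm_cases π j with rfl | rfl | rfl | rfl <;>
    first
    | exact absurd rfl hij
    | (simp [lamPoly_zero, lamPoly_one, lamPoly_two, lamPoly_three, chartEqn] at h0; done)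
    | (simp [lamPoly_zero, lamPoly_one, lamPoly_two, lamPoly_three, chartEqn] at h1; done)

/-- The marked points with indices in `S` have homogeneous coordinates `ρ` in a chart. -/
def HasCoord (k : Type*) [Field k] (π : Equiv.Perm (Fin 4)) (S : Finset (Fin 5)) : Prop :=
  ∃ (g : MvPolynomial (Fin 2) k) (ρ : Fin 5 → MvPolynomial (Fin 2) k), g ≠ 0 ∧
    (∀ i ∈ S, ∀ j ∈ S, points (lamPoly k π) i - points (lamPoly k π) j = g * (ρ i - ρ j)) ∧
    ∀ a, eval a (chartEqn k) ≠ 0 → ∃ i ∈ S, ∃ j ∈ S, eval a (ρ i - ρ j) ≠ 0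

variable {π}

/-- Two differences of the three marked points are, up to sign, a common multiple of two of the
linear forms, so their ratio is a pencil coordinate; `abPoly` supplies it without common zeros. -/
theorem hasCoord_triple {x y z : Fin 5} {i j : Fin 4} {f : MvPolynomial (Fin 2) k} (hf : f ≠ 0)
    (hxy : x ≠ y) (hxz : x ≠ z) (hyz : y ≠ z) (hij : i ≠ j)
    (hy : points (lamPoly k π) x - points (lamPoly k π) y = f * lamPoly k π i)
    (hz : points (lamPoly k π) x - points (lamPoly k π) z = -(f * lamPoly k π j)) :
    HasCoord k π {x, y, z} := by
  obtain ⟨e, hi, hj⟩ := exists_lamPoly_eq_mul_abPoly (k := k) π i j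
  have he : e ≠ 0 := by
    rintro rfl
    exact lamPoly_ne_zero π i (by rw [hi, zero_mul])
  rw [hi] at hy
  rw [hj] at hz
  set ρ : Fin 5 → MvPolynomial (Fin 2) k := fun t =>
    if t = y then -abPoly k π i j else if t = z then abPoly k π j i else 0 with hρ
  have hρx : ρ x = 0 := by rw [hρ]; simp [hxy, hxz]
  have hρy : ρ y = -abPoly k π i j := by rw [hρ]; simp
  have hρz : ρ z = abPoly k π j i := by rw [hρ]; simp [hyz.symm]
  have key : ∀ t ∈ ({x, y, z} : Finset (Fin 5)),
      points (lamPoly k π) t = points (lamPoly k π) x + f * e * ρ t := by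
    intro t ht
    simp only [Finset.mem_insert, Finset.mem_singleton] at ht
    rcases ht with rfl | rfl | rfl
    · rw [hρx]; ring
    · rw [hρy]; linear_combination -hy
    · rw [hρz]; linear_combination -hz
  refine ⟨f * e, ρ, mul_ne_zero hf he, fun s hs t ht => ?_, fun a ha => ?_⟩
  · rw [key s hs, key t ht]; ring
  · rcases eval_abPoly_ne_zero π ha hij with h | h
    · exact ⟨x, by simp, y, by simp, by rw [hρx, hρy]; simpa using h⟩
    · exact ⟨x, by simp, z, by simp, by rw [hρx, hρz]; simpa using h⟩

/-- `f` vanishes nowhere on the chart. -/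
def IsNowhereZero (f : MvPolynomial (Fin 2) k) : Prop := ∀ a, eval a (chartEqn k) ≠ 0 → eval a f ≠ 0

theorem IsNowhereZero.mul {f g : MvPolynomial (Fin 2) k} (hf : IsNowhereZero f)
    (hg : IsNowhereZero g) : IsNowhereZero (f * g) := fun a ha => by
  rw [map_mul]; exact mul_ne_zero (hf a ha) (hg a ha)

theorem IsNowhereZero.neg {f : MvPolynomial (Fin 2) k} (hf : IsNowhereZero f) :
    IsNowhereZero (-f) := fun a ha => by
  rw [map_neg]; exact neg_ne_zero.mpr (hf a ha)

variable {S : Finset (Fin 5)} (h0 : (0 : Fin 5) ∈ S)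

include h0

/-- The marked point `0` is the origin, so after division by `g` it is enough that one of the other
points stays away from it on the whole chart. -/
theorem hasCoord_of_dvd {g : MvPolynomial (Fin 2) k} (hg : g ≠ 0)
    (ρ : Fin 5 → MvPolynomial (Fin 2) k)
    (hρ : ∀ i ∈ S, points (lamPoly k π) i = g * ρ i)
    (h : ∃ i ∈ S, IsNowhereZero (ρ i)) : HasCoord k π S := by
  obtain ⟨i, hi, hu⟩ := h
  have hρ0 : ρ 0 = 0 := by
    have := hρ 0 h0
    simp only [points, Matrix.cons_val_zero] at this
    exact (mul_eq_zero.mp this.symm).resolve_left hg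
  exact ⟨g, ρ, hg, fun i hi j hj => by rw [hρ i hi, hρ j hj]; ring,
    fun a ha => ⟨i, hi, 0, h0, by rw [hρ0, sub_zero]; exact hu a ha⟩⟩

theorem hasCoord_of_isNowhereZero (h : ∃ i ∈ S, IsNowhereZero (points (lamPoly k π) i)) :
    HasCoord k π S :=
  hasCoord_of_dvd h0 one_ne_zero _ (fun _ _ => (one_mul _).symm) h

end Poly

end FixedSurface

end

end ProjGeom

/-! ### Coordinates of the marked points without common zeros -/

namespace ProjGeom

noncomputable section

universe u

open MvPolynomial

variable {k : Type u} [Field k]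

namespace FixedSurface

variable {π : Equiv.Perm (Fin 4)} {S : Finset (Fin 5)}

/-- On the chart only the forms `i` and `j` can vanish, and their common factor is `w`. If the
marked point that is the product, up to sign, of the other two forms occurs in `S`, it is nowhere
zero. Otherwise all the points of `S` are divisible by `w`, and after division one of them is
nowhere zero because `p` or `q` is. -/
theorem hasCoord_of_lt {w p q : MvPolynomial (Fin 2) k} (hw : w ≠ 0)
    (hpq : IsNowhereZero p ∨ IsNowhereZero q) {i j : Fin 4} (hij : i < j)
    (hi : lamPoly k π i = w * p) (hj : lamPoly k π j = w * q)
    (hN : ∀ l, l ≠ i → l ≠ j → IsNowhereZero (lamPoly k π l)) (h0 : 0 ∈ S)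
    (hS : (1 ∈ S ∧ 2 ∈ S) ∨ (3 ∈ S ∧ 4 ∈ S)) : HasCoord k π S := by
  fin_cases i <;> fin_cases j <;>
    simp only [Fin.zero_eta, Fin.mk_one, Fin.reduceFinMk, lt_self_iff_false] at hij hi hj hN
  all_goals first
    | exact absurd hij (by decide)
    | skip
  · have h2 := hN 2 (by decide) (by decide)
    have h3 := hN 3 (by decide) (by decide)
    by_cases h : 2 ∈ S
    · exact hasCoord_of_isNowhereZero h0 ⟨2, h, h2.mul h3⟩
    · have h34 := hS.resolve_left fun e => h e.2
      refine hasCoord_of_dvd h0 hw ![0, p * (w * q), 0, -(p * lamPoly k π 2), -(q * lamPoly k π 3)]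
        (fun t ht => ?_) ?_
      · fin_cases t <;> simp [points, hi, hj] <;> first | exact absurd ht h | ring
      · rcases hpq with hp | hp
        · exact ⟨3, h34.1, (hp.mul h2).neg⟩
        · exact ⟨4, h34.2, (hp.mul h3).neg⟩
  · have h1 := hN 1 (by decide) (by decide)
    have h3 := hN 3 (by decide) (by decide)
    by_cases h : 4 ∈ S
    · exact hasCoord_of_isNowhereZero h0 ⟨4, h, (h1.mul h3).neg⟩
    · have h12 := hS.resolve_right fun e => h e.2
      refine hasCoord_of_dvd h0 hw ![0, p * lamPoly k π 1, q * lamPoly k π 3, -(p * (w * q)), 0]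
        (fun t ht => ?_) ?_
      · fin_cases t <;> simp [points, hi, hj] <;> first | exact absurd ht h | ring
      · rcases hpq with hp | hp
        · exact ⟨1, h12.1, hp.mul h1⟩
        · exact ⟨2, h12.2, hp.mul h3⟩
  · have h1 := hN 1 (by decide) (by decide)
    have h2 := hN 2 (by decide) (by decide)
    refine hasCoord_of_dvd h0 hw ![0, p * lamPoly k π 1, q * lamPoly k π 2, -(p * lamPoly k π 2),
      -(q * lamPoly k π 1)] (fun t ht => ?_) ?_
    · fin_cases t <;> simp [points, hi, hj] <;> ring
    · rcases hpq with hp | hp <;> rcases hS with hS | hS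
      · exact ⟨1, hS.1, hp.mul h1⟩
      · exact ⟨3, hS.1, (hp.mul h2).neg⟩
      · exact ⟨2, hS.2, hp.mul h2⟩
      · exact ⟨4, hS.2, (hp.mul h1).neg⟩
  · have h0' := hN 0 (by decide) (by decide)
    have h3 := hN 3 (by decide) (by decide)
    refine hasCoord_of_dvd h0 hw ![0, p * lamPoly k π 0, q * lamPoly k π 3, -(q * lamPoly k π 0),
      -(p * lamPoly k π 3)] (fun t ht => ?_) ?_
    · fin_cases t <;> simp [points, hi, hj] <;> ring
    · rcases hpq with hp | hp <;> rcases hS with hS | hS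
      · exact ⟨1, hS.1, hp.mul h0'⟩
      · exact ⟨4, hS.2, (hp.mul h3).neg⟩
      · exact ⟨2, hS.2, hp.mul h3⟩
      · exact ⟨3, hS.1, (hp.mul h0').neg⟩
  · have h0' := hN 0 (by decide) (by decide)
    have h2 := hN 2 (by decide) (by decide)
    by_cases h : 3 ∈ S
    · exact hasCoord_of_isNowhereZero h0 ⟨3, h, (h0'.mul h2).neg⟩
    · have h12 := hS.resolve_right fun e => h e.1
      refine hasCoord_of_dvd h0 hw ![0, p * lamPoly k π 0, q * lamPoly k π 2, 0, -(p * (w * q))]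
        (fun t ht => ?_) ?_
      · fin_cases t <;> simp [points, hi, hj] <;> first | exact absurd ht h | ring
      · rcases hpq with hp | hp
        · exact ⟨1, h12.1, hp.mul h0'⟩
        · exact ⟨2, h12.2, hp.mul h2⟩
  · have h0' := hN 0 (by decide) (by decide)
    have h1 := hN 1 (by decide) (by decide)
    by_cases h : 1 ∈ S
    · exact hasCoord_of_isNowhereZero h0 ⟨1, h, h0'.mul h1⟩
    · have h34 := hS.resolve_left fun e => h e.1
      refine hasCoord_of_dvd h0 hw ![0, 0, p * (w * q), -(p * lamPoly k π 0), -(q * lamPoly k π 1)]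
        (fun t ht => ?_) ?_
      · fin_cases t <;> simp [points, hi, hj] <;> first | exact absurd ht h | ring
      · rcases hpq with hp | hp
        · exact ⟨3, h34.1, (hp.mul h0').neg⟩
        · exact ⟨4, h34.2, (hp.mul h1).neg⟩

theorem isNowhereZero_one : IsNowhereZero (1 : MvPolynomial (Fin 2) k) := fun a _ => by simp

theorem isNowhereZero_lamPoly {i : Fin 4} (h0 : i ≠ π 0) (h1 : i ≠ π 1) :
    IsNowhereZero (lamPoly k π i) := fun _ ha => eval_lamPoly_ne_zero π ha h0 h1

theorem hasCoord_of_mem (h0 : 0 ∈ S) (hS : (1 ∈ S ∧ 2 ∈ S) ∨ (3 ∈ S ∧ 4 ∈ S)) :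
    HasCoord k π S := by
  have hne : π 0 ≠ π 1 := by simp
  have e0 : lamPoly k π (π 0) = MvPolynomial.X 1 * MvPolynomial.X 0 := by
    rw [lamPoly_zero, mul_comm]
  have e1 : lamPoly k π (π 1) = MvPolynomial.X 1 * 1 := by rw [lamPoly_one, mul_one]
  rcases hne.lt_or_gt with h | h
  · exact hasCoord_of_lt (X_ne_zero 1) (Or.inr isNowhereZero_one) h e0 e1
      (fun l h h' => isNowhereZero_lamPoly h h') h0 hS
  · exact hasCoord_of_lt (X_ne_zero 1) (Or.inl isNowhereZero_one) h e1 e0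
      (fun l h h' => isNowhereZero_lamPoly h' h) h0 hS

/-- All differences of these four points are divisible by `lam₁ + lam₂`: forgetting the marked point
`0` is the projection to the plane. -/
theorem hasCoord_four : HasCoord k π {1, 2, 3, 4} := by
  have hsum := sum_lamPoly (k := k) π
  refine ⟨lamPoly k π 1 + lamPoly k π 2, ![0, lamPoly k π 0, -lamPoly k π 2, 0,
    lamPoly k π 0 + lamPoly k π 1], lamPoly_add_ne_zero π (by decide), ?_, fun a _ => ?_⟩
  · obtain ⟨h13, h14, h23, h24, h12, h34⟩ := points_sub_eq hsum
    have key : ∀ i ∈ ({1, 2, 3, 4} : Finset (Fin 5)), points (lamPoly k π) i =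
        points (lamPoly k π) 3 + (lamPoly k π 1 + lamPoly k π 2) * (![0, lamPoly k π 0,
          -lamPoly k π 2, 0, lamPoly k π 0 + lamPoly k π 1] : Fin 5 → MvPolynomial (Fin 2) k) i := by
      intro i hi
      simp only [Finset.mem_insert, Finset.mem_singleton] at hi
      rcases hi with rfl | rfl | rfl | rfl <;> simp only [Matrix.cons_val, Matrix.cons_val_one]
      · linear_combination h13
      · linear_combination h23
      · ring
      · linear_combination -h34
    intro i hi j hj
    rw [key i hi, key j hj]; ring
  -- Each of the four linear forms is a difference of two of the reduced coordinates; take the one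
  -- numbered `π 2`, which is constantly one.
  · have h2 : eval a (lamPoly k π (π 2)) = 1 := by rw [lamPoly_two, map_one]
    generalize π 2 = t at h2
    fin_cases t
    · exact ⟨1, by decide, 3, by decide, by
        simp only [Matrix.cons_val, Matrix.cons_val_one, sub_zero]; exact h2 ▸ one_ne_zero⟩
    · refine ⟨4, by decide, 1, by decide, ?_⟩
      simp only [Matrix.cons_val, Matrix.cons_val_one, add_sub_cancel_left]
      exact h2 ▸ one_ne_zero
    · refine ⟨3, by decide, 2, by decide, ?_⟩
      simp only [Matrix.cons_val, zero_sub, neg_neg]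
      exact h2 ▸ one_ne_zero
    · refine ⟨2, by decide, 4, by decide, ?_⟩
      have : -lamPoly k π 2 - (lamPoly k π 0 + lamPoly k π 1) = lamPoly k π 3 := by
        linear_combination -hsum
      simp only [Matrix.cons_val, this]
      exact h2 ▸ one_ne_zero

/-- The set of four points and eight of the triples are treated separately; every other set contains
`0` and one of the pairs `{1, 2}`, `{3, 4}` exchanged by the involution. -/
theorem card_cases : ∀ S : Finset (Fin 5), 3 ≤ S.card → S = {1, 2, 3, 4} ∨ S = {1, 3, 4} ∨
    S = {3, 1, 2} ∨ S = {4, 1, 2} ∨ S = {2, 3, 4} ∨ S = {0, 1, 3} ∨ S = {0, 1, 4} ∨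
    S = {0, 2, 3} ∨ S = {0, 2, 4} ∨ (0 ∈ S ∧ ((1 ∈ S ∧ 2 ∈ S) ∨ (3 ∈ S ∧ 4 ∈ S))) := by
  decide

variable (k π) in
theorem hasCoord (hS : 3 ≤ S.card) : HasCoord k π S := by
  have hsum := sum_lamPoly (k := k) π
  obtain ⟨h13, h14, h23, h24, h12, h34⟩ := points_sub_eq hsum
  have hm : lamPoly k π 1 + lamPoly k π 2 ≠ 0 := lamPoly_add_ne_zero π (by decide)
  have hl := fun i => neg_ne_zero.mpr (lamPoly_ne_zero (k := k) π i)
  have p0 : points (lamPoly k π) 0 = 0 := rfl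
  have p1 : points (lamPoly k π) 1 = lamPoly k π 0 * lamPoly k π 1 := rfl
  have p2 : points (lamPoly k π) 2 = lamPoly k π 2 * lamPoly k π 3 := rfl
  have p3 : points (lamPoly k π) 3 = -(lamPoly k π 0 * lamPoly k π 2) := rfl
  have p4 : points (lamPoly k π) 4 = -(lamPoly k π 1 * lamPoly k π 3) := rfl
  rcases card_cases S hS with rfl | rfl | rfl | rfl | rfl | rfl | rfl | rfl | rfl | ⟨h0, h⟩
  · exact hasCoord_four
  · exact hasCoord_triple hm (by decide) (by decide) (by decide) (i := 0) (j := 1) (by decide)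
      h13 h14
  · exact hasCoord_triple (neg_ne_zero.mpr hm) (by decide) (by decide) (by decide) (i := 0) (j := 2)
      (by decide) (by linear_combination -h13) (by linear_combination -h23)
  · exact hasCoord_triple hm (by decide) (by decide) (by decide) (i := 1) (j := 3)
      (by decide) (by linear_combination -h14) (by linear_combination -h24)
  · exact hasCoord_triple (neg_ne_zero.mpr hm) (by decide) (by decide) (by decide) (i := 2) (j := 3)
      (by decide) (by linear_combination h23) (by linear_combination h24)
  · exact hasCoord_triple (hl 0) (by decide) (by decide) (by decide) (i := 1) (j := 2)
      (by decide) (by rw [p0, p1]; ring) (by rw [p0, p3]; ring)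
  · exact hasCoord_triple (hl 1) (by decide) (by decide) (by decide) (i := 0) (j := 3)
      (by decide) (by rw [p0, p1]; ring) (by rw [p0, p4]; ring)
  · exact hasCoord_triple (hl 2) (by decide) (by decide) (by decide) (i := 3) (j := 0)
      (by decide) (by rw [p0, p2]; ring) (by rw [p0, p3]; ring)
  · exact hasCoord_triple (hl 3) (by decide) (by decide) (by decide) (i := 2) (j := 1)
      (by decide) (by rw [p0, p2]; ring) (by rw [p0, p4]; ring)
  · exact hasCoord_of_mem h0 h

end FixedSurface

end

end ProjGeom

/-! ### Coordinates on the closure of the fixed locus -/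

namespace ProjGeom

noncomputable section

universe u

open MvPolynomial

variable {k : Type u} [Field k]

namespace FixedSurface

/-- The coordinate of `z` corresponding to `s i - s j`. -/
def diff (z : MultiProj k forgetCoord) (S : ForgetIndex) (i j : Fin 5) : k :=
  if h : i ∈ S.1 ∧ j ∈ S.1 then (z S).rep (⟨i, h.1⟩, ⟨j, h.2⟩) else 0

theorem diff_of_mem (z : MultiProj k forgetCoord) {S : ForgetIndex} {i j : Fin 5} (hi : i ∈ S.1)
    (hj : j ∈ S.1) : diff z S i j = (z S).rep (⟨i, hi⟩, ⟨j, hj⟩) := dif_pos ⟨hi, hj⟩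

theorem exists_diff_eq (S : ForgetIndex) (i j : Fin 5) : ∃ l : forgetCoord S → k,
    ∀ z : MultiProj k forgetCoord, diff z S i j = l ⬝ᵥ (z S).rep := by
  by_cases h : i ∈ S.1 ∧ j ∈ S.1
  · exact ⟨Pi.single (⟨i, h.1⟩, ⟨j, h.2⟩) 1, fun z => by
      rw [diff_of_mem z h.1 h.2, single_dotProduct, one_mul]⟩
  · exact ⟨0, fun z => by rw [diff, dif_neg h, zero_dotProduct]⟩

theorem _root_.ProjGeom.IsModuliPoint.exists_diff_eq {s : Fin 5 → k}
    {z : MultiProj k forgetCoord} (h : IsModuliPoint s z) (S : ForgetIndex) :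
    ∃ d, d ≠ 0 ∧ ∀ i ∈ S.1, ∀ j ∈ S.1, diff z S i j = d * (s i - s j) := by
  obtain ⟨h0, hz⟩ := h S
  obtain ⟨d, hd, hr⟩ := exists_rep_eq_smul (k := k) h0
  refine ⟨d, hd, fun i hi j hj => ?_⟩
  rw [diff_of_mem z hi hj, hz, hr]
  rfl

variable (k) in
/-- The points of the open moduli space satisfying the equation of the fixed surface, for marked
points numbered by `τ`. -/
def locus (τ : Equiv.Perm (Fin 5)) : Set (MultiProj k forgetCoord) :=
  {z | ∃ s : Fin 5 → k, Function.Injective s ∧ IsModuliPoint s z ∧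
    (s (τ 0) - s (τ 1)) * (s (τ 0) - s (τ 2)) = (s (τ 0) - s (τ 3)) * (s (τ 0) - s (τ 4))}

theorem fixedSurface_eq {σ : Equiv.Perm (Fin 6)} {τ : Equiv.Perm (Fin 5)} (h : IsLabeling σ τ) :
    fixedSurface k σ = closure (locus k τ) := by
  rw [fixedSurface]
  congr 1
  ext z
  constructor
  · rintro ⟨-, s, hs, hz, hg⟩
    exact ⟨s, hs, hz, (h.exists_smul_iff hs).mp hg⟩
  · rintro ⟨s, hs, hz, he⟩
    exact ⟨⟨s, hs, hz⟩, s, hs, hz, (h.exists_smul_iff hs).mpr he⟩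

/-- The index set with labels `T`. -/
def label (τ : Equiv.Perm (Fin 5)) (T : ForgetIndex) : ForgetIndex :=
  ⟨T.1.map τ.toEmbedding, by simpa using T.2⟩

/-- The coordinate of `z` corresponding to the labels `i`, `j`. -/
def labelDiff (τ : Equiv.Perm (Fin 5)) (z : MultiProj k forgetCoord) (T : ForgetIndex)
    (i j : Fin 5) : k := diff z (label τ T) (τ i) (τ j)

variable {τ : Equiv.Perm (Fin 5)} {T : ForgetIndex}

theorem mem_label {i : Fin 5} (h : i ∈ T.1) : τ i ∈ (label τ T).1 := by
  simpa [label] using h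

/-- The relation is linear in the homogeneous coordinates and holds on the locus, so it holds on the
closure, where the coordinates need not come from actual marked points. -/
theorem diff_add_diff (x : closure (locus k τ)) {S : ForgetIndex} {i j l : Fin 5} (hi : i ∈ S.1)
    (hj : j ∈ S.1) (hl : l ∈ S.1) : diff x.1 S i j + diff x.1 S j l = diff x.1 S i l := by
  by_contra h
  obtain ⟨u, hu⟩ := exists_diff_eq (k := k) S i j
  obtain ⟨v, hv⟩ := exists_diff_eq (k := k) S j l
  obtain ⟨w, hw⟩ := exists_diff_eq (k := k) S i l
  have key : ∀ y : closure (locus k τ),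
      (u + v - w) ⬝ᵥ (y.1 S).rep = diff y.1 S i j + diff y.1 S j l - diff y.1 S i l := fun y => by
    rw [hu, hv, hw, sub_dotProduct, add_dotProduct]
  obtain ⟨y, hy, s, -, hys, -⟩ := exists_mem_of_mem_nhds_closure
    ((isOpen_dotProduct_ne_zero (X := closure (locus k τ)) S (u + v - w)).mem_nhds (x := x)
      (by rw [Set.mem_ofPred_eq, key]; exact sub_ne_zero.mpr h))
  rw [Set.mem_ofPred_eq, key] at hy
  obtain ⟨d, -, hd⟩ := hys.exists_diff_eq S
  rw [hd i hi j hj, hd j hj l hl, hd i hi l hl] at hy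
  exact hy (by ring)

theorem diff_self (x : closure (locus k τ)) {S : ForgetIndex} {i : Fin 5} (hi : i ∈ S.1) :
    diff x.1 S i i = 0 := by
  simpa using diff_add_diff x hi hi hi

/-- If all differences starting at `i` vanished, additivity would make all homogeneous coordinates
zero. -/
theorem exists_labelDiff_ne_zero (x : closure (locus k τ)) {i : Fin 5} (hi : i ∈ T.1) :
    ∃ j ∈ T.1, j ≠ i ∧ labelDiff τ x.1 T i j ≠ 0 := by
  by_contra! h
  have hi' := mem_label (τ := τ) hi
  have h' : ∀ j ∈ (label τ T).1, diff x.1 (label τ T) (τ i) j = 0 := by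
    intro j hj
    obtain ⟨t, ht, rfl⟩ := Finset.mem_map.mp hj
    by_cases hti : t = i
    · rw [hti]; exact diff_self x hi'
    · exact h t ht hti
  obtain ⟨⟨p, q⟩, hpq⟩ := exists_rep_ne_zero x.1 (label τ T)
  refine hpq ?_
  have := diff_add_diff x hi' p.2 q.2
  rw [h' _ p.2, h' _ q.2, zero_add, diff_of_mem x.1 p.2 q.2] at this
  exact this

theorem labelDiff_add (x : closure (locus k τ)) {i j l : Fin 5} (hi : i ∈ T.1)
    (hj : j ∈ T.1) (hl : l ∈ T.1) :
    labelDiff τ x.1 T i j + labelDiff τ x.1 T j l = labelDiff τ x.1 T i l :=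
  diff_add_diff x (mem_label hi) (mem_label hj) (mem_label hl)

/-! ### Coordinates of the points of the charts -/

theorem exists_rep (τ : Equiv.Perm (Fin 5)) (π : Equiv.Perm (Fin 4)) (S : ForgetIndex) :
    ∃ (g : MvPolynomial (Fin 2) k) (r : forgetCoord S → MvPolynomial (Fin 2) k), g ≠ 0 ∧
      (∀ c, points (lamPoly k π) (τ.symm c.1) - points (lamPoly k π) (τ.symm c.2) = g * r c) ∧
      ∀ a, eval a (chartEqn k) ≠ 0 → ∃ c, eval a (r c) ≠ 0 := by
  obtain ⟨g, ρ, hg, h, h'⟩ := hasCoord k π (S := S.1.map τ.symm.toEmbedding) (by simpa using S.2)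
  have hm : ∀ i, τ.symm i ∈ S.1.map τ.symm.toEmbedding ↔ i ∈ S.1 := by simp
  refine ⟨g, fun c => ρ (τ.symm c.1) - ρ (τ.symm c.2), hg,
    fun c => h _ ((hm _).mpr c.1.2) _ ((hm _).mpr c.2.2), fun a ha => ?_⟩
  obtain ⟨i, hi, j, hj, hij⟩ := h' a ha
  obtain ⟨i, hiS, rfl⟩ := Finset.mem_map.mp hi
  obtain ⟨j, hjS, rfl⟩ := Finset.mem_map.mp hj
  exact ⟨(⟨i, hiS⟩, ⟨j, hjS⟩), hij⟩

variable (k) in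
/-- A common factor of the differences of marked points. -/
def factor (τ : Equiv.Perm (Fin 5)) (π : Equiv.Perm (Fin 4)) (S : ForgetIndex) :
    MvPolynomial (Fin 2) k := (exists_rep τ π S).choose

variable (k) in
/-- Homogeneous coordinates of the points of a chart. -/
def r (τ : Equiv.Perm (Fin 5)) (π : Equiv.Perm (Fin 4)) (c : Σ S, forgetCoord S) :
    MvPolynomial (Fin 2) k := (exists_rep τ π c.1).choose_spec.choose c.2

theorem factor_ne_zero (τ : Equiv.Perm (Fin 5)) (π : Equiv.Perm (Fin 4)) (S : ForgetIndex) :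
    factor k τ π S ≠ 0 := (exists_rep τ π S).choose_spec.choose_spec.1

theorem points_sub_points (τ : Equiv.Perm (Fin 5)) (π : Equiv.Perm (Fin 4)) {S : ForgetIndex}
    (c : forgetCoord S) :
    points (lamPoly k π) (τ.symm c.1) - points (lamPoly k π) (τ.symm c.2) =
      factor k τ π S * r k τ π ⟨S, c⟩ := (exists_rep τ π S).choose_spec.choose_spec.2.1 c

theorem eval_r_ne_zero (τ : Equiv.Perm (Fin 5)) (π : Equiv.Perm (Fin 4)) {a : Fin 2 → k}
    (ha : eval a (chartEqn k) ≠ 0) (S : ForgetIndex) : ∃ c, eval a (r k τ π ⟨S, c⟩) ≠ 0 :=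
  (exists_rep τ π S).choose_spec.choose_spec.2.2 a ha

/-- The common factor of the differences can be cancelled as a polynomial, before evaluation; the
conclusion therefore also holds at points where that factor vanishes. -/
theorem labelDiff_mul_eq {π : Equiv.Perm (Fin 4)} {a : Fin 2 → k} {z : MultiProj k forgetCoord}
    (h : IsRep (r k τ π) a z) {i j i' j' : Fin 5} (hi : i ∈ T.1) (hj : j ∈ T.1) (hi' : i' ∈ T.1)
    (hj' : j' ∈ T.1) {A B : MvPolynomial (Fin 2) k}
    (hAB : (points (lamPoly k π) i - points (lamPoly k π) j) * A =
      (points (lamPoly k π) i' - points (lamPoly k π) j') * B) :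
    labelDiff τ z T i j * eval a A = labelDiff τ z T i' j' * eval a B := by
  obtain ⟨b, hb, hr⟩ := h (label τ T)
  have key := fun {i j} (hi : i ∈ T.1) (hj : j ∈ T.1) => points_sub_points (k := k) τ π
    (S := label τ T) (⟨τ i, mem_label hi⟩, ⟨τ j, mem_label hj⟩)
  simp only [Equiv.symm_apply_apply] at key
  rw [key hi hj, key hi' hj', mul_assoc, mul_assoc] at hAB
  have := congrArg (eval a) (mul_left_cancel₀ (factor_ne_zero τ π _) hAB)
  rw [map_mul, map_mul, hr, hr, mul_assoc, mul_assoc] at this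
  rw [labelDiff, labelDiff, diff_of_mem z (mem_label hi) (mem_label hj),
    diff_of_mem z (mem_label hi') (mem_label hj')]
  exact mul_left_cancel₀ hb this

end FixedSurface

end

end ProjGeom

/-! ### The linear forms and the pencil coordinates on the fixed surface -/

namespace ProjGeom

noncomputable section

universe u

open MvPolynomial

variable {k : Type u} [Field k]

namespace FixedSurface

/-- The four labels other than `0`. -/
def quad : ForgetIndex := ⟨{1, 2, 3, 4}, by decide⟩

/-- The labels whose difference is a line. -/
def src : Fin 4 → Fin 5 := ![1, 1, 2, 2]

/-- The labels whose difference is a line. -/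
def tgt : Fin 4 → Fin 5 := ![3, 4, 3, 4]

/-- The signs of the lines. -/
def sign (k : Type*) [Ring k] : Fin 4 → k := ![1, -1, -1, 1]

theorem src_mem : ∀ i, src i ∈ quad.1 := by decide

theorem tgt_mem : ∀ i, tgt i ∈ quad.1 := by decide

/-- The triangle of marked points related to a pair of lines. -/
def tri (i j : Fin 4) : ForgetIndex :=
  ⟨if i = j then {0, 1, 2, 3, 4} else {apex i j, leg i j, leg j i}, by revert i j; decide⟩

theorem tri_comm : ∀ i j, tri i j = tri j i := by decide

theorem apex_comm : ∀ i j, apex i j = apex j i := by decide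

theorem apex_mem : ∀ i j, apex i j ∈ (tri i j).1 := by decide

theorem leg_mem : ∀ i j, leg i j ∈ (tri i j).1 := by decide

theorem eq_leg_of_mem : ∀ i j, i ≠ j → ∀ t ∈ (tri i j).1, t ≠ apex i j → t = leg i j ∨ t = leg j i := by
  decide

section Ring

variable {R : Type*} [CommRing R]

theorem sign_mul_sub (s : Fin 5 → R) (i : Fin 4) :
    sign R i * (s (src i) - s (tgt i)) = lines s i := by
  fin_cases i <;> simp [sign, src, tgt, lines]

theorem sign_mul_points_sub {l : Fin 4 → R} (h : l 0 + l 1 + l 2 + l 3 = 0) (i : Fin 4) :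
    sign R i * (points l (src i) - points l (tgt i)) = (l 1 + l 2) * l i := by
  obtain ⟨h13, h14, h23, h24, -, -⟩ := points_sub_eq h
  fin_cases i <;> simp [sign, src, tgt, *]

/-- For every pair of lines the chosen triangle of marked points has two sides proportional to the
two linear forms; the signs come from the choice of `lines`. -/
theorem sgn_mul_points_sub_mul {l : Fin 4 → R} (h : l 0 + l 1 + l 2 + l 3 = 0) {i j : Fin 4}
    (hij : i ≠ j) :
    sgn i j * (points l (apex i j) - points l (leg i j)) * l j =
      sgn j i * (points l (apex j i) - points l (leg j i)) * l i := by
  have h3 : l 3 = -(l 0 + l 1 + l 2) := by linear_combination h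
  have p0 : points l 0 = 0 := rfl
  have p1 : points l 1 = l 0 * l 1 := rfl
  have p2 : points l 2 = l 2 * l 3 := rfl
  have p3 : points l 3 = -(l 0 * l 2) := rfl
  have p4 : points l 4 = -(l 1 * l 3) := rfl
  fin_cases i <;> fin_cases j <;> first
    | exact absurd rfl hij
    | (simp only [sgn, apex, leg, Fin.zero_eta, Fin.mk_one, Fin.reduceFinMk, Fin.reduceLT,
        if_true, if_false, Matrix.cons_val, Matrix.cons_val_zero, Matrix.cons_val_one, p0, p1, p2,
        p3, p4, h3]
       ring)

end Ring

section Locus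

variable {τ : Equiv.Perm (Fin 5)}

/-- The lines. -/
def lam (τ : Equiv.Perm (Fin 5)) (z : MultiProj k forgetCoord) (i : Fin 4) : k :=
  sign k i * labelDiff τ z quad (src i) (tgt i)

/-- The coordinates on the pencils of lines. -/
def ab (τ : Equiv.Perm (Fin 5)) (z : MultiProj k forgetCoord) (i j : Fin 4) : k :=
  sgn i j * labelDiff τ z (tri i j) (apex i j) (leg i j)

theorem lam_linear (τ : Equiv.Perm (Fin 5)) : ∃ (S : ForgetIndex) (l : Fin 4 → forgetCoord S → k),
    ∀ (z : MultiProj k forgetCoord) i, lam τ z i = l i ⬝ᵥ (z S).rep := by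
  choose l hl using fun i => exists_diff_eq (k := k) (label τ quad) (τ (src i)) (τ (tgt i))
  exact ⟨label τ quad, fun i => sign k i • l i, fun z i => by
    rw [smul_dotProduct, ← hl, smul_eq_mul, lam, labelDiff]⟩

theorem ab_linear (τ : Equiv.Perm (Fin 5)) (i j : Fin 4) :
    ∃ (S : ForgetIndex) (l m : forgetCoord S → k), ∀ z : MultiProj k forgetCoord,
      ab τ z i j = l ⬝ᵥ (z S).rep ∧ ab τ z j i = m ⬝ᵥ (z S).rep := by
  obtain ⟨l, hl⟩ := exists_diff_eq (k := k) (label τ (tri i j)) (τ (apex i j)) (τ (leg i j))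
  obtain ⟨m, hm⟩ := exists_diff_eq (k := k) (label τ (tri i j)) (τ (apex j i)) (τ (leg j i))
  refine ⟨label τ (tri i j), (sgn i j : k) • l, (sgn j i : k) • m, fun z => ⟨?_, ?_⟩⟩
  · rw [smul_dotProduct, ← hl, smul_eq_mul, ab, labelDiff]
  · rw [smul_dotProduct, ← hm, smul_eq_mul, ab, labelDiff, tri_comm]

theorem sign_ne_zero (i : Fin 4) : sign k i ≠ 0 := by
  fin_cases i <;> simp [sign]

theorem sgn_ne_zero (i j : Fin 4) : (sgn i j : k) ≠ 0 := by
  rw [sgn]; split_ifs <;> simp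

theorem lam_ne_zero (x : closure (locus k τ)) : ∃ i, lam τ x.1 i ≠ 0 := by
  by_contra! h
  have h' := fun i => (mul_eq_zero.mp (h i)).resolve_left (sign_ne_zero i)
  have m1 : 1 ∈ quad.1 := by decide
  have m2 : 2 ∈ quad.1 := by decide
  have m3 : 3 ∈ quad.1 := by decide
  have h13 : labelDiff τ x.1 quad 1 3 = 0 := h' 0
  have h14 : labelDiff τ x.1 quad 1 4 = 0 := h' 1
  have h23 : labelDiff τ x.1 quad 2 3 = 0 := h' 2
  have h12 : labelDiff τ x.1 quad 1 2 = 0 := by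
    have := labelDiff_add x m1 m2 m3
    rwa [h23, h13, add_zero] at this
  obtain ⟨j, hj, hj1, hne⟩ := exists_labelDiff_ne_zero x m1
  have hj' : ∀ j ∈ quad.1, j ≠ 1 → j = 2 ∨ j = 3 ∨ j = 4 := by decide
  rcases hj' j hj hj1 with rfl | rfl | rfl
  · exact hne h12
  · exact hne h13
  · exact hne h14

theorem ab_ne_zero (x : closure (locus k τ)) {i j : Fin 4} (hij : i ≠ j) :
    ab τ x.1 i j ≠ 0 ∨ ab τ x.1 j i ≠ 0 := by
  obtain ⟨t, ht, hta, hne⟩ := exists_labelDiff_ne_zero x (apex_mem i j)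
  rcases eq_leg_of_mem i j hij t ht hta with rfl | rfl
  · exact Or.inl (mul_ne_zero (sgn_ne_zero i j) hne)
  · refine Or.inr (mul_ne_zero (sgn_ne_zero j i) ?_)
    rwa [tri_comm, apex_comm]

/-- The equations of the coordinates in terms of marked points. -/
theorem exists_points {z : MultiProj k forgetCoord} (hz : z ∈ locus k τ) :
    ∃ s : Fin 5 → k, lines s 1 + lines s 2 ≠ 0 ∧
      (∀ i j, (lines s 1 + lines s 2) * (s i - s j) = points (lines s) i - points (lines s) j) ∧
      (∃ d, d ≠ 0 ∧ ∀ i, lam τ z i = d * lines s i) ∧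
      (∀ i j, i ≠ j → ∃ d, ab τ z i j = d * (sgn i j * (s (apex i j) - s (leg i j))) ∧
        ab τ z j i = d * (sgn j i * (s (apex j i) - s (leg j i)))) ∧
      ∀ S : ForgetIndex, ∃ d, ∀ c : forgetCoord S, (z S).rep c = d * (s (τ.symm c.1) - s (τ.symm c.2)) := by
  obtain ⟨s, hs, hz, he⟩ := hz
  have hne : ∀ {i j}, i ≠ j → s (τ i) - s (τ j) ≠ 0 := fun h =>
    sub_ne_zero.mpr (hs.ne (τ.injective.ne h))
  have hm := mul_sub_eq_points_sub (s := s ∘ τ) he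
  refine ⟨s ∘ τ, fun h => ?_, hm, ?_, fun i j hij => ?_, fun S => ?_⟩
  · have := hm 1 0
    rw [h, zero_mul] at this
    simp only [points, Matrix.cons_val_one, Matrix.cons_val_zero, sub_zero] at this
    exact mul_ne_zero (hne (i := 1) (j := 3) (by decide))
      (neg_ne_zero.mpr (hne (i := 1) (j := 4) (by decide))) this.symm
  · obtain ⟨d, hd, h⟩ := hz.exists_diff_eq (label τ quad)
    refine ⟨d, hd, fun i => ?_⟩
    rw [lam, labelDiff, h _ (mem_label (src_mem i)) _ (mem_label (tgt_mem i)), ← sign_mul_sub]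
    simp only [Function.comp_apply]
    ring
  · obtain ⟨d, -, h⟩ := hz.exists_diff_eq (label τ (tri i j))
    refine ⟨d, ?_, ?_⟩
    · rw [ab, labelDiff, h _ (mem_label (apex_mem i j)) _ (mem_label (leg_mem i j))]
      simp only [Function.comp_apply]
      ring
    · rw [tri_comm] at h
      rw [ab, labelDiff, h _ (mem_label (apex_mem j i)) _ (mem_label (leg_mem j i))]
      simp only [Function.comp_apply]
      ring
  · obtain ⟨d, -, h⟩ := hz.exists_diff_eq S
    exact ⟨d, fun c => by
      simp only [Function.comp_apply, Equiv.apply_symm_apply]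
      rw [← h _ c.1.2 _ c.2.2, diff_of_mem z c.1.2 c.2.2]⟩

theorem lam_sum {z : MultiProj k forgetCoord} (hz : z ∈ locus k τ) :
    lam τ z 0 + lam τ z 1 + lam τ z 2 + lam τ z 3 = 0 := by
  obtain ⟨s, -, -, ⟨d, -, hd⟩, -⟩ := exists_points hz
  rw [hd, hd, hd, hd]
  linear_combination d * sum_lines s

/-- After multiplication by the nonzero scalar `lines s 1 + lines s 2` the differences become those
of `points (lines s)`, for which the relation is a polynomial identity. -/
theorem rel {z : MultiProj k forgetCoord} (hz : z ∈ locus k τ) {i j : Fin 4} (hij : i ≠ j) :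
    lam τ z i * ab τ z j i = lam τ z j * ab τ z i j := by
  obtain ⟨s, hm, hs, ⟨d, -, hd⟩, hab, -⟩ := exists_points hz
  obtain ⟨e, h, h'⟩ := hab i j hij
  rw [hd, hd, h, h']
  refine mul_left_cancel₀ hm ?_
  have := sgn_mul_points_sub_mul (sum_lines s) hij
  rw [← hs, ← hs] at this
  linear_combination -(d * e) * this

/-- The values of the four forms are a multiple of `lamPoly` at the chart coordinates. Since
`points` is homogeneous of degree two, the differences of the marked points are a common multiple of
the chosen polynomial coordinates. -/
theorem minor {z : MultiProj k forgetCoord} (hz : z ∈ locus k τ) (π : Equiv.Perm (Fin 4))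
    (h2 : lam τ z (π 2) ≠ 0) (h10 : ab τ z (π 1) (π 0) ≠ 0) (S : ForgetIndex) :
    ∃ d, ∀ c, (z S).rep c = d * eval ![ab τ z (π 0) (π 1) / ab τ z (π 1) (π 0),
      lam τ z (π 1) / lam τ z (π 2)] (r k τ π ⟨S, c⟩) := by
  have hlam := eq_mul_eval_lamPoly (lam_sum hz) (rel hz (i := π 0) (j := π 1) (by simp)) h10 h2
  obtain ⟨s, hm, hs, ⟨d, hd0, hd⟩, -, hrep⟩ := exists_points hz
  obtain ⟨e, he⟩ := hrep S
  set a := ![ab τ z (π 0) (π 1) / ab τ z (π 1) (π 0), lam τ z (π 1) / lam τ z (π 2)]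
  have hl : lines s = fun i => lam τ z (π 2) / d * eval a (lamPoly k π i) := by
    ext i
    have := (hd i).symm.trans (hlam i)
    field_simp
    linear_combination this
  refine ⟨e * (lam τ z (π 2) / d) ^ 2 * eval a (factor k τ π S) / (lines s 1 + lines s 2),
    fun c => ?_⟩
  have h1 := hs (τ.symm c.1) (τ.symm c.2)
  have h2 := congrArg (eval a) (points_sub_points (k := k) τ π c)
  rw [map_sub, map_mul, map_points, map_points] at h2
  have h3 : ∀ i, points (lines s) i =
      (lam τ z (π 2) / d) ^ 2 * points (fun i => eval a (lamPoly k π i)) i := fun i => by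
    conv_lhs => rw [hl]
    exact points_smul _ _ _
  rw [h3, h3] at h1
  rw [he, div_mul_eq_mul_div, eq_div_iff hm]
  linear_combination e * h1 + e * (lam τ z (π 2) / d) ^ 2 * h2

end Locus

end FixedSurface

end

end ProjGeom

/-! ### The atlas of the fixed surface and the theorem -/

namespace ProjGeom

noncomputable section

universe u

open MvPolynomial

variable {k : Type u} [Field k]

namespace FixedSurface

variable {τ : Equiv.Perm (Fin 5)}

/-- Each difference of two marked points is, up to sign, a product of forms `lamᵢ` and sums `lamᵢ +
lamⱼ`, none of which is the zero polynomial. A general point of a chart thus lies in the open moduli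
space. -/
theorem points_lamPoly_injective (π : Equiv.Perm (Fin 4)) :
    Function.Injective (points (lamPoly k π)) := by
  have hl := lamPoly_ne_zero (k := k) π
  have hm : ∀ {i j}, i ≠ j → lamPoly k π i + lamPoly k π j ≠ 0 := lamPoly_add_ne_zero π
  obtain ⟨h13, h14, h23, h24, h12, h34⟩ := points_sub_eq (sum_lamPoly (k := k) π)
  have key : ∀ i j : Fin 5, i < j → points (lamPoly k π) i ≠ points (lamPoly k π) j := by
    intro i j hij
    fin_cases i <;> fin_cases j <;> first
      | exact absurd hij (by decide)
      | skip
    · exact (mul_ne_zero (hl 0) (hl 1)).symm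
    · exact (mul_ne_zero (hl 2) (hl 3)).symm
    · exact (neg_ne_zero.mpr (mul_ne_zero (hl 0) (hl 2))).symm
    · exact (neg_ne_zero.mpr (mul_ne_zero (hl 1) (hl 3))).symm
    · exact sub_ne_zero.mp (h12.trans_ne (mul_ne_zero (hm (by decide)) (hm (by decide))))
    · exact sub_ne_zero.mp (h13.trans_ne (mul_ne_zero (hm (by decide)) (hl 0)))
    · exact sub_ne_zero.mp
        (h14.trans_ne (neg_ne_zero.mpr (mul_ne_zero (hm (by decide)) (hl 1))))
    · exact sub_ne_zero.mp
        (h23.trans_ne (neg_ne_zero.mpr (mul_ne_zero (hm (by decide)) (hl 2))))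
    · exact sub_ne_zero.mp (h24.trans_ne (mul_ne_zero (hm (by decide)) (hl 3)))
    · exact sub_ne_zero.mp
        (h34.trans_ne (neg_ne_zero.mpr (mul_ne_zero (hm (by decide)) (hm (by decide)))))
  intro i j h
  by_contra hij
  rcases Ne.lt_or_gt hij with hij | hij
  · exact key i j hij h
  · exact key j i hij h.symm

variable (k) in
/-- A polynomial which does not vanish at the points of a chart in the open moduli space. -/
def discr (τ : Equiv.Perm (Fin 5)) (π : Equiv.Perm (Fin 4)) : MvPolynomial (Fin 2) k :=
  (∏ S, factor k τ π S) *
    ∏ p : {p : Fin 5 × Fin 5 // p.1 ≠ p.2}, (points (lamPoly k π) p.1.1 - points (lamPoly k π) p.1.2)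

theorem discr_ne_zero (τ : Equiv.Perm (Fin 5)) (π : Equiv.Perm (Fin 4)) : discr k τ π ≠ 0 :=
  mul_ne_zero (Finset.prod_ne_zero_iff.mpr fun S _ => factor_ne_zero τ π S)
    (Finset.prod_ne_zero_iff.mpr fun p _ =>
      sub_ne_zero.mpr ((points_lamPoly_injective π).ne p.2))

/-- Where the common factors and the differences do not vanish, the marked points `points (lamPoly k
π)`, evaluated at `a`, are distinct, satisfy the quadric equation identically and have the
homogeneous coordinates of `z`. -/
theorem mem_locus_of_isRep {π : Equiv.Perm (Fin 4)} {a : Fin 2 → k} {z : MultiProj k forgetCoord}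
    (ha : eval a (discr k τ π) ≠ 0) (h : IsRep (r k τ π) a z) : z ∈ locus k τ := by
  rw [discr, map_mul, map_prod, map_prod] at ha
  have h1 := fun S => Finset.prod_ne_zero_iff.mp (left_ne_zero_of_mul ha) S (Finset.mem_univ S)
  have h2 := fun p => Finset.prod_ne_zero_iff.mp (right_ne_zero_of_mul ha) p (Finset.mem_univ p)
  set t : Fin 5 → k := fun i => eval a (points (lamPoly k π) i) with ht
  have hte : t = points (fun i => eval a (lamPoly k π i)) := funext fun i => map_points _ _ _
  refine ⟨t ∘ τ.symm, ?_, fun S => ?_, ?_⟩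
  · refine Function.Injective.comp (fun i j hij => ?_) τ.symm.injective
    by_contra hne
    refine h2 ⟨(i, j), hne⟩ ?_
    rw [map_sub]
    exact sub_eq_zero.mpr hij
  · obtain ⟨b, hb, hr⟩ := h S
    have key : (fun c : forgetCoord S => (t ∘ τ.symm) c.1 - (t ∘ τ.symm) c.2) =
        (eval a (factor k τ π S) * b) • (z S).rep := by
      ext c
      rw [Pi.smul_apply, smul_eq_mul, mul_assoc, ← hr, ← map_mul, ← points_sub_points, map_sub]
      rfl
    have hne : (fun c : forgetCoord S => (t ∘ τ.symm) c.1 - (t ∘ τ.symm) c.2) ≠ 0 := by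
      rw [key]
      exact smul_ne_zero (mul_ne_zero (h1 S) hb) (Projectivization.rep_nonzero (z S))
    exact ⟨hne, eq_mk_of_eq_smul_rep hne key⟩
  · simp only [Function.comp_apply, Equiv.symm_apply_apply]
    rw [hte]
    exact points_mul_eq _

theorem lam_mul_eq {π : Equiv.Perm (Fin 4)} {a : Fin 2 → k} {z : MultiProj k forgetCoord}
    (h : IsRep (r k τ π) a z) (i j : Fin 4) :
    lam τ z i * eval a (lamPoly k π j) = lam τ z j * eval a (lamPoly k π i) := by
  have hs := sum_lamPoly (k := k) π
  have hC : ∀ i, (sign (MvPolynomial (Fin 2) k) i) = C (sign k i) := by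
    intro i; fin_cases i <;> simp [sign]
  have := labelDiff_mul_eq h (src_mem i) (tgt_mem i) (src_mem j) (tgt_mem j)
    (A := sign _ i * lamPoly k π j) (B := sign _ j * lamPoly k π i) (by
      linear_combination lamPoly k π j * sign_mul_points_sub hs i -
        lamPoly k π i * sign_mul_points_sub hs j)
  rw [hC, hC, map_mul, map_mul, eval_C, eval_C] at this
  rw [lam, lam]
  linear_combination this

theorem ab_eq_mul {π : Equiv.Perm (Fin 4)} {a : Fin 2 → k} {z : MultiProj k forgetCoord}
    (h : IsRep (r k τ π) a z) : ab τ z (π 0) (π 1) = ab τ z (π 1) (π 0) * a 0 := by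
  have hs := sum_lamPoly (k := k) π
  have hC : ∀ i j, (sgn i j : MvPolynomial (Fin 2) k) = C (sgn i j) := by
    intro i j; rw [sgn, sgn]; split_ifs <;> simp
  have hm : apex (π 1) (π 0) ∈ (tri (π 0) (π 1)).1 := by rw [tri_comm]; exact apex_mem _ _
  have hm' : leg (π 1) (π 0) ∈ (tri (π 0) (π 1)).1 := by rw [tri_comm]; exact leg_mem _ _
  have := labelDiff_mul_eq h (apex_mem (π 0) (π 1)) (leg_mem (π 0) (π 1)) hm hm'
    (A := sgn (π 0) (π 1)) (B := sgn (π 1) (π 0) * MvPolynomial.X 0) (by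
      have := sgn_mul_points_sub_mul hs (i := π 0) (j := π 1) (by simp)
      rw [lamPoly_zero, lamPoly_one] at this
      refine mul_right_cancel₀ (X_ne_zero (R := k) (1 : Fin 2)) ?_
      linear_combination this)
  rw [hC, hC, map_mul, eval_C, eval_C, eval_X] at this
  rw [ab, ab, tri_comm (π 1)]
  linear_combination this

variable (k τ) in
/-- The presentation of the fixed surface. -/
def presentation : LinesPresentation (locus k τ) where
  lam x := lam τ x.1
  ab x := ab τ x.1
  lam_linear := by
    obtain ⟨S, l, h⟩ := lam_linear (k := k) τ
    exact ⟨S, l, fun x => h x.1⟩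
  ab_linear i j _ := by
    obtain ⟨S, l, m, h⟩ := ab_linear (k := k) τ i j
    exact ⟨S, l, m, fun x => h x.1⟩
  lam_ne_zero := lam_ne_zero
  ab_ne_zero x _ _ hij := ab_ne_zero x hij
  lam_sum _ hx := lam_sum hx
  rel _ hx _ _ hij := rel hx hij
  r := r k τ
  r_ne_zero π _ ha := eval_r_ne_zero τ π ha
  minor π x hx h2 _ h10 S c c' := by
    obtain ⟨d, hd⟩ := minor hx π h2 h10 S
    rw [hd, hd]; ring
  g := discr k τ
  g_ne_zero := discr_ne_zero τ
  mem_of_isRep _ _ _ ha _ h := mem_locus_of_isRep ha h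
  lam_of_isRep π a x _ h := by
    have key : ∀ i, lam τ x.1 i = lam τ x.1 (π 2) * eval a (lamPoly k π i) := fun i => by
      have := lam_mul_eq h i (π 2)
      rwa [lamPoly_two, map_one, mul_one] at this
    refine ⟨_, fun h0 => ?_, key⟩
    obtain ⟨i, hi⟩ := lam_ne_zero x
    exact hi (by rw [key, h0, zero_mul])
  ab_of_isRep π a x _ h := by
    refine ⟨_, fun h0 => ?_, ab_eq_mul h, rfl⟩
    rcases ab_ne_zero x (i := π 0) (j := π 1) (by simp) with h' | h'
    · exact h' (by rw [ab_eq_mul h, h0, zero_mul])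
    · exact h' h0

theorem nonempty_atlas [Infinite k] {σ : Equiv.Perm (Fin 6)} (hσ : σ.cycleType = {2, 2, 2}) :
    Nonempty (LinesAtlas (fixedSurface k σ)) := by
  obtain ⟨τ, hτ⟩ := exists_isLabeling hσ
  rw [fixedSurface_eq hτ]
  exact ⟨(presentation k τ).toAtlas⟩

end FixedSurface

end

end ProjGeom
open ProjGeom in
theorem proposition3 {k : Type*} [Field k] [IsAlgClosed k]
    (σ : Equiv.Perm (Fin 6)) (hσ : σ.cycleType = {2, 2, 2})
    (ℓ : Fin 4 → Fin 3 → k)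
    (hℓ : ∀ i j l, i ≠ j → i ≠ l → j ≠ l → LinearIndependent k ![ℓ i, ℓ j, ℓ l]) :
    Nonempty (VarIso (fixedSurface k σ) (blowUpPlane ℓ)) ∧
    ∀ e : VarIso (fixedSurface k σ) (blowUpPlane ℓ),
      ∃ (H : NS (fixedSurface k σ)) (G M : Fin 4 → Fin 4 → PrimeDivisor (fixedSurface k σ))
        (L : Fin 4 → PrimeDivisor (fixedSurface k σ))
        (Γ : Set (PrimeDivisor (fixedSurface k σ))),
        (∀ m : Fin 3 → k, m ≠ 0 → ∃ D : Divisor (fixedSurface k σ),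
          IsLinePullback (fun x => blowDown ℓ (e.toHomeomorph x)) m D ∧ nsClass D = H) ∧
        (∀ i j, i ≠ j →
          (G i j).pts = {x | ℓ i ⬝ᵥ (blowDown ℓ (e.toHomeomorph x)).rep = 0 ∧
            ℓ j ⬝ᵥ (blowDown ℓ (e.toHomeomorph x)).rep = 0} ∧
          IsSmoothRationalCurve (G i j) (-1)) ∧
        (∀ π : Equiv.Perm (Fin 4),
          (M (π 0) (π 1)).nsClass =
            H - (G (π 0) (π 1)).nsClass - (G (π 2) (π 3)).nsClass ∧
          IsSmoothRationalCurve (M (π 0) (π 1)) (-1)) ∧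
        (∀ π : Equiv.Perm (Fin 4),
          (L (π 0)).nsClass =
            H - (G (π 0) (π 1)).nsClass - (G (π 0) (π 2)).nsClass - (G (π 0) (π 3)).nsClass ∧
          IsSmoothRationalCurve (L (π 0)) (-2)) ∧
        Γ = {C | ∃ i j, i ≠ j ∧ (C = G i j ∨ C = M i j)} ∪ Set.range L ∧
        Γ.ncard = 13 ∧
        effectiveCone (fixedSurface k σ) =
          (PointedCone.hull ℝ ((fun C => (1 : ℝ) ⊗ₜ[ℤ] C.nsClass) '' Γ) :
            Set (ℝ ⊗[ℤ] NS (fixedSurface k σ))) := by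
  obtain ⟨𝒜⟩ := FixedSurface.nonempty_atlas (k := k) hσ
  obtain ⟨ℬ, c, hc, hφ⟩ := BlowUpPlane.exists_atlas hℓ
  refine ⟨𝒜.nonempty_varIso ℬ, fun e => ?_⟩
  have : IrreducibleSpace (fixedSurface k σ) := 𝒜.irreducibleSpace
  -- The atlas is transported along the given `e`, so that its linear forms are those of the
  -- blow-down induced by this particular isomorphism.
  exact (LinesAtlas.comap e ℬ).exists_curves (φ := fun x => blowDown ℓ (e.toHomeomorph x))
    (hℓ 0 1 2 (by decide) (by decide) (by decide)) hc fun x i => hφ (e.toHomeomorph x) i
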